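/- Let $\mathbf k$ be a field of characteristic $0$. A stable $\mathbb S$-module $\mathcal V$ is a collection of graded $\mathbf k$-vector spaces $\mathcal V((g,n))=\bigoplus_{i\in\mathbb Z}\mathcal V((g,n))_i$, $g,n\ge 0$, with degree-preserving actions of the symmetric groups $\mathbb S_n$, such that $\mathcal V((g,n))=0$ if $2(g-1)+n\le 0$. (If the $\mathcal V((g,n))$ are chain complexes, the statement concerns the underlying graded spaces; differentials play no role.) Assume that every $\mathcal V((g,n))$ has finite total dimension. A stable graph is a connected graph $G$, possibly with legs, whose vertices $v$ carry genera $g(v)\ge 0$ with $2(g(v)-1)+n(v)>0$, where $n(v)$ is the number of flags at $v$; its genus is $\sum_v (g(v)-1)+|\mathrm{Edge}(G)|+1$. Let $\Gamma((g,n))$ be the category of stable graphs of genus $g$ with legs numbered by $1,\dots,n$, and put $\mathcal V((G))=\bigotimes_v\mathcal V((g(v),\mathrm{Leg}(v)))$, the tensor product of graded spaces with the Koszul sign rule, where $\mathrm{Leg}(v)$ is the set of flags at $v$. The free modular operad on $\mathcal V$ is $$\mathbb M\mathcal V((g,n))=\operatorname*{colim}_{G\in\mathrm{Iso}\,\Gamma((g,n))}\mathcal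 V((G))\cong\bigoplus_{[G]}\mathcal V((G))_{\mathrm{Aut}(G)} .$$ For $\sigma\in\mathbb S_n$ with cycles of lengths $a_1,\dots,a_\ell$ let $\psi(\sigma)=p_{a_1}\cdots p_{a_\ell}$. The characteristic of $\mathcal V$ is $$\mathbf{Ch}(\mathcal V)=\sum_{2(g-1)+n>0}\hbar^{g-1}\,\mathrm{ch}_n(\mathcal V((g,n))),\qquad \mathrm{ch}_n(W)=\sum_i(-1)^i\frac1{n!}\sum_{\sigma\in\mathbb S_n}\mathrm{Tr}_{W_i}(\sigma)\,\psi(\sigma),$$ a power series in the power sums $p_1,p_2,\dots$ whose coefficients are Laurent series in $\hbar$. For such a series $f$, possibly in two families of power sums $p=(p_1,p_2,\dots)$ and $q=(q_1,q_2,\dots)$, let $p_n\circ f$ be the result of the substitution $\hbar\mapsto\hbar^n$, $p_m\mapsto p_{nm}$, $q_m\mapsto q_{nm}$, and put, whenever the series converge coefficientwise in the $\hbar$-adic sense, $$\mathrm{Exp}(f)=\exp\Bigl(\sum_{n\ge1}\frac{p_n\circ f}{n}\Bigr),\qquad \mathrm{Log}(f)=\sum_{n\ge1}\frac{\mu(n)}{n}\log(p_n\circ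 f).$$ For a monomial $p^\alpha=\prod_n p_n^{\alpha_n}$ let $$\int^*_{\mathbb R^\infty}p^\alpha\,d\mu(p)=\prod_{n\text{ odd}}\int_{-\infty}^\infty p_n^{\alpha_n}e^{-p_n^2/2n\hbar^n}\frac{dp_n}{\sqrt{2\pi n\hbar^n}}\ \prod_{n\text{ even}}\int_{-\infty}^\infty p_n^{\alpha_n}e^{-p_n^2/2n\hbar^n+p_n/n\hbar^{n/2}}\frac{dp_n}{e^{1/2n}\sqrt{2\pi n\hbar^n}},$$ a polynomial in $\hbar$. Extend $\int^*$ to power series in $p$ and $q$ with coefficients Laurent series in $\hbar$ by integrating the monomials in $p$ term by term, for each monomial in $q$, whenever the resulting series converge $\hbar$-adically. Then $\mathbb M\mathcal V((g,n))$ has finite total dimension for all $g,n$; the series defining $\mathrm{Exp}$, $\int^*$ and $\mathrm{Log}$ on the right-hand side below all converge in the sense above; and, as functions of $\hbar$ and $q$, $$\hbar^{-1}h_2+\mathbf{Ch}(\mathbb M\mathcal V)=\mathrm{Log}\int^*_{\mathbb R^\infty}\mathrm{Exp}\bigl(\hbar^{-1}p_1q_1+\mathbf{Ch}(\mathcal V)\bigr)\,d\mu(p).$$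 Here $\mathbf{Ch}(\mathcal V)$ is taken as a function of $\hbar$ and $p$, while $h_2=\tfrac12(q_1^2+q_2)$ and $\mathbf{Ch}(\mathbb M\mathcal V)$ are functions of $\hbar$ and $q$. -/

import Mathlib

open scoped DirectSum TensorProduct

noncomputable section

namespace ModularOperad

universe w u

/-! ### Stable graphs -/

/-- A connected stable graph of genus `g` with legs numbered by `Fin N`, whose vertices are
numbered by `Fin k`, the vertex `v` having genus `gen v` and its flags being numbered by
`Fin (val v)`. A flag is thus an element of `Σ v, Fin (val v)`; the two-cycles of the involution
`inv` are the edges and its fixed points are the legs. -/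
structure StableGraph (g N : ℕ) {k : ℕ} (gen val : Fin k → ℕ) where
  inv : Equiv.Perm (Σ v, Fin (val v))
  inv_inv : ∀ a, inv (inv a) = a
  /-- the numbering of the legs -/
  leg : Fin N → Σ v, Fin (val v)
  leg_injective : Function.Injective leg
  range_leg : Set.range leg = {a | inv a = a}
  stable : ∀ v, 2 < 2 * gen v + val v
  nonempty : 0 < k
  connected : ∀ v w, Relation.EqvGen (fun v w => ∃ a, a.1 = v ∧ (inv a).1 = w) v w
  /-- `g - 1 = ∑ v, (gen v - 1) + #edges`; the number of edges is half the number of flags that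
  are moved by the involution. -/
  genus_eq : ∑ v, gen v + inv.support.card / 2 + 1 = g + k

namespace StableGraph

variable {g N k : ℕ} {gen val : Fin k → ℕ}

theorem two_lt (G : StableGraph g N gen val) : 2 < 2 * g + N := by
  classical
  have h1 : Fintype.card (Σ v, Fin (val v)) = ∑ v, val v := by simp
  have h2 : 2 ∣ G.inv.support.card :=
    Equiv.Perm.two_dvd_card_support (by ext1 a; simp [sq, G.inv_inv])
  have h3 : (Finset.univ.image G.leg).card = N := by
    rw [Finset.card_image_of_injective _ G.leg_injective]; simp
  have h4 : G.inv.supportᶜ = Finset.univ.image G.leg := by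
    ext a
    have := Set.ext_iff.1 G.range_leg a
    simp only [Set.mem_range, Set.mem_ofPred_eq] at this
    simp [this]
  have h5 := Finset.card_add_card_compl G.inv.support
  rw [h4, h3, h1] at h5
  have h6 : ∑ _v : Fin k, 3 ≤ ∑ v, (2 * gen v + val v) :=
    Finset.sum_le_sum fun v _ => G.stable v
  rw [Finset.sum_add_distrib, ← Finset.mul_sum] at h6
  simp only [Finset.sum_const, Finset.card_univ, Fintype.card_fin, smul_eq_mul] at h6
  have h7 := G.genus_eq
  have h8 := G.nonempty
  omega

/-- Renumbering the legs: the leg with number `i` gets the number `s i`. -/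
def relabel (s : Equiv.Perm (Fin N)) (G : StableGraph g N gen val) : StableGraph g N gen val :=
  { G with
    leg := fun i => G.leg (s⁻¹ i)
    leg_injective := G.leg_injective.comp (s⁻¹).injective
    range_leg := by
      rw [← G.range_leg]
      exact (s⁻¹).surjective.range_comp G.leg }

/-- The bijection between the flags of a graph and the flags of the graph obtained from it by
renumbering: the old vertex `τ v` is the new vertex `v`, and its old flag `a` is the new
flag `π v a`. -/
def flagEquiv (val : Fin k → ℕ) (τ : Equiv.Perm (Fin k)) (π : ∀ v, Equiv.Perm (Fin (val (τ v)))) :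
    (Σ v, Fin (val v)) ≃ Σ v, Fin (val (τ v)) :=
  (Equiv.sigmaCongrLeft (β := fun v => Fin (val v)) τ).symm.trans (Equiv.sigmaCongrRight π)

/-- `τ` and `π` define an isomorphism from `G` to `G'` which preserves the numbering of the
legs. -/
def IsIso {g N k : ℕ} {gen val : Fin k → ℕ} (τ : Equiv.Perm (Fin k))
    (π : ∀ v, Equiv.Perm (Fin (val (τ v)))) (G : StableGraph g N gen val)
    (G' : StableGraph g N (fun v => gen (τ v)) (fun v => val (τ v))) : Prop :=
  (∀ a, G'.inv (flagEquiv val τ π a) = flagEquiv val τ π (G.inv a)) ∧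
    ∀ i, G'.leg i = flagEquiv val τ π (G.leg i)

end StableGraph

/-! ### Stable `𝕊`-modules and the free modular operad -/

/-- A stable `𝕊`-module over `k`: `obj g n i` is the component of degree `i` of `𝒱((g,n))`.
If the `𝒱((g,n))` are chain complexes, this is the underlying graded `𝕊`-module: differentials
are not recorded, since they enter neither the characteristic nor the graded `𝕊`-module underlying
the free modular operad. -/
structure StableSModule (k : Type w) [Field k] where
  obj : ℕ → ℕ → ℤ → Type u
  [addCommGroup : ∀ g n i, AddCommGroup (obj g n i)]
  [module : ∀ g n i, Module k (obj g n i)]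
  /-- the action of the symmetric group -/
  rep : ∀ g n i, Representation k (Equiv.Perm (Fin n)) (obj g n i)
  stable : ∀ g n i, 2 * g + n ≤ 2 → Subsingleton (obj g n i)

namespace StableSModule

attribute [instance] StableSModule.addCommGroup StableSModule.module

variable {k : Type w} [Field k]

/-- Each `𝒱((g,n))` is finite-dimensional (as a graded vector space, in total). -/
def FiniteDim (V : StableSModule.{w, u} k) : Prop :=
  ∀ g n, (∀ i, Module.Finite k (V.obj g n i)) ∧ {i | Nontrivial (V.obj g n i)}.Finite

/-- The Koszul sign of the reordering `x₀ ⊗ x₁ ⊗ ⋯ ↦ x_{τ 0} ⊗ x_{τ 1} ⊗ ⋯` of homogeneous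
elements of degrees `d`. -/
def koszulSign {m : ℕ} (τ : Equiv.Perm (Fin m)) (d : Fin m → ℤ) : ℤˣ :=
  ∏ p : Fin m × Fin m with p.1 < p.2 ∧ τ p.2 < τ p.1, (d (τ p.1) * d (τ p.2)).negOnePow

/-- Stable graphs in `Γ((g,N))` (with numbered vertices and flags) whose vertices are decorated
by degrees of total `i`. -/
abbrev Decorated (g N : ℕ) (i : ℤ) : Type :=
  Σ (m : ℕ) (gen : Fin m → ℕ) (val : Fin m → ℕ),
    StableGraph g N gen val × {d : Fin m → ℤ // ∑ v, d v = i}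

instance (g N : ℕ) (i : ℤ) : DecidableEq (Decorated g N i) := Classical.decEq _

/-- Renumbering the legs of a decorated graph. -/
abbrev Decorated.relabel {g N : ℕ} {i : ℤ} (s : Equiv.Perm (Fin N)) (c : Decorated g N i) :
    Decorated g N i :=
  ⟨c.1, c.2.1, c.2.2.1, c.2.2.2.1.relabel s, c.2.2.2.2⟩

/-- The summand of multidegree `d` of `𝒱((G)) = ⨂ v, 𝒱((gen v, val v))`. -/
abbrev decTensor (V : StableSModule.{w, u} k) {g N : ℕ} {i : ℤ} (c : Decorated g N i) :
    Type (max w u) :=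
  ⨂[k] v : Fin c.1, V.obj (c.2.1 v) (c.2.2.1 v) (c.2.2.2.2.1 v)

/-- The degree `i` part of the direct sum of `𝒱((G))` over all stable graphs `G` in `Γ((g,N))`
with numbered vertices and flags. -/
abbrev graphSum (V : StableSModule.{w, u} k) (g N : ℕ) (i : ℤ) : Type (max w u) :=
  ⨁ c : Decorated g N i, V.decTensor c

/-- The inclusion of a summand. -/
def inclusion (V : StableSModule.{w, u} k) {g N : ℕ} {i : ℤ} (c : Decorated g N i) :
    V.decTensor c →ₗ[k] V.graphSum g N i :=
  DirectSum.lof k (Decorated g N i) V.decTensor c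

/-- The subspace generated by the differences between homogeneous pure tensors in `𝒱((G))` and
their images in `𝒱((G'))`, for all isomorphisms `G ≅ G'` in `Γ((g,N))`. -/
def isoRelations (V : StableSModule.{w, u} k) (g N : ℕ) (i : ℤ) :
    Submodule k (V.graphSum g N i) :=
  Submodule.span k {z | ∃ (m : ℕ) (gen val : Fin m → ℕ) (τ : Equiv.Perm (Fin m))
    (π : ∀ v, Equiv.Perm (Fin (val (τ v)))) (G : StableGraph g N gen val)
    (G' : StableGraph g N (fun v => gen (τ v)) (fun v => val (τ v)))
    (d : Fin m → ℤ) (hd : ∑ v, d v = i) (hd' : ∑ v, d (τ v) = i)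
    (x : ∀ v, V.obj (gen v) (val v) (d v)),
    StableGraph.IsIso τ π G G' ∧
    z = V.inclusion ⟨m, gen, val, G, ⟨d, hd⟩⟩ (PiTensorProduct.tprod k x) -
      (koszulSign τ d : ℤ) • V.inclusion
        ⟨m, fun v => gen (τ v), fun v => val (τ v), G', ⟨fun v => d (τ v), hd'⟩⟩
        (PiTensorProduct.tprod k fun v => V.rep _ _ _ (π v) (x (τ v)))}

/-- Renumbering of the legs on `graphSum`. -/
def relabelMap (V : StableSModule.{w, u} k) (g N : ℕ) (i : ℤ) (s : Equiv.Perm (Fin N)) :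
    V.graphSum g N i →ₗ[k] V.graphSum g N i :=
  DirectSum.toModule k (Decorated g N i) (V.graphSum g N i) fun c =>
    V.inclusion (Decorated.relabel s c)

theorem relabelMap_inclusion (V : StableSModule.{w, u} k) {g N : ℕ} {i : ℤ}
    (s : Equiv.Perm (Fin N)) (c : Decorated g N i) (x : V.decTensor c) :
    V.relabelMap g N i s (V.inclusion c x) = V.inclusion (Decorated.relabel s c) x :=
  DirectSum.toModule_lof k c x

theorem graphSum_ext (V : StableSModule.{w, u} k) {g N : ℕ} {i : ℤ}
    {f f' : V.graphSum g N i →ₗ[k] V.graphSum g N i}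
    (h : ∀ c x, f (V.inclusion c x) = f' (V.inclusion c x)) : f = f' :=
  DirectSum.linearMap_ext _ fun c => LinearMap.ext fun x => h c x

theorem relabelMap_one (V : StableSModule.{w, u} k) (g N : ℕ) (i : ℤ) :
    V.relabelMap g N i 1 = 1 :=
  V.graphSum_ext fun c x => V.relabelMap_inclusion 1 c x

theorem relabelMap_mul (V : StableSModule.{w, u} k) (g N : ℕ) (i : ℤ)
    (s t : Equiv.Perm (Fin N)) :
    V.relabelMap g N i (s * t) = V.relabelMap g N i s * V.relabelMap g N i t :=
  V.graphSum_ext fun c x =>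
    (V.relabelMap_inclusion (s * t) c x).trans
      ((V.relabelMap_inclusion s (Decorated.relabel t c) x).symm.trans
        (congrArg (V.relabelMap g N i s) (V.relabelMap_inclusion t c x).symm))

theorem isoRelations_le (V : StableSModule.{w, u} k) (g N : ℕ) (i : ℤ)
    (s : Equiv.Perm (Fin N)) :
    V.isoRelations g N i ≤ (V.isoRelations g N i).comap (V.relabelMap g N i s) := by
  refine Submodule.span_le.2 ?_
  rintro z ⟨m, gen, val, τ, π, G, G', d, hd, hd', x, hG, rfl⟩
  refine Submodule.subset_span
    ⟨m, gen, val, τ, π, G.relabel s, G'.relabel s, d, hd, hd', x, ⟨hG.1, fun i => hG.2 _⟩, ?_⟩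
  refine (map_sub _ _ _).trans (congrArg₂ _ (V.relabelMap_inclusion s _ _) ?_)
  exact (map_zsmul _ _ _).trans (congrArg _ (V.relabelMap_inclusion s _ _))

/-- The graded stable `𝕊`-module underlying the free modular operad `𝕄𝒱`: the colimit of
`G ↦ 𝒱((G))` over the groupoid of stable graphs in `Γ((g,N))` and their isomorphisms. -/
def free (V : StableSModule.{w, u} k) : StableSModule.{w, max w u} k where
  obj g N i := V.graphSum g N i ⧸ V.isoRelations g N i
  rep g N i :=
    { toFun := fun s => (V.isoRelations g N i).mapQ (V.isoRelations g N i)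
        (V.relabelMap g N i s) (V.isoRelations_le g N i s)
      map_one' := Submodule.linearMap_qext _ (LinearMap.ext fun x =>
        congrArg (Submodule.Quotient.mk (p := V.isoRelations g N i))
          (LinearMap.congr_fun (V.relabelMap_one g N i) x))
      map_mul' := fun s t => Submodule.linearMap_qext _ (LinearMap.ext fun x =>
        congrArg (Submodule.Quotient.mk (p := V.isoRelations g N i))
          (LinearMap.congr_fun (V.relabelMap_mul g N i s t) x)) }
  stable g N i h := by
    have : IsEmpty (Decorated g N i) := ⟨fun c => by
      have := c.2.2.2.1.two_lt
      omega⟩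
    have : Subsingleton (V.graphSum g N i) := by
      refine ⟨fun a b => ?_⟩
      exact DFinsupp.ext fun c => isEmptyElim c
    exact (Submodule.mkQ_surjective (V.isoRelations g N i)).subsingleton

end StableSModule

/-! ### Functions of `ħ` and of power sums -/

section Series

variable {k : Type w} [Field k] {σ τ ι : Type}

/-- The power `ħ ^ e` in the field `k((ħ))`. -/
def hbar (k : Type w) [Field k] (e : ℤ) : LaurentSeries k := HahnSeries.single e 1

/-- The substitution `ħ ↦ ħ ^ n`. -/
def hbarPow (n : ℕ+) : LaurentSeries k →+* LaurentSeries k :=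
  HahnSeries.embDomainRingHom (AddMonoidHom.mulLeft (n : ℤ))
    (fun _ _ h => mul_left_cancel₀ (by exact_mod_cast n.ne_zero) h)
    (fun _ _ => mul_le_mul_iff_right₀ (by exact_mod_cast n.pos))

/-- Index sets of families of power sums: `scale n` describes the substitution
`p_m ↦ p_{n m}`. -/
class PowerSumVars (σ : Type) where
  scale : ℕ+ → σ ↪ σ

/-- One alphabet: the variable with index `m` is the power sum `p_m`, `m ≥ 1`. -/
instance : PowerSumVars ℕ+ where
  scale n := ⟨fun m => n * m, mul_right_injective n⟩

/-- Two alphabets. -/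
instance [PowerSumVars σ] [PowerSumVars τ] : PowerSumVars (σ ⊕ τ) where
  scale n := (PowerSumVars.scale n).sumMap (PowerSumVars.scale n)

/-- Power series in the power sums whose coefficients are Laurent series in `ħ`. -/
abbrev PowerSumSeries (σ : Type) (k : Type w) [Field k] : Type w :=
  MvPowerSeries σ (LaurentSeries k)

/-- Plethysm with a power sum: `p_n ∘ f(ħ, p_1, p_2, …) = f(ħ ^ n, p_n, p_{2n}, …)`. -/
def powerSumPlethysm [PowerSumVars σ] (n : ℕ+) : PowerSumSeries σ k →+* PowerSumSeries σ k :=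
  (MvPowerSeries.rename (PowerSumVars.scale (σ := σ) n)).toRingHom.comp
    (MvPowerSeries.map (hbarPow n))

/-- The (possibly infinite) sum of the Laurent series `f i` converges in the `ħ`-adic sense
and its value is `s`. -/
def HasLaurentSum (f : ι → LaurentSeries k) (s : LaurentSeries k) : Prop :=
  ∃ F : HahnSeries.SummableFamily ℤ k ι, (∀ i, F i = f i) ∧ F.hsum = s

/-- Coefficientwise convergence of a sum of power series in the power sums. -/
def HasSeriesSum (f : ι → PowerSumSeries σ k) (s : PowerSumSeries σ k) : Prop :=
  ∀ α, HasLaurentSum (fun i => MvPowerSeries.coeff α (f i)) (MvPowerSeries.coeff α s)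

/-- `E = Exp(f) = exp(∑ n ≥ 1, p_n / n) ∘ f = exp(∑ n ≥ 1, (p_n ∘ f) / n)`, including the
convergence of both series. -/
def HasExp [PowerSumVars σ] (f E : PowerSumSeries σ k) : Prop :=
  ∃ s, HasSeriesSum (fun n : ℕ+ => ((n : k)⁻¹) • powerSumPlethysm n f) s ∧
    HasSeriesSum (fun j : ℕ => ((j.factorial : k)⁻¹) • s ^ j) E

/-- `L = Log(f) = ∑ n ≥ 1, (μ(n) / n) log(p_n ∘ f)`, where
`log(u) = ∑ j ≥ 0, (-1) ^ j (u - 1) ^ (j + 1) / (j + 1)`, including the convergence of all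
these series. -/
def HasLog [PowerSumVars σ] (f L : PowerSumSeries σ k) : Prop :=
  ∃ l : ℕ+ → PowerSumSeries σ k,
    (∀ n, HasSeriesSum
      (fun j : ℕ => ((-1) ^ j / (j + 1 : k)) • (powerSumPlethysm n f - 1) ^ (j + 1)) (l n)) ∧
    HasSeriesSum (fun n : ℕ+ => ((ArithmeticFunction.moebius n : k) / (n : k)) • l n) L

theorem HasLaurentSum.unique {f : ι → LaurentSeries k} {s t : LaurentSeries k}
    (hs : HasLaurentSum f s) (ht : HasLaurentSum f t) : s = t := by
  obtain ⟨F, hF, rfl⟩ := hs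
  obtain ⟨F', hF', rfl⟩ := ht
  congr 1
  exact HahnSeries.SummableFamily.ext fun i => (hF i).trans (hF' i).symm

theorem HasSeriesSum.unique {f : ι → PowerSumSeries σ k} {s t : PowerSumSeries σ k}
    (hs : HasSeriesSum f s) (ht : HasSeriesSum f t) : s = t :=
  MvPowerSeries.ext fun α => (hs α).unique (ht α)

theorem HasExp.unique [PowerSumVars σ] {f E E' : PowerSumSeries σ k}
    (h : HasExp f E) (h' : HasExp f E') : E = E' := by
  obtain ⟨s, hs, hE⟩ := h
  obtain ⟨s', hs', hE'⟩ := h'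
  obtain rfl := hs.unique hs'
  exact hE.unique hE'

theorem HasLog.unique [PowerSumVars σ] {f L L' : PowerSumSeries σ k}
    (h : HasLog f L) (h' : HasLog f L') : L = L' := by
  obtain ⟨l, hl, hL⟩ := h
  obtain ⟨l', hl', hL'⟩ := h'
  obtain rfl : l = l' := funext fun n => (hl n).unique (hl' n)
  exact hL.unique hL'

end Series

/-! ### The formal Gaussian integral -/

section Gauss

open Polynomial MeasureTheory ProbabilityTheory
open scoped NNReal

/-- The centre of the `n`-th one-dimensional Gaussian factor of `dμ`: `ħ ^ (n / 2)` for `n`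
even and `0` for `n` odd. -/
def gaussMean (n : ℕ+) : ℤ[X] := if Even (n : ℕ) then X ^ ((n : ℕ) / 2) else 0

/-- The integral of `p_n ^ a` against the `n`-th factor of `dμ`, as a polynomial in `ħ = X`,
computed by integration by parts. -/
def gaussMoment (n : ℕ+) : ℕ → ℤ[X]
  | 0 => 1
  | 1 => gaussMean n
  | a + 2 => gaussMean n * gaussMoment n (a + 1) +
      ((a + 1 : ℕ) : ℤ[X]) * ((n : ℕ) : ℤ[X]) * X ^ (n : ℕ) * gaussMoment n a

/-- The density of the `n`-th factor of `dμ`. -/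
def gaussDensity (n : ℕ+) (h x : ℝ) : ℝ :=
  if Even (n : ℕ) then
    Real.exp (-x ^ 2 / (2 * n * h ^ (n : ℕ)) + x / (n * h ^ ((n : ℕ) / 2))) /
      (Real.exp (1 / (2 * n)) * √(2 * Real.pi * n * h ^ (n : ℕ)))
  else Real.exp (-x ^ 2 / (2 * n * h ^ (n : ℕ))) / √(2 * Real.pi * n * h ^ (n : ℕ))

theorem gaussDensity_eq (n : ℕ+) {h : ℝ} (hh : 0 < h) (v : ℝ≥0)
    (hv : (v : ℝ) = n * h ^ (n : ℕ)) :
    gaussDensity n h = gaussianPDFReal (aeval h (gaussMean n)) v := by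
  have hn : (0 : ℝ) < n := by exact_mod_cast n.pos
  ext x
  unfold gaussDensity gaussianPDFReal gaussMean
  rw [hv]
  split_ifs with he
  · obtain ⟨m, hm⟩ := he
    have hm2 : (n : ℕ) / 2 = m := by omega
    rw [hm2, show h ^ (n : ℕ) = h ^ m * h ^ m by rw [hm, pow_add]]
    have hm' : 0 < h ^ m := by positivity
    simp only [map_pow, aeval_X]
    generalize h ^ m = t at *
    rw [div_mul_eq_div_div, ← Real.exp_sub, div_eq_inv_mul, mul_assoc (2 * Real.pi)]
    congr 2
    field_simp
    ring
  · rw [map_zero, sub_zero, div_eq_inv_mul, mul_assoc (2 * Real.pi), mul_assoc 2 (n : ℝ)]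

theorem gaussianMoment_rec (m : ℝ) {v : ℝ≥0} (hv : v ≠ 0) (a : ℕ) :
    ∫ x, x ^ (a + 2) * gaussianPDFReal m v x =
      m * (∫ x, x ^ (a + 1) * gaussianPDFReal m v x) +
        (a + 1) * v * (∫ x, x ^ a * gaussianPDFReal m v x) := by
  have hv' : (0 : ℝ) < v := by positivity
  have int : ∀ a : ℕ, Integrable (fun x => x ^ a * gaussianPDFReal m v x) := by
    intro a
    have h1 : Integrable (fun x : ℝ => x ^ a) (gaussianReal m v) :=
      integrable_pow_of_mem_interior_integrableExpSet (X := fun x => x)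
        (by simp [integrableExpSet_fun_id_gaussianReal]) a
    rw [gaussianReal_of_var_ne_zero m hv,
      integrable_withDensity_iff (measurable_gaussianPDF m v) (by simp [gaussianPDF])] at h1
    simpa [toReal_gaussianPDF] using h1
  have i1 := (int a).const_mul ((a : ℝ) + 1)
  have i2 := (int (a + 2)).const_mul (v : ℝ)⁻¹
  have i3 := (int (a + 1)).const_mul (m * (v : ℝ)⁻¹)
  have hd : ∀ x, HasDerivAt (fun x => x ^ (a + 1) * gaussianPDFReal m v x)
      ((a + 1) * (x ^ a * gaussianPDFReal m v x) -
        (v : ℝ)⁻¹ * (x ^ (a + 2) * gaussianPDFReal m v x) +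
        m * (v : ℝ)⁻¹ * (x ^ (a + 1) * gaussianPDFReal m v x)) x := by
    intro x
    have h1 : HasDerivAt (fun x => -(x - m) ^ 2 / (2 * v)) (-(x - m) / v) x := by
      have h := (((hasDerivAt_id x).sub_const m).pow 2).neg.div_const (2 * (v : ℝ))
      refine HasDerivAt.congr_deriv h ?_
      simp
      field_simp
      ring
    have h2 : HasDerivAt (gaussianPDFReal m v) (gaussianPDFReal m v x * (-(x - m) / v)) x := by
      refine HasDerivAt.congr_deriv (h1.exp.const_mul ((√(2 * Real.pi * v))⁻¹)) ?_
      rw [gaussianPDFReal]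
      ring
    refine HasDerivAt.congr_deriv ((hasDerivAt_pow (a + 1) x).mul h2) ?_
    push_cast
    field_simp
    ring
  have key := integral_eq_zero_of_hasDerivAt_of_integrable hd ((i1.sub i2).add i3) (int (a + 1))
  have e := (integral_add (i1.sub i2) i3).symm.trans key
  simp only [Pi.sub_apply] at e
  rw [integral_sub i1 i2, integral_const_mul, integral_const_mul,
    integral_const_mul] at e
  field_simp at e
  linarith

/-- The polynomial `gaussMoment n a` is the value of the one-dimensional Gaussian integral. -/
theorem integral_gaussDensity (n : ℕ+) {h : ℝ} (hh : 0 < h) (a : ℕ) :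
    ∫ x, x ^ a * gaussDensity n h x = aeval h (gaussMoment n a) := by
  have hn : (0 : ℝ) < n := by exact_mod_cast n.pos
  have hp : 0 < (n : ℝ) * h ^ (n : ℕ) := by positivity
  obtain ⟨v, hv⟩ : ∃ v : ℝ≥0, (v : ℝ) = n * h ^ (n : ℕ) := ⟨⟨_, hp.le⟩, rfl⟩
  have hv0 : v ≠ 0 := by
    rintro rfl
    exact hp.ne hv
  rw [gaussDensity_eq n hh v hv]
  induction a using Nat.twoStepInduction with
  | zero => simp [gaussMoment, integral_gaussianPDFReal_eq_one _ hv0]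
  | one =>
    have := integral_id_gaussianReal (μ := aeval h (gaussMean n)) (v := v)
    rw [integral_gaussianReal_eq_integral_smul hv0] at this
    simpa [gaussMoment, mul_comm] using this
  | more a h1 h2 =>
    rw [gaussianMoment_rec _ hv0, h1, h2, gaussMoment, hv]
    simp only [map_add, map_mul, map_natCast, map_pow, aeval_X]
    push_cast
    ring

/-- `∫* p ^ α dμ(p)`, a power series in `ħ`. -/
def monomialIntegral (k : Type w) [Field k] (α : ℕ+ →₀ ℕ) : LaurentSeries k :=
  α.prod fun n a => aeval (hbar k 1) (gaussMoment n a)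

/-- `I(ħ, q) = ∫* E(ħ, p, q) dμ(p)`, including the convergence of the formal integral: the
monomials in `p` (the left alphabet) are integrated term by term, for each monomial in `q` (the
right alphabet). -/
def HasGaussIntegral {k : Type w} [Field k] (E : PowerSumSeries (ℕ+ ⊕ ℕ+) k)
    (I : PowerSumSeries ℕ+ k) : Prop :=
  ∀ β : ℕ+ →₀ ℕ, HasLaurentSum
    (fun α : ℕ+ →₀ ℕ => MvPowerSeries.coeff (α.sumElim β) E * monomialIntegral k α)
    (MvPowerSeries.coeff β I)

theorem HasGaussIntegral.unique {k : Type w} [Field k] {E : PowerSumSeries (ℕ+ ⊕ ℕ+) k}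
    {I I' : PowerSumSeries ℕ+ k} (h : HasGaussIntegral E I) (h' : HasGaussIntegral E I') :
    I = I' :=
  MvPowerSeries.ext fun β => (h β).unique (h' β)

end Gauss

/-! ### Characteristics -/

section Characteristic

variable {k : Type w} [Field k]

/-- The power sum `p_n` (for `n ≥ 1`). -/
def powerSum (k : Type w) [Field k] (n : ℕ) : MvPolynomial ℕ+ k := MvPolynomial.X n.toPNat'

/-- The cycle index `p_{a_1} ⋯ p_{a_l}` of a permutation with cycles of lengths
`a_1, …, a_l` (fixed points included). -/
def cycleIndex (k : Type w) [Field k] {n : ℕ} (s : Equiv.Perm (Fin n)) : MvPolynomial ℕ+ k :=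
  (s.partition.parts.map (powerSum k)).prod

/-- The characteristic of the graded `𝕊_n`-module `𝒱((g,n))`: the sum over all degrees `i` of
`(-1) ^ i ∑ s, Tr(s) ψ(s) / n!`. -/
def StableSModule.ch (V : StableSModule.{w, u} k) (g n : ℕ) : MvPolynomial ℕ+ k :=
  ∑ᶠ i : ℤ, (i.negOnePow : ℤ) • ((n.factorial : k)⁻¹) •
    ∑ s : Equiv.Perm (Fin n), LinearMap.trace k (V.obj g n i) (V.rep g n i s) • cycleIndex k s

/-- The characteristic `𝐂𝐡(𝒱) = ∑_{2(g-1)+n>0} ħ^{g-1} ch_n(𝒱((g,n)))`. Since the cycle indices of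
the elements of `𝕊_n` have weight `n`, a monomial `p ^ α` occurs only in the summands with
`n = ∑ i, i α_i`. -/
def StableSModule.Ch (V : StableSModule.{w, u} k) : PowerSumSeries ℕ+ k := fun α =>
  hbar k (-1) * HahnSeries.ofPowerSeries ℤ k (PowerSeries.mk fun g =>
    if 2 < 2 * g + α.sum (fun i a => (i : ℕ) * a) then
      MvPolynomial.coeff α (V.ch g (α.sum fun i a => (i : ℕ) * a))
    else 0)

/-- `h_2 = (p_1 ^ 2 + p_2) / 2`. -/
def h₂ (k : Type w) [Field k] : PowerSumSeries ℕ+ k :=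
  (2⁻¹ : k) • (MvPowerSeries.X 1 ^ 2 + MvPowerSeries.X 2)

/-- A function of `ħ` and one alphabet, as a function of `ħ` and `p`, constant in `q`. -/
def functionOfP (f : PowerSumSeries ℕ+ k) : PowerSumSeries (ℕ+ ⊕ ℕ+) k :=
  MvPowerSeries.rename (Function.Embedding.inl : ℕ+ ↪ ℕ+ ⊕ ℕ+) f

end Characteristic

end ModularOperad

end

set_option linter.unusedSectionVars false

noncomputable section

namespace ModularOperad

open PowerSeries

universe w

variable {k : Type w} [Field k] {σ ι : Type}

/-! ### Graded power series and Laurent series -/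

/-! Put `t ^ 2 = ħ` and rescale `p_n` by `t ^ n` and `q_n` by `t ^ (2 * n)`. By stability every term
of `𝐂𝐡(𝒱)` then has positive degree in `t`, and so do `ħ⁻¹ p_1 q_1` and `ħ⁻¹ h_2`. Everything takes
place among power series in `t` with polynomial coefficients (`GradedSeries`), where `Exp` and `Log`
are locally finite sums, and `toSeries` translates back. A monomial `p ^ α` of weight `w` integrates
to an integer times `ħ ^ (w / 2)`, so after rescaling the integral preserves the degree in `t` and
merely replaces `p ^ α` by the integer `gaussWeight α`.

That integer is combinatorial: it is the number of fixed-point-free involutions commuting with a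
permutation of cycle type `α` (`card_invol`). This is Wick's theorem in the presence of a symmetry.

Accordingly, consider finite sets divided into vertices, flags and legs, with an attachment of flags
to vertices, a gluing involution, and a permutation `aut` respecting all of this (`Str`). The weight
is a product over the orbits of `aut`. An orbit of length `n` contributes the Adams operation `ψ_n`
of a local weight; for a vertex this is built from the supertraces of `𝒱` at the cycle type of `aut
^ n` on its flags. With the factor `1 / |Z|!`, the sum over all structures is the plethystic
exponential of the sum over the connected ones (`IsGraded.fullSum_eq`). Indeed, the ordinary
exponential formula splits off the orbits of `aut` on the set of components, and an orbit of `m`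
components is a cyclic union of `m` copies of one connected structure with its return map, which
contributes `ψ_m / m`.

This is applied to two weights. For `dataP` nothing is glued and every flag and leg carries a factor
`p_1`; the connected structures are corollas and single legs, whose sum is `ħ⁻¹ p_1 q_1 + 𝐂𝐡(𝒱)`.
For `dataQ` flags and legs are glued in pairs: two flags form an edge, a flag and a leg form a leg
of a graph, and two legs form the exceptional component responsible for `ħ⁻¹ h_2`. Counting
involutions shows that the integral of the full sum for `dataP` is the full sum for `dataQ`
(`gaussSeries_fullSum`). Hence the integral of `Exp` of one connected sum is `Exp` of the other, and
`Log` inverts `Exp` by Möbius inversion.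

It remains to recognize the connected gluings as `𝐂𝐡(𝕄𝒱)`. In characteristic zero the colimit over
isomorphisms is the image of an average over all renumberings of vertices and flags, so traces on
`𝕄𝒱` become sums over graphs with an automorphism. The trace of a permuted tensor product is a
product over orbits of factors of the traces of return maps (`trace_tensor`). The Koszul sign times
`(-1)` to the total degree is a product over the same orbits (`koszulSign_mul_negOnePow`). So the
supertrace of an automorphism is a product of supertraces of `𝒱`, which is the weight used for
`dataQ`. -/

/-- Power series in `t` whose coefficients are polynomials in the power sums. -/
abbrev GradedSeries (σ : Type) (k : Type w) [Field k] : Type w := PowerSeries (MvPolynomial σ k)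

/-- Replace `t ^ d * p ^ α` by `ħ ^ ((d - wt α) / 2) * p ^ α`. -/
def toSeries (wt : σ → ℕ) (f : GradedSeries σ k) : PowerSumSeries σ k := fun α =>
  HahnSeries.ofSuppBddBelow
    (fun e : ℤ => if 0 ≤ 2 * e + Finsupp.weight wt α then
      MvPolynomial.coeff α (PowerSeries.coeff (2 * e + Finsupp.weight wt α).toNat f) else 0)
    ⟨-(Finsupp.weight wt α : ℤ), fun e he => by
      by_contra h
      refine he (if_neg ?_)
      omega⟩

theorem coeff_toSeries (wt : σ → ℕ) (f : GradedSeries σ k) (α : σ →₀ ℕ) (e : ℤ) :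
    (MvPowerSeries.coeff α (toSeries wt f)).coeff e =
      if 0 ≤ 2 * e + Finsupp.weight wt α then
        MvPolynomial.coeff α (PowerSeries.coeff (2 * e + Finsupp.weight wt α).toNat f) else 0 :=
  rfl

theorem PowerSumSeries.ext' {f g : PowerSumSeries σ k}
    (h : ∀ α e, (MvPowerSeries.coeff α f).coeff e = (MvPowerSeries.coeff α g).coeff e) : f = g :=
  MvPowerSeries.ext fun α => HahnSeries.ext (funext fun e => h α e)

theorem PowerSumSeries.coeff_smul (c : k) (f : PowerSumSeries σ k) (α : σ →₀ ℕ) (e : ℤ) :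
    (MvPowerSeries.coeff α (c • f)).coeff e = c * (MvPowerSeries.coeff α f).coeff e := by
  rw [Algebra.smul_def, MvPowerSeries.algebraMap_apply, MvPowerSeries.coeff_C_mul,
    HahnSeries.algebraMap_apply', PowerSeries.algebraMap_apply, Algebra.algebraMap_self,
    RingHom.id_apply, HahnSeries.ofPowerSeries_C, HahnSeries.C_mul_eq_smul,
    HahnSeries.coeff_smul, smul_eq_mul]

theorem toSeries_add (wt : σ → ℕ) (f g : GradedSeries σ k) :
    toSeries wt (f + g) = toSeries wt f + toSeries wt g := by
  refine PowerSumSeries.ext' fun α e => ?_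
  simp only [map_add, HahnSeries.coeff_add, coeff_toSeries, MvPolynomial.coeff_add]
  split_ifs <;> simp

theorem toSeries_smul (wt : σ → ℕ) (c : k) (f : GradedSeries σ k) :
    toSeries wt (c • f) = c • toSeries wt f := by
  refine PowerSumSeries.ext' fun α e => ?_
  rw [PowerSumSeries.coeff_smul, coeff_toSeries, coeff_toSeries, coeff_smul, MvPolynomial.coeff_smul]
  split_ifs <;> simp

theorem toSeries_sub (wt : σ → ℕ) (f g : GradedSeries σ k) :
    toSeries wt (f - g) = toSeries wt f - toSeries wt g := by
  rw [eq_sub_iff_add_eq, ← toSeries_add, sub_add_cancel]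

theorem toSeries_one (wt : σ → ℕ) : toSeries wt (1 : GradedSeries σ k) = 1 := by
  classical
  refine PowerSumSeries.ext' fun α e => ?_
  rw [coeff_toSeries, MvPowerSeries.coeff_one, PowerSeries.coeff_one]
  by_cases hα : α = 0
  · subst hα
    by_cases he : e = 0
    · subst he; simp
    · have h2 : 0 ≤ 2 * e → (2 * e).toNat ≠ 0 := fun _ => by omega
      rw [if_pos rfl, HahnSeries.coeff_one, if_neg he]
      split_ifs with h3 h4
      · exact absurd h4 (by simpa using h2 (by simpa using h3))
      · simp
      · rfl
  · rw [if_neg hα]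
    split_ifs <;> simp [MvPolynomial.coeff_one, Ne.symm hα]

/-- Series in which `t ^ d * p ^ α` occurs only for `d` congruent to `wt α` modulo `2`. -/
def evenSeries (k : Type w) [Field k] (wt : σ → ℕ) : Subalgebra k (GradedSeries σ k) where
  carrier := {f | ∀ d α, MvPolynomial.coeff α (PowerSeries.coeff d f) ≠ 0 →
    Even (d + Finsupp.weight wt α)}
  mul_mem' {f g} hf hg d α h := by
    classical
    rw [PowerSeries.coeff_mul, MvPolynomial.coeff_sum] at h
    obtain ⟨⟨d₁, d₂⟩, hd, h⟩ := Finset.exists_ne_zero_of_sum_ne_zero h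
    rw [MvPolynomial.coeff_mul] at h
    obtain ⟨⟨α₁, α₂⟩, hα, h⟩ := Finset.exists_ne_zero_of_sum_ne_zero h
    have h1 := hf _ _ (left_ne_zero_of_mul h)
    have h2 := hg _ _ (right_ne_zero_of_mul h)
    rw [Finset.HasAntidiagonal.mem_antidiagonal] at hd hα
    dsimp only at hd hα
    rw [← hd, ← hα, map_add]
    rw [add_add_add_comm]
    exact h1.add h2
  add_mem' {f g} hf hg d α h := by
    rw [map_add, MvPolynomial.coeff_add] at h
    by_cases h1 : MvPolynomial.coeff α (PowerSeries.coeff d f) = 0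
    · exact hg d α (by simpa [h1] using h)
    · exact hf d α h1
  algebraMap_mem' c d α h := by
    classical
    rw [PowerSeries.algebraMap_apply, PowerSeries.coeff_C] at h
    split_ifs at h with hd
    · rw [MvPolynomial.algebraMap_eq, MvPolynomial.coeff_C] at h
      split_ifs at h with hα
      · simp [← hα, hd]
      · simp at h
    · simp at h

/-- Two terms of the wrong parity are both killed by `toSeries`, although their product has the
right parity and may survive. Evenness of one factor excludes this, and then splittings of the
exponent of `ħ` correspond to splittings of the degree in `t`. -/
theorem toSeries_mul {wt : σ → ℕ} {f : GradedSeries σ k} (hf : f ∈ evenSeries k wt)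
    (g : GradedSeries σ k) : toSeries wt (f * g) = toSeries wt f * toSeries wt g := by
  classical
  refine PowerSumSeries.ext' fun α e => ?_
  have hsum : ∀ (s : Finset ((σ →₀ ℕ) × (σ →₀ ℕ))) (F : _ → LaurentSeries k),
      (∑ p ∈ s, F p).coeff e = ∑ p ∈ s, (F p).coeff e := fun s F => HahnSeries.coeff_sum e
  rw [MvPowerSeries.coeff_mul, hsum, coeff_toSeries]
  have key : ∀ p ∈ Finset.HasAntidiagonal.antidiagonal α,
      (MvPowerSeries.coeff p.1 (toSeries wt f) * MvPowerSeries.coeff p.2 (toSeries wt g)).coeff e =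
      if 0 ≤ 2 * e + Finsupp.weight wt α then
        ∑ q ∈ Finset.HasAntidiagonal.antidiagonal (2 * e + Finsupp.weight wt α).toNat,
          MvPolynomial.coeff p.1 (PowerSeries.coeff q.1 f) *
            MvPolynomial.coeff p.2 (PowerSeries.coeff q.2 g) else 0 := by
    rintro ⟨α₁, α₂⟩ hα
    rw [Finset.HasAntidiagonal.mem_antidiagonal] at hα
    dsimp only at hα ⊢
    have hw : (Finsupp.weight wt α : ℤ) = Finsupp.weight wt α₁ + Finsupp.weight wt α₂ := by
      rw [← hα, map_add]; push_cast; rfl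
    rw [HahnSeries.coeff_mul]
    split_ifs with h0
    · refine Finset.sum_bij_ne_zero
        (fun q _ _ => ((2 * q.1 + Finsupp.weight wt α₁).toNat,
          (2 * q.2 + Finsupp.weight wt α₂).toNat)) ?_ ?_ ?_ ?_
      · rintro ⟨e₁, e₂⟩ hq hne
        rw [coeff_toSeries, coeff_toSeries] at hne
        have h1 := left_ne_zero_of_mul hne
        have h2 := right_ne_zero_of_mul hne
        rw [ite_ne_right_iff] at h1 h2
        rw [Finset.mem_antidiagonal] at hq
        obtain ⟨-, -, hq⟩ := hq
        dsimp only at *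
        rw [Finset.HasAntidiagonal.mem_antidiagonal]
        dsimp only
        omega
      · rintro ⟨e₁, e₂⟩ hq hne ⟨e₁', e₂'⟩ hq' hne' heq
        rw [coeff_toSeries, coeff_toSeries] at hne hne'
        have h1 := left_ne_zero_of_mul hne
        have h2 := right_ne_zero_of_mul hne
        have h3 := left_ne_zero_of_mul hne'
        have h4 := right_ne_zero_of_mul hne'
        rw [ite_ne_right_iff] at h1 h2 h3 h4
        simp only [Prod.mk.injEq] at heq ⊢
        omega
      · rintro ⟨d₁, d₂⟩ hd hne
        rw [Finset.HasAntidiagonal.mem_antidiagonal] at hd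
        dsimp only at hd hne
        have h1 := hf _ _ (left_ne_zero_of_mul hne)
        -- Evenness writes `d₁ + wt α₁` as `x + x`, so `x - wt α₁` is the integral exponent `(d₁ -
        -- wt α₁) / 2` of `ħ`.
        obtain ⟨x, hx⟩ := h1
        have e1 : 2 * ((x : ℤ) - Finsupp.weight wt α₁) + Finsupp.weight wt α₁ = d₁ := by omega
        have e2 : 2 * (e - ((x : ℤ) - Finsupp.weight wt α₁)) + Finsupp.weight wt α₂ = d₂ := by
          omega
        have n1 : (MvPowerSeries.coeff α₁ (toSeries wt f)).coeff
            ((x : ℤ) - Finsupp.weight wt α₁) = MvPolynomial.coeff α₁ (PowerSeries.coeff d₁ f) := by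
          rw [coeff_toSeries, e1, if_pos (by positivity), Int.toNat_natCast]
        have n2 : (MvPowerSeries.coeff α₂ (toSeries wt g)).coeff
            (e - ((x : ℤ) - Finsupp.weight wt α₁)) =
              MvPolynomial.coeff α₂ (PowerSeries.coeff d₂ g) := by
          rw [coeff_toSeries, e2, if_pos (by positivity), Int.toNat_natCast]
        refine ⟨((x : ℤ) - Finsupp.weight wt α₁, e - ((x : ℤ) - Finsupp.weight wt α₁)),
          ?_, ?_, ?_⟩
        · rw [Finset.mem_antidiagonal]
          refine ⟨?_, ?_, by simp⟩
          · exact n1.trans_ne (left_ne_zero_of_mul hne)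
          · exact n2.trans_ne (right_ne_zero_of_mul hne)
        · rw [n1, n2]; exact hne
        · dsimp only
          rw [e1, e2]
          simp
      · rintro ⟨e₁, e₂⟩ hq hne
        rw [coeff_toSeries, coeff_toSeries] at hne ⊢
        have h1 := left_ne_zero_of_mul hne
        have h2 := right_ne_zero_of_mul hne
        rw [ite_ne_right_iff] at h1 h2
        rw [if_pos h1.1, if_pos h2.1]
    · refine Finset.sum_eq_zero ?_
      rintro ⟨e₁, e₂⟩ hq
      rw [Finset.mem_antidiagonal] at hq
      obtain ⟨-, -, hq⟩ := hq
      dsimp only at *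
      by_contra hne
      rw [coeff_toSeries, coeff_toSeries] at hne
      have h1 := left_ne_zero_of_mul hne
      have h2 := right_ne_zero_of_mul hne
      rw [ite_ne_right_iff] at h1 h2
      omega
  rw [Finset.sum_congr rfl key]
  split_ifs
  · rw [PowerSeries.coeff_mul, MvPolynomial.coeff_sum, Finset.sum_comm]
    exact Finset.sum_congr rfl fun q _ => MvPolynomial.coeff_mul _ _ _
  · simp

theorem toSeries_pow {wt : σ → ℕ} {f : GradedSeries σ k} (hf : f ∈ evenSeries k wt) (n : ℕ) :
    toSeries wt (f ^ n) = toSeries wt f ^ n := by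
  induction n with
  | zero => rw [pow_zero, pow_zero, toSeries_one]
  | succ n ih => rw [pow_succ', pow_succ', toSeries_mul hf, ih]

/-! ### Locally finite sums -/

/-- In each degree, only finitely many members of the family are non-zero. -/
def LocFin {A : Type*} [CommRing A] {ι : Type*} (f : ι → PowerSeries A) : Prop :=
  ∀ d, {i | PowerSeries.coeff d (f i) ≠ 0}.Finite

/-- The sum of a locally finite family. -/
def lsum {A : Type*} [CommRing A] {ι : Type*} (f : ι → PowerSeries A) : PowerSeries A :=
  PowerSeries.mk fun d => ∑ᶠ i, PowerSeries.coeff d (f i)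

theorem coeff_lsum {A : Type*} [CommRing A] {ι : Type*} (f : ι → PowerSeries A) (d : ℕ) :
    PowerSeries.coeff d (lsum f) = ∑ᶠ i, PowerSeries.coeff d (f i) := coeff_mk _ _

/-- A subset of `ℤ` that is bounded below is partially well-ordered, so a common lower bound for the
exponents together with finiteness at each exponent is all that a summable family needs. -/
theorem hasLaurentSum_of_bounded {f : ι → LaurentSeries k} {s : LaurentSeries k} (B : ℤ)
    (hB : ∀ i e, (f i).coeff e ≠ 0 → B ≤ e) (hf : ∀ e, {i | (f i).coeff e ≠ 0}.Finite)
    (hs : ∀ e, s.coeff e = ∑ᶠ i, (f i).coeff e) : HasLaurentSum f s := by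
  refine ⟨⟨f, ?_, hf⟩, fun i => rfl, ?_⟩
  · have : BddBelow (⋃ i, (f i).support) := ⟨B, by
      rintro e he
      obtain ⟨i, hi⟩ := Set.mem_iUnion.1 he
      exact hB i e hi⟩
    exact this.isWF.isPWO
  · refine HahnSeries.ext (funext fun e => ?_)
    rw [HahnSeries.SummableFamily.coeff_hsum, hs]
    rfl

/-- For a fixed monomial `p ^ α`, the coefficient of `ħ ^ e` only sees the single degree `2 * e + wt
α` in `t`, and no exponent is below `-wt α`. Local finiteness in `t` is therefore `ħ`-adic
convergence coefficient by coefficient. -/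
theorem hasSeriesSum_toSeries (wt : σ → ℕ) {f : ι → GradedSeries σ k} (hf : LocFin f) :
    HasSeriesSum (fun i => toSeries wt (f i)) (toSeries wt (lsum f)) := by
  intro α
  refine hasLaurentSum_of_bounded (-(Finsupp.weight wt α : ℤ)) ?_ ?_ ?_
  · intro i e h
    rw [coeff_toSeries, ite_ne_right_iff] at h
    omega
  · intro e
    refine (hf (2 * e + Finsupp.weight wt α).toNat).subset fun i hi => ?_
    rw [Set.mem_ofPred_eq, coeff_toSeries, ite_ne_right_iff] at hi
    intro h0
    rw [h0] at hi
    simp at hi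
  · intro e
    simp only [coeff_toSeries]
    split_ifs
    · rw [coeff_lsum]
      exact (MvPolynomial.coeffAddMonoidHom α).map_finsum (hf _)
    · simp

theorem finsum_mem_support_ne {M : Type*} [AddCommMonoid M] {f : ι → M} (h : ∑ᶠ i, f i ≠ 0) :
    ∃ i, f i ≠ 0 := by
  by_contra! h'
  exact h (by simp [h'])

theorem lsum_mem_evenSeries {wt : σ → ℕ} {f : ι → GradedSeries σ k} (hf : LocFin f)
    (he : ∀ i, f i ∈ evenSeries k wt) : lsum f ∈ evenSeries k wt := by
  intro d α h
  rw [coeff_lsum] at h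
  have := (MvPolynomial.coeffAddMonoidHom (R := k) α).map_finsum (hf d)
  simp only [MvPolynomial.coeffAddMonoidHom_apply] at this
  rw [this] at h
  obtain ⟨i, hi⟩ := finsum_mem_support_ne h
  exact he i d α hi

/-! ### Adams operations -/

/-- The substitution `t ↦ t ^ n`, `p_m ↦ p_{n m}`. -/
def adams [PowerSumVars σ] (n : ℕ+) : GradedSeries σ k →+* GradedSeries σ k :=
  (PowerSeries.expand (n : ℕ) n.ne_zero).toRingHom.comp
    (PowerSeries.map (MvPolynomial.rename (PowerSumVars.scale (σ := σ) n)).toRingHom)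

theorem coeff_adams [PowerSumVars σ] (n : ℕ+) (f : GradedSeries σ k) (d : ℕ) :
    PowerSeries.coeff d (adams n f) = if (n : ℕ) ∣ d then
      MvPolynomial.rename (PowerSumVars.scale n) (PowerSeries.coeff (d / n) f) else 0 := by
  have : adams n f = PowerSeries.expand (n : ℕ) n.ne_zero (PowerSeries.map
    (MvPolynomial.rename (PowerSumVars.scale (σ := σ) n)).toRingHom f) := rfl
  rw [this, PowerSeries.coeff_expand]
  rfl

theorem adams_smul [PowerSumVars σ] (n : ℕ+) (c : k) (f : GradedSeries σ k) :
    adams n (c • f) = c • adams n f := by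
  ext d : 1
  rw [coeff_adams, coeff_smul, coeff_smul, coeff_adams]
  split_ifs <;> simp

theorem weight_embDomain [PowerSumVars σ] {wt : σ → ℕ} (hwt : ∀ (n : ℕ+) (i : σ),
    wt (PowerSumVars.scale n i) = n * wt i) (n : ℕ+) (α : σ →₀ ℕ) :
    Finsupp.weight wt (α.embDomain (PowerSumVars.scale n)) = n * Finsupp.weight wt α := by
  rw [Finsupp.weight_apply, Finsupp.weight_apply, Finsupp.sum_embDomain, Finsupp.sum,
    Finsupp.sum, Finset.mul_sum]
  refine Finset.sum_congr rfl fun i _ => ?_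
  rw [hwt, smul_eq_mul, smul_eq_mul]; ring

theorem adams_mem_evenSeries [PowerSumVars σ] {wt : σ → ℕ} (hwt : ∀ (n : ℕ+) (i : σ),
    wt (PowerSumVars.scale n i) = n * wt i) {f : GradedSeries σ k} (hf : f ∈ evenSeries k wt)
    (n : ℕ+) : adams n f ∈ evenSeries k wt := by
  intro d α h
  rw [coeff_adams] at h
  split_ifs at h with hd
  · obtain ⟨d, rfl⟩ := hd
    rw [Nat.mul_div_cancel_left _ n.pos] at h
    obtain ⟨β, rfl, h2⟩ := MvPolynomial.coeff_rename_ne_zero _ _ _ h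
    rw [← Finsupp.embDomain_eq_mapDomain, weight_embDomain hwt, ← mul_add]
    exact (hf _ _ h2).mul_left _
  · simp at h

/-- The operation multiplies the exponent of `ħ`, the weight and the degree in `t` all by `n`, hence
preserves the relation between them. Evenness is needed because divisibility of the degree in `t` by
`n` does not imply that of the exponent of `ħ`. -/
theorem plethysm_toSeries [PowerSumVars σ] {wt : σ → ℕ} (hwt : ∀ (n : ℕ+) (i : σ),
    wt (PowerSumVars.scale n i) = n * wt i) {f : GradedSeries σ k} (hf : f ∈ evenSeries k wt)
    (n : ℕ+) : powerSumPlethysm n (toSeries wt f) = toSeries wt (adams n f) := by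
  refine PowerSumSeries.ext' fun α e => ?_
  have h0 : powerSumPlethysm n (toSeries wt f) =
    MvPowerSeries.rename (PowerSumVars.scale (σ := σ) n)
      (MvPowerSeries.map (hbarPow n) (toSeries wt f)) := rfl
  rw [h0]
  by_cases hα : α ∈ Set.range (Finsupp.embDomain (M := ℕ) (PowerSumVars.scale (σ := σ) n))
  · obtain ⟨β, rfl⟩ := hα
    rw [MvPowerSeries.coeff_embDomain_rename, MvPowerSeries.coeff_map, coeff_toSeries,
      weight_embDomain hwt, coeff_adams]
    have hc : ∀ p : MvPolynomial σ k,
        MvPolynomial.coeff (β.embDomain (PowerSumVars.scale n))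
          (MvPolynomial.rename (PowerSumVars.scale n) p) = MvPolynomial.coeff β p := by
      intro p
      rw [Finsupp.embDomain_eq_mapDomain]
      exact MvPolynomial.coeff_rename_mapDomain _ (PowerSumVars.scale n).injective _ _
    have hn : (0 : ℤ) < n := by exact_mod_cast n.pos
    by_cases hne : (n : ℤ) ∣ e
    · obtain ⟨e, rfl⟩ := hne
      have h1 : (hbarPow n (MvPowerSeries.coeff β (toSeries wt f))).coeff ((n : ℤ) * e) =
          (MvPowerSeries.coeff β (toSeries wt f)).coeff e :=
        HahnSeries.embDomain_coeff (f := ⟨⟨fun x : ℤ => (n : ℤ) * x, _⟩, _⟩)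
      rw [h1, coeff_toSeries]
      have h2 : 2 * ((n : ℤ) * e) + ((n * Finsupp.weight wt β : ℕ) : ℤ) =
          n * (2 * e + Finsupp.weight wt β) := by push_cast; ring
      rw [h2]
      by_cases h3 : 0 ≤ 2 * e + (Finsupp.weight wt β : ℤ)
      · obtain ⟨x, hx⟩ := Int.eq_ofNat_of_zero_le h3
        rw [hx, if_pos (by positivity), if_pos (by positivity)]
        have : ((n : ℤ) * (x : ℤ)).toNat = n * x := by
          rw [← Nat.cast_mul, Int.toNat_natCast]
        rw [this, if_pos (Nat.dvd_mul_right _ _), Nat.mul_div_cancel_left _ n.pos, hc,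
          Int.toNat_natCast]
      · rw [if_neg h3, if_neg]
        intro h4
        exact h3 (nonneg_of_mul_nonneg_right h4 hn)
    · have h1 : (hbarPow n (MvPowerSeries.coeff β (toSeries wt f))).coeff e = 0 := by
        refine HahnSeries.embDomain_of_notMem_range (f := ⟨⟨fun x : ℤ => (n : ℤ) * x, ?_⟩, ?_⟩) ?_
        · rintro ⟨x, hx⟩
          exact hne ⟨x, hx.symm⟩
      rw [h1]
      split_ifs with h2 h3
      · rw [hc]
        -- Here `n` divides `2 * e` but not `e`, as can happen for even `n`. A nonzero coefficient
        -- would, by evenness of `f`, exhibit `e` as a multiple of `n`.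
        by_contra h4
        obtain ⟨x, hx⟩ := hf _ _ (Ne.symm h4)
        obtain ⟨y, hy⟩ := h3
        rw [hy, Nat.mul_div_cancel_left _ n.pos] at hx
        refine hne ⟨(x : ℤ) - Finsupp.weight wt β, ?_⟩
        have h5 : 2 * e + ((n * Finsupp.weight wt β : ℕ) : ℤ) = ((n * y : ℕ) : ℤ) := by omega
        push_cast at h5
        have h6 : (y : ℤ) = 2 * x - Finsupp.weight wt β := by omega
        rw [h6] at h5
        linarith
      · simp
      · rfl
  · rw [MvPowerSeries.coeff_rename_eq_zero, coeff_toSeries, coeff_adams]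
    · have : ∀ p : MvPolynomial σ k, MvPolynomial.coeff α
          (MvPolynomial.rename (PowerSumVars.scale n) p) = 0 := by
        intro p
        refine MvPolynomial.coeff_rename_eq_zero _ _ _ fun u hu => ?_
        exact absurd ⟨u, by rw [Finsupp.embDomain_eq_mapDomain, hu]⟩ hα
      split_ifs <;> simp [this]
    · rintro ⟨β, hβ⟩
      exact hα ⟨β, by rw [Finsupp.embDomain_eq_mapDomain]; exact hβ⟩

end ModularOperad

end

/-! ### The plethystic exponential and logarithm of graded series -/

noncomputable section

namespace ModularOperad

open PowerSeries

universe w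

variable {k : Type w} [Field k] {σ : Type}

/-- Families of power sums with a grading for which `p_{n m}` has `n` times the degree of `p_m`. -/
class GradedVars (σ : Type) [PowerSumVars σ] where
  wt : σ → ℕ
  wt_scale : ∀ (n : ℕ+) (i : σ), wt (PowerSumVars.scale n i) = n * wt i
  scale_one : ∀ i : σ, PowerSumVars.scale 1 i = i
  scale_scale : ∀ (m n : ℕ+) (i : σ),
    PowerSumVars.scale m (PowerSumVars.scale n i) = PowerSumVars.scale (m * n) i

/-- In one alphabet, `p_n` has degree `2 n`. -/
instance : GradedVars ℕ+ where
  wt n := 2 * n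
  wt_scale n i := by
    have : ((PowerSumVars.scale n i : ℕ+) : ℕ) = n * i := PNat.mul_coe n i
    rw [this]; ring
  scale_one i := one_mul i
  scale_scale m n i := (mul_assoc m n i).symm

/-- In two alphabets, `p_n` has degree `n` and `q_n` has degree `2 n`. -/
instance : GradedVars (ℕ+ ⊕ ℕ+) where
  wt := Sum.elim (fun n => n) (fun n => 2 * n)
  wt_scale n i := by
    obtain i | i := i
    · exact PNat.mul_coe n i
    · have : ((PowerSumVars.scale n i : ℕ+) : ℕ) = n * i := PNat.mul_coe n i
      exact (congrArg (2 * ·) this).trans (mul_left_comm 2 (n : ℕ) i)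
  scale_one i := by
    obtain i | i := i
    · exact congrArg Sum.inl (one_mul i)
    · exact congrArg Sum.inr (one_mul i)
  scale_scale m n i := by
    obtain i | i := i
    · exact congrArg Sum.inl (mul_assoc m n i).symm
    · exact congrArg Sum.inr (mul_assoc m n i).symm

theorem adams_one [PowerSumVars σ] [GradedVars σ] (f : GradedSeries σ k) : adams 1 f = f := by
  ext1 d
  rw [coeff_adams, if_pos (by simp)]
  have : (⇑(PowerSumVars.scale (1 : ℕ+)) : σ → σ) = id := funext GradedVars.scale_one
  simp [this]

theorem adams_adams [PowerSumVars σ] [GradedVars σ] (m n : ℕ+) (f : GradedSeries σ k) :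
    adams m (adams n f) = adams (m * n) f := by
  ext1 d
  rw [coeff_adams, coeff_adams, coeff_adams]
  have : (⇑(PowerSumVars.scale m) : σ → σ) ∘ ⇑(PowerSumVars.scale n) =
    ⇑(PowerSumVars.scale (m * n)) := funext fun i => GradedVars.scale_scale m n i
  by_cases h : (m : ℕ) ∣ d
  · obtain ⟨d, rfl⟩ := h
    rw [if_pos (Nat.dvd_mul_right _ _), Nat.mul_div_cancel_left _ m.pos, PNat.mul_coe,
      Nat.mul_div_mul_left _ _ m.pos]
    simp only [Nat.mul_dvd_mul_iff_left m.pos]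
    split_ifs
    · rw [MvPolynomial.rename_rename, this]
    · simp
  · rw [if_neg h, if_neg]
    exact fun h' => h ((Dvd.intro _ (PNat.mul_coe m n).symm).trans h')

theorem adams_lsum [PowerSumVars σ] {ι : Type*} {f : ι → GradedSeries σ k} (hf : LocFin f)
    (n : ℕ+) : adams n (lsum f) = lsum fun i => adams n (f i) := by
  refine PowerSeries.ext fun d => ?_
  rw [coeff_lsum (fun i => adams n (f i)), coeff_adams]
  split_ifs with h
  · have : ∀ i, PowerSeries.coeff d (adams n (f i)) =
        MvPolynomial.rename (PowerSumVars.scale n) (PowerSeries.coeff (d / n) (f i)) := fun i => by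
      rw [coeff_adams, if_pos h]
    rw [finsum_congr this, coeff_lsum]
    exact (MvPolynomial.rename (R := k) (PowerSumVars.scale (σ := σ) n)).toAddMonoidHom.map_finsum
      (hf _)
  · refine (finsum_eq_zero_of_forall_eq_zero fun i => ?_).symm
    rw [coeff_adams, if_neg h]

/-- Without constant term `f` is divisible by `t`, so `adams n f` is divisible by `t ^ n` and only
the `n ≤ d` are seen in degree `d`. -/
theorem locFin_adams [PowerSumVars σ] {f : GradedSeries σ k} (h0 : constantCoeff f = 0)
    (c : ℕ+ → k) : LocFin fun n : ℕ+ => c n • ModularOperad.adams n f := by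
  intro d
  refine ((Set.finite_Iic d).preimage PNat.coe_injective.injOn).subset fun n hn => ?_
  by_contra h
  have h : d < n := not_le.1 h
  refine hn ?_
  rw [PowerSeries.coeff_smul, coeff_adams]
  split_ifs
  · rw [Nat.div_eq_of_lt h, coeff_zero_eq_constantCoeff_apply, h0]; simp
  · simp

/-- `∑ n ≥ 1, (p_n ∘ f) / n`. -/
def adamsSum [PowerSumVars σ] (f : GradedSeries σ k) : GradedSeries σ k :=
  lsum fun n : ℕ+ => ((n : k)⁻¹) • adams n f

/-- The plethystic exponential. -/
def plethExp [CharZero k] [PowerSumVars σ] (f : GradedSeries σ k) : GradedSeries σ k :=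
  (PowerSeries.exp (MvPolynomial σ k)).subst (adamsSum f)

theorem constantCoeff_adamsSum [PowerSumVars σ] {f : GradedSeries σ k}
    (h0 : constantCoeff f = 0) : constantCoeff (adamsSum f) = 0 := by
  rw [← coeff_zero_eq_constantCoeff_apply, adamsSum, coeff_lsum]
  refine finsum_eq_zero_of_forall_eq_zero fun n => ?_
  rw [PowerSeries.coeff_smul, coeff_adams]
  simp [h0]

theorem adamsSum_mem_evenSeries [PowerSumVars σ] [GradedVars σ] {f : GradedSeries σ k}
    (hf : f ∈ evenSeries k GradedVars.wt) (h0 : constantCoeff f = 0) :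
    adamsSum f ∈ evenSeries k GradedVars.wt :=
  lsum_mem_evenSeries (locFin_adams h0 _) fun n =>
    Subalgebra.smul_mem _ (adams_mem_evenSeries GradedVars.wt_scale hf n) _

theorem locFin_pow {A : Type*} [CommRing A] {s : PowerSeries A} (h0 : constantCoeff s = 0) :
    LocFin fun j : ℕ => s ^ j := by
  intro d
  obtain ⟨N, hN⟩ := Filter.eventually_atTop.1
    ((HasSubst.of_constantCoeff_zero' h0).eventually_coeff_pow_eq_zero d)
  refine (Set.finite_lt_nat N).subset fun j hj => ?_
  by_contra h
  exact hj (hN j (not_lt.1 h) d le_rfl)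

theorem LocFin.smul {A : Type*} [CommRing A] {R : Type*} [Semiring R] [Module R A] {ι : Type*}
    {f : ι → PowerSeries A} (hf : LocFin f) (c : ι → R) : LocFin fun i => c i • f i := by
  intro d
  refine (hf d).subset fun i hi h0 => hi ?_
  rw [PowerSeries.coeff_smul, h0, smul_zero]

theorem subst_eq_lsum {A : Type*} [CommRing A] {s : PowerSeries A} (h0 : constantCoeff s = 0)
    (f : PowerSeries A) : f.subst s = lsum fun j : ℕ => PowerSeries.coeff j f • s ^ j := by
  ext1 d
  rw [PowerSeries.coeff_subst' (HasSubst.of_constantCoeff_zero' h0), coeff_lsum]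
  rfl

theorem rat_smul_eq [CharZero k] {A : Type*} [CommRing A] [Algebra k A] [Algebra ℚ A] (q : ℚ) (x : A) :
    algebraMap ℚ A q • x = (q : k) • x := by
  rw [smul_eq_mul, Algebra.smul_def]
  congr 1
  have : algebraMap ℚ A = (algebraMap k A).comp (Rat.castHom k) := Subsingleton.elim _ _
  rw [this]; rfl

/-- On pairs with product `N` the denominators multiply to `N`, which leaves `1 / N` times the sum
of `μ` over the divisors of `N`. -/
theorem sum_moebius_pairs {M : Type*} [AddCommGroup M] [Module k M] (N : ℕ+) (x : M) (s : Finset (ℕ+ × ℕ+))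
    (hs : ∀ p : ℕ+ × ℕ+, p ∈ s ↔ p.1 * p.2 = N) :
    ∑ p ∈ s, ((ArithmeticFunction.moebius p.1 : k) / (p.1 : k)) • ((p.2 : k)⁻¹) • x =
      if N = 1 then x else 0 := by
  have h1 : ∀ p ∈ s, ((ArithmeticFunction.moebius p.1 : k) / (p.1 : k)) • ((p.2 : k)⁻¹) • x =
      (ArithmeticFunction.moebius p.1 : k) • ((N : k)⁻¹) • x := by
    intro p hp
    rw [hs] at hp
    rw [smul_smul, smul_smul, ← hp, PNat.mul_coe, Nat.cast_mul, mul_inv, div_eq_mul_inv, mul_assoc]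
  rw [Finset.sum_congr rfl h1, ← Finset.sum_smul]
  have h2 : ∑ p ∈ s, (ArithmeticFunction.moebius p.1 : ℤ) =
      ∑ p ∈ (N : ℕ).divisorsAntidiagonal, ArithmeticFunction.moebius p.1 := by
    refine Finset.sum_bij (fun p _ => ((p.1 : ℕ), (p.2 : ℕ))) ?_ ?_ ?_ ?_
    · intro p hp
      rw [hs] at hp
      rw [Nat.mem_divisorsAntidiagonal, ← hp]
      exact ⟨(PNat.mul_coe _ _).symm, (p.1 * p.2).ne_zero⟩
    · rintro ⟨a, b⟩ _ ⟨c, d⟩ _ h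
      simp only [Prod.mk.injEq, PNat.coe_inj] at h
      rw [h.1, h.2]
    · rintro ⟨a, b⟩ h
      rw [Nat.mem_divisorsAntidiagonal] at h
      have ha : 0 < a := Nat.pos_of_ne_zero fun h0 => h.2 (by rw [← h.1, h0]; simp)
      have hb : 0 < b := Nat.pos_of_ne_zero fun h0 => h.2 (by rw [← h.1, h0]; simp)
      exact ⟨(⟨a, ha⟩, ⟨b, hb⟩), (hs _).2 (PNat.eq h.1), rfl⟩
    · intro p _; rfl
  have h3 : ∑ p ∈ (N : ℕ).divisorsAntidiagonal, ArithmeticFunction.moebius p.1 =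
      if (N : ℕ) = 1 then 1 else 0 := by
    have := congrArg (fun f => f (N : ℕ)) ArithmeticFunction.moebius_mul_coe_zeta
    simp only [ArithmeticFunction.mul_apply, ArithmeticFunction.one_apply] at this
    rw [← this]
    refine Finset.sum_congr rfl fun p hp => ?_
    have := (Nat.mem_divisorsAntidiagonal.1 hp)
    have hb : p.2 ≠ 0 := fun h0 => this.2 (by rw [← this.1, h0]; simp)
    simp [hb]
  have h4 : (∑ p ∈ s, (ArithmeticFunction.moebius p.1 : k)) =
      ((∑ p ∈ s, (ArithmeticFunction.moebius p.1 : ℤ) : ℤ) : k) := by push_cast; rfl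
  rw [h4, h2, h3]
  by_cases hN : N = 1
  · simp [hN]
  · have : (N : ℕ) ≠ 1 := fun h => hN (PNat.eq h)
    simp [hN, this]

variable [CharZero k]

theorem exp_subst_eq_lsum {s : GradedSeries σ k} (h0 : constantCoeff s = 0) :
    (PowerSeries.exp (MvPolynomial σ k)).subst s =
      lsum fun j : ℕ => ((j.factorial : k)⁻¹) • s ^ j := by
  rw [subst_eq_lsum h0]
  congr 1
  funext j
  ext1 d
  rw [PowerSeries.coeff_smul, PowerSeries.coeff_smul, coeff_exp, rat_smul_eq (k := k)]
  simp

theorem plethExp_mem_evenSeries [PowerSumVars σ] [GradedVars σ] {f : GradedSeries σ k}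
    (hf : f ∈ evenSeries k GradedVars.wt) (h0 : constantCoeff f = 0) :
    plethExp f ∈ evenSeries k GradedVars.wt := by
  have hs := constantCoeff_adamsSum h0
  rw [plethExp, exp_subst_eq_lsum hs]
  exact lsum_mem_evenSeries ((locFin_pow hs).smul _) fun j =>
    Subalgebra.smul_mem _ (Subalgebra.pow_mem _ (adamsSum_mem_evenSeries hf h0) j) _

theorem hasExp_toSeries [PowerSumVars σ] [GradedVars σ] {f : GradedSeries σ k}
    (hf : f ∈ evenSeries k GradedVars.wt) (h0 : constantCoeff f = 0) :
    HasExp (toSeries GradedVars.wt f) (toSeries GradedVars.wt (plethExp f)) := by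
  have hs := constantCoeff_adamsSum h0
  refine ⟨toSeries GradedVars.wt (adamsSum f), ?_, ?_⟩
  · have := hasSeriesSum_toSeries (GradedVars.wt (σ := σ))
      (locFin_adams h0 fun n : ℕ+ => ((n : k)⁻¹))
    simp only [toSeries_smul, ← plethysm_toSeries GradedVars.wt_scale hf] at this
    exact this
  · have := hasSeriesSum_toSeries (GradedVars.wt (σ := σ))
      ((locFin_pow hs).smul fun j : ℕ => ((j.factorial : k)⁻¹))
    rw [← exp_subst_eq_lsum hs] at this
    simp only [toSeries_smul, toSeries_pow (adamsSum_mem_evenSeries hf h0)] at this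
    exact this

/-! ### Logarithms -/

theorem constantCoeff_exp_subst {A : Type*} [CommRing A] [Algebra ℚ A] {s : PowerSeries A}
    (h0 : constantCoeff s = 0) : constantCoeff ((PowerSeries.exp A).subst s) = 1 := by
  have h : constantCoeff ((PowerSeries.exp A - 1).subst s) = 0 :=
    PowerSeries.constantCoeff_subst_eq_zero h0 _ (by simp)
  rw [subst_sub (HasSubst.of_constantCoeff_zero' h0), map_sub, sub_eq_zero] at h
  rw [h]
  have : (1 : PowerSeries A).subst s = (1 : PowerSeries A) := by
    rw [← coe_substAlgHom (HasSubst.of_constantCoeff_zero' h0), map_one]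
  rw [this, map_one]

/-- Both sides have constant term zero, and the chain rule with `log' * (1 + X) = 1` shows that both
have the derivative of `s`; without additive torsion this determines a series. -/
theorem logOf_exp_subst {A : Type*} [CommRing A] [Algebra ℚ A] [IsAddTorsionFree A]
    {s : PowerSeries A} (h0 : constantCoeff s = 0) :
    logOf ((PowerSeries.exp A).subst s) = s := by
  have hs := HasSubst.of_constantCoeff_zero' h0
  have he := constantCoeff_exp_subst h0
  have he' : HasSubst ((PowerSeries.exp A).subst s - 1) :=
    HasSubst.of_constantCoeff_zero' (by rw [map_sub, he, map_one, sub_self])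
  refine derivative.ext ?_ ?_
  · rw [logOf_eq, derivative_subst he', map_sub, derivative_one, sub_zero, derivative_subst hs,
      derivative_exp, ← mul_assoc]
    have h1 : d⁄dX A (log A) * (1 + X) = 1 := by
      rw [deriv_log]
      ext n
      rw [mul_add, mul_one, map_add]
      cases n with
      | zero => simp
      | succ n =>
        rw [coeff_succ_mul_X, coeff_mk, coeff_mk, pow_succ, coeff_one, if_neg n.succ_ne_zero]
        simp
    have h2 := congrArg (PowerSeries.subst ((PowerSeries.exp A).subst s - 1)) h1
    rw [subst_mul he', subst_add he', subst_X he', ← coe_substAlgHom he', map_one,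
      coe_substAlgHom he', add_sub_cancel] at h2
    rw [h2, one_mul]
  · rw [constantCoeff_logOf he, h0]

theorem finsum_nat_eq_succ {M : Type*} [AddCommMonoid M] {f : ℕ → M} (h0 : f 0 = 0)
    (hf : {i | f i ≠ 0}.Finite) : ∑ᶠ i, f i = ∑ᶠ i, f (i + 1) := by
  obtain ⟨N, hN⟩ := hf.bddAbove
  rw [finsum_eq_sum_of_support_subset (s := Finset.range (N + 2)) f ?_,
    finsum_eq_sum_of_support_subset (s := Finset.range (N + 1)) _ ?_, Finset.sum_range_succ', h0,
    add_zero]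
  · intro i hi
    have := hN (show i + 1 ∈ {i | f i ≠ 0} from hi)
    simp only [Finset.coe_range, Set.mem_Iio]
    omega
  · intro i hi
    have := hN (show i ∈ {i | f i ≠ 0} from hi)
    simp only [Finset.coe_range, Set.mem_Iio]
    omega

theorem logOf_eq_lsum {f : GradedSeries σ k} (h1 : constantCoeff f = 1) :
    logOf f = lsum fun j : ℕ => ((-1) ^ j / (j + 1 : k)) • (f - 1) ^ (j + 1) := by
  have h0 : constantCoeff (f - 1) = 0 := by rw [map_sub, h1, map_one, sub_self]
  rw [logOf_eq, subst_eq_lsum h0]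
  ext1 d
  rw [coeff_lsum, coeff_lsum, finsum_nat_eq_succ (by simp)]
  · refine finsum_congr fun j => ?_
    rw [PowerSeries.coeff_smul, PowerSeries.coeff_smul, coeff_log, if_neg j.succ_ne_zero,
      rat_smul_eq (k := k)]
    simp [pow_add]
  · exact ((locFin_pow h0).smul _) d

theorem adams_exp_subst [PowerSumVars σ] {s : GradedSeries σ k} (h0 : constantCoeff s = 0)
    (n : ℕ+) : adams n ((PowerSeries.exp (MvPolynomial σ k)).subst s) =
      (PowerSeries.exp (MvPolynomial σ k)).subst (adams n s) := by
  have h1 : constantCoeff (adams n s) = 0 := by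
    rw [← coeff_zero_eq_constantCoeff_apply, coeff_adams]
    simp [h0]
  rw [exp_subst_eq_lsum h0, exp_subst_eq_lsum h1, adams_lsum ((locFin_pow h0).smul _)]
  simp only [adams_smul, map_pow]

/-- Möbius inversion: since `adams n` and `adams m` compose to `adams (n * m)`, the double sum
regroups by the product `N = n * m`, and only `N = 1` survives. -/
theorem moebius_adamsSum [PowerSumVars σ] [GradedVars σ] {f : GradedSeries σ k}
    (h0 : constantCoeff f = 0) :
    lsum (fun n : ℕ+ => ((ArithmeticFunction.moebius n : k) / (n : k)) • adams n (adamsSum f)) =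
      f := by
  classical
  ext1 d
  have hz : ∀ n : ℕ+, d < n → ∀ g : GradedSeries σ k, constantCoeff g = 0 →
      PowerSeries.coeff d (adams n g) = 0 := by
    intro n hn g hg
    rw [coeff_adams]
    split_ifs
    · rw [Nat.div_eq_of_lt hn, coeff_zero_eq_constantCoeff_apply, hg]; simp
    · rfl
  -- Degree `d` involves only indices up to `d`. The bound `d + 1` ensures that `1` belongs to `S`
  -- even for `d = 0`.
  obtain ⟨S, hmem⟩ : ∃ S : Finset ℕ+, ∀ n : ℕ+, n ∈ S ↔ (n : ℕ) ≤ d + 1 := by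
    have hfin := (Set.finite_Iic (d + 1)).preimage PNat.coe_injective.injOn
    exact ⟨hfin.toFinset, fun n => by rw [Set.Finite.mem_toFinset]; rfl⟩
  have hS : ∀ n : ℕ+, n ∉ S → d < n := by
    intro n hn
    rw [hmem] at hn
    omega
  have hin : ∀ n : ℕ+, PowerSeries.coeff d (adams n (adamsSum f)) =
      ∑ m ∈ S, ((m : k)⁻¹) • PowerSeries.coeff d (adams (n * m) f) := by
    intro n
    rw [adamsSum, adams_lsum (locFin_adams h0 _), coeff_lsum,
      finsum_eq_sum_of_support_subset (s := S)]
    · refine Finset.sum_congr rfl fun m _ => ?_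
      rw [adams_smul, PowerSeries.coeff_smul, adams_adams]
    · intro m hm
      by_contra h
      refine hm ?_
      dsimp only
      rw [adams_smul, adams_adams, PowerSeries.coeff_smul, hz _ _ _ h0, smul_zero]
      refine (hS m h).trans_le ?_
      rw [PNat.mul_coe]
      exact Nat.le_mul_of_pos_left _ n.pos
  rw [coeff_lsum, finsum_eq_sum_of_support_subset (s := S)]
  · have h1 : ∀ n ∈ S, PowerSeries.coeff d (((ArithmeticFunction.moebius n : k) / (n : k)) •
        adams n (adamsSum f)) = ∑ m ∈ S, ((ArithmeticFunction.moebius n : k) / (n : k)) •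
          ((m : k)⁻¹) • PowerSeries.coeff d (adams (n * m) f) := by
      intro n _
      rw [PowerSeries.coeff_smul, hin, Finset.smul_sum]
    rw [Finset.sum_congr rfl h1, ← Finset.sum_product', ← Finset.sum_filter_add_sum_filter_not
      (S ×ˢ S) (fun p => p.1 * p.2 ∈ S)]
    rw [Finset.sum_eq_zero (s := (S ×ˢ S).filter (fun p => ¬ p.1 * p.2 ∈ S)), add_zero,
      ← Finset.sum_fiberwise_of_maps_to (t := S) (g := fun p : ℕ+ × ℕ+ => p.1 * p.2)
        (fun p hp => (Finset.mem_filter.1 hp).2)]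
    · have h2 : ∀ N ∈ S, ∑ p ∈ ((S ×ˢ S).filter (fun p => p.1 * p.2 ∈ S)).filter
          (fun p => p.1 * p.2 = N), ((ArithmeticFunction.moebius p.1 : k) / (p.1 : k)) •
            ((p.2 : k)⁻¹) • PowerSeries.coeff d (adams (p.1 * p.2) f) =
            if N = 1 then PowerSeries.coeff d (adams N f) else 0 := by
        intro N hN
        rw [← sum_moebius_pairs (k := k) N (PowerSeries.coeff d (adams N f))
          (((S ×ˢ S).filter (fun p => p.1 * p.2 ∈ S)).filter (fun p => p.1 * p.2 = N))]
        · refine Finset.sum_congr rfl fun p hp => ?_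
          rw [(Finset.mem_filter.1 hp).2]
        · rintro ⟨a, b⟩
          rw [Finset.mem_filter, Finset.mem_filter, Finset.mem_product]
          refine ⟨fun h => h.2, fun h => ⟨⟨⟨?_, ?_⟩, ?_⟩, h⟩⟩
          · have hN' := (hmem N).1 hN
            rw [← h, PNat.mul_coe] at hN'
            exact (hmem a).2 (le_trans (Nat.le_mul_of_pos_right _ b.pos) hN')
          · have hN' := (hmem N).1 hN
            rw [← h, PNat.mul_coe] at hN'
            exact (hmem b).2 (le_trans (Nat.le_mul_of_pos_left _ a.pos) hN')
          · dsimp only at h ⊢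
            rwa [h]
      rw [Finset.sum_congr rfl h2, Finset.sum_ite_eq', if_pos, adams_one]
      exact (hmem 1).2 (by simp)
    · intro p hp
      rw [hz _ (hS _ (Finset.mem_filter.1 hp).2) _ h0, smul_zero, smul_zero]
  · intro n hn
    by_contra h
    refine hn ?_
    dsimp only
    rw [PowerSeries.coeff_smul, hz _ (hS n h) _ (constantCoeff_adamsSum h0), smul_zero]

/-- The Adams operations commute with `exp`, so the logarithm of `adams n` of the plethystic
exponential is `adams n (adamsSum f)`; Möbius inversion of these recovers `f`. -/
theorem hasLog_toSeries [PowerSumVars σ] [GradedVars σ] {f : GradedSeries σ k}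
    (hf : f ∈ evenSeries k GradedVars.wt) (h0 : constantCoeff f = 0) :
    HasLog (toSeries GradedVars.wt (plethExp f)) (toSeries GradedVars.wt f) := by
  have hs := constantCoeff_adamsSum h0
  have hE := plethExp_mem_evenSeries hf h0
  have h1 : ∀ n : ℕ+, constantCoeff (adams n (adamsSum f)) = 0 := fun n => by
    rw [← coeff_zero_eq_constantCoeff_apply, coeff_adams]
    simp [hs]
  have hlog : ∀ n : ℕ+, logOf (adams n (plethExp f)) = adams n (adamsSum f) := fun n => by
    rw [plethExp, adams_exp_subst hs, logOf_exp_subst (h1 n)]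
  have hc : ∀ n : ℕ+, constantCoeff (adams n (plethExp f)) = 1 := fun n => by
    rw [plethExp, adams_exp_subst hs, constantCoeff_exp_subst (h1 n)]
  have hc' : ∀ n : ℕ+, constantCoeff (adams n (plethExp f) - 1) = 0 := fun n => by
    rw [map_sub, hc, map_one, sub_self]
  refine ⟨fun n => toSeries GradedVars.wt (adams n (adamsSum f)), fun n => ?_, ?_⟩
  · have hlf : LocFin fun j : ℕ =>
        ((-1) ^ j / (j + 1 : k)) • (adams n (plethExp f) - 1) ^ (j + 1) := by
      refine LocFin.smul (fun d => ?_) _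
      exact ((locFin_pow (hc' n)) d).preimage (f := fun j => j + 1) (add_left_injective 1).injOn
    have := hasSeriesSum_toSeries (GradedVars.wt (σ := σ)) hlf
    rw [← logOf_eq_lsum (hc n), hlog] at this
    have he : adams n (plethExp f) - 1 ∈ evenSeries k (GradedVars.wt (σ := σ)) :=
      Subalgebra.sub_mem _ (adams_mem_evenSeries GradedVars.wt_scale hE n) (Subalgebra.one_mem _)
    simpa only [toSeries_smul, toSeries_pow he, toSeries_sub, toSeries_one,
      ← plethysm_toSeries GradedVars.wt_scale hE] using this
  · have := hasSeriesSum_toSeries (GradedVars.wt (σ := σ))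
      (locFin_adams hs fun n : ℕ+ => ((ArithmeticFunction.moebius n : k) / (n : k)))
    rw [moebius_adamsSum h0] at this
    simpa only [toSeries_smul] using this

end ModularOperad

end

noncomputable section

namespace ModularOperad

open PowerSeries

universe w

/-! ### The formal Gaussian integral of graded series -/

section Gauss

variable {k : Type w} [Field k]

/-- The coefficient of the power of `ħ` in `gaussMoment n a`. -/
def gaussNum (n : ℕ) : ℕ → ℕ
  | 0 => 1
  | 1 => if Even n then 1 else 0
  | a + 2 => (if Even n then gaussNum n (a + 1) else 0) + (a + 1) * n * gaussNum n a

theorem gaussNum_of_odd {n : ℕ} (hn : ¬ Even n) (a : ℕ) (ha : ¬ Even a) : gaussNum n a = 0 := by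
  induction a using Nat.twoStepInduction with
  | zero => simp at ha
  | one => simp [gaussNum, hn]
  | more a h1 _ =>
    rw [gaussNum, if_neg hn, h1 (fun h => ha (h.add even_two)), mul_zero, add_zero]

-- In the Gaussian factor `p_n` has the size of `ħ ^ (n / 2)`, so each moment is one power of `ħ`
-- with an integral coefficient. The rounding in the exponent matters only when `n * a` is odd, and
-- then `gaussNum` vanishes.
open Polynomial in
theorem gaussMoment_eq (n : ℕ+) (a : ℕ) :
    gaussMoment n a = (gaussNum n a : ℤ[X]) * Polynomial.X ^ ((n : ℕ) * a / 2) := by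
  induction a using Nat.twoStepInduction with
  | zero => simp [gaussMoment, gaussNum]
  | one =>
    rw [gaussMoment, gaussMean, gaussNum]
    split_ifs <;> simp
  | more a h1 h2 =>
    rw [gaussMoment, h1, h2, gaussMean, gaussNum]
    have e1 : (n : ℕ) * (a + 2) / 2 = n + n * a / 2 := by
      rw [show (n : ℕ) * (a + 2) = n * a + n * 2 by ring, Nat.add_mul_div_right _ _ two_pos,
        add_comm]
    by_cases hn : Even (n : ℕ)
    · obtain ⟨m, hm⟩ := hn
      have hev : Even (n : ℕ) := ⟨m, hm⟩
      have e2 : (n : ℕ) * (a + 1) / 2 = m * (a + 1) := by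
        rw [hm, ← two_mul, mul_assoc, Nat.mul_div_cancel_left _ two_pos]
      have e3 : (n : ℕ) * a / 2 = m * a := by
        rw [hm, ← two_mul, mul_assoc, Nat.mul_div_cancel_left _ two_pos]
      have e4 : (n : ℕ) / 2 = m := by omega
      have e5 : (n : ℕ) = 2 * m := by omega
      rw [if_pos hev, if_pos hev, e1, e2, e3, e4]
      push_cast
      rw [show (Polynomial.X : ℤ[X]) ^ (n : ℕ) = Polynomial.X ^ (2 * m) by rw [← e5]]
      rw [show (Polynomial.X : ℤ[X]) ^ ((n : ℕ) + m * a) = Polynomial.X ^ (2 * m + m * a) by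
        rw [← e5]]
      ring
    · rw [if_neg hn, if_neg hn, e1]
      push_cast
      ring

/-- The product of the numbers `gaussNum n (α n)`. -/
def gaussWeight (α : ℕ+ →₀ ℕ) : ℕ := α.prod fun n a => gaussNum n a

theorem monomialIntegral_eq (k : Type w) [Field k] (α : ℕ+ →₀ ℕ) : monomialIntegral k α =
    HahnSeries.single ((Finsupp.weight (fun n : ℕ+ => (n : ℕ)) α / 2 : ℕ) : ℤ)
      (gaussWeight α : k) := by
  have h1 : ∀ n a, Polynomial.aeval (hbar k 1) (gaussMoment n a) =
      HahnSeries.single (((n : ℕ) * a / 2 : ℕ) : ℤ) (gaussNum n a : k) := by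
    intro n a
    rw [gaussMoment_eq, map_mul, map_natCast, map_pow, Polynomial.aeval_X, hbar,
      HahnSeries.single_pow, one_pow, ← nsmul_eq_mul, nsmul_one, nsmul_eq_mul]
    have : ((gaussNum n a : ℕ) : LaurentSeries k) = HahnSeries.single 0 ((gaussNum n a : ℕ) : k) := by
      rw [← HahnSeries.C_apply, map_natCast]
    rw [this, HahnSeries.single_mul_single]
    simp
  rw [monomialIntegral, Finsupp.prod]
  simp only [h1]
  by_cases hev : ∀ n ∈ α.support, Even ((n : ℕ) * α n)
  · have h2 : ∀ s : Finset ℕ+, (∀ n ∈ s, Even ((n : ℕ) * α n)) →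
        ∏ n ∈ s, HahnSeries.single (((n : ℕ) * α n / 2 : ℕ) : ℤ) (gaussNum n (α n) : k) =
          HahnSeries.single (((∑ n ∈ s, (n : ℕ) * α n) / 2 : ℕ) : ℤ)
            ((∏ n ∈ s, gaussNum n (α n) : ℕ) : k) := by
      classical
      intro s
      induction s using Finset.induction_on with
      | empty => intro _; simp
      | insert x s hx ih =>
        intro hs
        rw [Finset.prod_insert hx, ih fun n hn => hs n (Finset.mem_insert_of_mem hn),
          HahnSeries.single_mul_single, Finset.sum_insert hx, Finset.prod_insert hx,
          Nat.add_div_of_dvd_right (hs x (Finset.mem_insert_self _ _)).two_dvd]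
        push_cast
        rfl
    rw [h2 _ hev, Finsupp.weight_apply, gaussWeight, Finsupp.prod, Finsupp.sum]
    simp only [smul_eq_mul, mul_comm]
  -- If some `n * α n` is odd, the corresponding moment vanishes and both sides are zero. Hence no
  -- odd number is halved in a case that counts.
  · push Not at hev
    obtain ⟨n, hn, hodd⟩ := hev
    rw [Nat.even_mul, not_or] at hodd
    have h0 := gaussNum_of_odd hodd.1 _ hodd.2
    have h2 : gaussWeight α = 0 := Finset.prod_eq_zero hn h0
    rw [h2, Finset.prod_eq_zero hn]
    · simp
    · rw [h0]; simp

/-- The linear map `p ^ α * q ^ β ↦ c_α * q ^ β` with `c_α = gaussWeight α`. -/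
def gaussLin (k : Type w) [Field k] : MvPolynomial (ℕ+ ⊕ ℕ+) k →ₗ[k] MvPolynomial ℕ+ k :=
  (MvPolynomial.basisMonomials (ℕ+ ⊕ ℕ+) k).constr k fun γ =>
    MvPolynomial.monomial (Finsupp.sumFinsuppEquivProdFinsupp γ).2
      (gaussWeight (Finsupp.sumFinsuppEquivProdFinsupp γ).1 : k)

theorem gaussLin_monomial (α β : ℕ+ →₀ ℕ) (c : k) :
    gaussLin k (MvPolynomial.monomial (α.sumElim β) c) =
      MvPolynomial.monomial β (c * gaussWeight α) := by
  have h : gaussLin k (MvPolynomial.monomial (α.sumElim β) 1) =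
      MvPolynomial.monomial β (gaussWeight α : k) := by
    have := (MvPolynomial.basisMonomials (ℕ+ ⊕ ℕ+) k).constr_basis k (fun γ =>
      MvPolynomial.monomial (Finsupp.sumFinsuppEquivProdFinsupp γ).2
        (gaussWeight (Finsupp.sumFinsuppEquivProdFinsupp γ).1 : k)) (α.sumElim β)
    rw [MvPolynomial.coe_basisMonomials] at this
    refine this.trans ?_
    have h2 : Finsupp.sumFinsuppEquivProdFinsupp (α.sumElim β) = (α, β) :=
      Finsupp.sumFinsuppEquivProdFinsupp.apply_symm_apply (α, β)
    rw [h2]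
  have h2 : MvPolynomial.monomial (α.sumElim β) c =
      c • MvPolynomial.monomial (α.sumElim β) (1 : k) := by
    rw [MvPolynomial.smul_monomial, smul_eq_mul, mul_one]
  rw [h2, map_smul, h, MvPolynomial.smul_monomial, smul_eq_mul]

theorem sumElim_injective (β : ℕ+ →₀ ℕ) :
    Function.Injective fun α : ℕ+ →₀ ℕ => α.sumElim β := fun α α' h => by
  have := Finsupp.sumFinsuppEquivProdFinsupp.symm.injective
    (a₁ := (α, β)) (a₂ := (α', β)) h
  exact (Prod.mk.injEq _ _ _ _ ▸ this).1

theorem finite_coeff_sumElim (P : MvPolynomial (ℕ+ ⊕ ℕ+) k) (β : ℕ+ →₀ ℕ) :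
    {α : ℕ+ →₀ ℕ | MvPolynomial.coeff (α.sumElim β) P ≠ 0}.Finite := by
  refine (P.support.finite_toSet.preimage (sumElim_injective β).injOn).subset fun α h => ?_
  exact MvPolynomial.mem_support_iff.2 h

theorem coeff_gaussLin (P : MvPolynomial (ℕ+ ⊕ ℕ+) k) (β : ℕ+ →₀ ℕ) :
    MvPolynomial.coeff β (gaussLin k P) =
      ∑ᶠ α : ℕ+ →₀ ℕ, MvPolynomial.coeff (α.sumElim β) P * gaussWeight α := by
  classical
  induction P using MvPolynomial.induction_on' with
  | monomial γ c =>
    obtain ⟨⟨α, β'⟩, rfl⟩ := Finsupp.sumFinsuppEquivProdFinsupp.symm.surjective γ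
    change MvPolynomial.coeff β (gaussLin k (MvPolynomial.monomial (α.sumElim β') c)) =
      ∑ᶠ α', MvPolynomial.coeff (α'.sumElim β) (MvPolynomial.monomial (α.sumElim β') c) *
        (gaussWeight α' : k)
    have hinj : ∀ α', α.sumElim β' = α'.sumElim β ↔ α = α' ∧ β' = β := by
      intro α'
      have := (Finsupp.sumFinsuppEquivProdFinsupp.symm :
        (ℕ+ →₀ ℕ) × (ℕ+ →₀ ℕ) ≃ (ℕ+ ⊕ ℕ+ →₀ ℕ)).injective.eq_iff
        (a := (α, β')) (b := (α', β))
      rw [Prod.mk.injEq] at this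
      exact this
    rw [gaussLin_monomial, MvPolynomial.coeff_monomial, finsum_eq_single _ α]
    · rw [MvPolynomial.coeff_monomial]
      simp only [hinj, true_and]
      split_ifs <;> simp
    · intro α' h
      rw [MvPolynomial.coeff_monomial, if_neg, zero_mul]
      rw [hinj]
      exact fun h' => h h'.1.symm
  | add P Q hP hQ =>
    rw [map_add, MvPolynomial.coeff_add, hP, hQ, ← finsum_add_distrib]
    · refine finsum_congr fun α => ?_
      rw [MvPolynomial.coeff_add, add_mul]
    · refine (finite_coeff_sumElim P β).subset fun α h h0 => h ?_
      dsimp only; rw [h0, zero_mul]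
    · refine (finite_coeff_sumElim Q β).subset fun α h h0 => h ?_
      dsimp only; rw [h0, zero_mul]

/-- The formal Gaussian integral, coefficientwise. -/
def gaussSeries (E : GradedSeries (ℕ+ ⊕ ℕ+) k) : GradedSeries ℕ+ k :=
  PowerSeries.mk fun d => gaussLin k (PowerSeries.coeff d E)

theorem weight_sumElim (α β : ℕ+ →₀ ℕ) :
    Finsupp.weight (GradedVars.wt (σ := ℕ+ ⊕ ℕ+)) (α.sumElim β) =
      Finsupp.weight (fun n : ℕ+ => (n : ℕ)) α + Finsupp.weight (GradedVars.wt (σ := ℕ+)) β := by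
  rw [Finsupp.weight_apply, Finsupp.weight_apply, Finsupp.weight_apply]
  exact Finsupp.sum_sumElim (g := fun i (c : ℕ) => c • GradedVars.wt (σ := ℕ+ ⊕ ℕ+) i) ..

theorem gaussWeight_of_odd {α : ℕ+ →₀ ℕ}
    (h : ¬ Even (Finsupp.weight (fun n : ℕ+ => (n : ℕ)) α)) : gaussWeight α = 0 := by
  by_contra h0
  refine h ?_
  rw [Finsupp.weight_apply]
  refine Finset.even_sum _ fun n hn => ?_
  by_contra hodd
  replace hodd : ¬ Even (α n * (n : ℕ)) := hodd
  rw [Nat.even_mul, not_or] at hodd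
  exact h0 (Finset.prod_eq_zero hn (gaussNum_of_odd hodd.2 _ hodd.1))

/-- The factor `ħ ^ (wt α / 2)` produced by `p ^ α` cancels the shift by `wt α` in `toSeries`. For
given `β` and `e`, all `α` therefore draw on one coefficient of `E` in `t`, which is a polynomial,
so only finitely many contribute. When `wt α` is odd, both the integral and `gaussWeight α` are
zero. -/
theorem hasGaussIntegral_toSeries (E : GradedSeries (ℕ+ ⊕ ℕ+) k) :
    HasGaussIntegral (toSeries GradedVars.wt E) (toSeries GradedVars.wt (gaussSeries E)) := by
  intro β
  have key : ∀ (α : ℕ+ →₀ ℕ) (e : ℤ),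
      (MvPowerSeries.coeff (α.sumElim β) (toSeries GradedVars.wt E) *
        monomialIntegral k α).coeff e =
      if 0 ≤ 2 * e + (Finsupp.weight (GradedVars.wt (σ := ℕ+)) β : ℤ) then
        MvPolynomial.coeff (α.sumElim β) (PowerSeries.coeff
          (2 * e + Finsupp.weight (GradedVars.wt (σ := ℕ+)) β : ℤ).toNat E) *
          (gaussWeight α : k) else 0 := by
    intro α e
    rw [monomialIntegral_eq]
    by_cases hev : Even (Finsupp.weight (fun n : ℕ+ => (n : ℕ)) α)
    · obtain ⟨x, hx⟩ := hev
      have hx2 : Finsupp.weight (fun n : ℕ+ => (n : ℕ)) α / 2 = x := by omega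
      have : e = (e - x) + x := by ring
      rw [hx2]
      conv_lhs => rw [this]
      rw [HahnSeries.coeff_mul_single_add, coeff_toSeries, weight_sumElim, hx]
      have e1 : 2 * (e - (x : ℤ)) + ((x + x + Finsupp.weight (GradedVars.wt (σ := ℕ+)) β : ℕ) : ℤ) =
          2 * e + Finsupp.weight (GradedVars.wt (σ := ℕ+)) β := by push_cast; ring
      rw [e1]
      split_ifs <;> simp
    · rw [gaussWeight_of_odd hev]
      simp
  refine hasLaurentSum_of_bounded (-(Finsupp.weight (GradedVars.wt (σ := ℕ+)) β : ℤ)) ?_ ?_ ?_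
  · intro α e h
    rw [key, ite_ne_right_iff] at h
    omega
  · intro e
    refine (finite_coeff_sumElim (PowerSeries.coeff
      (2 * e + Finsupp.weight (GradedVars.wt (σ := ℕ+)) β : ℤ).toNat E) β).subset fun α h h0 => ?_
    rw [Set.mem_ofPred_eq, key, h0] at h
    simp at h
  · intro e
    rw [finsum_congr fun α => key α e, coeff_toSeries]
    split_ifs
    · rw [gaussSeries, PowerSeries.coeff_mk, coeff_gaussLin]
    · simp

end Gauss

/-! ### Specialization of an auxiliary variable to `1` -/

section Specialize

variable {A : Type*} [CommRing A]

/-- The degree in the auxiliary variable is at most four times the degree in `t`. -/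
def AuxBounded (f : PowerSeries (PowerSeries A)) : Prop :=
  ∀ l d, 4 * d < l → PowerSeries.coeff d (PowerSeries.coeff l f) = 0

/-- The specialization of the auxiliary variable to `1`. -/
def specialize (f : PowerSeries (PowerSeries A)) : PowerSeries A :=
  PowerSeries.mk fun d => ∑ l ∈ Finset.range (4 * d + 1),
    PowerSeries.coeff d (PowerSeries.coeff l f)

theorem coeff_specialize (f : PowerSeries (PowerSeries A)) (d : ℕ) :
    PowerSeries.coeff d (specialize f) = ∑ l ∈ Finset.range (4 * d + 1),
      PowerSeries.coeff d (PowerSeries.coeff l f) := PowerSeries.coeff_mk _ _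

theorem specialize_one : specialize (1 : PowerSeries (PowerSeries A)) = 1 := by
  ext d
  rw [coeff_specialize, Finset.sum_range_succ']
  simp

theorem AuxBounded.one : AuxBounded (1 : PowerSeries (PowerSeries A)) := by
  intro l d h
  rw [PowerSeries.coeff_one, if_neg (by omega), map_zero]

theorem AuxBounded.mul {f g : PowerSeries (PowerSeries A)} (hf : AuxBounded f)
    (hg : AuxBounded g) : AuxBounded (f * g) := by
  intro l d h
  rw [PowerSeries.coeff_mul, map_sum]
  refine Finset.sum_eq_zero fun p hp => ?_
  rw [PowerSeries.coeff_mul]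
  refine Finset.sum_eq_zero fun q hq => ?_
  rw [Finset.HasAntidiagonal.mem_antidiagonal] at hp hq
  by_cases h1 : 4 * q.1 < p.1
  · rw [hf _ _ h1, zero_mul]
  · rw [hg _ _ (by omega), mul_zero]

theorem AuxBounded.pow {f : PowerSeries (PowerSeries A)} (hf : AuxBounded f) (n : ℕ) :
    AuxBounded (f ^ n) := by
  induction n with
  | zero => simpa using AuxBounded.one
  | succ n ih => rw [pow_succ]; exact ih.mul hf

/-- By the bounds on `f` and `g`, the pairs of auxiliary degrees that contribute to `t`-degrees `q.1
+ q.2 = d` fill the rectangle up to `4 * q.1` and `4 * q.2`. Their sums do not exceed `4 * d`, so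
the truncation in the definition loses nothing. -/
theorem specialize_mul {f g : PowerSeries (PowerSeries A)} (hf : AuxBounded f)
    (hg : AuxBounded g) : specialize (f * g) = specialize f * specialize g := by
  ext d
  rw [coeff_specialize, PowerSeries.coeff_mul]
  simp only [coeff_specialize, PowerSeries.coeff_mul, map_sum]
  have h1 : ∀ l ∈ Finset.range (4 * d + 1),
      ∑ p ∈ Finset.HasAntidiagonal.antidiagonal l, ∑ q ∈ Finset.HasAntidiagonal.antidiagonal d,
        PowerSeries.coeff q.1 (PowerSeries.coeff p.1 f) *
          PowerSeries.coeff q.2 (PowerSeries.coeff p.2 g) =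
      ∑ q ∈ Finset.HasAntidiagonal.antidiagonal d, ∑ p ∈ Finset.HasAntidiagonal.antidiagonal l,
        PowerSeries.coeff q.1 (PowerSeries.coeff p.1 f) *
          PowerSeries.coeff q.2 (PowerSeries.coeff p.2 g) := fun l _ => Finset.sum_comm
  rw [Finset.sum_congr rfl h1, Finset.sum_comm]
  refine Finset.sum_congr rfl fun q hq => ?_
  rw [Finset.HasAntidiagonal.mem_antidiagonal] at hq
  rw [Finset.sum_mul_sum, ← Finset.sum_product', ← Finset.sum_fiberwise_of_maps_to
    (t := Finset.range (4 * d + 1)) (g := fun p : ℕ × ℕ => p.1 + p.2)]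
  · refine Finset.sum_congr rfl fun l hl => (Finset.sum_subset ?_ ?_).symm
    · intro p hp
      exact Finset.HasAntidiagonal.mem_antidiagonal.2 (Finset.mem_filter.1 hp).2
    · intro p hp hp'
      rw [Finset.HasAntidiagonal.mem_antidiagonal] at hp
      rw [Finset.mem_filter, Finset.mem_product, Finset.mem_range, Finset.mem_range] at hp'
      by_cases h1 : 4 * q.1 < p.1
      · rw [hf _ _ h1, zero_mul]
      · rw [hg _ _ (by omega), mul_zero]
  · intro p hp
    rw [Finset.mem_product, Finset.mem_range, Finset.mem_range] at hp
    rw [Finset.mem_range]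
    omega

theorem specialize_pow {f : PowerSeries (PowerSeries A)} (hf : AuxBounded f) (n : ℕ) :
    specialize (f ^ n) = specialize f ^ n := by
  induction n with
  | zero => rw [pow_zero, pow_zero, specialize_one]
  | succ n ih => rw [pow_succ, pow_succ, specialize_mul (hf.pow n) hf, ih]

theorem coeff_pow_of_lt {s : PowerSeries A} (h0 : constantCoeff s = 0) {l j : ℕ} (h : l < j) :
    PowerSeries.coeff l (s ^ j) = 0 :=
  PowerSeries.X_pow_dvd_iff.1 (pow_dvd_pow_of_dvd (PowerSeries.X_dvd_iff.2 h0) j) l h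

theorem coeff_exp_subst [Algebra ℚ A] {s : PowerSeries A} (h0 : constantCoeff s = 0) {l N : ℕ}
    (h : l ≤ N) : PowerSeries.coeff l ((PowerSeries.exp A).subst s) =
      ∑ j ∈ Finset.range (N + 1), (1 / (j.factorial : ℚ)) • PowerSeries.coeff l (s ^ j) := by
  rw [PowerSeries.coeff_subst' (HasSubst.of_constantCoeff_zero' h0),
    finsum_eq_sum_of_support_subset (s := Finset.range (N + 1))]
  · refine Finset.sum_congr rfl fun j _ => ?_
    rw [coeff_exp, smul_eq_mul, ← Algebra.smul_def]
  · intro j hj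
    by_contra h1
    refine hj ?_
    dsimp only
    rw [Finset.mem_coe, Finset.mem_range] at h1
    rw [coeff_pow_of_lt h0 (by omega), smul_zero]

theorem coeff_rat_smul [Algebra ℚ A] (q : ℚ) (f : PowerSeries A) (d : ℕ) :
    PowerSeries.coeff d (q • f) = q • PowerSeries.coeff d f := by
  rw [Algebra.smul_def, Algebra.smul_def, PowerSeries.algebraMap_apply, PowerSeries.coeff_C_mul]

theorem constantCoeff_specialize {c : PowerSeries (PowerSeries A)} (h0 : constantCoeff c = 0) :
    constantCoeff (specialize c) = 0 := by
  rw [← coeff_zero_eq_constantCoeff_apply, coeff_specialize]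
  simp [h0]

/-- The exponential series may be cut at the common index `4 * d` on both sides, since neither `c`
nor its specialization has a constant term; what remains is compatibility with finite sums and
powers. -/
theorem specialize_exp [Algebra ℚ A] {c : PowerSeries (PowerSeries A)}
    (h0 : constantCoeff c = 0) (hc : AuxBounded c) :
    specialize ((PowerSeries.exp (PowerSeries A)).subst c) =
      (PowerSeries.exp A).subst (specialize c) := by
  ext d
  rw [coeff_specialize, coeff_exp_subst (constantCoeff_specialize h0)
    (show d ≤ 4 * d by omega)]
  have h1 : ∀ l ∈ Finset.range (4 * d + 1), PowerSeries.coeff d (PowerSeries.coeff l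
      ((PowerSeries.exp (PowerSeries A)).subst c)) = ∑ j ∈ Finset.range (4 * d + 1),
        (1 / (j.factorial : ℚ)) • PowerSeries.coeff d (PowerSeries.coeff l (c ^ j)) := by
    intro l hl
    rw [Finset.mem_range] at hl
    rw [coeff_exp_subst h0 (show l ≤ 4 * d by omega), map_sum]
    exact Finset.sum_congr rfl fun j _ => coeff_rat_smul _ _ _
  rw [Finset.sum_congr rfl h1, Finset.sum_comm]
  refine Finset.sum_congr rfl fun j _ => ?_
  rw [← Finset.smul_sum, ← specialize_pow hc, coeff_specialize]

/-- The equation `f' = f * c'` determines `(n + 1)` times the next coefficient from the previous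
ones, so it has only one solution with constant term `1`. -/
theorem eq_exp_subst_of_derivative [Algebra ℚ A] [IsAddTorsionFree A] {f c : PowerSeries A}
    (h0 : constantCoeff c = 0) (hf : constantCoeff f = 1) (hd : d⁄dX A f = f * d⁄dX A c) :
    f = (PowerSeries.exp A).subst c := by
  have he : d⁄dX A ((PowerSeries.exp A).subst c) = (PowerSeries.exp A).subst c * d⁄dX A c := by
    rw [derivative_subst (HasSubst.of_constantCoeff_zero' h0), derivative_exp]
  ext n
  induction n using Nat.strong_induction_on with
  | _ n ih =>
    cases n with
    | zero =>
      rw [coeff_zero_eq_constantCoeff_apply, coeff_zero_eq_constantCoeff_apply, hf,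
        constantCoeff_exp_subst h0]
    | succ n =>
      have e1 := congrArg (PowerSeries.coeff n) hd
      have e2 := congrArg (PowerSeries.coeff n) he
      rw [coeff_derivative, PowerSeries.coeff_mul] at e1 e2
      have e3 : PowerSeries.coeff (n + 1) f * ((n : A) + 1) =
          PowerSeries.coeff (n + 1) ((PowerSeries.exp A).subst c) * ((n : A) + 1) := by
        rw [e1, e2]
        refine Finset.sum_congr rfl fun p hp => ?_
        rw [Finset.HasAntidiagonal.mem_antidiagonal] at hp
        rw [ih p.1 (by omega)]
      rw [← Nat.cast_succ, mul_comm, ← nsmul_eq_mul, mul_comm, ← nsmul_eq_mul] at e3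
      exact (smul_right_inj (Nat.succ_ne_zero n)).mp e3

end Specialize

end ModularOperad

end

noncomputable section

namespace ModularOperad

/-! ### Orbits of permutations -/

section Orbits

variable {Z Z' : Type} [Finite Z] [Finite Z'] {M : Type*} [CommMonoid M]

/-- The set of orbits of a permutation. -/
def Orb (φ : Equiv.Perm Z) : Type := Quotient (Equiv.Perm.SameCycle.setoid φ)

instance (φ : Equiv.Perm Z) : Finite (Orb φ) :=
  inferInstanceAs (Finite (Quotient (Equiv.Perm.SameCycle.setoid φ)))

instance (φ : Equiv.Perm Z) : Fintype (Orb φ) := Fintype.ofFinite _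

/-- The orbit of an element. -/
def Orb.mk (φ : Equiv.Perm Z) (z : Z) : Orb φ := Quotient.mk (Equiv.Perm.SameCycle.setoid φ) z

/-- A representative of an orbit. -/
def Orb.out {φ : Equiv.Perm Z} (o : Orb φ) : Z := Quotient.out o

theorem Orb.mk_out {φ : Equiv.Perm Z} (o : Orb φ) : Orb.mk φ o.out = o := Quotient.out_eq o

theorem Orb.mk_eq_mk {φ : Equiv.Perm Z} {z z' : Z} :
    Orb.mk φ z = Orb.mk φ z' ↔ φ.SameCycle z z' := Quotient.eq

theorem Orb.sameCycle_out (φ : Equiv.Perm Z) (z : Z) : φ.SameCycle (Orb.mk φ z).out z :=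
  Orb.mk_eq_mk.1 (Orb.mk_out _)

/-- The product over all orbits of a function that is constant on orbits. -/
def orbProd (φ : Equiv.Perm Z) (w : Z → M) : M := ∏ o : Orb φ, w o.out

theorem orbProd_mul (φ : Equiv.Perm Z) (w w' : Z → M) :
    orbProd φ (fun z => w z * w' z) = orbProd φ w * orbProd φ w' := Finset.prod_mul_distrib

theorem orbProd_map {N : Type*} [CommMonoid N] (f : M →* N) (φ : Equiv.Perm Z) (w : Z → M) :
    f (orbProd φ w) = orbProd φ fun z => f (w z) := map_prod f _ _

theorem orbProd_one (φ : Equiv.Perm Z) : orbProd φ (fun _ => (1 : M)) = 1 :=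
  Finset.prod_const_one

theorem orbProd_congr (φ : Equiv.Perm Z) {w w' : Z → M} (h : ∀ z, w z = w' z) :
    orbProd φ w = orbProd φ w' := Finset.prod_congr rfl fun _ _ => h _

/-- The comparison principle for products over orbits. `F` has to be injective on orbits, and it may
miss orbits on which the second function is `1`; it need not be equivariant, which is used for the
inclusion of one copy into a cyclic union. -/
theorem orbProd_transfer {φ : Equiv.Perm Z} {φ' : Equiv.Perm Z'} {w : Z → M} {w' : Z' → M}
    (F : Z → Z') (hF : ∀ a b, φ.SameCycle a b ↔ φ'.SameCycle (F a) (F b))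
    (hw : ∀ z, w' (F z) = w z) (hinv : ∀ a b, φ'.SameCycle a b → w' a = w' b)
    (hsurj : ∀ z', w' z' ≠ 1 → ∃ z, φ'.SameCycle (F z) z') :
    orbProd φ w = orbProd φ' w' := by
  refine Finset.prod_of_injOn (fun o => Orb.mk φ' (F o.out)) ?_ (fun _ _ => Finset.mem_coe.2 (Finset.mem_univ _)) ?_ ?_
  · intro o _ o' _ h
    have := (hF _ _).2 (Orb.mk_eq_mk.1 h)
    rw [← Orb.mk_out o, ← Orb.mk_out o']
    exact Orb.mk_eq_mk.2 this
  · intro o _ ho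
    by_contra h
    obtain ⟨z, hz⟩ := hsurj _ h
    refine ho ⟨Orb.mk φ z, Finset.mem_coe.2 (Finset.mem_univ _), ?_⟩
    rw [← Orb.mk_out o]
    refine Orb.mk_eq_mk.2 (Equiv.Perm.SameCycle.trans ?_ hz)
    exact (hF _ _).1 (Orb.sameCycle_out φ z)
  · intro o _
    exact ((hinv _ _ (Orb.sameCycle_out _ _)).trans (hw _)).symm

theorem zpow_semiconj {φ : Equiv.Perm Z} {φ' : Equiv.Perm Z'} {F : Z → Z'}
    (h : ∀ z, F (φ z) = φ' (F z)) (i : ℤ) (z : Z) : F ((φ ^ i) z) = (φ' ^ i) (F z) := by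
  induction i with
  | zero => simp
  | succ n ih =>
    rw [add_comm, zpow_add, zpow_add, Equiv.Perm.mul_apply, Equiv.Perm.mul_apply, zpow_one,
      zpow_one, h, ih]
  | pred n ih =>
    rw [sub_eq_neg_add, zpow_add, zpow_add, Equiv.Perm.mul_apply, Equiv.Perm.mul_apply,
      zpow_neg_one, zpow_neg_one, Equiv.Perm.eq_inv_iff_eq, ← h, ← Equiv.Perm.mul_apply φ φ⁻¹, mul_inv_cancel,
      Equiv.Perm.one_apply, ih]

theorem pow_semiconj {φ : Equiv.Perm Z} {φ' : Equiv.Perm Z'} {F : Z → Z'}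
    (h : ∀ z, F (φ z) = φ' (F z)) (i : ℕ) (z : Z) : F ((φ ^ i) z) = (φ' ^ i) (F z) := by
  exact_mod_cast zpow_semiconj h (i : ℤ) z

theorem sameCycle_iff_of_semiconj {φ : Equiv.Perm Z} {φ' : Equiv.Perm Z'} {F : Z → Z'}
    (hF : Function.Injective F) (h : ∀ z, F (φ z) = φ' (F z)) (a b : Z) :
    φ.SameCycle a b ↔ φ'.SameCycle (F a) (F b) := by
  refine exists_congr fun i => ?_
  rw [← zpow_semiconj h, hF.eq_iff]

/-- The length of the orbit of an element. -/
def orbLen (φ : Equiv.Perm Z) (z : Z) : ℕ := Function.minimalPeriod φ z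

theorem orbLen_pos (φ : Equiv.Perm Z) (z : Z) : 0 < orbLen φ z :=
  Function.minimalPeriod_pos_of_mem_periodicPts (Function.Injective.mem_periodicPts φ.injective z)

theorem pow_eq_self_iff (φ : Equiv.Perm Z) (n : ℕ) (z : Z) :
    (φ ^ n) z = z ↔ orbLen φ z ∣ n := by
  rw [orbLen, ← Function.isPeriodicPt_iff_minimalPeriod_dvd, Function.IsPeriodicPt,
    Function.IsFixedPt, Equiv.Perm.iterate_eq_pow]

theorem pow_orbLen (φ : Equiv.Perm Z) (z : Z) : (φ ^ orbLen φ z) z = z :=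
  (pow_eq_self_iff φ _ z).2 dvd_rfl

theorem orbLen_eq_of_semiconj {φ : Equiv.Perm Z} {φ' : Equiv.Perm Z'} {F : Z → Z'}
    (hF : Function.Injective F) (h : ∀ z, F (φ z) = φ' (F z)) (z : Z) :
    orbLen φ' (F z) = orbLen φ z := by
  refine Nat.dvd_antisymm ?_ ?_ <;> rw [← pow_eq_self_iff]
  · rw [← pow_semiconj h, pow_orbLen]
  · rw [← hF.eq_iff, pow_semiconj h, pow_orbLen]

theorem orbLen_apply (φ : Equiv.Perm Z) (z : Z) : orbLen φ (φ z) = orbLen φ z :=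
  orbLen_eq_of_semiconj φ.injective (fun _ => rfl) z

theorem eq_of_sameCycle {α : Type*} {φ : Equiv.Perm Z} {w : Z → α} (h : ∀ z, w (φ z) = w z)
    {a b : Z} (hab : φ.SameCycle a b) : w a = w b := by
  obtain ⟨n, -, rfl⟩ := hab.exists_pow_eq'
  induction n with
  | zero => rfl
  | succ n ih =>
    rw [pow_succ', Equiv.Perm.mul_apply, h]
    exact ih ⟨n, rfl⟩

/-- Factor `w` into a function that is `1` on the right summand and one that is `1` on the left
summand; `orbProd_transfer` ignores the orbits of value `1`. -/
theorem orbProd_sum {φ : Equiv.Perm Z} {φ' : Equiv.Perm Z'} {w : Z ⊕ Z' → M}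
    (h : ∀ z, w (Equiv.sumCongr φ φ' z) = w z) :
    orbProd (Equiv.sumCongr φ φ' : Equiv.Perm (Z ⊕ Z')) w =
      orbProd φ (fun z => w (Sum.inl z)) * orbProd φ' (fun z => w (Sum.inr z)) := by
  let w₁ : Z ⊕ Z' → M := Sum.elim (fun z => w (Sum.inl z)) 1
  let w₂ : Z ⊕ Z' → M := Sum.elim 1 (fun z => w (Sum.inr z))
  have h1 : ∀ z, w z = w₁ z * w₂ z := by rintro (z | z) <;> simp [w₁, w₂]
  rw [orbProd_congr _ h1, orbProd_mul]
  congr 1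
  · symm
    refine orbProd_transfer Sum.inl
      (sameCycle_iff_of_semiconj Sum.inl_injective fun z => rfl) (fun z => rfl)
      (fun a b => eq_of_sameCycle ?_) ?_
    · rintro (z | z)
      · exact h (Sum.inl z)
      · rfl
    · rintro (z | z) hz
      · exact ⟨z, Equiv.Perm.SameCycle.refl _ _⟩
      · exact absurd rfl hz
  · symm
    refine orbProd_transfer Sum.inr
      (sameCycle_iff_of_semiconj Sum.inr_injective fun z => rfl) (fun z => rfl)
      (fun a b => eq_of_sameCycle ?_) ?_
    · rintro (z | z)
      · rfl
      · exact h (Sum.inr z)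
    · rintro (z | z) hz
      · exact absurd rfl hz
      · exact ⟨z, Equiv.Perm.SameCycle.refl _ _⟩

/-- The multiset of the lengths of the orbits of `φ` in the invariant subset `p`. -/
def orbType (φ : Equiv.Perm Z) (p : Z → Prop) : Multiset ℕ :=
  open Classical in
  (orbProd φ fun z => Multiplicative.ofAdd (if p z then {orbLen φ z} else 0)).toAdd

theorem orbType_transfer {φ : Equiv.Perm Z} {φ' : Equiv.Perm Z'} {p : Z → Prop} {p' : Z' → Prop}
    (F : Z → Z') (hF : Function.Injective F) (h : ∀ z, F (φ z) = φ' (F z))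
    (hp : ∀ z, p' (F z) ↔ p z) (hinv : ∀ z, p' (φ' z) ↔ p' z)
    (hsurj : ∀ z', p' z' → ∃ z, F z = z') : orbType φ p = orbType φ' p' := by
  classical
  rw [orbType, orbType, orbProd_transfer F (sameCycle_iff_of_semiconj hF h)]
  · intro z
    rw [orbLen_eq_of_semiconj hF h]
    simp only [hp]
  · intro a b
    refine eq_of_sameCycle (φ := φ') (w := fun z => Multiplicative.ofAdd
      (if p' z then ({orbLen φ' z} : Multiset ℕ) else 0)) fun z => ?_
    simp only [orbLen_apply, hinv]
  · intro z' hz'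
    have : p' z' := by
      by_contra h'
      exact hz' (by rw [if_neg h']; rfl)
    obtain ⟨z, rfl⟩ := hsurj z' this
    exact ⟨z, Equiv.Perm.SameCycle.refl _ _⟩

end Orbits

/-! ### Cyclic unions of copies of a permuted set -/

section Cyclic

variable {Y : Type}

/-- The permutation of `m` copies of a set which maps each copy to the next one, and the last
copy to the first one by means of `ρ`. -/
def cycPerm (ρ : Equiv.Perm Y) (m : ℕ) : Equiv.Perm (Y × Fin m) where
  toFun p := if h : p.2.1 + 1 < m then (p.1, ⟨p.2.1 + 1, h⟩) else (ρ p.1, ⟨0, p.2.pos⟩)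
  invFun p := if p.2.1 = 0 then (ρ⁻¹ p.1, ⟨m - 1, Nat.sub_one_lt_of_lt p.2.2⟩)
    else (p.1, ⟨p.2.1 - 1, (Nat.sub_le _ _).trans_lt p.2.2⟩)
  left_inv := by
    rintro ⟨a, i, hi⟩
    by_cases h : i + 1 < m
    · simp [h]
    · have : m - 1 = i := by omega
      simp [h, this]
  right_inv := by
    rintro ⟨a, i, hi⟩
    by_cases h : i = 0
    · have : ¬ (m - 1 + 1 < m) := by omega
      simp [h, this]
    · have : i - 1 + 1 = i := by omega
      simp [h, this, hi]

theorem cycPerm_pow (ρ : Equiv.Perm Y) (m n : ℕ) (a : Y) (i : Fin m) :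
    (cycPerm ρ m ^ n) (a, i) = ((ρ ^ ((i + n) / m)) a, ⟨(i + n) % m, Nat.mod_lt _ i.pos⟩) := by
  induction n with
  | zero =>
    simp [Nat.div_eq_of_lt i.2, Nat.mod_eq_of_lt i.2]
  | succ n ih =>
    rw [pow_succ', Equiv.Perm.mul_apply, ih]
    have hm : 0 < m := i.pos
    by_cases h : (i + n) % m + 1 < m
    · have h1 : (i + (n + 1)) / m = (i + n) / m := by
        rw [← add_assoc]; exact Nat.succ_div_of_not_dvd (by
          intro hd; rw [Nat.dvd_iff_mod_eq_zero, Nat.add_mod] at hd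
          rcases Nat.lt_or_ge 1 m with h2 | h2
          · rw [Nat.mod_eq_of_lt h2, Nat.mod_eq_of_lt h] at hd; omega
          · omega)
      have h2 : (i + (n + 1)) % m = (i + n) % m + 1 := by
        have e1 := Nat.div_add_mod (i + n) m
        have e2 := Nat.div_add_mod (i + (n + 1)) m
        rw [h1] at e2; omega
      have : cycPerm ρ m ((ρ ^ ((↑i + n) / m)) a, ⟨(↑i + n) % m, Nat.mod_lt _ hm⟩) =
        ((ρ ^ ((↑i + n) / m)) a, ⟨(↑i + n) % m + 1, h⟩) := dif_pos h
      rw [this, h1]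
      simp only [h2]
    · have h0 : (i + n) % m < m := Nat.mod_lt _ hm
      have h3 : (i + n) % m + 1 = m := by omega
      have e1 := Nat.div_add_mod (i + n) m
      have e3 : i + (n + 1) = m * ((i + n) / m + 1) := by rw [mul_add]; omega
      have h1 : (i + (n + 1)) / m = (i + n) / m + 1 := by rw [e3, Nat.mul_div_cancel_left _ hm]
      have h2 : (i + (n + 1)) % m = 0 := by rw [e3, Nat.mul_mod_right]
      have : cycPerm ρ m ((ρ ^ ((↑i + n) / m)) a, ⟨(↑i + n) % m, Nat.mod_lt _ hm⟩) =
        (ρ ((ρ ^ ((↑i + n) / m)) a), ⟨0, hm⟩) := dif_neg h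
      rw [this, h1, pow_succ', Equiv.Perm.mul_apply]
      simp only [h2]

theorem cycPerm_pow_mul (ρ : Equiv.Perm Y) (m n : ℕ) (a : Y) (i : Fin m) :
    (cycPerm ρ m ^ (m * n)) (a, i) = ((ρ ^ n) a, i) := by
  rw [cycPerm_pow, Nat.add_mul_div_left _ _ i.pos, Nat.div_eq_of_lt i.2, zero_add]
  simp only [Nat.add_mul_mod_self_left, Nat.mod_eq_of_lt i.2]

theorem cycPerm_pow_zero (ρ : Equiv.Perm Y) (m : ℕ) (hm : 0 < m) (a : Y) (i : Fin m) :
    (cycPerm ρ m ^ (i : ℕ)) (a, ⟨0, hm⟩) = (a, i) := by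
  rw [cycPerm_pow]
  simp [Nat.div_eq_of_lt i.2, Nat.mod_eq_of_lt i.2]

variable [Finite Y]

theorem sameCycle_cycPerm (ρ : Equiv.Perm Y) (m : ℕ) (hm : 0 < m) (a b : Y) :
    ρ.SameCycle a b ↔ (cycPerm ρ m).SameCycle (a, ⟨0, hm⟩) (b, ⟨0, hm⟩) := by
  constructor
  · intro h
    obtain ⟨n, -, rfl⟩ := h.exists_pow_eq'
    refine ⟨(m * n : ℕ), ?_⟩
    rw [zpow_natCast, cycPerm_pow_mul]
  · intro h
    obtain ⟨n, -, hn⟩ := h.exists_pow_eq'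
    rw [cycPerm_pow, Prod.mk.injEq] at hn
    exact ⟨((0 + n) / m : ℕ), by rw [zpow_natCast]; exact hn.1⟩

/-- Returning to the same copy takes a multiple of `m` steps, and `m * n` steps act on a copy as `ρ
^ n`. -/
theorem orbLen_cycPerm (ρ : Equiv.Perm Y) (m : ℕ) (a : Y) (i : Fin m) :
    orbLen (cycPerm ρ m) (a, i) = m * orbLen ρ a := by
  refine Nat.dvd_antisymm ?_ ?_
  · rw [← pow_eq_self_iff, cycPerm_pow_mul, pow_orbLen]
  · have h := pow_orbLen (cycPerm ρ m) (a, i)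
    have hd : m ∣ orbLen (cycPerm ρ m) (a, i) := by
      rw [cycPerm_pow, Prod.mk.injEq, Fin.ext_iff] at h
      have h2 : (i + orbLen (cycPerm ρ m) (a, i)) % m = (i + 0) % m :=
        h.2.trans (by rw [add_zero, Nat.mod_eq_of_lt i.2])
      exact (Nat.modEq_zero_iff_dvd).1 (Nat.ModEq.add_left_cancel' (i : ℕ) h2)
    obtain ⟨n, hn⟩ := hd
    rw [hn, cycPerm_pow_mul, Prod.mk.injEq] at h
    rw [hn]
    exact Nat.mul_dvd_mul_left _ ((pow_eq_self_iff ρ n a).1 h.1)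

end Cyclic

end ModularOperad

end

noncomputable section

namespace ModularOperad

/-! ### Labelled structures with an automorphism -/

/-- A structure on `Z`: the elements are vertices (`lab z = 0`), flags (`lab z = 1`) and legs
(`lab z = 2`); `att` maps a flag to its vertex, `inv` glues flags and legs to edges, and `aut` is
a permutation. -/
@[ext]
structure Str (Z : Type) where
  lab : Z → Fin 3
  att : Z → Z
  inv : Z → Z
  aut : Equiv.Perm Z

namespace Str

variable {Y Z Z' : Type}

instance [Finite Z] : Finite (Str Z) :=
  Finite.of_injective (fun x : Str Z => (x.lab, x.att, x.inv, x.aut)) fun x y h => by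
    simp only [Prod.mk.injEq] at h
    exact Str.ext h.1 h.2.1 h.2.2.1 h.2.2.2

instance [Finite Z] : Fintype (Str Z) := Fintype.ofFinite _

/-- Transport of structure. -/
def map (e : Z ≃ Z') (x : Str Z) : Str Z' where
  lab z := x.lab (e.symm z)
  att z := e (x.att (e.symm z))
  inv z := e (x.inv (e.symm z))
  aut := (e.symm.trans x.aut).trans e

/-- Transport of structure as a bijection. -/
def mapEquiv (e : Z ≃ Z') : Str Z ≃ Str Z' where
  toFun := map e
  invFun := map e.symm
  left_inv x := by ext z <;> simp [map]
  right_inv x := by ext z <;> simp [map]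

/-- Disjoint unions. -/
def sum (x : Str Z) (x' : Str Z') : Str (Z ⊕ Z') where
  lab := Sum.elim x.lab x'.lab
  att := Sum.map x.att x'.att
  inv := Sum.map x.inv x'.inv
  aut := Equiv.sumCongr x.aut x'.aut

/-- A union of `m` copies, permuted cyclically. -/
def cyc (x : Str Z) (m : ℕ) : Str (Z × Fin m) where
  lab p := x.lab p.1
  att p := (x.att p.1, p.2)
  inv p := (x.inv p.1, p.2)
  aut := cycPerm x.aut m

/-- The relation generated by attaching and gluing. -/
def GRel (x : Str Z) : Z → Z → Prop := Relation.EqvGen fun a b => x.att a = b ∨ x.inv a = b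

/-- The relation generated by attaching, gluing and the automorphism. -/
def TRel (x : Str Z) : Z → Z → Prop :=
  Relation.EqvGen fun a b => x.att a = b ∨ x.inv a = b ∨ x.aut a = b

/-- Connectedness of the underlying graph. -/
def GConn (x : Str Z) : Prop := Nonempty Z ∧ ∀ a b, x.GRel a b

/-- Transitivity of the automorphism on the connected components. -/
def TConn (x : Str Z) : Prop := Nonempty Z ∧ ∀ a b, x.TRel a b

end Str

/-- The data for weights of structures in a ring with Adams operations. -/
structure WeightData (R : Type*) [CommRing R] where
  psi : ℕ → R →+* R
  psi_psi : ∀ m n, 0 < m → 0 < n → ∀ r, psi m (psi n r) = psi (m * n) r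
  /-- the weight of a vertex, depending on the cycle type of its stabilizer -/
  vert : Multiset ℕ → R
  flag : R
  leg : R
  /-- the labels of the elements that are not glued -/
  fix : Set (Fin 3)

namespace WeightData

variable {R : Type*} [CommRing R] (P : WeightData R) {Y Z Z' : Type} [Finite Y] [Finite Z]
  [Finite Z']

/-- The conditions on a structure, at an element. -/
structure ValidAt (x : Str Z) (z : Z) : Prop where
  lab_aut : x.lab (x.aut z) = x.lab z
  att_aut : x.att (x.aut z) = x.aut (x.att z)
  inv_aut : x.inv (x.aut z) = x.aut (x.inv z)
  lab_att : x.lab z = 1 → x.lab (x.att z) = 0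
  att_eq : x.lab z ≠ 1 → x.att z = z
  inv_inv : x.inv (x.inv z) = z
  inv_eq_iff : x.inv z = z ↔ x.lab z ∈ P.fix

/-- The conditions on a structure. -/
def Valid (x : Str Z) : Prop := ∀ z, P.ValidAt x z

/-- The flags at an element. -/
def flagsAt (x : Str Z) (z f : Z) : Prop := x.lab f = 1 ∧ x.att f = z

/-- The contribution of the orbit of an element. -/
def localWeight (x : Str Z) (z : Z) : R :=
  P.psi (orbLen x.aut z)
    (if x.lab z = 0 then P.vert (orbType (x.aut ^ orbLen x.aut z) (flagsAt x z))
      else if x.lab z = 1 then P.flag else P.leg)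

/-- The weight of a structure. -/
def weight (x : Str Z) : R :=
  open Classical in if P.Valid x then orbProd x.aut (P.localWeight x) else 0

variable {P}

theorem weight_of_valid {x : Str Z} (h : P.Valid x) :
    P.weight x = orbProd x.aut (P.localWeight x) := if_pos h

theorem weight_of_not_valid {x : Str Z} (h : ¬ P.Valid x) : P.weight x = 0 := if_neg h

theorem Valid.lab_pow {x : Str Z} (h : P.Valid x) (n : ℕ) (z : Z) :
    x.lab ((x.aut ^ n) z) = x.lab z := by
  induction n with
  | zero => rfl
  | succ n ih => rw [pow_succ', Equiv.Perm.mul_apply, (h _).lab_aut, ih]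

theorem Valid.att_pow {x : Str Z} (h : P.Valid x) (n : ℕ) (z : Z) :
    x.att ((x.aut ^ n) z) = (x.aut ^ n) (x.att z) := by
  induction n with
  | zero => rfl
  | succ n ih => rw [pow_succ', Equiv.Perm.mul_apply, (h _).att_aut, ih, Equiv.Perm.mul_apply]

theorem Valid.inv_pow {x : Str Z} (h : P.Valid x) (n : ℕ) (z : Z) :
    x.inv ((x.aut ^ n) z) = (x.aut ^ n) (x.inv z) := by
  induction n with
  | zero => rfl
  | succ n ih => rw [pow_succ', Equiv.Perm.mul_apply, (h _).inv_aut, ih, Equiv.Perm.mul_apply]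

theorem Valid.flagsAt_pow {x : Str Z} (h : P.Valid x) (n : ℕ) {z : Z} (hz : (x.aut ^ n) z = z)
    (f : Z) : flagsAt x z ((x.aut ^ n) f) ↔ flagsAt x z f := by
  rw [flagsAt, flagsAt, h.lab_pow, h.att_pow]
  conv_lhs => rw [← hz, (x.aut ^ n).injective.eq_iff]

/-- Local weights are preserved by injections of structures which contain all the flags. -/
theorem localWeight_eq {x : Str Z} {x' : Str Z'} (hx' : P.Valid x') (F : Z → Z')
    (hF : Function.Injective F) (m : ℕ) (hm : 0 < m)
    (hlen : ∀ z, orbLen x'.aut (F z) = m * orbLen x.aut z)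
    (haut : ∀ z, F (x.aut z) = (x'.aut ^ m) (F z))
    (hlab : ∀ z, x'.lab (F z) = x.lab z) (hatt : ∀ z, x'.att (F z) = F (x.att z))
    (hsurj : ∀ z f', flagsAt x' (F z) f' → ∃ f, F f = f') (z : Z) :
    P.localWeight x' (F z) = P.psi m (P.localWeight x z) := by
  have hlen0 := orbLen_pos x.aut z
  rw [localWeight, localWeight, P.psi_psi _ _ hm hlen0, hlen]
  simp only [hlab]
  have : orbType (x.aut ^ orbLen x.aut z) (flagsAt x z) =
      orbType (x'.aut ^ (m * orbLen x.aut z)) (flagsAt x' (F z)) := by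
    refine orbType_transfer F hF ?_ ?_ ?_ (hsurj z)
    · intro f
      rw [pow_mul, pow_semiconj haut]
    · intro f
      rw [flagsAt, flagsAt, hlab, hatt, hF.eq_iff]
    · intro f
      refine hx'.flagsAt_pow _ ?_ f
      rw [← hlen, pow_orbLen]
  rw [this]

theorem Valid.localWeight_aut {x : Str Z} (h : P.Valid x) (z : Z) :
    P.localWeight x (x.aut z) = P.localWeight x z := by
  have hl := orbLen_apply x.aut z
  rw [localWeight, localWeight, hl, (h z).lab_aut]
  have : orbType (x.aut ^ orbLen x.aut z) (flagsAt x z) =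
      orbType (x.aut ^ orbLen x.aut z) (flagsAt x (x.aut z)) := by
    refine orbType_transfer x.aut x.aut.injective ?_ ?_ ?_ ?_
    · intro f
      rw [← Equiv.Perm.mul_apply, ← Equiv.Perm.mul_apply, pow_mul_comm']
    · intro f
      rw [flagsAt, flagsAt, (h f).lab_aut, (h f).att_aut, x.aut.injective.eq_iff]
    · intro f
      refine h.flagsAt_pow _ ?_ f
      rw [← hl, pow_orbLen]
    · intro f _
      exact x.aut.surjective f
  rw [this]

theorem Valid.localWeight_sameCycle {x : Str Z} (h : P.Valid x) {a b : Z}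
    (hab : x.aut.SameCycle a b) : P.localWeight x a = P.localWeight x b :=
  eq_of_sameCycle h.localWeight_aut hab

theorem valid_map (e : Z ≃ Z') (x : Str Z) : P.Valid (x.map e) ↔ P.Valid x := by
  have key : ∀ z, P.ValidAt (x.map e) (e z) ↔ P.ValidAt x z := by
    intro z
    constructor
    · rintro ⟨h1, h2, h3, h4, h5, h6, h7⟩
      simp only [Str.map, Equiv.symm_apply_apply, Equiv.trans_apply, e.injective.eq_iff] at *
      exact ⟨h1, h2, h3, h4, h5, h6, h7⟩
    · rintro ⟨h1, h2, h3, h4, h5, h6, h7⟩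
      constructor <;>
        simpa only [Str.map, Equiv.symm_apply_apply, Equiv.trans_apply, e.injective.eq_iff]
  refine ⟨fun h z => (key z).1 (h _), fun h z => ?_⟩
  rw [← e.apply_symm_apply z]
  exact (key _).2 (h _)

theorem map_aut_apply (e : Z ≃ Z') (x : Str Z) (z : Z) : e (x.aut z) = (x.map e).aut (e z) := by
  simp [Str.map]

theorem weight_map (e : Z ≃ Z') (x : Str Z) : P.weight (x.map e) = P.weight x := by
  by_cases h : P.Valid x
  · have h' := (valid_map e x).2 h
    rw [weight_of_valid h, weight_of_valid h']
    symm
    refine orbProd_transfer e (sameCycle_iff_of_semiconj e.injective (map_aut_apply e x)) ?_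
      (fun a b => h'.localWeight_sameCycle) fun z' _ => ?_
    · intro z
      rw [localWeight, localWeight, orbLen_eq_of_semiconj e.injective (map_aut_apply e x)]
      have hlab : (x.map e).lab (e z) = x.lab z := by simp [Str.map]
      have : orbType (x.aut ^ orbLen x.aut z) (flagsAt x z) =
          orbType ((x.map e).aut ^ orbLen x.aut z) (flagsAt (x.map e) (e z)) := by
        refine orbType_transfer e e.injective (pow_semiconj (map_aut_apply e x) _) ?_ ?_
          fun f _ => e.surjective f
        · intro f
          simp [flagsAt, Str.map]
        · intro f
          refine h'.flagsAt_pow _ ?_ f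
          rw [← pow_semiconj (map_aut_apply e x), pow_orbLen]
      rw [hlab, this]
    · exact ⟨e.symm z', by rw [e.apply_symm_apply]⟩
  · rw [weight_of_not_valid h, weight_of_not_valid (fun h' => h ((valid_map e x).1 h'))]

theorem valid_sum (x : Str Z) (x' : Str Z') :
    P.Valid (x.sum x') ↔ P.Valid x ∧ P.Valid x' := by
  have key : ∀ z, P.ValidAt (x.sum x') (Sum.inl z) ↔ P.ValidAt x z := by
    intro z
    constructor
    · rintro ⟨h1, h2, h3, h4, h5, h6, h7⟩
      simp only [Str.sum, Sum.elim_inl, Sum.map_inl, Equiv.sumCongr_apply, Sum.inl.injEq] at *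
      exact ⟨h1, h2, h3, h4, h5, h6, h7⟩
    · rintro ⟨h1, h2, h3, h4, h5, h6, h7⟩
      constructor <;>
        simpa only [Str.sum, Sum.elim_inl, Sum.map_inl, Equiv.sumCongr_apply, Sum.inl.injEq]
  have key' : ∀ z, P.ValidAt (x.sum x') (Sum.inr z) ↔ P.ValidAt x' z := by
    intro z
    constructor
    · rintro ⟨h1, h2, h3, h4, h5, h6, h7⟩
      simp only [Str.sum, Sum.elim_inr, Sum.map_inr, Equiv.sumCongr_apply, Sum.inr.injEq] at *
      exact ⟨h1, h2, h3, h4, h5, h6, h7⟩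
    · rintro ⟨h1, h2, h3, h4, h5, h6, h7⟩
      constructor <;>
        simpa only [Str.sum, Sum.elim_inr, Sum.map_inr, Equiv.sumCongr_apply, Sum.inr.injEq]
  refine ⟨fun h => ⟨fun z => (key z).1 (h _), fun z => (key' z).1 (h _)⟩, ?_⟩
  rintro ⟨h, h'⟩ (z | z)
  · exact (key z).2 (h z)
  · exact (key' z).2 (h' z)

theorem weight_sum (x : Str Z) (x' : Str Z') :
    P.weight (x.sum x') = P.weight x * P.weight x' := by
  by_cases h : P.Valid x ∧ P.Valid x'
  · have h' := (valid_sum x x').2 h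
    rw [weight_of_valid h.1, weight_of_valid h.2, weight_of_valid h']
    refine (orbProd_sum (φ := x.aut) (φ' := x'.aut) h'.localWeight_aut).trans ?_
    congr 1
    · refine orbProd_congr _ fun z => ?_
      rw [localWeight, localWeight]
      have e1 : orbLen (x.sum x').aut (Sum.inl z) = orbLen x.aut z :=
        orbLen_eq_of_semiconj Sum.inl_injective (fun _ => rfl) z
      have e2 : orbType (x.aut ^ orbLen x.aut z) (flagsAt x z) =
          orbType ((x.sum x').aut ^ orbLen x.aut z) (flagsAt (x.sum x') (Sum.inl z)) := by
        refine orbType_transfer Sum.inl Sum.inl_injective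
          (pow_semiconj (φ := x.aut) (φ' := (x.sum x').aut) (F := Sum.inl) (fun _ => rfl) _) ?_ ?_ ?_
        · intro f
          simp [flagsAt, Str.sum]
        · intro f
          refine h'.flagsAt_pow _ ?_ f
          rw [← e1, pow_orbLen]
        · rintro (f | f) hf
          · exact ⟨f, rfl⟩
          · simp [flagsAt, Str.sum] at hf
      rw [e1, e2]
      rfl
    · refine orbProd_congr _ fun z => ?_
      rw [localWeight, localWeight]
      have e1 : orbLen (x.sum x').aut (Sum.inr z) = orbLen x'.aut z :=
        orbLen_eq_of_semiconj Sum.inr_injective (fun _ => rfl) z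
      have e2 : orbType (x'.aut ^ orbLen x'.aut z) (flagsAt x' z) =
          orbType ((x.sum x').aut ^ orbLen x'.aut z) (flagsAt (x.sum x') (Sum.inr z)) := by
        refine orbType_transfer Sum.inr Sum.inr_injective
          (pow_semiconj (φ := x'.aut) (φ' := (x.sum x').aut) (F := Sum.inr) (fun _ => rfl) _) ?_ ?_ ?_
        · intro f
          simp [flagsAt, Str.sum]
        · intro f
          refine h'.flagsAt_pow _ ?_ f
          rw [← e1, pow_orbLen]
        · rintro (f | f) hf
          · simp [flagsAt, Str.sum] at hf
          · exact ⟨f, rfl⟩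
      rw [e1, e2]
      rfl
  · rw [weight_of_not_valid fun h' => h ((valid_sum x x').1 h')]
    rw [not_and_or] at h
    rcases h with h | h
    · rw [weight_of_not_valid h, zero_mul]
    · rw [weight_of_not_valid h, mul_zero]

theorem valid_cyc (x : Str Z) {m : ℕ} (hm : 0 < m) : P.Valid (x.cyc m) ↔ P.Valid x := by
  constructor
  · intro h z
    have haut : ((x.cyc m).aut ^ m) (z, ⟨0, hm⟩) = (x.aut z, ⟨0, hm⟩) := by
      have := cycPerm_pow_mul x.aut m 1 z ⟨0, hm⟩
      rwa [mul_one, pow_one] at this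
    have hinv : ((x.cyc m).aut ^ m) (x.inv z, ⟨0, hm⟩) = (x.aut (x.inv z), ⟨0, hm⟩) := by
      have := cycPerm_pow_mul x.aut m 1 (x.inv z) ⟨0, hm⟩
      rwa [mul_one, pow_one] at this
    have hatt : ((x.cyc m).aut ^ m) (x.att z, ⟨0, hm⟩) = (x.aut (x.att z), ⟨0, hm⟩) := by
      have := cycPerm_pow_mul x.aut m 1 (x.att z) ⟨0, hm⟩
      rwa [mul_one, pow_one] at this
    have a1 := h.lab_pow m (z, ⟨0, hm⟩)
    have a2 := h.att_pow m (z, ⟨0, hm⟩)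
    have a3 := h.inv_pow m (z, ⟨0, hm⟩)
    rw [haut] at a1 a2 a3
    have a2' := a2.trans hatt
    have a3' := a3.trans hinv
    obtain ⟨-, -, -, h4, h5, h6, h7⟩ := h (z, ⟨0, hm⟩)
    simp only [Str.cyc, Prod.mk.injEq, and_true] at *
    exact ⟨a1, a2', a3', h4, h5, h6, h7⟩
  · rintro h ⟨z, i⟩
    obtain ⟨h1, h2, h3, h4, h5, h6, h7⟩ := h z
    constructor <;> simp only [Str.cyc, Prod.mk.injEq, and_true] <;> try assumption
    all_goals
      simp only [cycPerm, Equiv.coe_fn_mk]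
      split_ifs <;> simp [*]

/-- Every orbit meets copy zero in exactly one orbit of `x.aut`. Its length is `m` times as large,
while the return map on the flags of a vertex is unchanged, so `psi (m * n) = psi m ∘ psi n` pulls
`psi m` out of the product. -/
theorem weight_cyc (x : Str Z) {m : ℕ} (hm : 0 < m) :
    P.weight (x.cyc m) = P.psi m (P.weight x) := by
  by_cases h : P.Valid x
  · have h' := (valid_cyc x hm).2 h
    rw [weight_of_valid h, weight_of_valid h']
    have := orbProd_map (P.psi m : R →* R) x.aut (P.localWeight x)
    refine Eq.trans ?_ this.symm
    symm
    refine orbProd_transfer (fun a => (a, ⟨0, hm⟩)) (sameCycle_cycPerm x.aut m hm) ?_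
      (fun a b => h'.localWeight_sameCycle) fun z' _ => ?_
    · refine localWeight_eq h' _ (fun a b hab => (Prod.mk.inj hab).1) m hm
        (fun z => orbLen_cycPerm x.aut m z _) ?_ (fun _ => rfl) (fun _ => rfl) ?_
      · intro z
        have := cycPerm_pow_mul x.aut m 1 z ⟨0, hm⟩
        rw [mul_one, pow_one] at this
        exact this.symm
      · rintro z ⟨f, i⟩ ⟨-, hf⟩
        exact ⟨f, Prod.ext rfl (Prod.mk.inj hf).2.symm⟩
    · refine ⟨z'.1, (z'.2 : ℕ), ?_⟩
      rw [zpow_natCast]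
      exact cycPerm_pow_zero x.aut m hm z'.1 z'.2
  · rw [weight_of_not_valid h, weight_of_not_valid (fun h' => h ((valid_cyc x hm).1 h')), map_zero]

end WeightData

end ModularOperad

end

noncomputable section

namespace ModularOperad

/-! ### Equivalence relations generated by maps -/

section EqvGen

open Relation

variable {α β : Type*} {r : α → α → Prop} {s : β → β → Prop}

theorem eqvGen_invariant {p : α → Prop} (h : ∀ a b, r a b → (p a ↔ p b)) {a b : α}
    (hab : EqvGen r a b) : p a ↔ p b := by
  induction hab with
  | rel a b hab => exact h a b hab
  | refl => rfl
  | symm a b _ ih => exact ih.symm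
  | trans a b c _ _ ih ih' => exact ih.trans ih'

theorem eqvGen_subtype {p : α → Prop} (h : ∀ a b, r a b → (p a ↔ p b)) {a b : α}
    (hab : EqvGen r a b) (ha : p a) (hb : p b) :
    EqvGen (fun x y : Subtype p => r x y) ⟨a, ha⟩ ⟨b, hb⟩ := by
  induction hab with
  | rel a b hab => exact .rel _ _ hab
  | refl => exact .refl _
  | symm a b _ ih => exact (ih hb ha).symm
  | trans a b c h1 _ ih ih' =>
    have := (eqvGen_invariant h h1).1 ha
    exact (ih ha this).trans _ _ _ (ih' this hb)

theorem eqvGen_transfer (F : α → β) (h : ∀ a b, r a b → EqvGen s (F a) (F b)) {a b : α}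
    (hab : EqvGen r a b) : EqvGen s (F a) (F b) := by
  induction hab with
  | rel a b hab => exact h a b hab
  | refl => exact .refl _
  | symm a b _ ih => exact ih.symm
  | trans a b c _ _ ih ih' => exact ih.trans _ _ _ ih'

end EqvGen

/-! ### Connectedness under transport, restriction and disjoint union -/

namespace Str

variable {Y Z Z' : Type}

theorem gRel_map (e : Z ≃ Z') (x : Str Z) (a b : Z) :
    (x.map e).GRel (e a) (e b) ↔ x.GRel a b := by
  constructor
  · intro h
    have := eqvGen_transfer (s := fun a b => x.att a = b ∨ x.inv a = b) e.symm ?_ h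
    · simp only [Equiv.symm_apply_apply] at this
      exact this
    · rintro a b (h | h)
      · exact .rel _ _ (Or.inl (by rw [← h]; simp [map]))
      · exact .rel _ _ (Or.inr (by rw [← h]; simp [map]))
  · refine eqvGen_transfer e ?_
    rintro a b (h | h)
    · exact .rel _ _ (Or.inl (by rw [← h]; simp [map]))
    · exact .rel _ _ (Or.inr (by rw [← h]; simp [map]))

theorem tRel_map (e : Z ≃ Z') (x : Str Z) (a b : Z) :
    (x.map e).TRel (e a) (e b) ↔ x.TRel a b := by
  constructor
  · intro h
    have := eqvGen_transfer (s := fun a b => x.att a = b ∨ x.inv a = b ∨ x.aut a = b) e.symm ?_ h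
    · simp only [Equiv.symm_apply_apply] at this
      exact this
    · rintro a b (h | h | h)
      · exact .rel _ _ (Or.inl (by rw [← h]; simp [map]))
      · exact .rel _ _ (Or.inr (Or.inl (by rw [← h]; simp [map])))
      · exact .rel _ _ (Or.inr (Or.inr (by rw [← h]; simp [map])))
  · refine eqvGen_transfer e ?_
    rintro a b (h | h | h)
    · exact .rel _ _ (Or.inl (by rw [← h]; simp [map]))
    · exact .rel _ _ (Or.inr (Or.inl (by rw [← h]; simp [map])))
    · exact .rel _ _ (Or.inr (Or.inr (by rw [← h]; simp [map])))

theorem gConn_map (e : Z ≃ Z') (x : Str Z) : (x.map e).GConn ↔ x.GConn := by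
  refine and_congr e.symm.nonempty_congr ⟨fun h a b => (gRel_map e x a b).1 (h _ _), fun h => ?_⟩
  intro a b
  rw [← e.apply_symm_apply a, ← e.apply_symm_apply b, gRel_map]
  exact h _ _

theorem tConn_map (e : Z ≃ Z') (x : Str Z) : (x.map e).TConn ↔ x.TConn := by
  refine and_congr e.symm.nonempty_congr ⟨fun h a b => (tRel_map e x a b).1 (h _ _), fun h => ?_⟩
  intro a b
  rw [← e.apply_symm_apply a, ← e.apply_symm_apply b, tRel_map]
  exact h _ _

/-- The restriction to a closed subset, with a given automorphism. -/
def restrict (x : Str Z) (p : Z → Prop) (φ : Equiv.Perm Z) (hatt : ∀ a, p a → p (x.att a))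
    (hinv : ∀ a, p a → p (x.inv a)) (haut : ∀ a, p (φ a) ↔ p a) : Str {a // p a} where
  lab a := x.lab a
  att a := ⟨x.att a, hatt a a.2⟩
  inv a := ⟨x.inv a, hinv a a.2⟩
  aut := φ.subtypePerm haut

/-- The union of structures on a subset and on its complement. -/
def glue (p : Z → Prop) [DecidablePred p] (y : Str {a // p a}) (y' : Str {a // ¬ p a}) : Str Z :=
  (y.sum y').map (Equiv.sumCompl p)

theorem glue_injective (p : Z → Prop) [DecidablePred p] {y₁ y₂ : Str {a // p a}}
    {y₁' y₂' : Str {a // ¬ p a}} (h : glue p y₁ y₁' = glue p y₂ y₂') : y₁ = y₂ ∧ y₁' = y₂' := by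
  have h := (mapEquiv (Equiv.sumCompl p)).injective h
  have h1 := congrArg lab h
  have h2 := congrArg att h
  have h3 := congrArg inv h
  have h4 := congrArg (fun x => (x.aut : _ → _)) h
  constructor
  · ext a : 2
    · exact congrFun h1 (Sum.inl a)
    · exact Sum.inl_injective (congrFun h2 (Sum.inl a))
    · exact Sum.inl_injective (congrFun h3 (Sum.inl a))
    · exact Sum.inl_injective (congrFun h4 (Sum.inl a))
  · ext a : 2
    · exact congrFun h1 (Sum.inr a)
    · exact Sum.inr_injective (congrFun h2 (Sum.inr a))
    · exact Sum.inr_injective (congrFun h3 (Sum.inr a))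
    · exact Sum.inr_injective (congrFun h4 (Sum.inr a))

theorem glue_restrict (x : Str Z) (p : Z → Prop) [DecidablePred p]
    (hatt : ∀ a, p (x.att a) ↔ p a) (hinv : ∀ a, p (x.inv a) ↔ p a)
    (haut : ∀ a, p (x.aut a) ↔ p a) :
    glue p (x.restrict p x.aut (fun a => (hatt a).2) (fun a => (hinv a).2) haut)
      (x.restrict (fun a => ¬ p a) x.aut (fun a => mt (hatt a).1) (fun a => mt (hinv a).1)
        (fun a => not_congr (haut a))) = x := by
  ext a : 2 <;> by_cases h : p a <;>
    simp [glue, map, sum, restrict, h]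

end Str

/-! ### Splitting off the orbit of components that contains a given point -/

namespace WeightData

variable {R : Type*} [CommRing R] (P : WeightData R) (Z : Type) [Finite Z]

/-- The sum of the weights of all structures. -/
def total : R := ∑ x : Str Z, P.weight x

open scoped Classical in
/-- The sum of the weights of the structures whose automorphism permutes the components
transitively. -/
def totalT : R := ∑ x : Str Z with x.TConn, P.weight x

open scoped Classical in
/-- The sum of the weights of the connected structures. -/
def totalG : R := ∑ x : Str Z with x.GConn, P.weight x

variable {P Z} {Z' : Type} [Finite Z']

theorem total_congr (e : Z ≃ Z') : P.total Z = P.total Z' :=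
  Fintype.sum_equiv (Str.mapEquiv e) _ _ fun x => (weight_map e x).symm

theorem totalT_congr (e : Z ≃ Z') : P.totalT Z = P.totalT Z' := by
  classical
  refine Finset.sum_equiv (Str.mapEquiv e) (fun x => ?_) fun x _ => (weight_map e x).symm
  simp only [Finset.mem_filter, Finset.mem_univ, true_and]
  exact (Str.tConn_map e x).symm

theorem totalG_congr (e : Z ≃ Z') : P.totalG Z = P.totalG Z' := by
  classical
  refine Finset.sum_equiv (Str.mapEquiv e) (fun x => ?_) fun x _ => (weight_map e x).symm
  simp only [Finset.mem_filter, Finset.mem_univ, true_and]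
  exact (Str.gConn_map e x).symm

-- Attaching, gluing and the automorphism preserve the class of `z` and hence its complement, so a
-- structure is the disjoint union of its restrictions to the two, and weights multiply over
-- disjoint unions.
open scoped Classical in
theorem sum_tRel_class (z : Z) (p : Z → Prop) [DecidablePred p] (hz : p z) :
    ∑ x : Str Z with (∀ a, x.TRel z a ↔ p a), P.weight x =
      P.totalT {a // p a} * P.total {a // ¬ p a} := by
  rw [totalT, total, Finset.sum_mul_sum, ← Finset.sum_product']
  symm
  refine Finset.sum_of_injOn (fun y => Str.glue p y.1 y.2) ?_ ?_ ?_ ?_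
  · rintro ⟨y₁, y₁'⟩ _ ⟨y₂, y₂'⟩ _ h
    exact Prod.ext_iff.2 (Str.glue_injective p h)
  · rintro ⟨y, y'⟩ hy
    simp only [Finset.coe_product, Set.mem_prod, Finset.mem_coe, Finset.mem_filter,
      Finset.mem_univ, true_and, and_true] at hy ⊢
    have h1 : ∀ a, p ((Str.glue p y y').att a) ↔ p a := by
      intro a
      by_cases h : p a <;> simp [Str.glue, Str.map, Str.sum, h, Subtype.prop]
      exact (y'.att ⟨a, h⟩).2
    have h2 : ∀ a, p ((Str.glue p y y').inv a) ↔ p a := by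
      intro a
      by_cases h : p a <;> simp [Str.glue, Str.map, Str.sum, h, Subtype.prop]
      exact (y'.inv ⟨a, h⟩).2
    have h3 : ∀ a, p ((Str.glue p y y').aut a) ↔ p a := by
      intro a
      by_cases h : p a <;> simp [Str.glue, Str.map, Str.sum, h, Subtype.prop]
      exact (y'.aut ⟨a, h⟩).2
    intro a
    constructor
    · intro h
      refine (eqvGen_invariant ?_ h).1 hz
      rintro a b (rfl | rfl | rfl)
      exacts [(h1 a).symm, (h2 a).symm, (h3 a).symm]
    · intro h
      refine eqvGen_transfer (s := _) (fun a : {a // p a} => (a : Z)) ?_ (hy.2 ⟨z, hz⟩ ⟨a, h⟩)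
      rintro ⟨a, ha⟩ b (rfl | rfl | rfl)
      · exact .rel _ _ (Or.inl (by simp [Str.glue, Str.map, Str.sum, ha]))
      · exact .rel _ _ (Or.inr (Or.inl (by simp [Str.glue, Str.map, Str.sum, ha])))
      · exact .rel _ _ (Or.inr (Or.inr (by simp [Str.glue, Str.map, Str.sum, ha])))
  · intro x hx h
    simp only [Finset.mem_filter, Finset.mem_univ, true_and] at hx
    have key : ∀ a b, (x.att a = b ∨ x.inv a = b ∨ x.aut a = b) → (p b ↔ p a) := by
      intro a b hab
      rw [← hx, ← hx]
      exact ⟨fun h => h.trans _ _ _ (.symm _ _ (.rel _ _ hab)),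
        fun h => h.trans _ _ _ (.rel _ _ hab)⟩
    refine absurd ?_ h
    refine ⟨(_, _), ?_, Str.glue_restrict x p (fun a => key _ _ (Or.inl rfl))
      (fun a => key _ _ (Or.inr (Or.inl rfl))) (fun a => key _ _ (Or.inr (Or.inr rfl)))⟩
    simp only [Finset.coe_product, Set.mem_prod, Finset.mem_coe, Finset.mem_filter,
      Finset.mem_univ, true_and, and_true]
    refine ⟨⟨⟨z, hz⟩⟩, ?_⟩
    rintro ⟨a, ha⟩ ⟨b, hb⟩
    have hab : x.TRel a b := (((hx a).2 ha).symm).trans _ _ _ ((hx b).2 hb)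
    have := eqvGen_subtype (fun a b h => (key a b h).symm) hab ha hb
    refine eqvGen_transfer (fun a => a) ?_ this
    rintro a b h
    refine .rel _ _ ?_
    simpa [Str.restrict, Subtype.ext_iff] using h
  · rintro ⟨y, y'⟩ _
    rw [Str.glue, weight_map, weight_sum]

theorem total_eq_sum_finset [Fintype Z] [DecidableEq Z] (z : Z) :
    P.total Z = ∑ Y : Finset Z with z ∈ Y,
      P.totalT (Fin Y.card) * P.total (Fin (Fintype.card Z - Y.card)) := by
  classical
  rw [total, ← Finset.sum_fiberwise_of_maps_to
    (g := fun x : Str Z => Finset.univ.filter fun a => x.TRel z a)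
    (t := Finset.univ.filter fun Y : Finset Z => z ∈ Y)]
  · refine Finset.sum_congr rfl fun Y hY => ?_
    have hz : z ∈ Y := (Finset.mem_filter.1 hY).2
    have := sum_tRel_class (P := P) z (fun a => a ∈ Y) hz
    rw [totalT_congr (Z := {a // a ∈ Y}) (Z' := Fin Y.card) Y.equivFin,
      total_congr (Z := {a // ¬ a ∈ Y}) (Z' := Fin (Fintype.card Z - Y.card))
        (Fintype.equivFinOfCardEq (by simp [Fintype.card_subtype_compl]))] at this
    rw [← this]
    refine Finset.sum_congr ?_ fun _ _ => rfl
    ext x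
    simp [Finset.ext_iff]
  · intro x _
    simp only [Finset.mem_filter, Finset.mem_univ, true_and]
    exact Relation.EqvGen.refl _

theorem sum_finset_mem {M : Type*} [AddCommMonoid M] (n : ℕ) (f : ℕ → M) :
    ∑ z : Fin n, ∑ Y : Finset (Fin n) with z ∈ Y, f Y.card =
      ∑ j ∈ Finset.range (n + 1), n.choose j • j • f j := by
  simp only [Finset.sum_filter]
  rw [Finset.sum_comm]
  have h1 : ∀ Y : Finset (Fin n), (∑ z : Fin n, if z ∈ Y then f Y.card else 0) =
      Y.card • f Y.card := by
    intro Y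
    rw [← Finset.sum_filter, Finset.sum_const]
    simp
  simp only [h1]
  have := Finset.sum_powerset_apply_card (fun j => j • f j) (x := (Finset.univ : Finset (Fin n)))
  rw [Finset.powerset_univ, Finset.card_fin] at this
  exact this

/-- Adding the decomposition over all base points `z` counts each possible class `Y` once for every
element of `Y`, hence the factor `j`. After normalization this is the coefficient form of `F' = T' *
F`. -/
theorem card_mul_total (n : ℕ) : n • P.total (Fin n) = ∑ j ∈ Finset.range (n + 1),
    n.choose j • j • (P.totalT (Fin j) * P.total (Fin (n - j))) := by
  rw [← sum_finset_mem n fun j => P.totalT (Fin j) * P.total (Fin (n - j))]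
  have : ∀ z : Fin n, P.total (Fin n) = _ := fun z => total_eq_sum_finset (P := P) z
  simp only [Fintype.card_fin] at this
  rw [← Finset.sum_congr rfl fun z _ => this z]
  simp

end WeightData

end ModularOperad

end

/-! ### Structures whose components are permuted transitively -/

noncomputable section

namespace ModularOperad

namespace Str

variable {Y Z Z' : Type} [Finite Y] [Finite Z]

theorem gRel_cyc (y : Str Y) {m : ℕ} (hy : y.GConn) (a b : Y) (i j : Fin m) :
    (y.cyc m).GRel (a, i) (b, j) ↔ i = j := by
  constructor
  · intro h
    refine (eqvGen_invariant (p := fun c => i = c.2) ?_ h).1 rfl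
    rintro a b (rfl | rfl) <;> rfl
  · rintro rfl
    refine eqvGen_transfer (fun a => (a, i)) ?_ (hy.2 a b)
    rintro a b (rfl | rfl)
    · exact .rel _ _ (Or.inl rfl)
    · exact .rel _ _ (Or.inr rfl)

theorem tRel_of_gRel {x : Str Z} {a b : Z} (h : x.GRel a b) : x.TRel a b := by
  refine eqvGen_transfer id ?_ h
  rintro a b (h | h)
  · exact .rel _ _ (Or.inl h)
  · exact .rel _ _ (Or.inr (Or.inl h))

theorem tRel_pow (x : Str Z) (n : ℕ) (a : Z) : x.TRel a ((x.aut ^ n) a) := by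
  induction n with
  | zero => exact .refl _
  | succ n ih => 
    rw [pow_succ', Equiv.Perm.mul_apply]
    exact ih.trans _ _ _ (.rel _ _ (Or.inr (Or.inr rfl)))

theorem tConn_cyc (y : Str Y) {m : ℕ} (hm : 0 < m) (hy : y.GConn) : (y.cyc m).TConn := by
  obtain ⟨a₀⟩ := hy.1
  refine ⟨⟨(a₀, ⟨0, hm⟩)⟩, ?_⟩
  have h : ∀ p : Y × Fin m, (y.cyc m).TRel (a₀, ⟨0, hm⟩) p := by
    rintro ⟨a, i⟩
    have h1 := tRel_pow (y.cyc m) i (a, ⟨0, hm⟩)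
    have h2 : ((y.cyc m).aut ^ (i : ℕ)) (a, ⟨0, hm⟩) = (a, i) := cycPerm_pow_zero y.aut m hm a i
    rw [h2] at h1
    exact (tRel_of_gRel ((gRel_cyc y hy _ _ _ _).2 rfl)).trans _ _ _ h1
  exact fun a b => (h a).symm.trans _ _ _ (h b)

theorem cyc_injective {m : ℕ} (hm : 0 < m) {y y' : Str Y} (h : y.cyc m = y'.cyc m) : y = y' := by
  have h1 := congrArg lab h
  have h2 := congrArg att h
  have h3 := congrArg inv h
  have h4 := congrArg (fun x => ((x.aut ^ m : Equiv.Perm _) : _ → _)) h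
  ext a : 2
  · exact congrFun h1 (a, ⟨0, hm⟩)
  · exact (Prod.mk.inj (congrFun h2 (a, ⟨0, hm⟩))).1
  · exact (Prod.mk.inj (congrFun h3 (a, ⟨0, hm⟩))).1
  · have h5 := congrFun h4 (a, ⟨0, hm⟩)
    have e := cycPerm_pow_mul y.aut m 1 a ⟨0, hm⟩
    have e' := cycPerm_pow_mul y'.aut m 1 a ⟨0, hm⟩
    rw [mul_one, pow_one] at e e'
    exact (Prod.mk.inj (e.symm.trans (h5.trans e'))).1

end Str

namespace WeightData

variable {R : Type*} [CommRing R] {P : WeightData R} {Z : Type} [Finite Z]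

theorem Valid.gRel_aut {x : Str Z} (hx : P.Valid x) {a b : Z} (h : x.GRel a b) :
    x.GRel (x.aut a) (x.aut b) := by
  refine eqvGen_transfer x.aut ?_ h
  rintro a b (rfl | rfl)
  · exact .rel _ _ (Or.inl (hx a).att_aut)
  · exact .rel _ _ (Or.inr (hx a).inv_aut)

theorem Valid.gRel_pow {x : Str Z} (hx : P.Valid x) {a b : Z} (h : x.GRel a b) (n : ℕ) :
    x.GRel ((x.aut ^ n) a) ((x.aut ^ n) b) := by
  induction n with
  | zero => exact h
  | succ n ih =>
    rw [pow_succ', Equiv.Perm.mul_apply, Equiv.Perm.mul_apply]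
    exact hx.gRel_aut ih

theorem Valid.gRel_pow_iff {x : Str Z} (hx : P.Valid x) {a b : Z} (n : ℕ) :
    x.GRel ((x.aut ^ n) a) ((x.aut ^ n) b) ↔ x.GRel a b := by
  refine ⟨fun h => ?_, fun h => hx.gRel_pow h n⟩
  -- The exponent is chosen so that together with the first `n` steps it makes `n` full periods of
  -- `x.aut`; the inverse of `aut ^ n` is thus again a power.
  have h1 := hx.gRel_pow h (n * (orderOf x.aut - 1))
  have h2 : ∀ c, (x.aut ^ (n * (orderOf x.aut - 1))) ((x.aut ^ n) c) = c := by
    intro c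
    have := orderOf_pos x.aut
    have e : n * (orderOf x.aut - 1) + n = orderOf x.aut * n := by
      obtain ⟨k, hk⟩ : ∃ k, orderOf x.aut = k + 1 := ⟨_, (Nat.succ_pred_eq_of_pos this).symm⟩
      rw [hk]
      simp
      ring
    rw [← Equiv.Perm.mul_apply, ← pow_add, e, pow_mul, pow_orderOf_eq_one, one_pow,
      Equiv.Perm.one_apply]
  rwa [h2, h2] at h1

/-- A transitively permuted structure is a cyclic union of copies of a component. -/
theorem exists_cyc_of_tConn {x : Str Z} (hx : P.Valid x) (hT : x.TConn) (z : Z) {p : Z → Prop}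
    (hp : ∀ a, x.GRel z a ↔ p a) :
    ∃ (m : ℕ) (y : Str {a // p a}) (e : {a // p a} × Fin m ≃ Z), 0 < m ∧ y.GConn ∧
      (∀ a i, i.1 = 0 → e (a, i) = a) ∧ (y.cyc m).map e = x := by
  have hex : ∃ r, 0 < r ∧ p ((x.aut ^ r) z) := by
    refine ⟨orderOf x.aut, orderOf_pos _, ?_⟩
    rw [pow_orderOf_eq_one, ← hp]
    exact .refl _
  classical
  -- The first return time of the component of `z`: it will be the number of copies, and `aut ^ r`
  -- will be the automorphism of one copy.
  set r := Nat.find hex with hr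
  obtain ⟨hr0, hrz⟩ := Nat.find_spec hex
  rw [← hr] at hr0 hrz
  have hmin : ∀ i, 0 < i → p ((x.aut ^ i) z) → r ≤ i := fun i h1 h2 => Nat.find_min' hex ⟨h1, h2⟩
  have hpp : ∀ {a b}, p a → (p b ↔ x.GRel a b) := by
    intro a b ha
    rw [← hp] at ha ⊢
    exact ⟨fun h => ha.symm.trans _ _ _ h, fun h => ha.trans _ _ _ h⟩
  have hz : p z := (hp z).1 (.refl _)
  -- As `aut` carries components to components, all points of the component return at the same times
  -- as `z`.
  have hmin' : ∀ i a, 0 < i → p a → p ((x.aut ^ i) a) → r ≤ i := by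
    intro i a h0 h1 h2
    refine hmin i h0 ?_
    rw [hpp h2, hx.gRel_pow_iff, ← hpp h1]
    exact hz
  have hpr : ∀ a, p ((x.aut ^ r) a) ↔ p a := by
    intro a
    rw [hpp hrz, hx.gRel_pow_iff, ← hpp hz]
  have hprn : ∀ n a, p ((x.aut ^ (r * n)) a) ↔ p a := by
    intro n
    induction n with
    | zero => intro a; rfl
    | succ n ih => intro a; rw [mul_add, pow_add, Equiv.Perm.mul_apply, ih, mul_one, hpr]
  have hatt : ∀ a, p a → p (x.att a) := fun a ha => (hpp ha).2 (.rel _ _ (Or.inl rfl))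
  have hinv : ∀ a, p a → p (x.inv a) := fun a ha => (hpp ha).2 (.rel _ _ (Or.inr rfl))
  -- The points that some power of `aut` moves into the component are closed, in both directions,
  -- under attaching, gluing and `aut`; by transitivity these are all points.
  have hall : ∀ w, ∃ n : ℕ, p ((x.aut ^ n) w) := by
    intro w
    refine (eqvGen_invariant (p := fun w => ∃ n : ℕ, p ((x.aut ^ n) w)) ?_ (hT.2 z w)).1 ⟨0, hz⟩
    have aux : ∀ a b, x.GRel a b → (∃ n : ℕ, p ((x.aut ^ n) a)) → ∃ n : ℕ, p ((x.aut ^ n) b) := by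
      rintro a b hab ⟨n, hn⟩
      exact ⟨n, (hpp hn).2 ((hx.gRel_pow_iff n).2 hab)⟩
    rintro a b (h | h | rfl)
    · have : x.GRel a b := .rel _ _ (Or.inl h)
      exact ⟨aux a b this, aux b a this.symm⟩
    · have : x.GRel a b := .rel _ _ (Or.inr h)
      exact ⟨aux a b this, aux b a this.symm⟩
    · constructor
      · rintro ⟨n, hn⟩
        rcases n with _ | n
        · refine ⟨r - 1, ?_⟩
          rw [← Equiv.Perm.mul_apply, ← pow_succ, Nat.sub_add_cancel hr0, hpr]
          exact hn
        · exact ⟨n, by rwa [← Equiv.Perm.mul_apply, ← pow_succ]⟩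
      · rintro ⟨n, hn⟩
        exact ⟨n + 1, by rwa [pow_succ, Equiv.Perm.mul_apply]⟩
  let E : {a // p a} × Fin r → Z := fun c => (x.aut ^ (c.2 : ℕ)) c.1
  have hE : Function.Bijective E := by
    constructor
    · have aux : ∀ (a b : {a // p a}) (i j : Fin r), (i : ℕ) ≤ j →
          (x.aut ^ (i : ℕ)) a = (x.aut ^ (j : ℕ)) b → (a, i) = (b, j) := by
        intro a b i j hij h
        obtain ⟨d, hd⟩ := Nat.exists_eq_add_of_le hij
        rw [hd, pow_add, Equiv.Perm.mul_apply, (x.aut ^ (i : ℕ)).injective.eq_iff] at h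
        have hd0 : d = 0 := by
          by_contra h0
          have := hmin' d b (Nat.pos_of_ne_zero h0) b.2 (h ▸ a.2)
          omega
        subst hd0
        exact Prod.ext (Subtype.ext h) (Fin.ext (by simpa using hd.symm))
      rintro ⟨a, i⟩ ⟨b, j⟩ h
      rcases le_total (i : ℕ) j with hij | hij
      · exact aux a b i j hij h
      · exact (aux b a j i hij h.symm).symm
    · intro w
      obtain ⟨n, hn⟩ := hall w
      -- choose a multiple of the order that exceeds `n`
      let N := orderOf x.aut * n
      have hNn : n ≤ N := Nat.le_mul_of_pos_left _ (orderOf_pos _)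
      have hw : (x.aut ^ (N - n)) ((x.aut ^ n) w) = w := by
        rw [← Equiv.Perm.mul_apply, ← pow_add, Nat.sub_add_cancel hNn, pow_mul,
          pow_orderOf_eq_one, one_pow, Equiv.Perm.one_apply]
      -- Getting from `(aut ^ n) w` back to `w` takes `N - n` more steps. The multiple of `r`
      -- contained in `N - n` stays inside the component, and the remainder modulo `r` selects the
      -- copy.
      refine ⟨(⟨(x.aut ^ (r * ((N - n) / r))) ((x.aut ^ n) w), (hprn _ _).2 hn⟩,
        ⟨(N - n) % r, Nat.mod_lt _ hr0⟩), ?_⟩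
      change (x.aut ^ ((N - n) % r)) ((x.aut ^ (r * ((N - n) / r))) ((x.aut ^ n) w)) = w
      rw [← Equiv.Perm.mul_apply, ← pow_add, Nat.mod_add_div, hw]
  refine ⟨r, x.restrict p (x.aut ^ r) hatt hinv hpr, Equiv.ofBijective E hE, hr0, ?_, ?_, ?_⟩
  · refine ⟨⟨⟨z, hz⟩⟩, ?_⟩
    rintro ⟨a, ha⟩ ⟨b, hb⟩
    have hab : x.GRel a b := (hpp ha).1 hb
    have key : ∀ a b, (x.att a = b ∨ x.inv a = b) → (p a ↔ p b) := by
      intro a b h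
      have h' : x.GRel a b := .rel _ _ h
      exact ⟨fun h => (hpp h).2 h', fun h => (hpp h).2 h'.symm⟩
    refine eqvGen_transfer (fun a => a) ?_ (eqvGen_subtype key hab ha hb)
    rintro a b h
    refine .rel _ _ ?_
    simpa [Str.restrict, Subtype.ext_iff] using h
  · rintro a i hi
    change (x.aut ^ (i : ℕ)) a = a
    rw [hi]
    rfl
  · set e := Equiv.ofBijective E hE with he
    have hsurj : ∀ w, ∃ c, e c = w := e.surjective
    ext w : 2 <;> obtain ⟨⟨a, i⟩, rfl⟩ := hsurj w
    · simp only [Str.map, Equiv.symm_apply_apply, Str.cyc, Str.restrict]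
      exact (hx.lab_pow _ _).symm
    · simp only [Str.map, Equiv.symm_apply_apply, Str.cyc, Str.restrict]
      exact (hx.att_pow _ _).symm
    · simp only [Str.map, Equiv.symm_apply_apply, Str.cyc, Str.restrict]
      exact (hx.inv_pow _ _).symm
    · simp only [Str.map, Equiv.symm_apply_apply, Str.cyc, Str.restrict, Equiv.trans_apply]
      simp only [cycPerm, Equiv.coe_fn_mk]
      split_ifs with h
      · change (x.aut ^ ((i : ℕ) + 1)) a = x.aut ((x.aut ^ (i : ℕ)) a)
        rw [pow_succ', Equiv.Perm.mul_apply]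
      · change (x.aut ^ r) a = x.aut ((x.aut ^ (i : ℕ)) a)
        rw [← Equiv.Perm.mul_apply, ← pow_succ', show (i : ℕ) + 1 = r by omega]

/-- The bijections that extend the inclusion of a subset. -/
theorem card_extensions [Fintype Z] {p : Z → Prop} {m : ℕ} (hm : 0 < m)
    (h : Nat.card {a // p a} * m = Fintype.card Z) :
    Nat.card {e : {a // p a} × Fin m ≃ Z // ∀ a i, i.1 = 0 → e (a, i) = a} =
      (Fintype.card Z - Nat.card {a // p a}).factorial := by
  classical
  let i₀ : Fin m := ⟨0, hm⟩
  let s : Set ({a // p a} × Fin m) := {c | c.2 = i₀}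
  let t : Set Z := {a | p a}
  let e₀ : s ≃ t :=
    { toFun := fun c => ⟨c.1.1, c.1.1.2⟩
      invFun := fun a => ⟨(⟨a, a.2⟩, i₀), rfl⟩
      left_inv := by
        rintro ⟨⟨a, i⟩, rfl : i = i₀⟩
        rfl
      right_inv := fun a => rfl }
  have h1 : Nat.card {e : {a // p a} × Fin m ≃ Z // ∀ a i, i.1 = 0 → e (a, i) = a} =
      Nat.card {e : {a // p a} × Fin m ≃ Z // ∀ c : s, e c = e₀ c} := by
    refine Nat.card_congr (Equiv.subtypeEquivRight fun e => ?_)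
    constructor
    · rintro h ⟨⟨a, i⟩, rfl : i = i₀⟩
      exact h a i₀ rfl
    · intro h a i hi
      exact h ⟨(a, i), Fin.ext hi⟩
  have hs : Nat.card (sᶜ : Set _) = Fintype.card Z - Nat.card {a // p a} := by
    have e1 := Nat.card_congr e₀
    have e2 := Set.ncard_add_ncard_compl s
    rw [← Nat.card_coe_set_eq, ← Nat.card_coe_set_eq, e1, Nat.card_prod, Nat.card_fin, h] at e2
    change Nat.card {a // p a} + _ = _ at e2
    omega
  have ht : Nat.card (tᶜ : Set _) = Fintype.card Z - Nat.card {a // p a} := by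
    have e2 := Set.ncard_add_ncard_compl t
    rw [← Nat.card_coe_set_eq, ← Nat.card_coe_set_eq, Nat.card_eq_fintype_card (α := Z)] at e2
    change Nat.card {a // p a} + _ = _ at e2
    omega
  have : Nonempty ((sᶜ : Set _) ≃ (tᶜ : Set _)) := by
    rw [← Finite.card_eq, hs, ht]
  obtain ⟨e₁⟩ := this
  rw [h1, Nat.card_congr (Equiv.Set.compl e₀), Nat.card_eq_fintype_card, Fintype.card_equiv e₁,
    ← Nat.card_eq_fintype_card, hs]

-- Such a structure is a cyclic union of `m` copies of the component `p`, and the identification `e`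
-- of these copies with `Z` is normalized by `e (a, 0) = a`. This makes it unique, since `e (a, i)`
-- must be `aut ^ i` applied to `a`. Conversely, every connected structure on `p` and every
-- normalized bijection occur, and the factorial counts the bijections.
open scoped Classical in
theorem sum_gRel_class [Fintype Z] (z : Z) (p : Z → Prop) (hz : p z) :
    ∑ x : Str Z with x.TConn ∧ ∀ a, x.GRel z a ↔ p a, P.weight x =
      if Nat.card {a // p a} ∣ Fintype.card Z then
        (Fintype.card Z - Nat.card {a // p a}).factorial •
          P.psi (Fintype.card Z / Nat.card {a // p a}) (P.totalG {a // p a})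
      else 0 := by
  have hpos : 0 < Nat.card {a // p a} := Nat.card_pos_iff.2 ⟨⟨⟨z, hz⟩⟩, inferInstance⟩
  have hcard : ∀ {m : ℕ}, ({a // p a} × Fin m ≃ Z) → Nat.card {a // p a} * m = Fintype.card Z := by
    intro m e
    rw [← Nat.card_eq_fintype_card, ← Nat.card_congr e, Nat.card_prod, Nat.card_fin]
  split_ifs with hd
  · set m := Fintype.card Z / Nat.card {a // p a} with hm
    have hlm : Nat.card {a // p a} * m = Fintype.card Z := Nat.mul_div_cancel' hd
    have hm0 : 0 < m := by
      refine Nat.pos_of_ne_zero fun h => ?_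
      rw [h, mul_zero] at hlm
      exact (Fintype.card_pos_iff.2 ⟨z⟩).ne hlm
    rw [← card_extensions hm0 hlm, Nat.card_eq_fintype_card, ← Finset.card_univ, totalG, map_sum,
      ← Finset.sum_const, ← Finset.sum_product']
    symm
    refine Finset.sum_of_injOn (fun c => (c.2.cyc m).map c.1.1) ?_ ?_ ?_ ?_
    · rintro ⟨⟨e, he⟩, y⟩ hy ⟨⟨e', he'⟩, y'⟩ _ h
      dsimp only at h
      have key : ∀ (e : {a // p a} × Fin m ≃ Z) (y : Str {a // p a}),
          (∀ a i, i.1 = 0 → e (a, i) = a) → ∀ c, e c = (((y.cyc m).map e).aut ^ (c.2 : ℕ)) c.1 := by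
        rintro e y he ⟨a, i⟩
        have h1 := pow_semiconj (map_aut_apply e (y.cyc m)) i (a, ⟨0, hm0⟩)
        rw [he a _ rfl] at h1
        have h2 : ((y.cyc m).aut ^ (i : ℕ)) (a, ⟨0, hm0⟩) = (a, i) :=
          cycPerm_pow_zero y.aut m hm0 a i
        rw [← h1, h2]
      have hee : e = e' := by
        ext c
        rw [key e y he, h, key e' y' he']
      subst hee
      have := Str.cyc_injective hm0 ((Str.mapEquiv e).injective h)
      rw [this]
    · rintro ⟨⟨e, he⟩, y⟩ hy
      simp only [Finset.coe_product, Set.mem_prod, Finset.mem_coe, Finset.mem_filter,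
        Finset.mem_univ, true_and] at hy ⊢
      refine ⟨(Str.tConn_map _ _).2 (Str.tConn_cyc y hm0 hy), fun a => ?_⟩
      have h1 : z = e (⟨z, hz⟩, ⟨0, hm0⟩) := (he ⟨z, hz⟩ _ rfl).symm
      obtain ⟨⟨b, i⟩, rfl⟩ := e.surjective a
      rw [h1, Str.gRel_map, Str.gRel_cyc y hy]
      constructor
      · rintro rfl
        rw [he b _ rfl]
        exact b.2
      · intro h
        have h2 := he ⟨_, h⟩ ⟨0, hm0⟩ rfl
        dsimp only at h2
        rw [e.injective.eq_iff] at h2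
        exact (Prod.mk.inj h2).2
    · intro x hx h
      simp only [Finset.mem_filter, Finset.mem_univ, true_and] at hx
      by_contra hw
      have hv : P.Valid x := by
        by_contra h'
        exact hw (weight_of_not_valid h')
      obtain ⟨m', y, e, hm', hy, he, hyx⟩ := exists_cyc_of_tConn hv hx.1 z hx.2
      obtain rfl : m' = m := Nat.eq_of_mul_eq_mul_left hpos ((hcard e).trans hlm.symm)
      refine h ⟨(⟨e, he⟩, y), ?_, hyx⟩
      simpa using hy
    · rintro ⟨⟨e, he⟩, y⟩ hy
      rw [weight_map, weight_cyc _ hm0]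
  · refine Finset.sum_eq_zero fun x hx => ?_
    simp only [Finset.mem_filter, Finset.mem_univ, true_and] at hx
    refine weight_of_not_valid fun hv => ?_
    obtain ⟨m, y, e, hm, hy, he, hyx⟩ := exists_cyc_of_tConn hv hx.1 z hx.2
    exact hd ⟨m, (hcard e).symm⟩

theorem totalT_eq_sum_finset [Fintype Z] [DecidableEq Z] (z : Z) :
    P.totalT Z = ∑ Y : Finset Z with z ∈ Y,
      if Y.card ∣ Fintype.card Z then (Fintype.card Z - Y.card).factorial •
        P.psi (Fintype.card Z / Y.card) (P.totalG (Fin Y.card)) else 0 := by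
  classical
  rw [totalT, ← Finset.sum_fiberwise_of_maps_to
    (g := fun x : Str Z => Finset.univ.filter fun a => x.GRel z a)
    (t := Finset.univ.filter fun Y : Finset Z => z ∈ Y)]
  · refine Finset.sum_congr rfl fun Y hY => ?_
    have hz : z ∈ Y := (Finset.mem_filter.1 hY).2
    have := sum_gRel_class (P := P) z (fun a => a ∈ Y) hz
    rw [totalG_congr (Z := {a // a ∈ Y}) (Z' := Fin Y.card) Y.equivFin,
      Nat.card_eq_fintype_card, Fintype.card_coe] at this
    rw [← this]
    refine Finset.sum_congr ?_ fun _ _ => rfl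
    ext x
    simp [Finset.ext_iff]
  · intro x _
    simp only [Finset.mem_filter, Finset.mem_univ, true_and]
    exact Relation.EqvGen.refl _

theorem card_mul_totalT (n : ℕ) : n • P.totalT (Fin n) = ∑ j ∈ Finset.range (n + 1),
    n.choose j • j • if j ∣ n then (n - j).factorial • P.psi (n / j) (P.totalG (Fin j)) else 0 := by
  rw [← sum_finset_mem n fun j => if j ∣ n then (n - j).factorial •
    P.psi (n / j) (P.totalG (Fin j)) else 0]
  have : ∀ z : Fin n, P.totalT (Fin n) = _ := fun z => totalT_eq_sum_finset (P := P) z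
  simp only [Fintype.card_fin] at this
  rw [← Finset.sum_congr rfl fun z _ => this z]
  simp

end WeightData

end ModularOperad

end

noncomputable section

namespace ModularOperad

universe w

/-! ### Sums over orbits -/

section OrbitSum

variable {Z : Type} [Finite Z] (φ : Equiv.Perm Z)

theorem card_orbit (z : Z) : Nat.card {a // Orb.mk φ a = Orb.mk φ z} = orbLen φ z := by
  classical
  have : Fintype Z := Fintype.ofFinite Z
  have h1 : (Finset.univ.filter fun a => Orb.mk φ a = Orb.mk φ z) =
      (Finset.range (orbLen φ z)).image fun i => (φ ^ i) z := by
    ext a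
    simp only [Finset.mem_filter, Finset.mem_univ, true_and, Finset.mem_image, Finset.mem_range]
    rw [eq_comm, Orb.mk_eq_mk]
    constructor
    · intro h
      obtain ⟨n, -, rfl⟩ := h.exists_pow_eq'
      refine ⟨n % orbLen φ z, Nat.mod_lt _ (orbLen_pos φ z), ?_⟩
      conv_rhs => rw [← Nat.mod_add_div n (orbLen φ z), pow_add, Equiv.Perm.mul_apply]
      rw [(pow_eq_self_iff φ _ z).2 (Nat.dvd_mul_right _ _)]
    · rintro ⟨i, -, rfl⟩
      exact ⟨i, rfl⟩
  rw [Nat.card_eq_fintype_card, Fintype.card_subtype, h1, Finset.card_image_of_injOn,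
    Finset.card_range]
  intro i hi j hj h
  have hi : i < orbLen φ z := by simpa using hi
  have hj : j < orbLen φ z := by simpa using hj
  dsimp only at h
  rw [← Equiv.Perm.iterate_eq_pow, ← Equiv.Perm.iterate_eq_pow] at h
  exact Function.iterate_injOn_Iio_minimalPeriod hi hj h

theorem sum_eq_sum_orb [Fintype Z] {M : Type*} [AddCommMonoid M] (c : Z → M)
    (h : ∀ z, c (φ z) = c z) : ∑ z, c z = ∑ o : Orb φ, orbLen φ o.out • c o.out := by
  classical
  rw [← Finset.sum_fiberwise (g := fun z => Orb.mk φ z)]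
  refine Finset.sum_congr rfl fun o _ => ?_
  have : ∀ z ∈ Finset.univ.filter (fun z => Orb.mk φ z = o), c z = c o.out := by
    intro z hz
    refine eq_of_sameCycle h (Orb.mk_eq_mk.1 ?_)
    rw [Orb.mk_out]
    exact (Finset.mem_filter.1 hz).2
  rw [Finset.sum_congr rfl this, Finset.sum_const]
  congr 1
  rw [← card_orbit, Nat.card_eq_fintype_card, Fintype.card_subtype, Orb.mk_out]

theorem sum_orbType {p : Z → Prop} (hp : ∀ z, p (φ z) ↔ p z) :
    (orbType φ p).sum = Nat.card {z // p z} := by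
  classical
  have : Fintype Z := Fintype.ofFinite Z
  have h1 := sum_eq_sum_orb φ (fun z => if p z then 1 else 0) (fun z => by simp only [hp])
  rw [Nat.card_eq_fintype_card, Fintype.card_subtype, Finset.card_filter, h1, orbType, orbProd,
    toAdd_prod]
  refine (map_sum Multiset.sumAddMonoidHom _ _).trans (Finset.sum_congr rfl fun o _ => ?_)
  by_cases h : p o.out <;> simp [h]

end OrbitSum

/-! ### Normalized sums -/

namespace WeightData

section Normalized

variable {R : Type*} [CommRing R] [Algebra ℚ R] (P : WeightData R)

/-- The exponential generating coefficients of all structures. -/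
def avg (n : ℕ) : R := (n.factorial : ℚ)⁻¹ • P.total (Fin n)

/-- The exponential generating coefficients of the transitively permuted structures. -/
def avgT (n : ℕ) : R := (n.factorial : ℚ)⁻¹ • P.totalT (Fin n)

/-- The exponential generating coefficients of the connected structures. -/
def avgG (n : ℕ) : R := (n.factorial : ℚ)⁻¹ • P.totalG (Fin n)

theorem avg_zero : P.avg 0 = 1 := by
  have h : ∀ x : Str (Fin 0), P.weight x = 1 := by
    intro x
    rw [weight_of_valid fun z => z.elim0]
    refine Finset.prod_eq_one fun o _ => o.out.elim0
  have h1 : Fintype.card (Str (Fin 0)) = 1 := by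
    refine Fintype.card_eq_one_iff.2 ⟨⟨Fin.elim0, id, id, 1⟩, fun y => ?_⟩
    ext z <;> exact z.elim0
  rw [avg, total, Finset.sum_congr rfl fun x _ => h x]
  simp [h1]

theorem avgT_zero : P.avgT 0 = 0 := by
  classical
  rw [avgT, totalT, Finset.sum_eq_zero, smul_zero]
  intro x hx
  obtain ⟨z⟩ := (Finset.mem_filter.1 hx).2.1
  exact z.elim0

theorem avgG_zero : P.avgG 0 = 0 := by
  classical
  rw [avgG, totalG, Finset.sum_eq_zero, smul_zero]
  intro x hx
  obtain ⟨z⟩ := (Finset.mem_filter.1 hx).2.1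
  exact z.elim0

theorem nsmul_avg (n : ℕ) : (n : ℚ) • P.avg n =
    ∑ j ∈ Finset.range (n + 1), (j : ℚ) • (P.avgT j * P.avg (n - j)) := by
  have h := card_mul_total (P := P) n
  simp only [← Nat.cast_smul_eq_nsmul ℚ] at h
  rw [avg, smul_comm, h, Finset.smul_sum]
  refine Finset.sum_congr rfl fun j hj => ?_
  have hj : j ≤ n := Nat.lt_succ_iff.1 (Finset.mem_range.1 hj)
  simp only [avgT, avg, smul_mul_assoc, mul_smul_comm, smul_smul]
  congr 1
  rw [Nat.cast_choose ℚ hj]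
  have : (n.factorial : ℚ) ≠ 0 := by positivity
  field_simp

/-- For `n = m * l` the numerical factors give `n.choose l * l * (n - l)! / n! = l / l!`, and the
remaining quotient `l / n = 1 / m` is the denominator in the definition of `Exp`. -/
theorem avgT_eq {n : ℕ} (hn : n ≠ 0) : P.avgT n =
    ∑ p ∈ n.divisorsAntidiagonal, (p.1 : ℚ)⁻¹ • P.psi p.1 (P.avgG p.2) := by
  have h := card_mul_totalT (P := P) n
  simp only [← Nat.cast_smul_eq_nsmul ℚ] at h
  have hn' : (n : ℚ) ≠ 0 := by exact_mod_cast hn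
  refine smul_right_injective R hn' ?_
  dsimp only
  rw [avgT, smul_comm, h, Finset.smul_sum]
  rw [Nat.sum_divisorsAntidiagonal' (f := fun m j => (m : ℚ)⁻¹ • P.psi m (P.avgG j)),
    Finset.smul_sum]
  symm
  refine Finset.sum_subset_zero_on_sdiff (f := fun j => (n : ℚ) • _) ?_ ?_ ?_
  · intro j hj
    have := Nat.divisor_le hj
    simp only [Finset.mem_range]
    omega
  · intro j hj
    simp only [Finset.mem_sdiff, Finset.mem_range, Nat.mem_divisors, not_and, not_not] at hj
    have : ¬ j ∣ n := fun h => hn (hj.2 h)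
    simp [this]
  · intro j hj
    obtain ⟨m, rfl⟩ := Nat.dvd_of_mem_divisors hj
    have hj0 : 0 < j := Nat.pos_of_mem_divisors hj
    have hm0 : m ≠ 0 := by rintro rfl; simp at hn
    simp only [Nat.mul_div_cancel_left _ hj0, dvd_mul_right, if_true,
      avgG, map_rat_smul, smul_smul]
    congr 1
    rw [Nat.cast_choose ℚ (Nat.le_mul_of_pos_right j (Nat.pos_of_ne_zero hm0))]
    push_cast
    field_simp

/-- `nsmul_avg` says coefficientwise that the derivative of the left series is the series times the
derivative of the transitive one; the constant terms are `1` and `0`. -/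
theorem mk_avg [IsAddTorsionFree R] : PowerSeries.mk P.avg =
    (PowerSeries.exp R).subst (PowerSeries.mk P.avgT) := by
  refine eq_exp_subst_of_derivative ?_ ?_ ?_
  · rw [← PowerSeries.coeff_zero_eq_constantCoeff_apply, PowerSeries.coeff_mk, avgT_zero]
  · rw [← PowerSeries.coeff_zero_eq_constantCoeff_apply, PowerSeries.coeff_mk, avg_zero]
  · ext n
    rw [PowerSeries.coeff_derivative, PowerSeries.coeff_mul]
    simp only [PowerSeries.coeff_derivative, PowerSeries.coeff_mk]
    have h := P.nsmul_avg (n + 1)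
    rw [Finset.sum_range_succ'] at h
    simp only [Nat.cast_zero, zero_smul, add_zero] at h
    rw [Finset.Nat.sum_antidiagonal_eq_sum_range_succ_mk]
    rw [← Finset.sum_range_reflect]
    have e : ∀ (j : ℕ) (x : R), x * ((j : R) + 1) = ((j + 1 : ℕ) : ℚ) • x := by
      intro j x
      rw [Nat.cast_smul_eq_nsmul, nsmul_eq_mul, mul_comm]
      push_cast
      rfl
    rw [e, h]
    refine Finset.sum_congr rfl fun j hj => ?_
    have hj := Finset.mem_range.1 hj
    simp only [e, mul_smul_comm]
    rw [show n + 1 - 1 - j = n - j by omega, show n - (n - j) = j by omega,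
      show n + 1 - (j + 1) = n - j by omega, mul_comm]

end Normalized

end WeightData

end ModularOperad

end

noncomputable section

namespace ModularOperad

universe w

/-! ### The exponential formula for graded weights -/

namespace WeightData

variable {k : Type w} [Field k] [CharZero k] {σ : Type} [PowerSumVars σ] [GradedVars σ]

/-- The Adams operations of the weights are those of `GradedSeries`, and the orders of the weights
of vertices and legs are bounded below. -/
structure IsGraded (P : WeightData (GradedSeries σ k)) : Prop where
  psi_eq : ∀ n : ℕ+, P.psi n = adams n
  coeff_vert : ∀ ν d, 4 * d < 1 + ν.sum → PowerSeries.coeff d (P.vert ν) = 0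
  coeff_leg : PowerSeries.coeff 0 P.leg = 0

theorem coeff_prod_eq_zero {A : Type*} [CommRing A] {ι : Type*} (s : Finset ι)
    (f : ι → PowerSeries A) (c : ι → ℕ)
    (h : ∀ i ∈ s, ∀ d, 4 * d < c i → PowerSeries.coeff d (f i) = 0) (d : ℕ)
    (hd : 4 * d < ∑ i ∈ s, c i) : PowerSeries.coeff d (∏ i ∈ s, f i) = 0 := by
  classical
  induction s using Finset.induction_on generalizing d with
  | empty => simp at hd
  | insert a s ha ih =>
    rw [Finset.prod_insert ha, PowerSeries.coeff_mul]
    rw [Finset.sum_insert ha] at hd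
    refine Finset.sum_eq_zero fun p hp => ?_
    have hp := Finset.HasAntidiagonal.mem_antidiagonal.1 hp
    rcases Nat.lt_or_ge (4 * p.1) (c a) with h1 | h1
    · rw [h a (Finset.mem_insert_self _ _) _ h1, zero_mul]
    · rw [ih (fun i hi => h i (Finset.mem_insert_of_mem hi)) p.2 (by omega), mul_zero]

variable {P : WeightData (GradedSeries σ k)}

theorem IsGraded.coeff_psi (hP : P.IsGraded) (n : ℕ+) (f : GradedSeries σ k) (d : ℕ) :
    PowerSeries.coeff d (P.psi n f) = if (n : ℕ) ∣ d then
      MvPolynomial.rename (PowerSumVars.scale n) (PowerSeries.coeff (d / n) f) else 0 := by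
  rw [hP.psi_eq, coeff_adams]

theorem IsGraded.coeff_psi_eq_zero (hP : P.IsGraded) {n c : ℕ} (hn : 0 < n)
    {f : GradedSeries σ k} (hf : ∀ d, 4 * d < c → PowerSeries.coeff d f = 0) {d : ℕ}
    (hd : 4 * d < n * c) : PowerSeries.coeff d (P.psi n f) = 0 := by
  lift n to ℕ+ using hn
  rw [hP.coeff_psi]
  split_ifs with h
  · obtain ⟨e, rfl⟩ := h
    rw [Nat.mul_div_cancel_left _ n.pos, hf, map_zero]
    have : (n : ℕ) * (4 * e) < n * c := by linarith
    exact lt_of_mul_lt_mul_left this (Nat.zero_le _)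
  · rfl

/-- The flags are charged to their vertices: a vertex counts for itself and its flags, a leg for
itself, a flag for nothing. Validity puts every flag at a vertex, so each element is counted once.
This is how flags, which carry no power of `t`, are controlled by vertices. -/
theorem sum_charge {Z : Type} [Fintype Z] {x : Str Z} (hx : P.Valid x) :
    (∑ z, if x.lab z = 0 then 1 + Nat.card {f // flagsAt x z f}
      else if x.lab z = 1 then 0 else 1) = Fintype.card Z := by
  classical
  have h1 : ∀ z, (if x.lab z = 0 then 1 + Nat.card {f // flagsAt x z f}
      else if x.lab z = 1 then 0 else 1) =
      (if x.lab z = 1 then 0 else 1) + Nat.card {f // flagsAt x z f} := by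
    intro z
    rcases Decidable.em (x.lab z = 0) with h | h
    · simp [h]
    · have : IsEmpty {f // flagsAt x z f} := ⟨fun f => h (by
        rw [← f.2.2]; exact (hx _).lab_att f.2.1)⟩
      simp [h]
  rw [Finset.sum_congr rfl fun z _ => h1 z, Finset.sum_add_distrib]
  have h2 : ∑ z, Nat.card {f // flagsAt x z f} =
      (Finset.univ.filter fun f => x.lab f = 1).card := by
    rw [Finset.card_eq_sum_card_fiberwise (f := x.att) (t := Finset.univ) (fun _ _ => by simp)]
    refine Finset.sum_congr rfl fun z _ => ?_
    rw [Nat.card_eq_fintype_card, Fintype.card_subtype, Finset.filter_filter]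
    exact congrArg Finset.card (Finset.filter_congr fun f _ => Iff.rfl)
  have h3 : ∑ z, (if x.lab z = 1 then 0 else 1) =
      (Finset.univ.filter fun f => ¬ x.lab f = 1).card := by
    rw [Finset.card_filter]
    refine Finset.sum_congr rfl fun z _ => ?_
    split_ifs <;> simp_all
  rw [h2, h3, add_comm, Finset.card_filter_add_card_filter_not, Finset.card_univ]

/-- The order in `t` of a local weight is at least a quarter of its charge, `psi n` multiplies that
order by the orbit length `n`, and the charges add up to the number of elements. This bound is what
allows the variable counting elements to be set to `1`. -/
theorem IsGraded.coeff_weight (hP : P.IsGraded) {Z : Type} [Finite Z] (x : Str Z) (d : ℕ)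
    (hd : 4 * d < Nat.card Z) : PowerSeries.coeff d (P.weight x) = 0 := by
  classical
  have : Fintype Z := Fintype.ofFinite Z
  by_cases hx : P.Valid x
  · rw [weight_of_valid hx, orbProd]
    rw [Nat.card_eq_fintype_card, ← sum_charge hx, sum_eq_sum_orb x.aut] at hd
    · refine coeff_prod_eq_zero _ _ _ ?_ d hd
      intro o _ d hd
      rw [smul_eq_mul] at hd
      refine hP.coeff_psi_eq_zero (orbLen_pos _ _) ?_ hd
      intro d hd
      split_ifs at hd ⊢ with h1 h2
      · refine hP.coeff_vert _ _ ?_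
        rw [sum_orbType _ (hx.flagsAt_pow _ (pow_orbLen _ _))]
        exact hd
      · omega
      · obtain rfl : d = 0 := by omega
        exact hP.coeff_leg
    · intro z
      have : Nat.card {f // flagsAt x (x.aut z) f} = Nat.card {f // flagsAt x z f} := by
        refine (Nat.card_congr (x.aut.subtypeEquiv fun f => ?_)).symm
        rw [flagsAt, flagsAt, (hx f).lab_aut, (hx f).att_aut, x.aut.injective.eq_iff]
      rw [(hx z).lab_aut, this]
  · rw [weight_of_not_valid hx, map_zero]

theorem IsGraded.auxBounded_avgG (hP : P.IsGraded) : AuxBounded (PowerSeries.mk P.avgG) := by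
  intro l d hd
  rw [PowerSeries.coeff_mk, avgG, coeff_rat_smul, totalG, map_sum, Finset.sum_eq_zero, smul_zero]
  intro x _
  exact hP.coeff_weight x d (by simpa using hd)

theorem IsGraded.coeff_psi_avgG (hP : P.IsGraded) {m l d : ℕ} (hm : 0 < m)
    (h : 4 * d < m * l) : PowerSeries.coeff d (P.psi m (P.avgG l)) = 0 :=
  hP.coeff_psi_eq_zero hm (fun d hd => by
    have := hP.auxBounded_avgG l d hd
    rwa [PowerSeries.coeff_mk] at this) h

theorem IsGraded.auxBounded_avgT (hP : P.IsGraded) : AuxBounded (PowerSeries.mk P.avgT) := by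
  intro n d hd
  rw [PowerSeries.coeff_mk, avgT_eq P (by omega), map_sum]
  refine Finset.sum_eq_zero fun p hp => ?_
  have h := Nat.mem_divisorsAntidiagonal.1 hp
  have h0 : 0 < p.1 := Nat.pos_of_ne_zero (by rintro h0; rw [h0, zero_mul] at h; exact h.2 h.1.symm)
  rw [coeff_rat_smul, hP.coeff_psi_avgG h0 (by omega), smul_zero]

/-- The sum over all structures. -/
def fullSum (P : WeightData (GradedSeries σ k)) : GradedSeries σ k :=
  specialize (PowerSeries.mk P.avg)

/-- The sum over all connected structures. -/
def connSum (P : WeightData (GradedSeries σ k)) : GradedSeries σ k :=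
  specialize (PowerSeries.mk P.avgG)

theorem constantCoeff_connSum (P : WeightData (GradedSeries σ k)) :
    PowerSeries.constantCoeff P.connSum = 0 := by
  refine constantCoeff_specialize ?_
  rw [← PowerSeries.coeff_zero_eq_constantCoeff_apply, PowerSeries.coeff_mk, avgG_zero]

/-- In degree `d` both sides are the sum over pairs `(m, l)` of `1 / m` times the coefficient of
`psi m (avgG l)`. Pairs with `4 * d < m * l` contribute nothing, so one finite box of indices serves
both; on the left it is regrouped by `m * l`, on the right by `m`. -/
theorem IsGraded.specialize_avgT (hP : P.IsGraded) :
    specialize (PowerSeries.mk P.avgT) = adamsSum P.connSum := by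
  classical
  ext1 d
  rcases Nat.eq_zero_or_pos d with rfl | hd
  · rw [PowerSeries.coeff_zero_eq_constantCoeff_apply, PowerSeries.coeff_zero_eq_constantCoeff_apply,
      constantCoeff_adamsSum (constantCoeff_connSum P), constantCoeff_specialize]
    rw [← PowerSeries.coeff_zero_eq_constantCoeff_apply, PowerSeries.coeff_mk, avgT_zero]
  · let M : ℕ+ := ⟨4 * d, by omega⟩
    let F : ℕ+ × ℕ → MvPolynomial σ k := fun p =>
      (p.1 : ℚ)⁻¹ • PowerSeries.coeff d (P.psi p.1 (P.avgG p.2))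
    have hF0 : ∀ m, F (m, 0) = 0 := by
      intro m
      simp only [F, avgG_zero, map_zero, smul_zero]
    have hF1 : ∀ (m : ℕ+) (l : ℕ), 4 * d < (m : ℕ) * l → F (m, l) = 0 := by
      intro m l h
      simp only [F, hP.coeff_psi_avgG m.pos h, smul_zero]
    let S : Finset (ℕ+ × ℕ) := (Finset.Icc 1 M) ×ˢ Finset.range (4 * d + 1)
    have hL : PowerSeries.coeff d (specialize (PowerSeries.mk P.avgT)) = ∑ p ∈ S, F p := by
      rw [coeff_specialize]
      simp only [PowerSeries.coeff_mk]
      have h1 : ∑ p ∈ S, F p = ∑ p ∈ S with (p.1 : ℕ) * p.2 ≤ 4 * d, F p := by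
        rw [Finset.sum_filter]
        refine Finset.sum_congr rfl fun p _ => ?_
        split_ifs with h
        · rfl
        · exact hF1 _ _ (not_le.1 h)
      rw [h1, ← Finset.sum_fiberwise_of_maps_to (g := fun p : ℕ+ × ℕ => (p.1 : ℕ) * p.2)
        (t := Finset.range (4 * d + 1))]
      · refine Finset.sum_congr rfl fun n hn => ?_
        have hn := Finset.mem_range.1 hn
        rcases Nat.eq_zero_or_pos n with rfl | hn0
        · rw [avgT_zero, map_zero, Finset.sum_eq_zero]
          rintro ⟨m, l⟩ hp
          have := (Finset.mem_filter.1 hp).2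
          obtain rfl : l = 0 := by simpa using this
          exact hF0 m
        · rw [avgT_eq P hn0.ne', map_sum]
          symm
          refine Finset.sum_nbij' (fun p => ((p.1 : ℕ), p.2)) (fun p => (p.1.toPNat', p.2)) ?_ ?_ ?_
            ?_ ?_
          · rintro ⟨m, l⟩ hp
            have := (Finset.mem_filter.1 hp).2
            exact Nat.mem_divisorsAntidiagonal.2 ⟨this, hn0.ne'⟩
          · rintro ⟨m, l⟩ hp
            have h := Nat.mem_divisorsAntidiagonal.1 hp
            dsimp only at h ⊢
            have hm : 0 < m := Nat.pos_of_ne_zero (by rintro rfl; omega)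
            have hl : 0 < l := Nat.pos_of_ne_zero (by rintro rfl; omega)
            have hm' : ((m.toPNat' : ℕ+) : ℕ) = m := by simp [hm]
            have h2 : m ≤ m * l := Nat.le_mul_of_pos_right m hl
            have h3 : l ≤ m * l := Nat.le_mul_of_pos_left l hm
            simp only [Finset.mem_filter, S, Finset.mem_product, Finset.mem_Icc, Finset.mem_range,
              hm']
            refine ⟨⟨⟨⟨one_le, ?_⟩, by omega⟩, by omega⟩, by omega⟩
            rw [← PNat.coe_le_coe, hm']
            change m ≤ 4 * d
            omega
          · rintro ⟨m, l⟩ hp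
            simp
          · rintro ⟨m, l⟩ hp
            have h := Nat.mem_divisorsAntidiagonal.1 hp
            have hm : 0 < m := Nat.pos_of_ne_zero (by rintro rfl; simp at h; omega)
            simp [hm]
          · rintro ⟨m, l⟩ hp
            simp only [F]
            rw [coeff_rat_smul]
      · intro p hp
        have := (Finset.mem_filter.1 hp).2
        exact Finset.mem_range.2 (by omega)
    have hR : PowerSeries.coeff d (adamsSum P.connSum) = ∑ p ∈ S, F p := by
      rw [adamsSum, coeff_lsum, finsum_eq_sum_of_support_subset (s := Finset.Icc 1 M)]
      · rw [Finset.sum_product]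
        refine Finset.sum_congr rfl fun m _ => ?_
        have hq : ∀ x : MvPolynomial σ k, (m : ℚ)⁻¹ • x = (m : k)⁻¹ • x := by
          intro x
          have := rat_smul_eq (k := k) ((m : ℚ)⁻¹) x
          rw [algebraMap_smul] at this
          rw [this]
          push_cast
          rfl
        rw [PowerSeries.coeff_smul, coeff_adams]
        simp only [F, hq]
        rw [← Finset.smul_sum]
        congr 1
        simp only [hP.coeff_psi]
        split_ifs with h
        · rw [connSum, coeff_specialize, map_sum]
          have h4 : 4 * (d / m) ≤ 4 * d := Nat.mul_le_mul_left _ (Nat.div_le_self _ _)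
          refine Finset.sum_subset_zero_on_sdiff ?_ ?_ ?_
          · intro l hl
            have := Finset.mem_range.1 hl
            exact Finset.mem_range.2 (by omega)
          · intro l hl
            simp only [Finset.mem_sdiff, Finset.mem_range] at hl
            have := hP.auxBounded_avgG l (d / m) (by omega)
            rw [PowerSeries.coeff_mk] at this
            rw [this, map_zero]
          · intro l _
            rw [PowerSeries.coeff_mk]
        · simp
      · intro m hm
        by_contra h
        refine hm ?_
        dsimp only
        rw [PowerSeries.coeff_smul, coeff_adams, if_neg, smul_zero]
        intro hd'
        have := Nat.le_of_dvd hd hd'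
        refine h ?_
        simp only [Finset.coe_Icc, Set.mem_Icc]
        refine ⟨one_le, ?_⟩
        rw [← PNat.coe_le_coe]
        change (m : ℕ) ≤ 4 * d
        omega
    rw [hL, hR]

/-- The ordinary exponential formula holds before specialization, with the transitive structures as
exponent; after specialization that exponent becomes the sum of Adams operations of the connected
series. -/
theorem IsGraded.fullSum_eq (hP : P.IsGraded) : P.fullSum = plethExp P.connSum := by
  have := IsAddTorsionFree.of_module_rat (GradedSeries σ k)
  rw [fullSum, mk_avg, specialize_exp _ hP.auxBounded_avgT, hP.specialize_avgT, plethExp]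
  rw [← PowerSeries.coeff_zero_eq_constantCoeff_apply, PowerSeries.coeff_mk, avgT_zero]

end WeightData

end ModularOperad

end

noncomputable section

namespace ModularOperad

/-! ### Involutions that commute with a permutation -/

section Involutions

variable {W : Type} [Finite W]

/-- The exponents of the monomial in power sums given by the orbits in an invariant subset. -/
def orbExp (φ : Equiv.Perm W) (p : W → Prop) : ℕ+ →₀ ℕ :=
  open Classical in
  (orbProd φ fun z => Multiplicative.ofAdd
    (if p z then Finsupp.single (orbLen φ z).toPNat' 1 else 0)).toAdd

theorem orbExp_eq_sum (φ : Equiv.Perm W) (p : W → Prop) [DecidablePred p] : orbExp φ p =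
    ∑ o : Orb φ, if p o.out then Finsupp.single (orbLen φ o.out).toPNat' 1 else 0 := by
  rw [orbExp, orbProd, toAdd_prod]
  refine Finset.sum_congr rfl fun o _ => ?_
  by_cases h : p o.out <;> simp [h]

theorem orbExp_add (φ : Equiv.Perm W) {p q r : W → Prop} (h : ∀ w, r w ↔ p w ∨ q w)
    (h' : ∀ w, ¬ (p w ∧ q w)) : orbExp φ r = orbExp φ p + orbExp φ q := by
  classical
  rw [orbExp_eq_sum, orbExp_eq_sum, orbExp_eq_sum, ← Finset.sum_add_distrib]
  refine Finset.sum_congr rfl fun o _ => ?_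
  have h1 := h o.out
  have h2 := h' o.out
  by_cases hp : p o.out <;> by_cases hq : q o.out <;> simp_all

theorem orbExp_orbit (φ : Equiv.Perm W) (x : W) :
    orbExp φ (fun w => φ.SameCycle x w) = Finsupp.single (orbLen φ x).toPNat' 1 := by
  classical
  rw [orbExp_eq_sum, Finset.sum_eq_single (Orb.mk φ x)]
  · have h := Orb.sameCycle_out φ x
    rw [if_pos h.symm]
    congr 2
    exact eq_of_sameCycle (orbLen_apply φ) h
  · intro o _ ho
    rw [if_neg]
    intro h
    exact ho ((Orb.mk_out o).symm.trans (Orb.mk_eq_mk.2 h).symm)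
  · intro h
    exact absurd (Finset.mem_univ _) h

theorem card_orbLen_eq (φ : Equiv.Perm W) {p : W → Prop} (hp : ∀ w, p (φ w) ↔ p w) (n : ℕ+) :
    Nat.card {w // p w ∧ orbLen φ w = n} = n * orbExp φ p n := by
  classical
  have : Fintype W := Fintype.ofFinite W
  have h1 := sum_eq_sum_orb φ (fun z => if p z ∧ orbLen φ z = n then 1 else 0)
    (fun z => by simp only [hp, orbLen_apply])
  rw [Nat.card_eq_fintype_card, Fintype.card_subtype, Finset.card_filter, h1, orbExp_eq_sum,
    Finsupp.finsetSum_apply, Finset.mul_sum]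
  refine Finset.sum_congr rfl fun o _ => ?_
  by_cases h : p o.out
  · have e : orbLen φ o.out = n ↔ (orbLen φ o.out).toPNat' = n := by
      rw [← PNat.coe_inj, Nat.toPNat'_coe, if_pos (orbLen_pos _ _)]
    by_cases h' : orbLen φ o.out = n
    · simp [h, h']
    · have := mt e.2 h'
      simp [h, h', this]
  · simp [h]

/-- The involutions that commute with `φ` and whose fixed points are the elements outside `S`. -/
abbrev Invol (φ : Equiv.Perm W) (S : W → Prop) : Type :=
  {ι : W → W // ∀ w, ι (φ w) = φ (ι w) ∧ ι (ι w) = w ∧ (ι w = w ↔ ¬ S w)}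

namespace Invol

variable {φ : Equiv.Perm W} {S T : W → Prop}

theorem comm_pow (ι : Invol φ S) (n : ℕ) (w : W) : ι.1 ((φ ^ n) w) = (φ ^ n) (ι.1 w) :=
  pow_semiconj (fun z => (ι.2 z).1) n w

theorem mem_iff (ι : Invol φ S) (w : W) : S (ι.1 w) ↔ S w := by
  have h1 := ι.2 w
  have h2 := ι.2 (ι.1 w)
  rw [h1.2.1] at h2
  rw [← not_iff_not, ← h1.2.2, ← h2.2.2, eq_comm]

theorem apply_eq_of_sameCycle {x y : W} {w : W} (hw : φ.SameCycle x w ∨ φ.SameCycle y w) (ι : Invol φ S)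
    (ι₀ : Invol φ T) (h : ι.1 x = y) (h₀ : ι₀.1 x = y) : ι.1 w = ι₀.1 w := by
  have h' : ι.1 y = x := by rw [← h, (ι.2 x).2.1]
  have h₀' : ι₀.1 y = x := by rw [← h₀, (ι₀.2 x).2.1]
  rcases hw with hw | hw <;> obtain ⟨n, -, rfl⟩ := hw.exists_pow_eq'
  · rw [ι.comm_pow, ι₀.comm_pow, h, h₀]
  · rw [ι.comm_pow, ι₀.comm_pow, h', h₀']

/-- Involutions with a prescribed value correspond to involutions of a smaller set. -/
theorem card_fiber (ι₀ : Invol φ T) (hT : ∀ w, T w → S w) {x y : W}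
    (hxy : ∀ w, T w ↔ φ.SameCycle x w ∨ φ.SameCycle y w) (h₀ : ι₀.1 x = y) :
    Nat.card {ι : Invol φ S // ι.1 x = y} = Nat.card (Invol φ fun w => S w ∧ ¬ T w) := by
  classical
  have hTφ : ∀ w, T (φ w) ↔ T w := by
    intro w
    rw [hxy, hxy, Equiv.Perm.sameCycle_apply_right, Equiv.Perm.sameCycle_apply_right]
  -- An involution commuting with `φ` is determined on the orbits of `x` and `y` by its value at
  -- `x`, so it agrees there with `ι₀` and only its restriction to the rest is free.
  have key : ∀ (ι : Invol φ S), ι.1 x = y → ∀ w, T w → ι.1 w = ι₀.1 w := fun ι h w hw =>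
    apply_eq_of_sameCycle ((hxy w).1 hw) ι ι₀ h h₀
  have hιT : ∀ (ι : Invol φ S), ι.1 x = y → ∀ w, T (ι.1 w) ↔ T w := by
    intro ι h w
    have aux : ∀ w, T w → T (ι.1 w) := fun w hw => by
      rw [key ι h w hw, ι₀.mem_iff]
      exact hw
    refine ⟨fun h' => ?_, aux w⟩
    have := aux _ h'
    rwa [(ι.2 w).2.1] at this
  have hTx : T x := (hxy x).2 (Or.inl (Equiv.Perm.SameCycle.refl _ _))
  refine Nat.card_congr
    { toFun := fun ι => ⟨fun w => if T w then w else ι.1.1 w, fun w => ?_⟩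
      invFun := fun ι => ⟨⟨fun w => if T w then ι₀.1 w else ι.1 w, fun w => ?_⟩, ?_⟩
      left_inv := fun ι => ?_
      right_inv := fun ι => ?_ }
  · have h1 := hιT ι.1 ι.2 w
    have h2 := ι.1.2 w
    by_cases h : T w
    · have h3 := h1.2 h
      simp [hTφ, h]
    · have h3 := mt h1.1 h
      simp [hTφ, h, h3, h2]
  · have h1 := ι.mem_iff w
    have h2 := ι.2 w
    have h3 := ι₀.2 w
    have h4 := ι₀.mem_iff w
    have h5 := hT w
    by_cases h : T w
    · simp [hTφ, h, h4, h3, h5]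
    · have h6 : ¬ T (ι.1 w) := by
        intro h'
        by_cases hs : S w
        · exact (h1.2 ⟨hs, h⟩).2 h'
        · have : ι.1 w = w := h2.2.2.2 fun h => hs h.1
          exact h (this ▸ h')
      simp [hTφ, h, h6, h2]
  · simp [hTx, h₀]
  · refine Subtype.ext (Subtype.ext (funext fun w => ?_))
    by_cases h : T w
    · simp [h, key ι.1 ι.2 w h]
    · simp [h]
  · refine Subtype.ext (funext fun w => ?_)
    by_cases h : T w
    · have := (ι.2 w).2.2.2 fun h' => h'.2 h
      simp [h, this]
    · simp [h]

/-- The involution that exchanges two orbits of the same length. -/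
theorem exists_exchange {x y : W} (hlen : orbLen φ x = orbLen φ y) (hxy : ¬ φ.SameCycle x y) :
    ∃ ι : Invol φ (fun w => φ.SameCycle x w ∨ φ.SameCycle y w), ι.1 x = y := by
  classical
  have hex : ∀ a b : W, orbLen φ a = orbLen φ b →
      ∃ f : W → W, ∀ n : ℕ, f ((φ ^ n) a) = (φ ^ n) b := by
    intro a b hab
    have hwd : ∀ m n : ℕ, m ≤ n → (φ ^ m) a = (φ ^ n) a → (φ ^ m) b = (φ ^ n) b := by
      intro m n hmn h
      obtain ⟨d, rfl⟩ := Nat.exists_eq_add_of_le hmn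
      rw [pow_add, Equiv.Perm.mul_apply, (φ ^ m).injective.eq_iff, eq_comm, pow_eq_self_iff] at h ⊢
      rwa [← hab]
    refine ⟨fun w => if h : ∃ n : ℕ, (φ ^ n) a = w then (φ ^ h.choose) b else w, fun n => ?_⟩
    have h : ∃ m : ℕ, (φ ^ m) a = (φ ^ n) a := ⟨n, rfl⟩
    dsimp only
    rw [dif_pos h]
    have := h.choose_spec
    rcases le_total h.choose n with h' | h'
    · exact hwd _ _ h' this
    · exact (hwd _ _ h' this.symm).symm
  obtain ⟨f, hf⟩ := hex x y hlen
  obtain ⟨f', hf'⟩ := hex y x hlen.symm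
  have hdisj : ∀ w, φ.SameCycle y w → ¬ φ.SameCycle x w := fun w h h' => hxy (h'.trans h.symm)
  refine ⟨⟨fun w => if φ.SameCycle x w then f w else if φ.SameCycle y w then f' w else w,
    fun w => ?_⟩, ?_⟩
  · by_cases h1 : φ.SameCycle x w
    · obtain ⟨n, -, rfl⟩ := h1.exists_pow_eq'
      have a1 : φ.SameCycle y ((φ ^ n) y) := ⟨n, rfl⟩
      have a2 : φ.SameCycle x (φ ((φ ^ n) x)) := by rwa [Equiv.Perm.sameCycle_apply_right]
      have a3 : (φ ^ n) y ≠ (φ ^ n) x := fun h => hxy (by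
        rw [(φ ^ n).injective h])
      have a4 : φ ((φ ^ n) x) = (φ ^ (n + 1)) x := by rw [pow_succ', Equiv.Perm.mul_apply]
      have a5 : f (φ ((φ ^ n) x)) = φ ((φ ^ n) y) := by
        rw [a4, hf, pow_succ', Equiv.Perm.mul_apply]
      simp only [h1, a2, a5, hf, hf', a1, hdisj _ a1, a3, if_true, if_false, true_or, not_true]
      exact ⟨trivial, trivial, trivial⟩
    · by_cases h2 : φ.SameCycle y w
      · obtain ⟨n, -, rfl⟩ := h2.exists_pow_eq'
        have a1 : φ.SameCycle x ((φ ^ n) x) := ⟨n, rfl⟩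
        have a2 : φ.SameCycle y (φ ((φ ^ n) y)) := by rwa [Equiv.Perm.sameCycle_apply_right]
        have a3 : (φ ^ n) x ≠ (φ ^ n) y := fun h => hxy (by
          rw [(φ ^ n).injective h])
        have a4 : φ ((φ ^ n) y) = (φ ^ (n + 1)) y := by rw [pow_succ', Equiv.Perm.mul_apply]
        have a5 : f' (φ ((φ ^ n) y)) = φ ((φ ^ n) x) := by
          rw [a4, hf', pow_succ', Equiv.Perm.mul_apply]
        simp only [h1, h2, a2, a5, hf, hf', a1, hdisj _ a2, a3, if_true, if_false, or_true,
          not_true]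
        exact ⟨trivial, trivial, trivial⟩
      · simp [h1, h2, Equiv.Perm.sameCycle_apply_right]
  · have := hf 0
    simpa [Equiv.Perm.SameCycle.refl] using this

/-- The involution of an orbit of even length. -/
theorem exists_antipode {x : W} {n : ℕ} (hn : orbLen φ x = n + n) (S : W → Prop)
    (hS : ∀ w, S w ↔ φ.SameCycle x w) : ∃ ι : Invol φ S, ι.1 x = (φ ^ n) x := by
  classical
  refine ⟨⟨fun w => if S w then (φ ^ n) w else w, fun w => ?_⟩, ?_⟩
  · have h1 : S (φ w) ↔ S w := by rw [hS, hS, Equiv.Perm.sameCycle_apply_right]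
    have h2 : S ((φ ^ n) w) ↔ S w := by rw [hS, hS, Equiv.Perm.sameCycle_pow_right]
    by_cases h : S w
    · have h3 : orbLen φ w = n + n := by
        rw [← hn]
        exact (eq_of_sameCycle (orbLen_apply φ) ((hS w).1 h)).symm
      have h4 : 0 < n := by have := orbLen_pos φ w; omega
      simp only [h1, h2, h, if_true, not_true]
      refine ⟨?_, ?_, ?_⟩
      · rw [← Equiv.Perm.mul_apply, ← Equiv.Perm.mul_apply, pow_mul_comm']
      · rw [← Equiv.Perm.mul_apply, ← pow_add, pow_eq_self_iff, h3]
      · rw [pow_eq_self_iff, h3, iff_false]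
        intro h5
        have := Nat.le_of_dvd h4 h5
        omega
    · simp [h1, h]
  · simp [(hS x).2 (Equiv.Perm.SameCycle.refl _ _)]

theorem orbLen_eq (ι : Invol φ S) (w : W) : orbLen φ (ι.1 w) = orbLen φ w :=
  orbLen_eq_of_semiconj (Function.LeftInverse.injective (g := ι.1) fun z => (ι.2 z).2.1)
    (fun z => (ι.2 z).1) w

end Invol

/-- The recursion from integration by parts in a form that includes `b = 0`, where the truncated `b
- 1` is multiplied by zero. It also governs the choice of the image of one point under an
equivariant involution. -/
theorem gaussNum_succ (n b : ℕ) : gaussNum n (b + 1) =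
    (if Even n then gaussNum n b else 0) + n * b * gaussNum n (b - 1) := by
  rcases b with _ | b
  · simp [gaussNum]
  · rw [gaussNum, Nat.add_sub_cancel]
    ring

theorem gaussWeight_eq (β : ℕ+ →₀ ℕ) (n : ℕ+) :
    gaussWeight β = gaussNum n (β n) * gaussWeight (β.erase n) :=
  (Finsupp.mul_prod_erase' β n _ fun _ => rfl).symm

theorem gaussWeight_add_single (β : ℕ+ →₀ ℕ) (n : ℕ+) :
    gaussWeight (β + Finsupp.single n 1) = (if Even (n : ℕ) then gaussWeight β else 0) +
      n * β n * gaussWeight (β - Finsupp.single n 1) := by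
  have h1 : (β + Finsupp.single n 1).erase n = β.erase n := by
    ext m
    by_cases h : m = n <;> simp [h]
  have h2 : (β - Finsupp.single n 1).erase n = β.erase n := by
    ext m
    by_cases h : m = n <;> simp [h]
  rw [gaussWeight_eq _ n, gaussWeight_eq β n, gaussWeight_eq (β - _) n, h1, h2]
  simp only [Finsupp.coe_add, Pi.add_apply, Finsupp.single_eq_same, Finsupp.coe_tsub, Pi.sub_apply,
    gaussNum_succ]
  split_ifs <;> ring

/-- The value of the Gaussian integral of a monomial counts involutions. -/
theorem card_invol (φ : Equiv.Perm W) (S : W → Prop) (hS : ∀ w, S (φ w) ↔ S w) :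
    Nat.card (Invol φ S) = gaussWeight (orbExp φ S) := by
  classical
  have : Fintype W := Fintype.ofFinite W
  induction hc : Nat.card {w // S w} using Nat.strong_induction_on generalizing S with
  | _ c ih =>
  subst hc
  by_cases hex : ∃ x, S x
  · obtain ⟨x, hx⟩ := hex
    set n := (orbLen φ x).toPNat' with hn
    have hn' : orbLen φ x = n := by rw [hn, Nat.toPNat'_coe, if_pos (orbLen_pos _ _)]
    have hScyc : ∀ {a b}, φ.SameCycle a b → (S a ↔ S b) := fun h =>
      (eq_of_sameCycle (w := S) (fun z => propext (hS z)) h).to_iff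
    have hlt : ∀ T : W → Prop, T x → Nat.card {w // S w ∧ ¬ T w} < Nat.card {w // S w} := by
      intro T hT
      rw [← Nat.card_congr (Equiv.subtypeSubtypeEquivSubtypeInter S fun w => ¬ T w)]
      exact Finite.card_subtype_lt (x := ⟨x, hx⟩) fun h => h hT
    have hOφ : ∀ w, φ.SameCycle x (φ w) ↔ φ.SameCycle x w := fun w =>
      Equiv.Perm.sameCycle_apply_right
    set β := orbExp φ (fun w => S w ∧ ¬ φ.SameCycle x w) with hβ
    have hSβ : orbExp φ S = β + Finsupp.single n 1 := by
      rw [hβ, hn, ← orbExp_orbit]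
      refine orbExp_add φ (fun w => ?_) fun w h => h.1.2 h.2
      constructor
      · intro h
        by_cases h' : φ.SameCycle x w
        exacts [Or.inr h', Or.inl ⟨h, h'⟩]
      · rintro (h | h)
        exacts [h.1, (hScyc h).1 hx]
    have hSO : ∀ w, (S (φ w) ∧ ¬ φ.SameCycle x (φ w)) ↔ (S w ∧ ¬ φ.SameCycle x w) := fun w => by
      rw [hS, hOφ]
    have hxx : φ.SameCycle x x := Equiv.Perm.SameCycle.refl _ _
    -- The image `y` of `x` has the same orbit length `n`. Either it lies in the orbit of `x` and is
    -- the antipode, which needs `n` even and leaves the type `β`; or it is one of the `n * β n`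
    -- points in other orbits of length `n`, and one more orbit is used up. These are the two terms
    -- of `gaussWeight_add_single`.
    have hf : ∀ y, Nat.card {ι : Invol φ S // ι.1 x = y} =
        (if y = (φ ^ ((n : ℕ) / 2)) x then if Even (n : ℕ) then gaussWeight β else 0 else 0) +
        (if (S y ∧ ¬ φ.SameCycle x y) ∧ orbLen φ y = n then
          gaussWeight (β - Finsupp.single n 1) else 0) := by
      intro y
      by_cases hy : φ.SameCycle x y
      · rw [if_neg (c := (S y ∧ ¬ φ.SameCycle x y) ∧ orbLen φ y = n) (fun h => h.1.2 hy), add_zero]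
        by_cases hyn : y = (φ ^ ((n : ℕ) / 2)) x ∧ Even (n : ℕ)
        · rw [if_pos hyn.1, if_pos hyn.2]
          obtain ⟨m, hm⟩ := hyn.2
          have hm2 : (n : ℕ) / 2 = m := by omega
          obtain ⟨ι₀, h₀⟩ := Invol.exists_antipode (φ := φ) (hn'.trans hm)
            (fun w => φ.SameCycle x w) (fun _ => Iff.rfl)
          rw [Invol.card_fiber ι₀ (fun w hw => (hScyc hw).1 hx) (y := y) ?_ ?_]
          · exact ih _ (hlt _ hxx) _ hSO rfl
          · intro w
            exact ⟨Or.inl, fun h => h.elim id fun h => hy.trans h⟩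
          · rw [h₀, hyn.1, hm2]
        · have : IsEmpty {ι : Invol φ S // ι.1 x = y} := by
            refine ⟨fun ι => hyn ?_⟩
            obtain ⟨i, hi, hiy⟩ := hy.exists_pow_eq'
            obtain ⟨i, hi, hiy⟩ : ∃ i < (n : ℕ), (φ ^ i) x = y := by
              refine ⟨i % n, Nat.mod_lt _ n.pos, ?_⟩
              rw [← hiy]
              conv_rhs => rw [← Nat.mod_add_div i n, pow_add, Equiv.Perm.mul_apply]
              rw [(pow_eq_self_iff φ (n * (i / n)) x).2 (hn' ▸ Nat.dvd_mul_right _ _)]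
            -- Being an involution forces `2 * i` to be a multiple of the orbit length `n`; as `0 <
            -- i < n`, it equals `n`.
            have h1 : (φ ^ (i + i)) x = x := by
              have e1 := ι.1.comm_pow i x
              have e2 := (ι.1.2 x).2.1
              rw [ι.2] at e1 e2
              rw [hiy] at e1
              rw [pow_add, Equiv.Perm.mul_apply, hiy, ← e1, e2]
            have h2 : i ≠ 0 := by
              rintro rfl
              have h3 : ι.1.1 x = x := ι.2.trans hiy.symm
              exact (ι.1.2 x).2.2.1 h3 hx
            rw [pow_eq_self_iff, hn'] at h1
            obtain ⟨c, hc⟩ := h1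
            have hc1 : c = 1 := by
              rcases c with _ | _ | c
              · omega
              · rfl
              · have : (n : ℕ) * (c + 1 + 1) = n * c + n + n := by ring
                have := Nat.zero_le (n * c)
                omega
            rw [hc1, mul_one] at hc
            exact ⟨by rw [← hiy]; congr 3; omega, ⟨i, hc.symm⟩⟩
          rw [Nat.card_of_isEmpty]
          rw [not_and] at hyn
          split_ifs with h1 h2
          · exact absurd h2 (hyn h1)
          · rfl
          · rfl
      · rw [if_neg (fun h => hy (by rw [h, Equiv.Perm.sameCycle_pow_right])), zero_add]
        by_cases hyS : S y ∧ orbLen φ y = n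
        · rw [if_pos ⟨⟨hyS.1, hy⟩, hyS.2⟩]
          obtain ⟨ι₀, h₀⟩ := Invol.exists_exchange (hn'.trans hyS.2.symm) hy
          rw [Invol.card_fiber ι₀ ?_ (fun _ => Iff.rfl) h₀]
          · rw [ih _ (hlt _ (Or.inl hxx)) _ ?_ rfl]
            · congr 1
              have : β = orbExp φ (fun w => S w ∧ ¬ (φ.SameCycle x w ∨ φ.SameCycle y w)) +
                  Finsupp.single n 1 := by
                have hny : n = (orbLen φ y).toPNat' := by rw [hyS.2, PNat.coe_toPNat']
                rw [hny, ← orbExp_orbit]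
                refine orbExp_add φ (fun w => ?_) fun w h => h.1.2 (Or.inr h.2)
                constructor
                · intro h
                  by_cases h' : φ.SameCycle y w
                  exacts [Or.inr h', Or.inl ⟨h.1, fun h'' => h''.elim h.2 h'⟩]
                · rintro (h | h)
                  · exact ⟨h.1, fun h' => h.2 (Or.inl h')⟩
                  · exact ⟨(hScyc h).1 hyS.1, fun h' => hy (h'.trans h.symm)⟩
              rw [this, add_tsub_cancel_right]
            · intro w
              rw [hS, Equiv.Perm.sameCycle_apply_right, Equiv.Perm.sameCycle_apply_right]
          · rintro w (h | h)
            exacts [(hScyc h).1 hx, (hScyc h).1 hyS.1]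
        · have : IsEmpty {ι : Invol φ S // ι.1 x = y} := by
            refine ⟨fun ι => hyS ?_⟩
            have e1 := ι.1.mem_iff x
            have e2 := ι.1.orbLen_eq x
            rw [ι.2] at e1 e2
            exact ⟨e1.2 hx, e2.trans hn'⟩
          rw [Nat.card_of_isEmpty, if_neg (fun h => hyS ⟨h.1.1, h.2⟩)]
    rw [Nat.card_congr (Equiv.sigmaFiberEquiv fun ι : Invol φ S => ι.1 x).symm, Nat.card_sigma,
      Finset.sum_congr rfl fun y _ => hf y, Finset.sum_add_distrib, Finset.sum_ite_eq',
      if_pos (Finset.mem_univ _), hSβ, gaussWeight_add_single, ← card_orbLen_eq φ hSO,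
      ← Finset.sum_filter, Finset.sum_const, smul_eq_mul, Nat.card_eq_fintype_card,
      Fintype.card_subtype]
  · have h1 : orbExp φ S = 0 := by
      rw [orbExp_eq_sum]
      exact Finset.sum_eq_zero fun o _ => if_neg fun h => hex ⟨_, h⟩
    have h2 : ∀ w, ¬ S w := fun w h => hex ⟨w, h⟩
    rw [h1]
    have h3 : gaussWeight 0 = 1 := Finsupp.prod_zero_index
    rw [h3]
    refine Nat.card_eq_one_iff_exists.2 ⟨⟨id, fun w => ⟨rfl, rfl, ?_⟩⟩, fun ι => ?_⟩
    · simpa using h2 w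
    · refine Subtype.ext (funext fun w => ?_)
      exact (ι.2 w).2.2.2 (h2 w)

end Involutions

end ModularOperad

end

noncomputable section

namespace ModularOperad

universe w

/-! ### Integration of sums over structures -/

section Integration

variable {k : Type w} [Field k] [CharZero k] {σ : Type}

/-- The weight of a vertex with a given cycle type on its flags. -/
def vertSeries (σ : Type) (chi : ℕ → Multiset ℕ → k) (ν : Multiset ℕ) : GradedSeries σ k :=
  PowerSeries.mk fun d => MvPolynomial.C
    (if 0 < d then ∑ g ∈ Finset.range (d + 3), if 2 * g + ν.sum = d + 2 then chi g ν else 0 else 0)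

/-- A nonzero coefficient needs `d ≥ 1` and `2 * g + ν.sum = d + 2`, whence `1 + ν.sum ≤ d + 3 ≤ 4 *
d`. This is where the constant four comes from. -/
theorem coeff_vertSeries_eq_zero (chi : ℕ → Multiset ℕ → k) (ν : Multiset ℕ) (d : ℕ)
    (h : 4 * d < 1 + ν.sum) : PowerSeries.coeff d (vertSeries σ chi ν) = 0 := by
  rw [vertSeries, PowerSeries.coeff_mk]
  split_ifs with h0
  · rw [Finset.sum_eq_zero, map_zero]
    intro g _
    rw [if_neg]
    omega
  · rw [map_zero]

theorem psi_adams_adams [PowerSumVars σ] [GradedVars σ] (m n : ℕ) (hm : 0 < m) (hn : 0 < n)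
    (r : GradedSeries σ k) :
    adams m.toPNat' (adams n.toPNat' r) = adams (m * n).toPNat' r := by
  have : m.toPNat' * n.toPNat' = (m * n).toPNat' := by
    rw [← PNat.coe_inj]
    simp [hm, hn]
  rw [adams_adams, this]

/-- Weights for structures without gluing. -/
def dataP (chi : ℕ → Multiset ℕ → k) : WeightData (GradedSeries (ℕ+ ⊕ ℕ+) k) where
  psi n := adams n.toPNat'
  psi_psi := psi_adams_adams
  vert := vertSeries _ chi
  flag := PowerSeries.C (MvPolynomial.X (Sum.inl 1))
  leg := PowerSeries.X * PowerSeries.C (MvPolynomial.X (Sum.inl 1) * MvPolynomial.X (Sum.inr 1))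
  fix := Set.univ

/-- Weights for structures in which all flags and legs are glued. -/
def dataQ (chi : ℕ → Multiset ℕ → k) : WeightData (GradedSeries ℕ+ k) where
  psi n := adams n.toPNat'
  psi_psi := psi_adams_adams
  vert := vertSeries _ chi
  flag := 1
  leg := PowerSeries.X * PowerSeries.C (MvPolynomial.X 1)
  fix := {0}

theorem isGraded_dataP (chi : ℕ → Multiset ℕ → k) : (dataP chi).IsGraded where
  psi_eq n := by simp [dataP]
  coeff_vert := coeff_vertSeries_eq_zero chi
  coeff_leg := by simp [dataP]

theorem isGraded_dataQ (chi : ℕ → Multiset ℕ → k) : (dataQ chi).IsGraded where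
  psi_eq n := by simp [dataQ]
  coeff_vert := coeff_vertSeries_eq_zero chi
  coeff_leg := by simp [dataQ]

/-- Series in the right alphabet as series in both alphabets. -/
def inclQ (k : Type w) [Field k] : GradedSeries ℕ+ k →+* GradedSeries (ℕ+ ⊕ ℕ+) k :=
  PowerSeries.map (MvPolynomial.rename Sum.inr).toRingHom

theorem coeff_inclQ (f : GradedSeries ℕ+ k) (d : ℕ) : PowerSeries.coeff d (inclQ k f) =
    MvPolynomial.rename Sum.inr (PowerSeries.coeff d f) := PowerSeries.coeff_map _ _ _

theorem inclQ_adams (n : ℕ+) (f : GradedSeries ℕ+ k) : inclQ k (adams n f) = adams n (inclQ k f) := by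
  ext1 d
  rw [coeff_inclQ, coeff_adams, coeff_adams, coeff_inclQ]
  split_ifs
  · rw [MvPolynomial.rename_rename, MvPolynomial.rename_rename]
    rfl
  · simp

theorem adams_C [PowerSumVars σ] (n : ℕ+) (a : MvPolynomial σ k) :
    adams n (PowerSeries.C a : GradedSeries σ k) =
      PowerSeries.C (MvPolynomial.rename (PowerSumVars.scale n) a) := by
  ext1 d
  rw [coeff_adams, PowerSeries.coeff_C, PowerSeries.coeff_C]
  by_cases hd : d = 0
  · simp [hd]
  · split_ifs with h1 h2
    · have := Nat.le_of_dvd (Nat.pos_of_ne_zero hd) h1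
      have := Nat.div_pos this n.pos
      omega
    · simp
    · rfl

variable {Z : Type} [Finite Z] (chi : ℕ → Multiset ℕ → k)

/-- The two weights differ only by one variable `p_n` for each orbit of length `n` of flags or legs.
The weight of an unglued structure is thus its glued weight times the monomial in `p` given by the
cycle type of `aut` on flags and legs, which is what the integral evaluates. -/
theorem localWeight_dataP (x : Str Z) (z : Z) : (dataP chi).localWeight x z =
    inclQ k ((dataQ chi).localWeight x z) * PowerSeries.C
      (if x.lab z ≠ 0 then MvPolynomial.X (Sum.inl (orbLen x.aut z).toPNat') else 1) := by
  have hscale : ∀ n : ℕ+, (PowerSumVars.scale n : (ℕ+ ⊕ ℕ+) ↪ _) (Sum.inl 1) = Sum.inl n := by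
    intro n
    exact congrArg Sum.inl (mul_one n)
  have hC : ∀ n : ℕ+, (adams n : GradedSeries (ℕ+ ⊕ ℕ+) k →+* _)
      (PowerSeries.C (MvPolynomial.X (Sum.inl 1))) = PowerSeries.C (MvPolynomial.X (Sum.inl n)) := by
    intro n
    rw [adams_C, MvPolynomial.rename_X, hscale]
  rw [WeightData.localWeight, WeightData.localWeight]
  change adams _ _ = inclQ k (adams _ _) * _
  rw [inclQ_adams]
  split_ifs with h1 h2
  · exact absurd h1 h2
  · rw [map_one, mul_one]
    congr 1
    ext1 d
    rw [coeff_inclQ]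
    simp [dataP, dataQ, vertSeries]
  · simp only [dataQ, map_one, one_mul]
    exact hC _
  · have : (dataP chi).leg = inclQ k (dataQ chi).leg *
        PowerSeries.C (MvPolynomial.X (Sum.inl 1)) := by
      simp only [dataP, dataQ, inclQ, map_mul, PowerSeries.map_X, PowerSeries.map_C]
      simp only [AlgHom.toRingHom_eq_coe, RingHom.coe_coe, MvPolynomial.rename_X]
      ring
    rw [this, map_mul, hC]

theorem gaussLin_mul_monomial (g : MvPolynomial ℕ+ k) (α : ℕ+ →₀ ℕ) :
    gaussLin k (MvPolynomial.rename Sum.inr g * MvPolynomial.monomial (α.sumElim 0) 1) =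
      (gaussWeight α : k) • g := by
  classical
  induction g using MvPolynomial.induction_on' with
  | monomial β c =>
    rw [MvPolynomial.rename_monomial, MvPolynomial.monomial_mul, mul_one]
    have : Finsupp.mapDomain Sum.inr β + α.sumElim 0 = α.sumElim β := by
      ext (i | i)
      · simp [Finsupp.mapDomain_of_notMem_range]
      · simp [Finsupp.mapDomain_apply Sum.inr_injective]
    rw [this, gaussLin_monomial, MvPolynomial.smul_monomial, smul_eq_mul, mul_comm]
  | add p q hp hq =>
    rw [map_add, add_mul, map_add, hp, hq, smul_add]

theorem gaussSeries_mul_monomial (f : GradedSeries ℕ+ k) (α : ℕ+ →₀ ℕ) :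
    gaussSeries (inclQ k f * PowerSeries.C (MvPolynomial.monomial (α.sumElim 0) 1)) =
      (gaussWeight α : k) • f := by
  ext1 d
  rw [gaussSeries, PowerSeries.coeff_mk, PowerSeries.coeff_mul_C, coeff_inclQ,
    gaussLin_mul_monomial, PowerSeries.coeff_smul]

theorem gaussSeries_sum {ι : Type*} (s : Finset ι) (f : ι → GradedSeries (ℕ+ ⊕ ℕ+) k) :
    gaussSeries (∑ i ∈ s, f i) = ∑ i ∈ s, gaussSeries (f i) := by
  ext1 d
  simp only [gaussSeries, PowerSeries.coeff_mk, map_sum]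

theorem orbProd_monomial (φ : Equiv.Perm Z) (p : Z → Prop) [DecidablePred p] :
    (orbProd φ fun z => if p z then MvPolynomial.X (Sum.inl (orbLen φ z).toPNat') else 1) =
      (MvPolynomial.monomial ((orbExp φ p).sumElim 0) 1 : MvPolynomial (ℕ+ ⊕ ℕ+) k) := by
  have h1 : (orbExp φ p).sumElim (0 : ℕ+ →₀ ℕ) = ∑ o : Orb φ,
      if p o.out then Finsupp.single (Sum.inl (orbLen φ o.out).toPNat') 1 else 0 := by
    have h : ∀ s : Finset (Orb φ), (∑ o ∈ s, if p o.out then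
        Finsupp.single (orbLen φ o.out).toPNat' 1 else 0 : ℕ+ →₀ ℕ).sumElim (0 : ℕ+ →₀ ℕ) =
        ∑ o ∈ s, if p o.out then Finsupp.single (Sum.inl (orbLen φ o.out).toPNat') 1 else 0 := by
      classical
      intro s
      ext (i | i)
      · simp only [Finsupp.sumElim_inl, Finsupp.finsetSum_apply]
        refine Finset.sum_congr rfl fun o _ => ?_
        split_ifs <;> simp [Finsupp.single_apply]
      · simp only [Finsupp.sumElim_inr, Finsupp.finsetSum_apply, Finsupp.coe_zero, Pi.zero_apply]
        symm
        refine Finset.sum_eq_zero fun o _ => ?_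
        split_ifs <;> simp
    rw [orbExp_eq_sum, h]
  rw [h1, MvPolynomial.monomial_sum_one, orbProd]
  refine Finset.prod_congr rfl fun o _ => ?_
  split_ifs
  · rfl
  · rfl

open scoped Classical in
/-- The integral of the weight of a structure is the sum over all gluings. -/
theorem gaussSeries_weight (x : Str Z) : gaussSeries ((dataP chi).weight x) =
    ∑ y : Str Z with ({ y with inv := id } : Str Z) = x, (dataQ chi).weight y := by
  have hloc : ∀ y : Str Z, ({ y with inv := id } : Str Z) = x →
      (dataQ chi).localWeight y = (dataQ chi).localWeight x := by
    rintro y rfl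
    rfl
  by_cases hx : (dataP chi).Valid x
  · have hinv : x.inv = id := funext fun z => (hx z).inv_eq_iff.2 (Set.mem_univ _)
    rw [WeightData.weight_of_valid hx, orbProd_congr _ (localWeight_dataP chi x), orbProd_mul]
    have h1 := orbProd_map (inclQ k).toMonoidHom x.aut ((dataQ chi).localWeight x)
    have h2 := orbProd_map (PowerSeries.C : _ →+* GradedSeries (ℕ+ ⊕ ℕ+) k).toMonoidHom x.aut
      fun z => if x.lab z ≠ 0 then MvPolynomial.X (Sum.inl (orbLen x.aut z).toPNat') else 1
    refine (congrArg gaussSeries (congrArg₂ _ h1.symm h2.symm)).trans ?_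
    rw [orbProd_monomial x.aut (fun z => x.lab z ≠ 0)]
    refine (gaussSeries_mul_monomial _ _).trans ?_
    -- The number by which the integral replaces the monomial is the number of admissible gluings,
    -- and none of them changes the local weights.
    rw [← card_invol]
    · have : Fintype (Invol x.aut fun z => x.lab z ≠ 0) := Fintype.ofFinite _
      rw [Nat.card_eq_fintype_card, ← Finset.card_univ, Nat.cast_smul_eq_nsmul, ← Finset.sum_const]
      refine Finset.sum_of_injOn (fun ι => { x with inv := ι.1 }) ?_ ?_ ?_ ?_
      · rintro ι _ ι' _ h
        exact Subtype.ext (congrArg Str.inv h)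
      · rintro ι _
        simp only [Finset.coe_filter, Finset.mem_univ, true_and, Set.mem_ofPred_eq]
        ext z <;> simp [hinv]
      · intro y hy h
        refine WeightData.weight_of_not_valid fun hv => h ?_
        have hyx := (Finset.mem_filter.1 hy).2
        have haut : y.aut = x.aut := by rw [← hyx]
        have hlab : y.lab = x.lab := by rw [← hyx]
        refine ⟨⟨y.inv, fun z => ⟨?_, (hv z).inv_inv, ?_⟩⟩,
          Finset.mem_coe.2 (Finset.mem_univ _), ?_⟩
        · rw [← haut]
          exact (hv z).inv_aut
        · rw [(hv z).inv_eq_iff, not_not, hlab]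
          exact Iff.rfl
        · have hatt : y.att = x.att := by rw [← hyx]
          refine Str.ext hlab.symm hatt.symm rfl haut.symm
      · rintro ι _
        have hv : (dataQ chi).Valid { x with inv := ι.1 } := by
          intro z
          refine ⟨(hx z).lab_aut, (hx z).att_aut, (ι.2 z).1, (hx z).lab_att, (hx z).att_eq,
            (ι.2 z).2.1, ?_⟩
          rw [(ι.2 z).2.2, not_not]
          exact Iff.rfl
        rw [WeightData.weight_of_valid hv]
        refine (orbProd_congr _ fun z => ?_)
        exact (congrFun (hloc { x with inv := ι.1 } (by ext z <;> simp [hinv])) z).symm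
    · intro z
      rw [(hx z).lab_aut]
  · rw [WeightData.weight_of_not_valid hx, Finset.sum_eq_zero]
    · ext d
      simp [gaussSeries]
    -- The validity conditions of `y` that do not involve gluing are those of the unglued structure,
    -- so an invalid `x` has no valid gluing and both sides vanish.
    · rintro y hy
      have hyx := (Finset.mem_filter.1 hy).2
      subst hyx
      refine WeightData.weight_of_not_valid fun hv => hx fun z => ?_
      exact ⟨(hv z).lab_aut, (hv z).att_aut, rfl, (hv z).lab_att, (hv z).att_eq, rfl,
        iff_of_true rfl (Set.mem_univ _)⟩

theorem gaussSeries_total : gaussSeries ((dataP chi).total Z) = (dataQ chi).total Z := by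
  classical
  rw [WeightData.total, gaussSeries_sum, Finset.sum_congr rfl fun x _ => gaussSeries_weight chi x]
  exact Finset.sum_fiberwise Finset.univ (fun y : Str Z => ({ y with inv := id } : Str Z)) _

theorem gaussSeries_fullSum : gaussSeries (dataP chi).fullSum = (dataQ chi).fullSum := by
  ext1 d
  rw [gaussSeries, PowerSeries.coeff_mk, WeightData.fullSum, WeightData.fullSum, coeff_specialize,
    coeff_specialize, map_sum]
  refine Finset.sum_congr rfl fun l _ => ?_
  rw [PowerSeries.coeff_mk, PowerSeries.coeff_mk, WeightData.avg, WeightData.avg,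
    ← gaussSeries_total, coeff_rat_smul, coeff_rat_smul, map_rat_smul, gaussSeries,
    PowerSeries.coeff_mk]

/-- The exponential formula and the integral. -/
theorem gaussSeries_plethExp :
    gaussSeries (plethExp (dataP chi).connSum) = plethExp (dataQ chi).connSum := by
  rw [← (isGraded_dataP chi).fullSum_eq, ← (isGraded_dataQ chi).fullSum_eq, gaussSeries_fullSum]

end Integration

end ModularOperad

end

open scoped DirectSum TensorProduct

noncomputable section

namespace ModularOperad

universe w u

/-! ### The Koszul sign -/

namespace StableSModule

/-- For symmetric `F` this is a product over unordered pairs, which `τ` permutes; the work lies in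
writing the image of a pair in increasing order. -/
theorem prod_lt_comp {M : Type*} [CommMonoid M] {m : ℕ} (τ : Equiv.Perm (Fin m))
    (F : Fin m → Fin m → M) (hF : ∀ a b, F a b = F b a) :
    (∏ p : Fin m × Fin m with p.1 < p.2, F (τ p.1) (τ p.2)) =
      ∏ p : Fin m × Fin m with p.1 < p.2, F p.1 p.2 := by
  have aux : ∀ τ : Equiv.Perm (Fin m), ∀ p : Fin m × Fin m, p.1 < p.2 →
      (if τ p.1 < τ p.2 then (τ p.1, τ p.2) else (τ p.2, τ p.1)).1 <
        (if τ p.1 < τ p.2 then (τ p.1, τ p.2) else (τ p.2, τ p.1)).2 := by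
    intro τ p hp
    have hne : τ p.1 ≠ τ p.2 := fun h => hp.ne (τ.injective h)
    split_ifs with h
    · exact h
    · exact lt_of_le_of_ne (not_lt.1 h) hne.symm
  refine Finset.prod_bij' (fun p _ => if τ p.1 < τ p.2 then (τ p.1, τ p.2) else (τ p.2, τ p.1))
    (fun p _ => if τ.symm p.1 < τ.symm p.2 then (τ.symm p.1, τ.symm p.2)
      else (τ.symm p.2, τ.symm p.1)) ?_ ?_ ?_ ?_ ?_
  · intro p hp
    simp only [Finset.mem_filter, Finset.mem_univ, true_and] at hp ⊢
    exact aux τ p hp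
  · intro p hp
    simp only [Finset.mem_filter, Finset.mem_univ, true_and] at hp ⊢
    exact aux τ.symm p hp
  · intro p hp
    simp only [Finset.mem_filter, Finset.mem_univ, true_and] at hp
    split_ifs with h1 h2 h2 <;> simp_all [not_lt_of_gt]
  · intro p hp
    simp only [Finset.mem_filter, Finset.mem_univ, true_and] at hp
    split_ifs with h1 h2 h2 <;> simp_all [not_lt_of_gt]
  · intro p hp
    split_ifs
    · rfl
    · exact hF _ _

/-- The contribution of a pair of positions to the Koszul sign. -/
def koszulPair {m : ℕ} (τ : Equiv.Perm (Fin m)) (d : Fin m → ℤ) (a b : Fin m) : ℤˣ :=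
  if (a < b ↔ τ a < τ b) then 1 else (d (τ a) * d (τ b)).negOnePow

theorem koszulSign_eq {m : ℕ} (τ : Equiv.Perm (Fin m)) (d : Fin m → ℤ) :
    koszulSign τ d = ∏ p : Fin m × Fin m with p.1 < p.2, koszulPair τ d p.1 p.2 := by
  rw [koszulSign, ← Finset.filter_filter, Finset.prod_filter]
  refine Finset.prod_congr rfl fun p hp => ?_
  have hp : p.1 < p.2 := (Finset.mem_filter.1 hp).2
  have hne : τ p.1 ≠ τ p.2 := fun h => hp.ne (τ.injective h)
  rw [koszulPair]
  by_cases h : τ p.1 < τ p.2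
  · rw [if_neg (not_lt_of_gt h), if_pos (iff_of_true hp h)]
  · rw [if_pos (lt_of_le_of_ne (not_lt.1 h) hne.symm), if_neg (fun h' => h (h'.1 hp))]

theorem koszulPair_comm {m : ℕ} (τ : Equiv.Perm (Fin m)) (d : Fin m → ℤ) (a b : Fin m) :
    koszulPair τ d a b = koszulPair τ d b a := by
  rcases eq_or_ne a b with rfl | h
  · rfl
  · have h' : τ a ≠ τ b := fun h' => h (τ.injective h')
    rw [koszulPair, koszulPair, mul_comm]
    have h1 : (a < b ↔ ¬ b < a) := ⟨fun h => not_lt_of_gt h, fun h'' =>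
      lt_of_le_of_ne (not_lt.1 h'') h⟩
    have h2 : (τ a < τ b ↔ ¬ τ b < τ a) := ⟨fun h => not_lt_of_gt h, fun h'' =>
      lt_of_le_of_ne (not_lt.1 h'') h'⟩
    simp only [h1, h2, not_iff_not]

/-- The cocycle property: a pair is inverted by the composite exactly when it is inverted at one of
the two stages but not at both. Signs square to `1`, so the identity holds pair by pair once the
pairs of the first factor are reindexed by `τ`. -/
theorem koszulSign_mul {m : ℕ} (τ₀ τ : Equiv.Perm (Fin m)) (d : Fin m → ℤ) :
    koszulSign (τ₀ * τ) d = koszulSign τ₀ d * koszulSign τ fun v => d (τ₀ v) := by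
  rw [koszulSign_eq, koszulSign_eq τ₀, koszulSign_eq τ,
    ← prod_lt_comp τ (koszulPair τ₀ d) (koszulPair_comm τ₀ d), ← Finset.prod_mul_distrib]
  refine Finset.prod_congr rfl fun p _ => ?_
  simp only [koszulPair, Equiv.Perm.mul_apply]
  by_cases h1 : p.1 < p.2 <;> by_cases h2 : τ p.1 < τ p.2 <;>
    by_cases h3 : τ₀ (τ p.1) < τ₀ (τ p.2) <;> simp [h1, h2, h3]

end StableSModule

/-! ### Transport of stable graphs -/

namespace StableGraph

variable {g N m : ℕ} {gen val : Fin m → ℕ}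

theorem ext' {G G' : StableGraph g N gen val} (h1 : G.inv = G'.inv) (h2 : G.leg = G'.leg) :
    G = G' := by
  cases G
  cases G'
  simp only at h1 h2
  subst h1 h2
  rfl

instance : Finite (StableGraph g N gen val) :=
  Finite.of_injective (fun G : StableGraph g N gen val => (G.inv, G.leg)) fun _ _ h =>
    ext' (Prod.mk.inj h).1 (Prod.mk.inj h).2

theorem flagEquiv_fst (val : Fin m → ℕ) (τ : Equiv.Perm (Fin m))
    (π : ∀ v, Equiv.Perm (Fin (val (τ v)))) (a : Σ v, Fin (val v)) :
    τ (flagEquiv val τ π a).1 = a.1 := by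
  obtain ⟨v, i⟩ := a
  obtain ⟨v, rfl⟩ := τ.surjective v
  have h : ∀ v (i : Fin (val (τ v))),
      (Equiv.sigmaCongrLeft (β := fun v => Fin (val v)) τ).symm ⟨τ v, i⟩ = ⟨v, i⟩ := by
    intro v i
    rw [Equiv.symm_apply_eq]
    rfl
  simp only [flagEquiv, Equiv.trans_apply, h]
  rfl

theorem flagEquiv_mk (val : Fin m → ℕ) (τ : Equiv.Perm (Fin m))
    (π : ∀ v, Equiv.Perm (Fin (val (τ v)))) (v : Fin m) (i : Fin (val (τ v))) :
    flagEquiv val τ π ⟨τ v, i⟩ = ⟨v, π v i⟩ := by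
  have h : (Equiv.sigmaCongrLeft (β := fun v => Fin (val v)) τ).symm ⟨τ v, i⟩ = ⟨v, i⟩ := by
    rw [Equiv.symm_apply_eq]
    rfl
  simp only [flagEquiv, Equiv.trans_apply, h]
  rfl

/-- The image of a graph under an isomorphism given by `τ` and `π`. -/
def transport (G : StableGraph g N gen val) (τ : Equiv.Perm (Fin m))
    (π : ∀ v, Equiv.Perm (Fin (val (τ v)))) :
    StableGraph g N (fun v => gen (τ v)) (fun v => val (τ v)) where
  inv := ((flagEquiv val τ π).symm.trans G.inv).trans (flagEquiv val τ π)
  inv_inv a := by simp [G.inv_inv]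
  leg i := flagEquiv val τ π (G.leg i)
  leg_injective := (flagEquiv val τ π).injective.comp G.leg_injective
  range_leg := by
    ext a
    obtain ⟨a, rfl⟩ := (flagEquiv val τ π).surjective a
    have := Set.ext_iff.1 G.range_leg a
    simp only [Set.mem_range, Set.mem_ofPred_eq] at this
    simp [this]
  stable v := G.stable (τ v)
  nonempty := G.nonempty
  connected v w := by
    have := eqvGen_transfer (s := fun v w => ∃ a, a.1 = v ∧
      ((((flagEquiv val τ π).symm.trans G.inv).trans (flagEquiv val τ π)) a).1 = w) τ.symm ?_
      (G.connected (τ v) (τ w))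
    · simpa only [Equiv.symm_apply_apply] using this
    · rintro v w ⟨a, rfl, rfl⟩
      refine .rel _ _ ⟨flagEquiv val τ π a, ?_, ?_⟩
      · rw [Equiv.eq_symm_apply, flagEquiv_fst]
      · rw [Equiv.eq_symm_apply]
        simp [flagEquiv_fst]
  genus_eq := by
    have h1 : ∑ v, gen (τ v) = ∑ v, gen v := Equiv.sum_comp τ gen
    have h2 : (Equiv.Perm.support
        (((flagEquiv val τ π).symm.trans G.inv).trans (flagEquiv val τ π))).card =
        G.inv.support.card := by
      symm
      refine Finset.card_bij (fun a _ => flagEquiv val τ π a) ?_ ?_ ?_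
      · intro a ha
        simpa using ha
      · intro a _ b _ h
        exact (flagEquiv val τ π).injective h
      · intro b hb
        obtain ⟨a, rfl⟩ := (flagEquiv val τ π).surjective b
        exact ⟨a, by simpa using hb, rfl⟩
    rw [h1, h2]
    exact G.genus_eq

theorem transport_inv_apply (G : StableGraph g N gen val) (τ : Equiv.Perm (Fin m))
    (π : ∀ v, Equiv.Perm (Fin (val (τ v)))) (a : Σ v, Fin (val v)) :
    (G.transport τ π).inv (flagEquiv val τ π a) = flagEquiv val τ π (G.inv a) := by
  simp [transport]

theorem isIso_iff (τ : Equiv.Perm (Fin m)) (π : ∀ v, Equiv.Perm (Fin (val (τ v))))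
    (G : StableGraph g N gen val)
    (G' : StableGraph g N (fun v => gen (τ v)) (fun v => val (τ v))) :
    IsIso τ π G G' ↔ G.transport τ π = G' := by
  constructor
  · rintro ⟨h1, h2⟩
    refine ext' ?_ ?_
    · ext1 b
      obtain ⟨a, rfl⟩ := (flagEquiv val τ π).surjective b
      rw [h1]
      simp [transport]
    · funext i
      exact (h2 i).symm
  · rintro rfl
    exact ⟨fun a => by simp [transport], fun i => rfl⟩

theorem flagEquiv_mul (τ₀ : Equiv.Perm (Fin m)) (π₀ : ∀ v, Equiv.Perm (Fin (val (τ₀ v))))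
    (τ : Equiv.Perm (Fin m)) (π : ∀ v, Equiv.Perm (Fin (val (τ₀ (τ v))))) (a : Σ v, Fin (val v)) :
    flagEquiv val (τ₀ * τ) (fun v => π v * π₀ (τ v)) a =
      flagEquiv (fun v => val (τ₀ v)) τ π (flagEquiv val τ₀ π₀ a) := by
  obtain ⟨v, i⟩ := a
  obtain ⟨v, rfl⟩ := τ₀.surjective v
  obtain ⟨v, rfl⟩ := τ.surjective v
  rw [flagEquiv_mk]
  refine (flagEquiv_mk val (τ₀ * τ) (fun v => π v * π₀ (τ v)) v i).trans ?_
  exact (flagEquiv_mk (fun v => val (τ₀ v)) τ π v _).symm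

theorem transport_transport (G : StableGraph g N gen val) (τ₀ : Equiv.Perm (Fin m))
    (π₀ : ∀ v, Equiv.Perm (Fin (val (τ₀ v)))) (τ : Equiv.Perm (Fin m))
    (π : ∀ v, Equiv.Perm (Fin (val (τ₀ (τ v))))) :
    (G.transport τ₀ π₀).transport τ π = G.transport (τ₀ * τ) (fun v => π v * π₀ (τ v)) := by
  symm
  refine (isIso_iff _ _ _ _).1 ⟨fun a => ?_, fun i => ?_⟩
  · have h : ∀ a, flagEquiv val (τ₀ * τ) (fun v => π v * π₀ (τ v)) a =
      flagEquiv (fun v => val (τ₀ v)) τ π (flagEquiv val τ₀ π₀ a) := flagEquiv_mul τ₀ π₀ τ π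
    refine (congrArg _ (h a)).trans ?_
    refine Eq.trans ?_ (h _).symm
    exact (transport_inv_apply (G.transport τ₀ π₀) τ π _).trans
      (congrArg _ (transport_inv_apply G τ₀ π₀ a))
  · exact (flagEquiv_mul τ₀ π₀ τ π _).symm

end StableGraph

end ModularOperad

end

open scoped DirectSum TensorProduct

noncomputable section

namespace ModularOperad

universe w u

/-! ### Averaging over isomorphisms of graphs -/

/-- The trace on a quotient on which an averaging operator is available. -/
theorem trace_mapQ {k M : Type*} [Field k] [AddCommGroup M] [Module k M] [Module.Finite k M]
    (R : Submodule k M) (P : M →ₗ[k] M) (hP : R ≤ LinearMap.ker P)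
    (hP' : R.mkQ.comp P = R.mkQ) (s : M →ₗ[k] M) (hs : R ≤ R.comap s) :
    LinearMap.trace k (M ⧸ R) (R.mapQ R s hs) = LinearMap.trace k M (s.comp P) := by
  have h1 : R.mapQ R s hs = R.mkQ.comp (s.comp (R.liftQ P hP)) := by
    refine Submodule.linearMap_qext _ (LinearMap.ext fun x => ?_)
    have h2 := LinearMap.congr_fun hP' x
    have h3 : R.mapQ R s hs (R.mkQ (P x)) = R.mapQ R s hs (R.mkQ x) := congrArg _ h2
    simpa using h3.symm
  rw [h1, LinearMap.trace_comp_comm', LinearMap.comp_assoc, Submodule.liftQ_mkQ]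

section DirectSum

variable {k ι : Type*} [Field k] [DecidableEq ι] {M : ι → Type*} [∀ i, AddCommGroup (M i)]
  [∀ i, Module k (M i)] (S : Finset ι) (hS : ∀ i ∉ S, Subsingleton (M i))

include hS in
theorem sum_lof_component (x : ⨁ i, M i) :
    ∑ i ∈ S, DirectSum.lof k ι M i (DirectSum.component k ι M i x) = x := by
  refine DirectSum.ext_component k fun j => ?_
  rw [map_sum]
  by_cases hj : j ∈ S
  · rw [Finset.sum_eq_single_of_mem j hj, DirectSum.component.lof_self]
    intro i _ hij
    rw [DirectSum.component.of, dif_neg hij]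
  · exact (hS j hj).elim _ _

include hS in
theorem finite_directSum [∀ i, Module.Finite k (M i)] : Module.Finite k (⨁ i, M i) := by
  refine Module.Finite.of_surjective
    (LinearMap.lsum k (fun i : S => M i.1) k fun i => DirectSum.lof k ι M i.1) fun x => ?_
  refine ⟨fun i => DirectSum.component k ι M i.1 x, ?_⟩
  rw [LinearMap.lsum_apply, LinearMap.sum_apply]
  refine Eq.trans ?_ (sum_lof_component (k := k) S hS x)
  exact Finset.sum_coe_sort S fun i => DirectSum.lof k ι M i (DirectSum.component k ι M i x)

include hS in
theorem trace_directSum [∀ i, Module.Finite k (M i)] (f : (⨁ i, M i) →ₗ[k] ⨁ i, M i) :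
    LinearMap.trace k (⨁ i, M i) f = ∑ i ∈ S, LinearMap.trace k (M i)
      ((DirectSum.component k ι M i).comp (f.comp (DirectSum.lof k ι M i))) := by
  have := finite_directSum (k := k) S hS
  have h : f = ∑ i ∈ S, (f.comp (DirectSum.lof k ι M i)).comp (DirectSum.component k ι M i) := by
    refine LinearMap.ext fun x => ?_
    rw [LinearMap.sum_apply]
    refine (congrArg f (sum_lof_component (k := k) S hS x)).symm.trans ?_
    rw [map_sum]
    rfl
  conv_lhs => rw [h, map_sum]
  exact Finset.sum_congr rfl fun i _ => LinearMap.trace_comp_comm' _ _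

end DirectSum

namespace StableSModule

variable {k : Type w} [Field k]

/-- Transport of decorated graphs. -/
abbrev Decorated.transport {g N : ℕ} {i : ℤ} (c : Decorated g N i) (τ : Equiv.Perm (Fin c.1))
    (π : ∀ v, Equiv.Perm (Fin (c.2.2.1 (τ v)))) : Decorated g N i :=
  ⟨c.1, fun v => c.2.1 (τ v), fun v => c.2.2.1 (τ v), c.2.2.2.1.transport τ π,
    fun v => c.2.2.2.2.1 (τ v), (Equiv.sum_comp τ c.2.2.2.2.1).trans c.2.2.2.2.2⟩

variable (V : StableSModule.{w, u} k) {g N : ℕ} {i : ℤ}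

/-- The isomorphism of tensor products induced by an isomorphism of graphs, without the sign. -/
def unsignedTransport (c : Decorated g N i) (τ : Equiv.Perm (Fin c.1))
    (π : ∀ v, Equiv.Perm (Fin (c.2.2.1 (τ v)))) :
    V.decTensor c →ₗ[k] V.decTensor (c.transport τ π) :=
  (PiTensorProduct.map fun v => V.rep _ _ _ (π v)).comp
    (PiTensorProduct.reindex k
      (fun v => V.obj (c.2.1 v) (c.2.2.1 v) (c.2.2.2.2.1 v)) τ.symm).toLinearMap

/-- The isomorphism of tensor products induced by an isomorphism of graphs. -/
def transportMap (c : Decorated g N i) (τ : Equiv.Perm (Fin c.1))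
    (π : ∀ v, Equiv.Perm (Fin (c.2.2.1 (τ v)))) :
    V.decTensor c →ₗ[k] V.decTensor (c.transport τ π) :=
  (koszulSign τ c.2.2.2.2.1 : ℤ) • V.unsignedTransport c τ π

theorem transportMap_tprod (c : Decorated g N i) (τ : Equiv.Perm (Fin c.1))
    (π : ∀ v, Equiv.Perm (Fin (c.2.2.1 (τ v))))
    (x : ∀ v, V.obj (c.2.1 v) (c.2.2.1 v) (c.2.2.2.2.1 v)) :
    V.transportMap c τ π (PiTensorProduct.tprod k x) =
      (koszulSign τ c.2.2.2.2.1 : ℤ) •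
        (PiTensorProduct.tprod k fun v => V.rep _ _ _ (π v) (x (τ v)) :
          V.decTensor (c.transport τ π)) := by
  refine Eq.trans (b := (koszulSign τ c.2.2.2.2.1 : ℤ) •
    V.unsignedTransport c τ π (PiTensorProduct.tprod k x)) rfl ?_
  refine congrArg (fun y : V.decTensor (c.transport τ π) => (koszulSign τ c.2.2.2.2.1 : ℤ) • y) ?_
  refine (congrArg (PiTensorProduct.map fun v =>
    V.rep (c.2.1 (τ v)) (c.2.2.1 (τ v)) (c.2.2.2.2.1 (τ v)) (π v))
    (PiTensorProduct.reindex_tprod (R := k)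
    (s := fun v => V.obj (c.2.1 v) (c.2.2.1 v) (c.2.2.2.2.1 v)) τ.symm x)).trans ?_
  exact PiTensorProduct.map_tprod _ _

/-- The weight of a shape in the average over isomorphisms. -/
def isoWeight (k : Type w) [Field k] {m : ℕ} (val : Fin m → ℕ) : k :=
  (m.factorial : k)⁻¹ * ∏ v, ((val v).factorial : k)⁻¹

/-- The average over isomorphisms of graphs. -/
def isoAverage (g N : ℕ) (i : ℤ) : V.graphSum g N i →ₗ[k] V.graphSum g N i :=
  DirectSum.toModule k (Decorated g N i) (V.graphSum g N i) fun c =>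
    isoWeight k c.2.2.1 • ∑ τ : Equiv.Perm (Fin c.1), ∑ π : ∀ v, Equiv.Perm (Fin (c.2.2.1 (τ v))),
      (V.inclusion (c.transport τ π)).comp (V.transportMap c τ π)

theorem isoAverage_inclusion (c : Decorated g N i) (x : V.decTensor c) :
    V.isoAverage g N i (V.inclusion c x) = isoWeight k c.2.2.1 •
      ∑ τ : Equiv.Perm (Fin c.1), ∑ π : ∀ v, Equiv.Perm (Fin (c.2.2.1 (τ v))),
        V.inclusion (c.transport τ π) (V.transportMap c τ π x) := by
  refine (DirectSum.toModule_lof k c x).trans ?_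
  simp only [LinearMap.smul_apply, LinearMap.sum_apply, LinearMap.comp_apply]

/-- The average runs over all renumberings of vertices and flags, not over the automorphism group of
one graph. Their number `m! * ∏ (val v)!` depends only on the valences, so it is the same for
isomorphic graphs; inverting it uses characteristic zero. -/
theorem card_mul_isoWeight [CharZero k] {m : ℕ} (val : Fin m → ℕ) :
    isoWeight k val * ∑ τ : Equiv.Perm (Fin m), ∑ _π : ∀ v, Equiv.Perm (Fin (val (τ v))), (1 : k) =
      1 := by
  have h : ∀ τ : Equiv.Perm (Fin m),
      ∑ _π : ∀ v, Equiv.Perm (Fin (val (τ v))), (1 : k) = ∏ v, ((val v).factorial : k) := by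
    intro τ
    rw [Finset.sum_const, Finset.card_univ, Fintype.card_pi, nsmul_eq_mul, mul_one, Nat.cast_prod,
      ← Equiv.prod_comp τ fun v => ((val v).factorial : k)]
    simp [Fintype.card_perm]
  simp only [h]
  rw [Finset.sum_const, Finset.card_univ, Fintype.card_perm, Fintype.card_fin, nsmul_eq_mul,
    isoWeight, Finset.prod_inv_distrib]
  have h1 : (m.factorial : k) ≠ 0 := Nat.cast_ne_zero.2 m.factorial_ne_zero
  have h2 : ∏ v, ((val v).factorial : k) ≠ 0 :=
    Finset.prod_ne_zero_iff.2 fun v _ => Nat.cast_ne_zero.2 (val v).factorial_ne_zero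
  field_simp

/-- A pure tensor in the direct sum over all graphs. -/
def pureTensor {m : ℕ} {gen val : Fin m → ℕ} (G : StableGraph g N gen val) {d : Fin m → ℤ}
    (hd : ∑ v, d v = i) (x : ∀ v, V.obj (gen v) (val v) (d v)) : V.graphSum g N i :=
  V.inclusion ⟨m, gen, val, G, d, hd⟩ (PiTensorProduct.tprod k x)

theorem pureTensor_congr {m : ℕ} {gen val : Fin m → ℕ} {G G' : StableGraph g N gen val}
    (hG : G = G') {d : Fin m → ℤ} (hd hd' : ∑ v, d v = i)
    {x x' : ∀ v, V.obj (gen v) (val v) (d v)} (hx : ∀ v, x v = x' v) :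
    V.pureTensor G hd x = V.pureTensor G' hd' x' := by
  obtain rfl : x = x' := funext hx
  subst hG
  rfl

/-- The image of a pure tensor under an isomorphism of graphs. -/
def isoTensor {m : ℕ} {gen val : Fin m → ℕ} (G : StableGraph g N gen val) {d : Fin m → ℤ}
    (hd : ∑ v, d v = i) (x : ∀ v, V.obj (gen v) (val v) (d v)) (τ : Equiv.Perm (Fin m))
    (π : ∀ v, Equiv.Perm (Fin (val (τ v)))) : V.graphSum g N i :=
  (koszulSign τ d : ℤ) • V.pureTensor (G.transport τ π) ((Equiv.sum_comp τ d).trans hd)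
    fun v => V.rep _ _ _ (π v) (x (τ v))

theorem isoTensor_isoTensor {m : ℕ} {gen val : Fin m → ℕ} (G : StableGraph g N gen val)
    {d : Fin m → ℤ} (hd : ∑ v, d v = i) (x : ∀ v, V.obj (gen v) (val v) (d v))
    (τ₀ : Equiv.Perm (Fin m)) (π₀ : ∀ v, Equiv.Perm (Fin (val (τ₀ v)))) (τ : Equiv.Perm (Fin m))
    (π : ∀ v, Equiv.Perm (Fin (val (τ₀ (τ v))))) :
    (koszulSign τ₀ d : ℤ) • V.isoTensor (G.transport τ₀ π₀) ((Equiv.sum_comp τ₀ d).trans hd)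
      (fun v => V.rep _ _ _ (π₀ v) (x (τ₀ v))) τ π =
      V.isoTensor G hd x (τ₀ * τ) fun v => π v * π₀ (τ v) := by
  refine (smul_smul _ _ _).trans (congrArg₂ (fun (a : ℤ) b => a • b)
    (by rw [koszulSign_mul, Units.val_mul]) ?_)
  refine (V.pureTensor_congr (StableGraph.transport_transport G τ₀ π₀ τ π) _ _
    fun v => ?_)
  exact ((LinearMap.congr_fun (map_mul (V.rep _ _ _) (π v) (π₀ (τ v))) _)).symm

theorem isoAverage_pureTensor {m : ℕ} {gen val : Fin m → ℕ} (G : StableGraph g N gen val)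
    {d : Fin m → ℤ} (hd : ∑ v, d v = i) (x : ∀ v, V.obj (gen v) (val v) (d v)) :
    V.isoAverage g N i (V.pureTensor G hd x) = isoWeight k val •
      ∑ τ : Equiv.Perm (Fin m), ∑ π : ∀ v, Equiv.Perm (Fin (val (τ v))),
        V.isoTensor G hd x τ π := by
  refine (V.isoAverage_inclusion _ _).trans ?_
  refine congrArg _ (Finset.sum_congr rfl fun τ _ => Finset.sum_congr rfl fun π _ => ?_)
  exact (congrArg _ (V.transportMap_tprod _ τ π x)).trans (map_zsmul _ _ _)

theorem mkQ_isoTensor {m : ℕ} {gen val : Fin m → ℕ} (G : StableGraph g N gen val)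
    {d : Fin m → ℤ} (hd : ∑ v, d v = i) (x : ∀ v, V.obj (gen v) (val v) (d v))
    (τ : Equiv.Perm (Fin m)) (π : ∀ v, Equiv.Perm (Fin (val (τ v)))) :
    (V.isoRelations g N i).mkQ (V.isoTensor G hd x τ π) =
      (V.isoRelations g N i).mkQ (V.pureTensor G hd x) := by
  symm
  refine (Submodule.Quotient.eq _).2 (Submodule.subset_span ⟨m, gen, val, τ, π, G,
    G.transport τ π, d, hd, (Equiv.sum_comp τ d).trans hd, x,
    (StableGraph.isIso_iff _ _ _ _).2 rfl, rfl⟩)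

/-- Every transported tensor represents the class of the original one in the colimit, and the
weights of the average add up to `1`. -/
theorem mkQ_isoAverage [CharZero k] (g N : ℕ) (i : ℤ) :
    (V.isoRelations g N i).mkQ.comp (V.isoAverage g N i) = (V.isoRelations g N i).mkQ := by
  refine DirectSum.linearMap_ext _ fun c => PiTensorProduct.ext (MultilinearMap.ext fun x => ?_)
  obtain ⟨m, gen, val, G, d, hd⟩ := c
  refine (congrArg (V.isoRelations g N i).mkQ (V.isoAverage_pureTensor G hd x)).trans ?_
  rw [map_smul, map_sum]
  simp only [map_sum, V.mkQ_isoTensor]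
  have h2 := congrArg (fun r : k => r • (V.isoRelations g N i).mkQ (V.pureTensor G hd x))
    (card_mul_isoWeight (k := k) val)
  simp only [one_smul, mul_smul, Finset.sum_smul] at h2
  exact h2

/-- The averages of a tensor and of its transport by `(τ₀, π₀)` are sums over the same set of
renumberings, shifted by composition with `(τ₀, π₀)`; the cocycle property of the Koszul sign
matches the signs. -/
theorem isoRelations_le_ker (g N : ℕ) (i : ℤ) :
    V.isoRelations g N i ≤ LinearMap.ker (V.isoAverage g N i) := by
  refine Submodule.span_le.2 ?_
  rintro z ⟨m, gen, val, τ₀, π₀, G, G', d, hd, hd', x, hG, rfl⟩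
  obtain rfl := (StableGraph.isIso_iff _ _ _ _).1 hG
  refine (map_sub _ _ _).trans (sub_eq_zero.2 ?_)
  refine Eq.trans ?_ (map_zsmul _ _ _).symm
  refine (V.isoAverage_pureTensor G hd x).trans ?_
  refine Eq.trans ?_ (congrArg _ (V.isoAverage_pureTensor (G.transport τ₀ π₀) hd'
    fun v => V.rep _ _ _ (π₀ v) (x (τ₀ v))).symm)
  have hw : isoWeight k (fun v => val (τ₀ v)) = isoWeight k val := by
    rw [isoWeight, isoWeight, Equiv.prod_comp τ₀ fun v => ((val v).factorial : k)⁻¹]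
  rw [hw, smul_comm]
  refine congrArg _ ?_
  rw [← Equiv.sum_comp (Equiv.mulLeft τ₀), Finset.smul_sum]
  refine Finset.sum_congr rfl fun τ _ => ?_
  rw [Finset.smul_sum]
  refine (Equiv.sum_comp (Equiv.mulRight fun v => π₀ (τ v)) _).symm.trans
    (Finset.sum_congr rfl fun π _ => ?_)
  exact (V.isoTensor_isoTensor G hd x τ₀ π₀ τ π).symm

end StableSModule

end ModularOperad

end

open scoped DirectSum TensorProduct

noncomputable section

namespace ModularOperad

universe w u

/-! ### Traces of permuted tensor products -/

section Cyclic

variable {R B : Type*} [CommSemiring R] [Fintype B] [DecidableEq B]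

/-- Sums over paths are entries of products of matrices. -/
theorem sum_path (n : ℕ) (A : ℕ → Matrix B B R) (F : B → B → R) :
    ∑ γ : Fin (n + 1) → B,
      (∏ j : Fin n, A j (γ j.castSucc) (γ j.succ)) * F (γ 0) (γ (Fin.last n)) =
      ∑ x, ∑ y, ((List.range n).map A).prod x y * F x y := by
  induction n generalizing A F with
  | zero =>
    rw [← Equiv.sum_comp (Equiv.funUnique (Fin 1) B).symm]
    refine Finset.sum_congr rfl fun x _ => ?_
    rw [Finset.sum_eq_single_of_mem x (Finset.mem_univ _)]
    · simp
    · intro y _ hy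
      simp [Matrix.one_apply_ne' hy]
  | succ n ih =>
    rw [← (Fin.consEquiv fun _ : Fin (n + 2) => B).sum_comp, Fintype.sum_prod_type,
      Finset.sum_comm]
    have h := ih (fun j => A (j + 1)) fun y z => ∑ x, A 0 x y * F x z
    refine Eq.trans (Finset.sum_congr rfl fun γ _ => ?_) (h.trans ?_)
    · rw [Finset.mul_sum]
      refine Finset.sum_congr rfl fun x _ => ?_
      rw [Fin.prod_univ_succ]
      simp only [Fin.consEquiv_apply, Fin.castSucc_zero, Fin.cons_zero, Fin.cons_succ,
        ← Fin.succ_castSucc, ← Fin.succ_last, Fin.val_succ, Fin.val_zero]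
      ring
    · simp only [List.range_succ_eq_map, List.map_cons, List.map_map, List.prod_cons,
        Matrix.mul_apply, Finset.sum_mul, Finset.mul_sum]
      calc _ = ∑ y, ∑ z, ∑ x, A 0 x y * ((List.range n).map fun j => A (j + 1)).prod y z * F x z :=
            Finset.sum_congr rfl fun y _ => Finset.sum_congr rfl fun z _ =>
              Finset.sum_congr rfl fun x _ => by ring
        _ = ∑ y, ∑ x, ∑ z, A 0 x y * ((List.range n).map fun j => A (j + 1)).prod y z * F x z :=
            Finset.sum_congr rfl fun y _ => Finset.sum_comm
        _ = ∑ x, ∑ y, ∑ z, A 0 x y * ((List.range n).map fun j => A (j + 1)).prod y z * F x z :=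
            Finset.sum_comm
        _ = _ := Finset.sum_congr rfl fun x _ => Finset.sum_comm

/-- Sums over closed paths are traces. -/
theorem sum_closed_path (n : ℕ) (hn : 0 < n) (A : ℕ → Matrix B B R) :
    ∑ γ : Fin n → B, ∏ j : Fin n, A j (γ j) (γ ⟨(j + 1) % n, Nat.mod_lt _ hn⟩) =
      (((List.range n).map A).prod).trace := by
  obtain ⟨n, rfl⟩ := Nat.exists_eq_succ_of_ne_zero hn.ne'
  have h := sum_path n A fun x y => A n y x
  rw [List.range_succ, List.map_append, List.prod_append]
  simp only [List.map_cons, List.map_nil, List.prod_cons, List.prod_nil, mul_one, Matrix.trace,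
    Matrix.diag, Matrix.mul_apply]
  rw [← h]
  refine Finset.sum_congr rfl fun γ _ => ?_
  rw [Fin.prod_univ_castSucc]
  congr 1
  · refine Finset.prod_congr rfl fun j _ => ?_
    congr 1
    refine congrArg γ (Fin.ext ?_)
    simp [Nat.mod_eq_of_lt]
  · congr 1
    simp

variable {Z : Type} [Finite Z]

/-- The points of an orbit. -/
def orbEquiv (τ : Equiv.Perm Z) : (Σ o : Orb τ, Fin (orbLen τ o.out)) ≃ Z :=
  Equiv.ofBijective (fun p => (τ ^ (p.2 : ℕ)) p.1.out) (by
    constructor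
    · rintro ⟨o, i⟩ ⟨o', i'⟩ h
      dsimp only at h
      have ho : o = o' := by
        rw [← Orb.mk_out o, ← Orb.mk_out o', Orb.mk_eq_mk]
        have h1 : τ.SameCycle o.out ((τ ^ (i : ℕ)) o.out) := ⟨(i : ℕ), by rw [zpow_natCast]⟩
        have h2 : τ.SameCycle o'.out ((τ ^ (i : ℕ)) o.out) := ⟨(i' : ℕ), by rw [zpow_natCast, h]⟩
        exact h1.trans h2.symm
      subst ho
      have hi := Function.iterate_injOn_Iio_minimalPeriod (f := τ) (x := o.out) i.2 i'.2
        (by simpa only [Equiv.Perm.iterate_eq_pow] using h)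
      rw [Fin.ext hi]
    · intro z
      obtain ⟨n, hn⟩ := (Orb.sameCycle_out τ z).exists_pow_eq'
      refine ⟨⟨Orb.mk τ z, ⟨n % orbLen τ (Orb.mk τ z).out, Nat.mod_lt _ (orbLen_pos _ _)⟩⟩, ?_⟩
      refine Eq.trans ?_ hn.2
      simp only [← Equiv.Perm.iterate_eq_pow]
      exact Function.iterate_mod_minimalPeriod_eq)

theorem orbEquiv_apply (τ : Equiv.Perm Z) (o : Orb τ) (i : Fin (orbLen τ o.out)) :
    orbEquiv τ ⟨o, i⟩ = (τ ^ (i : ℕ)) o.out := rfl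

theorem apply_orbEquiv (τ : Equiv.Perm Z) (o : Orb τ) (i : Fin (orbLen τ o.out)) :
    τ (orbEquiv τ ⟨o, i⟩) =
      orbEquiv τ ⟨o, ⟨(i + 1) % orbLen τ o.out, Nat.mod_lt _ (orbLen_pos _ _)⟩⟩ := by
  rw [orbEquiv_apply, orbEquiv_apply, ← Equiv.Perm.mul_apply, ← pow_succ',
    ← Equiv.Perm.iterate_eq_pow, ← Equiv.Perm.iterate_eq_pow]
  exact Function.iterate_mod_minimalPeriod_eq.symm

/-- A function on `Z` is an independent choice of one closed path per orbit of `τ`, and summing over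
closed paths gives traces of products of matrices. -/
theorem sum_prod_matrix [Fintype Z] [DecidableEq Z] (τ : Equiv.Perm Z) (W : Z → Matrix B B R) :
    ∑ β : Z → B, ∏ v, W v (β v) (β (τ v)) = orbProd τ fun v =>
      ((List.range (orbLen τ v)).map fun j => W ((τ ^ j) v)).prod.trace := by
  have : DecidableEq (Orb τ) := Classical.decEq _
  rw [← (((orbEquiv τ).symm.arrowCongr (Equiv.refl B)).trans
    (Equiv.piCurry fun _ _ => B)).symm.sum_comp, orbProd]
  simp only [← sum_closed_path _ (orbLen_pos _ _)]
  rw [Finset.prod_univ_sum, Fintype.piFinset_univ]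
  refine Finset.sum_congr rfl fun γ _ => ?_
  rw [← (orbEquiv τ).prod_comp, Fintype.prod_sigma]
  refine Finset.prod_congr rfl fun o _ => Finset.prod_congr rfl fun i _ => ?_
  rw [apply_orbEquiv]
  have h : ∀ p : Σ o : Orb τ, Fin (orbLen τ o.out),
      γ ((orbEquiv τ).symm (orbEquiv τ p)).1 ((orbEquiv τ).symm (orbEquiv τ p)).2 = γ p.1 p.2 := by
    intro p
    rw [Equiv.symm_apply_apply]
  exact congrArg₂ (W ((τ ^ (i : ℕ)) o.out)) (h ⟨o, i⟩) (h ⟨o, _⟩)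

end Cyclic

section TensorTrace

variable {k : Type*} [Field k] {Z : Type} [Fintype Z] [DecidableEq Z] {E : Z → Type*}
  [∀ v, AddCommGroup (E v)] [∀ v, Module k (E v)]

/-- The permutation of the factors of a product together with linear maps between them. -/
def permMap (τ : Equiv.Perm Z) (a : ∀ v, E (τ v) →ₗ[k] E v) : Module.End k (∀ v, E v) :=
  LinearMap.pi fun v => (a v).comp (LinearMap.proj (τ v))

theorem permMap_apply (τ : Equiv.Perm Z) (a : ∀ v, E (τ v) →ₗ[k] E v) (x : ∀ v, E v) (v : Z) :
    permMap τ a x v = a v (x (τ v)) := rfl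

/-- The projection to a factor of a product. -/
def projEnd (k : Type*) [Field k] (E : Z → Type*) [∀ v, AddCommGroup (E v)]
    [∀ v, Module k (E v)] (v : Z) : Module.End k (∀ v, E v) :=
  (LinearMap.single k E v).comp (LinearMap.proj v)

theorem projEnd_apply (v v' : Z) (x : ∀ v, E v) :
    projEnd k E v x v' = if v' = v then x v' else 0 := by
  rw [projEnd, LinearMap.comp_apply, LinearMap.coe_single, LinearMap.proj_apply]
  split_ifs with h
  · subst h
    exact Pi.single_eq_same _ _
  · exact Pi.single_eq_of_ne h _

theorem projEnd_mul_self (v : Z) : projEnd k E v * projEnd k E v = projEnd k E v := by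
  refine LinearMap.ext fun x => funext fun w => ?_
  simp only [Module.End.mul_apply, projEnd_apply]
  split_ifs <;> rfl

theorem permMap_mul_projEnd (τ : Equiv.Perm Z) (a : ∀ v, E (τ v) →ₗ[k] E v) (v : Z) :
    permMap τ a * projEnd k E (τ v) = projEnd k E v * permMap τ a := by
  refine LinearMap.ext fun x => funext fun w => ?_
  simp only [Module.End.mul_apply, projEnd_apply, permMap_apply, τ.injective.eq_iff]
  split_ifs
  · rfl
  · exact map_zero _

theorem permMap_pow_mul_projEnd (τ : Equiv.Perm Z) (a : ∀ v, E (τ v) →ₗ[k] E v) (v : Z) (n : ℕ) :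
    permMap τ a ^ n * projEnd k E ((τ ^ n) v) = projEnd k E v * permMap τ a ^ n := by
  induction n with
  | zero => simp
  | succ n ih =>
    rw [pow_succ, mul_assoc, pow_succ' τ, Equiv.Perm.mul_apply, permMap_mul_projEnd, ← mul_assoc,
      ih, mul_assoc]

theorem prod_projEnd_mul (τ : Equiv.Perm Z) (a : ∀ v, E (τ v) →ₗ[k] E v) (v : Z) (n : ℕ)
    (hn : 0 < n) :
    ((List.range n).map fun j => projEnd k E ((τ ^ j) v) * permMap τ a).prod =
      projEnd k E v * permMap τ a ^ n := by
  induction n, hn using Nat.le_induction with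
  | base => simp
  | succ n hn ih =>
    rw [List.range_succ, List.map_append, List.prod_append, ih]
    simp only [List.map_cons, List.map_nil, List.prod_cons, List.prod_nil, mul_one]
    rw [mul_assoc, ← mul_assoc (permMap τ a ^ n), permMap_pow_mul_projEnd, ← mul_assoc, ← mul_assoc,
      projEnd_mul_self, mul_assoc, ← pow_succ]

/-- The trace of an endomorphism of a tensor product which permutes the factors. -/
theorem trace_tensor [∀ v, Module.Finite k (E v)] (τ : Equiv.Perm Z) (a : ∀ v, E (τ v) →ₗ[k] E v) (c : k)
    (f : (⨂[k] v, E v) →ₗ[k] ⨂[k] v, E v)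
    (hf : ∀ x, f (PiTensorProduct.tprod k x) =
      c • PiTensorProduct.tprod k fun v => a v (x (τ v))) :
    LinearMap.trace k _ f = c * orbProd τ fun v =>
      LinearMap.trace k (∀ v, E v) (projEnd k E v * permMap τ a ^ orbLen τ v) := by
  classical
  let b : ∀ v, Module.Basis (Fin (Module.finrank k (E v))) k (E v) :=
    fun v => Module.finBasis k (E v)
  -- The factors `E v` are embedded in their common product, so that all maps become square matrices
  -- over one index set even though the `E v` differ.
  let W : Z → Module.End k (∀ v, E v) := fun v => projEnd k E v * permMap τ a
  let A := LinearMap.toMatrixAlgEquiv (Pi.basis b)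
  have h1 : LinearMap.trace k _ f = c * ∑ β : ∀ v, Fin (Module.finrank k (E v)),
      ∏ v, A (W v) ⟨v, β v⟩ ⟨τ v, β (τ v)⟩ := by
    rw [LinearMap.trace_eq_matrix_trace k (Basis.piTensorProduct b), Matrix.trace, Finset.mul_sum]
    refine Finset.sum_congr rfl fun β _ => ?_
    rw [Matrix.diag, LinearMap.toMatrix_apply, Basis.piTensorProduct_apply, hf, map_smul,
      Finsupp.smul_apply, Basis.piTensorProduct_repr_tprod_apply, smul_eq_mul]
    refine congrArg _ (Finset.prod_congr rfl fun v _ => ?_)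
    rw [LinearMap.toMatrixAlgEquiv_apply, Pi.basis_repr, Pi.basis_apply]
    refine congrArg (fun y => (b v).repr y (β v)) ?_
    rw [Module.End.mul_apply, projEnd_apply, if_pos rfl, permMap_apply, Pi.single_eq_same]
  have h2 : ∀ u v : Z, v ≠ u → ∀ x y, A (W u) ⟨v, x⟩ y = 0 := by
    intro u v huv x y
    rw [LinearMap.toMatrixAlgEquiv_apply, Pi.basis_repr, Module.End.mul_apply, projEnd_apply,
      if_neg huv, map_zero]
    rfl
  -- The sum extends from sections to arbitrary functions into the total index set: the projection
  -- in `W v` kills every choice whose row at `v` lies in another factor.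
  have h3 : ∑ β : ∀ v, Fin (Module.finrank k (E v)), ∏ v, A (W v) ⟨v, β v⟩ ⟨τ v, β (τ v)⟩ =
      ∑ β : Z → Σ v, Fin (Module.finrank k (E v)), ∏ v, A (W v) (β v) (β (τ v)) := by
    refine Finset.sum_of_injOn (fun β v => ⟨v, β v⟩) ?_ ?_ ?_ ?_
    · intro β _ β' _ h
      funext v
      simpa using congrFun h v
    · exact fun _ _ => Finset.mem_coe.2 (Finset.mem_univ _)
    · intro β _ hβ
      obtain ⟨v, hv⟩ : ∃ v, (β v).1 ≠ v := by
        by_contra! h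
        refine hβ ⟨fun v => Fin.cast (by rw [h v]) (β v).2, Finset.mem_coe.2 (Finset.mem_univ _), ?_⟩
        funext v
        refine Sigma.ext (h v).symm ?_
        have : ∀ (v v' : Z) (hv : v = v') (hc : Module.finrank k (E v) = Module.finrank k (E v'))
          (x : Fin (Module.finrank k (E v))), HEq (Fin.cast hc x) x := by
          rintro v _ rfl _ x
          rfl
        exact this _ _ (h v) (congrArg (fun u => Module.finrank k (E u)) (h v)) _
      exact Finset.prod_eq_zero (Finset.mem_univ v) (h2 _ _ hv _ _)
    · exact fun _ _ => rfl
  rw [h1, h3, sum_prod_matrix]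
  refine congrArg _ (orbProd_congr τ fun v => ?_)
  rw [← prod_projEnd_mul τ a v _ (orbLen_pos τ v), LinearMap.trace_eq_matrix_trace k (Pi.basis b)]
  refine congrArg Matrix.trace ?_
  refine Eq.trans ?_ (map_list_prod A _).symm
  rw [List.map_map]
  rfl

end TensorTrace

end ModularOperad

end

noncomputable section

namespace ModularOperad

/-! ### Cycle types and signs in terms of orbits -/

section CycleType

variable {Z : Type} [Fintype Z] [DecidableEq Z]

theorem orbType_eq_sum (φ : Equiv.Perm Z) :
    orbType φ (fun _ => True) = ∑ o : Orb φ, ({orbLen φ o.out} : Multiset ℕ) := by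
  rw [orbType, orbProd, toAdd_prod]
  simp

theorem orbType_eq_map (φ : Equiv.Perm Z) :
    orbType φ (fun _ => True) =
      (Finset.univ : Finset (Orb φ)).val.map fun o => orbLen φ o.out := by
  rw [orbType_eq_sum, ← Multiset.sum_map_singleton (Multiset.map _ _), Multiset.map_map]
  rfl

theorem orbLen_eq_one_iff (φ : Equiv.Perm Z) (z : Z) : orbLen φ z = 1 ↔ φ z = z := by
  rw [← Nat.dvd_one, ← pow_eq_self_iff, pow_one]

theorem card_support_cycleOf (φ : Equiv.Perm Z) (z : Z) (hz : φ z ≠ z) :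
    (φ.cycleOf z).support.card = orbLen φ z := by
  classical
  rw [← card_orbit φ z, Nat.card_eq_fintype_card, Fintype.card_subtype]
  congr 1
  ext a
  rw [Equiv.Perm.mem_support_cycleOf_iff, Finset.mem_filter, Orb.mk_eq_mk,
    Equiv.Perm.sameCycle_comm]
  simp [hz]

/-- Orbits of length at least two correspond to the cycle factors. The remaining orbits are fixed
points, and their number is found by comparing the sum of all orbit lengths with the cardinality. -/
theorem orbType_eq_parts (φ : Equiv.Perm Z) :
    orbType φ (fun _ => True) = φ.partition.parts := by
  classical
  have h1 : ((Finset.univ.filter fun o : Orb φ => orbLen φ o.out ≠ 1).val.map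
      fun o => orbLen φ o.out) = φ.cycleType := by
    rw [Equiv.Perm.cycleType_def]
    have : (Finset.univ.filter fun o : Orb φ => orbLen φ o.out ≠ 1).val.map
        (fun o => φ.cycleOf o.out) = φ.cycleFactorsFinset.val := by
      rw [← Finset.image_val_of_injOn]
      · congr 1
        ext c
        rw [Finset.mem_image]
        constructor
        · rintro ⟨o, ho, rfl⟩
          rw [Equiv.Perm.cycleOf_mem_cycleFactorsFinset_iff, Equiv.Perm.mem_support]
          simpa [orbLen_eq_one_iff] using ho
        · intro hc
          obtain ⟨z, hz⟩ := (Equiv.Perm.mem_cycleFactorsFinset_iff.1 hc).1.nonempty_support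
          have hcz := Equiv.Perm.cycle_is_cycleOf hz hc
          have hs := Orb.sameCycle_out φ z
          refine ⟨Orb.mk φ z, ?_, (hs.cycleOf_eq).trans hcz.symm⟩
          have hzs := Equiv.Perm.mem_cycleFactorsFinset_support_le hc hz
          simp only [Finset.mem_filter, Finset.mem_univ, true_and, ne_eq, orbLen_eq_one_iff]
          rw [hs.apply_eq_self_iff]
          exact Equiv.Perm.mem_support.1 hzs
      · intro o ho o' ho' h
        simp only [Finset.coe_filter, Finset.mem_univ, true_and, Set.mem_ofPred_eq, ne_eq,
          orbLen_eq_one_iff] at ho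
        have h1 := Equiv.Perm.mem_support_cycleOf_iff.2
          ⟨Equiv.Perm.SameCycle.refl φ o.out, Equiv.Perm.mem_support.2 ho⟩
        dsimp only at h
        rw [h] at h1
        rw [← Orb.mk_out o, ← Orb.mk_out o', Orb.mk_eq_mk]
        exact (Equiv.Perm.mem_support_cycleOf_iff.1 h1).1.symm
    rw [← this, Multiset.map_map]
    refine Multiset.map_congr rfl fun o ho => (card_support_cycleOf φ _ ?_).symm
    simpa [orbLen_eq_one_iff] using ho
  have h2 : orbType φ (fun _ => True) = φ.cycleType +
      Multiset.replicate (Finset.univ.filter fun o : Orb φ => ¬ orbLen φ o.out ≠ 1).card 1 := by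
    rw [orbType_eq_map, ← h1,
      ← Multiset.filter_add_not (fun o : Orb φ => orbLen φ o.out ≠ 1) Finset.univ.val,
      Multiset.map_add]
    refine congrArg₂ _ rfl ((Multiset.map_congr rfl fun o ho => ?_).trans (Multiset.map_const' _ 1))
    simpa using ho
  have h3 := sum_orbType φ (p := fun _ => True) fun _ => Iff.rfl
  rw [h2, Multiset.sum_add, Equiv.Perm.sum_cycleType, Multiset.sum_replicate] at h3
  simp only [smul_eq_mul, mul_one, Nat.card_eq_fintype_card, Fintype.card_subtype_true] at h3
  rw [h2, Equiv.Perm.parts_partition]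
  congr 2
  omega

theorem sign_eq_orbProd (φ : Equiv.Perm Z) :
    Equiv.Perm.sign φ = orbProd φ fun z => -(-1 : ℤˣ) ^ orbLen φ z := by
  have h : Equiv.Perm.sign φ = (φ.partition.parts.map fun n => -(-1 : ℤˣ) ^ n).prod := by
    rw [Equiv.Perm.parts_partition, Multiset.map_add, Multiset.prod_add, Equiv.Perm.sign_of_cycleType',
      Multiset.map_replicate]
    simp
  rw [h, ← orbType_eq_parts, orbType_eq_map, Multiset.map_map]
  rfl

theorem prod_eq_orbProd {M : Type*} [CommMonoid M] (φ : Equiv.Perm Z) (c : Z → M)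
    (h : ∀ z, c (φ z) = c z) : ∏ z, c z = orbProd φ fun z => c z ^ orbLen φ z :=
  sum_eq_sum_orb (M := Additive M) φ c h

/-- A `τ`-invariant function is a function on the set of orbits, so this is the expansion of a
product of sums. -/
theorem sum_invariant_prod {R ι : Type*} [CommSemiring R] [DecidableEq ι] (τ : Equiv.Perm Z)
    (D : Finset ι) (f : Z → ι → R) :
    ∑ d ∈ (Fintype.piFinset fun _ : Z => D).filter fun d => ∀ v, d (τ v) = d v,
      orbProd τ (fun v => f v (d v)) = orbProd τ fun v => ∑ i ∈ D, f v i := by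
  classical
  rw [orbProd, Finset.prod_univ_sum]
  symm
  refine Finset.sum_bij (fun p _ v => p (Orb.mk τ v)) ?_ ?_ ?_ ?_
  · intro p hp
    rw [Fintype.mem_piFinset] at hp
    refine Finset.mem_filter.2 ⟨Fintype.mem_piFinset.2 fun v => hp _, fun v => ?_⟩
    refine congrArg p (Orb.mk_eq_mk.2 ?_)
    exact (Equiv.Perm.sameCycle_apply_left).2 (Equiv.Perm.SameCycle.refl _ _)
  · intro p _ p' _ h
    funext o
    simpa only [Orb.mk_out] using congrFun h o.out
  · intro d hd
    rw [Finset.mem_filter, Fintype.mem_piFinset] at hd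
    exact ⟨fun o => d o.out, Fintype.mem_piFinset.2 fun o => hd.1 _, funext fun v =>
      eq_of_sameCycle hd.2 (Orb.sameCycle_out τ v)⟩
  · intro p _
    exact Finset.prod_congr rfl fun o _ => by dsimp only; rw [Orb.mk_out]

end CycleType

namespace StableSModule

/-- Only exchanges of odd factors count, so for invariant degrees the Koszul sign is the sign of `τ`
on the odd vertices. An odd orbit of length `n` gives `-(-1) ^ n` there and `(-1) ^ n` in the total
degree, so together `-1`, the supertrace sign of one factor. This makes supertraces multiplicative
over orbits. -/
theorem koszulSign_mul_negOnePow {m : ℕ} (τ : Equiv.Perm (Fin m)) (d : Fin m → ℤ)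
    (hd : ∀ v, d (τ v) = d v) :
    koszulSign τ d * (∑ v, d v).negOnePow = orbProd τ fun v => (d v).negOnePow := by
  classical
  let S : Finset (Fin m) := Finset.univ.filter fun v => Odd (d v)
  let e : Fin S.card ≃o S := S.orderIsoOfFin rfl
  have hS : ∀ v, v ∈ S ↔ Odd (d v) := fun v => by simp [S]
  let τ' : Equiv.Perm S := τ.subtypePerm fun v => by rw [hS, hS, hd]
  let σ : Equiv.Perm (Fin S.card) := (e.toEquiv.trans τ').trans e.symm.toEquiv
  have hσ : ∀ i, ((e (σ i) : S) : Fin m) = τ (e i) := fun i => by simp [σ, τ']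
  have h1 : koszulSign τ d = Equiv.Perm.sign σ := by
    have h : Equiv.Perm.sign σ = ∏ p : Fin S.card × Fin S.card with p.1 < p.2 ∧ σ p.2 < σ p.1,
        (-1 : ℤˣ) := by
      rw [Equiv.Perm.sign_eq_prod_prod_Ioi, Finset.prod_filter, Fintype.prod_prod_type]
      refine Finset.prod_congr rfl fun i _ => ?_
      rw [← Finset.filter_lt_eq_Ioi, Finset.prod_filter]
      refine Finset.prod_congr rfl fun j _ => ?_
      by_cases h1 : i < j
      · rcases lt_or_gt_of_ne (fun h => h1.ne (σ.injective h)) with h2 | h2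
        · simp [h1, h2, h2.not_gt]
        · simp [h1, h2, h2.not_gt]
      · simp [h1]
    rw [h, koszulSign]
    symm
    have hlt : ∀ i j, ((e i : S) : Fin m) < (e j : S) ↔ i < j := fun i j => e.lt_iff_lt
    refine Finset.prod_of_injOn (fun p => ((e p.1 : S), (e p.2 : S))) ?_ ?_ ?_ ?_
    · intro p _ p' _ h
      simpa [Prod.ext_iff] using h
    · intro p hp
      simpa [← hσ, hlt] using hp
    · intro p hp hp'
      rw [hd, hd]
      refine Int.negOnePow_even _ (by_contra fun ho => ?_)
      rw [Int.not_even_iff_odd, Int.odd_mul] at ho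
      refine hp' ⟨(e.symm ⟨p.1, (hS _).2 ho.1⟩, e.symm ⟨p.2, (hS _).2 ho.2⟩), ?_, ?_⟩
      · have hp2 := (Finset.mem_filter.1 hp).2
        refine Finset.mem_coe.2 (Finset.mem_filter.2 ⟨Finset.mem_univ _, ?_, ?_⟩)
        · rw [← hlt, OrderIso.apply_symm_apply, OrderIso.apply_symm_apply]
          exact hp2.1
        · rw [← hlt, hσ, hσ, OrderIso.apply_symm_apply, OrderIso.apply_symm_apply]
          exact hp2.2
      · simp
    · intro p _
      rw [hd, hd, Int.negOnePow_odd]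
      exact Int.odd_mul.2 ⟨(hS _).1 (e p.1).2, (hS _).1 (e p.2).2⟩
  have h2 : Equiv.Perm.sign σ =
      orbProd τ fun v => if Odd (d v) then -(-1 : ℤˣ) ^ orbLen τ v else 1 := by
    rw [sign_eq_orbProd]
    have hinj : Function.Injective fun i => ((e i : S) : Fin m) :=
      Subtype.val_injective.comp e.injective
    refine orbProd_transfer (fun i => ((e i : S) : Fin m))
      (sameCycle_iff_of_semiconj hinj hσ) ?_ ?_ ?_
    · intro i
      rw [if_pos ((hS _).1 (e i).2), orbLen_eq_of_semiconj hinj hσ]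
    · intro a b hab
      refine eq_of_sameCycle (w := fun v => if Odd (d v) then -(-1 : ℤˣ) ^ orbLen τ v else 1)
        (fun v => ?_) hab
      simp only [hd, orbLen_apply]
    · intro v hv
      have : v ∈ S := (hS v).2 (by_contra fun h => hv (if_neg h))
      exact ⟨e.symm ⟨v, this⟩, by simpa using Equiv.Perm.SameCycle.refl τ v⟩
  have h3 : (∑ v, d v).negOnePow = ∏ v, (d v).negOnePow := by
    refine Finset.induction_on Finset.univ (by simp) fun v s hv ih => ?_
    rw [Finset.sum_insert hv, Finset.prod_insert hv, Int.negOnePow_add, ih]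
  rw [h1, h2, h3, prod_eq_orbProd τ (fun v => (d v).negOnePow) fun v => by rw [hd], ← orbProd_mul]
  refine orbProd_congr τ fun v => ?_
  split_ifs with h
  · rw [Int.negOnePow_odd _ h, neg_mul, ← mul_pow]
    simp
  · rw [Int.negOnePow_even _ (Int.not_odd_iff_even.1 h)]
    simp

end StableSModule

end ModularOperad

end

open scoped DirectSum TensorProduct

noncomputable section

namespace ModularOperad

universe w u

namespace StableSModule

variable {k : Type w} [Field k] (V : StableSModule.{w, u} k)

/-! ### Bijections acting on a stable `𝕊`-module -/

/-- Transport along equalities of indices. -/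
def castObj {g g' n n' : ℕ} {i i' : ℤ} (hg : g = g') (hn : n = n') (hi : i = i') :
    V.obj g n i →ₗ[k] V.obj g' n' i' := by
  subst hg hn hi
  exact LinearMap.id

/-- The action of a bijection. -/
def act {g g' n n' : ℕ} {i i' : ℤ} (hg : g = g') (hi : i = i') (e : Fin n ≃ Fin n') :
    V.obj g n i →ₗ[k] V.obj g' n' i' :=
  have hn : n = n' := by simpa using Fintype.card_congr e
  (V.castObj hg hn hi).comp (V.rep g n i (e.trans (finCongr hn.symm)))

theorem act_self {g n : ℕ} {i : ℤ} (hg : g = g) (hi : i = i) (e : Equiv.Perm (Fin n)) :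
    V.act hg hi e = V.rep g n i e := rfl

theorem act_act {g g' g'' n n' n'' : ℕ} {i i' i'' : ℤ} (hg : g = g') (hg' : g' = g'')
    (hi : i = i') (hi' : i' = i'') (e : Fin n ≃ Fin n') (e' : Fin n' ≃ Fin n'') (x : V.obj g n i) :
    V.act hg' hi' e' (V.act hg hi e x) = V.act (hg.trans hg') (hi.trans hi') (e.trans e') x := by
  obtain rfl : n = n' := by simpa using Fintype.card_congr e
  obtain rfl : n = n'' := by simpa using Fintype.card_congr e'
  subst hg hg' hi hi'
  exact (LinearMap.congr_fun (map_mul (V.rep g n i) e' e) x).symm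

/-- The trace of a permutation of a given cycle type. -/
def typeTrace (g : ℕ) (i : ℤ) (μ : Multiset ℕ) : k :=
  open Classical in
  if h : ∃ σ : Equiv.Perm (Fin μ.sum), orbType σ (fun _ => True) = μ then
    LinearMap.trace k (V.obj g μ.sum i) (V.rep g μ.sum i h.choose) else 0

theorem trace_eq_of_isConj {g n : ℕ} {i : ℤ} {σ σ' : Equiv.Perm (Fin n)} (h : IsConj σ σ') :
    LinearMap.trace k (V.obj g n i) (V.rep g n i σ) =
      LinearMap.trace k (V.obj g n i) (V.rep g n i σ') := by
  obtain ⟨c, rfl⟩ := isConj_iff.1 h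
  rw [map_mul, LinearMap.trace_mul_comm, ← map_mul, inv_mul_cancel_left]

theorem typeTrace_orbType (g : ℕ) (i : ℤ) {n : ℕ} (σ : Equiv.Perm (Fin n)) :
    V.typeTrace g i (orbType σ fun _ => True) =
      LinearMap.trace k (V.obj g n i) (V.rep g n i σ) := by
  have hs : (orbType σ fun _ => True).sum = n := by
    rw [sum_orbType σ fun _ => Iff.rfl]
    simp
  generalize hμ : orbType σ (fun _ => True) = μ at hs ⊢
  subst hs
  have h : ∃ σ : Equiv.Perm (Fin μ.sum), orbType σ (fun _ => True) = μ := ⟨σ, hμ⟩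
  rw [typeTrace, dif_pos h]
  refine V.trace_eq_of_isConj (Equiv.Perm.partition_eq_of_isConj.2 (Nat.Partition.ext ?_))
  rw [← orbType_eq_parts, ← orbType_eq_parts, h.choose_spec, hμ]

/-! ### The trace of an automorphism of a decorated graph -/

section Local

variable {m : ℕ} {gen val : Fin m → ℕ} {d : Fin m → ℤ} (τ : Equiv.Perm (Fin m))
  (e : ∀ v, Fin (val (τ v)) ≃ Fin (val v)) (φ : Equiv.Perm (Σ v, Fin (val v)))
  (hφ : ∀ v i, φ ⟨τ v, i⟩ = ⟨v, e v i⟩) (hg : ∀ v, gen (τ v) = gen v)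
  (hd : ∀ v, d (τ v) = d v)

include hφ in
theorem permMap_act_pow (j : ℕ) (v v' : Fin m) (hv : (τ ^ j) v = v') :
    ∃ (h1 : gen v' = gen v) (h2 : d v' = d v) (e' : Fin (val v') ≃ Fin (val v)),
      (∀ i, (φ ^ j) ⟨v', i⟩ = ⟨v, e' i⟩) ∧
      ∀ x : ∀ v, V.obj (gen v) (val v) (d v),
        (permMap τ (fun v => V.act (hg v) (hd v) (e v)) ^ j) x v = V.act h1 h2 e' (x v') := by
  induction j generalizing v v' with
  | zero =>
    obtain rfl : v = v' := hv
    refine ⟨rfl, rfl, Equiv.refl _, fun i => rfl, fun x => ?_⟩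
    exact (LinearMap.congr_fun (map_one (V.rep (gen v) (val v) (d v))) (x v)).symm
  | succ j ih =>
    rw [pow_succ, Equiv.Perm.mul_apply] at hv
    obtain ⟨h1, h2, e', he, hx⟩ := ih (τ v) v' hv
    refine ⟨h1.trans (hg v), h2.trans (hd v), e'.trans (e v), fun i => ?_, fun x => ?_⟩
    · rw [pow_succ', Equiv.Perm.mul_apply, he, hφ]
      rfl
    · rw [pow_succ', Module.End.mul_apply, permMap_apply, hx, act_act]

-- After `orbLen τ v` steps the vertex `v` is back at itself, and the composite acts on the factor
-- at `v` through the permutation of its flags induced by the same power of `φ`. Its trace depends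
-- only on the cycle type of that permutation.
include hφ in
theorem trace_projEnd_mul [∀ g n i, Module.Finite k (V.obj g n i)] (v : Fin m) :
    LinearMap.trace k (∀ v, V.obj (gen v) (val v) (d v))
      (projEnd k (fun v => V.obj (gen v) (val v) (d v)) v *
        permMap τ (fun v => V.act (hg v) (hd v) (e v)) ^ orbLen τ v) =
    V.typeTrace (gen v) (d v) (orbType (φ ^ orbLen τ v) fun a => a.1 = v) := by
  obtain ⟨h1, h2, e', he, hx⟩ := permMap_act_pow V τ e φ hφ hg hd (orbLen τ v) v v (pow_orbLen τ v)
  have h3 : projEnd k (fun v => V.obj (gen v) (val v) (d v)) v *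
      permMap τ (fun v => V.act (hg v) (hd v) (e v)) ^ orbLen τ v =
      (LinearMap.single k (fun v => V.obj (gen v) (val v) (d v)) v).comp
        ((V.rep (gen v) (val v) (d v) e').comp (LinearMap.proj v)) := by
    refine LinearMap.ext fun x => ?_
    rw [Module.End.mul_apply, projEnd, LinearMap.comp_apply, LinearMap.comp_apply,
      LinearMap.comp_apply, LinearMap.proj_apply, LinearMap.proj_apply, hx, act_self]
  have h4 : (LinearMap.proj v).comp
      (LinearMap.single k (fun v => V.obj (gen v) (val v) (d v)) v) = LinearMap.id :=
    LinearMap.proj_comp_single_same k _ v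
  have h5 : orbType e' (fun _ => True) = orbType (φ ^ orbLen τ v) fun a => a.1 = v := by
    refine orbType_transfer (fun i => ⟨v, i⟩) (fun a b h => by simpa using h) (fun i => (he i).symm)
      (fun i => by simp) (fun a => ?_) ?_
    · constructor
      · intro h
        obtain ⟨⟨w, i⟩, rfl⟩ : ∃ b, (φ ^ orbLen τ v).symm b = a := ⟨_, Equiv.symm_apply_apply _ a⟩
        rw [Equiv.apply_symm_apply] at h
        obtain rfl : w = v := h
        obtain ⟨i, rfl⟩ := e'.surjective i
        rw [← he, Equiv.symm_apply_apply]
      · obtain ⟨w, i⟩ := a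
        rintro rfl
        rw [he]
    · rintro ⟨w, i⟩ rfl
      exact ⟨i, rfl⟩
  rw [h3, LinearMap.trace_comp_comm', LinearMap.comp_assoc, h4, LinearMap.comp_id, ← h5,
    typeTrace_orbType]

end Local

/-! ### The trace on the free modular operad -/

/-- The change of numbering of flags along an equality of valences. -/
def castFlag {m : ℕ} {val val' : Fin m → ℕ} (hv : ∀ v, val' v = val v) :
    (Σ v, Fin (val' v)) ≃ Σ v, Fin (val v) :=
  Equiv.sigmaCongrRight fun v => finCongr (hv v)

section Component

variable {g N : ℕ} {i : ℤ} {m : ℕ} {gen gen' val val' : Fin m → ℕ} {d d' : Fin m → ℤ}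
  (G : StableGraph g N gen val) (G' : StableGraph g N gen' val') (hd : ∑ v, d v = i)
  (hd' : ∑ v, d' v = i) (x : ∀ v, V.obj (gen' v) (val' v) (d' v))

/-- Equality of decorated graphs, whose types depend on the valences, is spelled out as pointwise
equalities. In this form it is the condition that a renumbering be an automorphism, and the
identification of summands acts through `act`. -/
theorem component_pureTensor_of_eq (hg : ∀ v, gen' v = gen v) (hv : ∀ v, val' v = val v)
    (hdd : ∀ v, d' v = d v) (hG : ∀ a, castFlag hv (G'.inv a) = G.inv (castFlag hv a))
    (hl : ∀ j, castFlag hv (G'.leg j) = G.leg j) :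
    DirectSum.component k (Decorated g N i) V.decTensor ⟨m, gen, val, G, d, hd⟩
      (V.pureTensor G' hd' x) =
      PiTensorProduct.tprod k fun v => V.act (hg v) (hdd v) (finCongr (hv v)) (x v) := by
  obtain rfl := funext hg
  obtain rfl := funext hv
  obtain rfl := funext hdd
  obtain rfl : G' = G := StableGraph.ext' (Equiv.ext hG) (funext hl)
  refine (DirectSum.component.lof_self k _ _).trans (congrArg _ (funext fun v => ?_))
  exact (LinearMap.congr_fun (map_one (V.rep (gen' v) (val' v) (d' v))) (x v)).symm

theorem component_pureTensor_of_ne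
    (h : ¬ ∃ (_ : ∀ v, gen' v = gen v) (hv : ∀ v, val' v = val v) (_ : ∀ v, d' v = d v),
      (∀ a, castFlag hv (G'.inv a) = G.inv (castFlag hv a)) ∧
        ∀ j, castFlag hv (G'.leg j) = G.leg j) :
    DirectSum.component k (Decorated g N i) V.decTensor ⟨m, gen, val, G, d, hd⟩
      (V.pureTensor G' hd' x) = 0 := by
  refine (DirectSum.component.of k _ _ _).trans (dif_neg fun hc => h ?_)
  simp only [Sigma.mk.injEq, heq_eq_eq, true_and] at hc
  obtain ⟨rfl, hc⟩ := hc
  simp only [Sigma.mk.injEq, heq_eq_eq] at hc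
  obtain ⟨rfl, hc⟩ := hc
  simp only [Prod.mk.injEq, heq_eq_eq, Subtype.mk.injEq] at hc
  obtain ⟨rfl, rfl⟩ := hc
  exact ⟨fun _ => rfl, fun _ => rfl, fun _ => rfl, fun _ => rfl, fun _ => rfl⟩

end Component

end StableSModule

end ModularOperad

end

open scoped DirectSum TensorProduct

noncomputable section

namespace ModularOperad

universe w u

/-! ### The trace of a renumbering of the legs -/

namespace StableGraph

variable {g N m : ℕ} {gen val : Fin m → ℕ}

/-- The permutations `τ⁻¹` of the vertices and `φ` of the flags define an automorphism of `G`
which renumbers the legs by `s`. -/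
structure IsAut (G : StableGraph g N gen val) (s : Equiv.Perm (Fin N)) (τ : Equiv.Perm (Fin m))
    (φ : Equiv.Perm (Σ v, Fin (val v))) : Prop where
  fst : ∀ a, τ (φ a).1 = a.1
  gen : ∀ v, gen (τ v) = gen v
  inv : ∀ a, φ (G.inv a) = G.inv (φ a)
  leg : ∀ i, φ (G.leg i) = G.leg (s i)

end StableGraph

namespace StableSModule

variable {k : Type w} [Field k] (V : StableSModule.{w, u} k) {g N : ℕ} {i : ℤ}

/-- The permutation of the flags defined by an isomorphism of graphs which preserves valences. -/
def flagPerm {m : ℕ} {val : Fin m → ℕ} {τ : Equiv.Perm (Fin m)} (hv : ∀ v, val (τ v) = val v)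
    (π : ∀ v, Equiv.Perm (Fin (val (τ v)))) : Equiv.Perm (Σ v, Fin (val v)) :=
  (StableGraph.flagEquiv val τ π).trans (castFlag hv)

theorem flagPerm_mk {m : ℕ} {val : Fin m → ℕ} {τ : Equiv.Perm (Fin m)}
    (hv : ∀ v, val (τ v) = val v) (π : ∀ v, Equiv.Perm (Fin (val (τ v)))) (v : Fin m)
    (i : Fin (val (τ v))) :
    flagPerm hv π ⟨τ v, i⟩ = ⟨v, ((π v).trans (finCongr (hv v))) i⟩ :=
  congrArg (castFlag hv) (StableGraph.flagEquiv_mk val τ π v i)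

theorem fst_flagPerm {m : ℕ} {val : Fin m → ℕ} {τ : Equiv.Perm (Fin m)}
    (hv : ∀ v, val (τ v) = val v) (π : ∀ v, Equiv.Perm (Fin (val (τ v)))) (a : Σ v, Fin (val v)) :
    τ (flagPerm hv π a).1 = a.1 :=
  StableGraph.flagEquiv_fst val τ π a

theorem flagPerm_injective {m : ℕ} {val : Fin m → ℕ} {τ : Equiv.Perm (Fin m)}
    (hv : ∀ v, val (τ v) = val v) : Function.Injective (flagPerm (τ := τ) hv) := by
  intro π π' h
  funext v
  ext1 i
  have := congrFun (congrArg DFunLike.coe h) ⟨τ v, i⟩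
  rw [flagPerm_mk, flagPerm_mk] at this
  simpa using this

theorem exists_flagPerm {m : ℕ} {val : Fin m → ℕ} {τ : Equiv.Perm (Fin m)}
    (φ : Equiv.Perm (Σ v, Fin (val v))) (h : ∀ a, τ (φ a).1 = a.1) :
    ∃ (hv : ∀ v, val (τ v) = val v) (π : ∀ v, Equiv.Perm (Fin (val (τ v)))),
      flagPerm hv π = φ := by
  have h' : ∀ v i, (φ ⟨τ v, i⟩).1 = v := fun v i => τ.injective (h _)
  have hb : ∀ v, ∃ e : Fin (val (τ v)) ≃ Fin (val v), ∀ i, φ ⟨τ v, i⟩ = ⟨v, e i⟩ := by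
    intro v
    choose f hf using fun i : Fin (val (τ v)) => show ∃ j, φ ⟨τ v, i⟩ = ⟨v, j⟩ by
      have := h' v i
      generalize φ ⟨τ v, i⟩ = a at this
      obtain ⟨w, j⟩ := a
      obtain rfl : w = v := this
      exact ⟨j, rfl⟩
    refine ⟨Equiv.ofBijective f ⟨fun i j hij => ?_, fun j => ?_⟩, hf⟩
    · have := (hf i).trans ((congrArg (Sigma.mk v) hij).trans (hf j).symm)
      simpa using this
    · obtain ⟨⟨w, i⟩, hi⟩ := φ.surjective ⟨v, j⟩
      have hw : w = τ v := by
        have := h ⟨w, i⟩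
        rw [hi] at this
        exact this.symm
      subst hw
      refine ⟨i, ?_⟩
      rw [hf] at hi
      simpa using hi
  choose e he using hb
  have hv : ∀ v, val (τ v) = val v := fun v => by simpa using Fintype.card_congr (e v)
  refine ⟨hv, fun v => (e v).trans (finCongr (hv v).symm), Equiv.ext fun a => ?_⟩
  obtain ⟨v, i⟩ := a
  obtain ⟨v, rfl⟩ := τ.surjective v
  rw [flagPerm_mk, he]
  rfl

open scoped Classical in
/-- The contribution of an automorphism to the trace of a renumbering of the legs. -/
def autTrace {m : ℕ} {gen val : Fin m → ℕ} (G : StableGraph g N gen val) (d : Fin m → ℤ)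
    (s : Equiv.Perm (Fin N)) (τ : Equiv.Perm (Fin m)) (φ : Equiv.Perm (Σ v, Fin (val v))) : k :=
  if G.IsAut s τ φ ∧ ∀ v, d (τ v) = d v then
    ((koszulSign τ d : ℤ) : k) * orbProd τ fun v =>
      V.typeTrace (gen v) (d v) (orbType (φ ^ orbLen τ v) fun a => a.1 = v)
  else 0

/-- The contribution of an isomorphism to the trace of a renumbering of the legs. -/
def isoEnd {m : ℕ} {gen val : Fin m → ℕ} (G : StableGraph g N gen val) {d : Fin m → ℤ}
    (hd : ∑ v, d v = i) (s : Equiv.Perm (Fin N)) (τ : Equiv.Perm (Fin m))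
    (π : ∀ v, Equiv.Perm (Fin (val (τ v)))) :
    V.decTensor (⟨m, gen, val, G, d, hd⟩ : Decorated g N i) →ₗ[k]
      V.decTensor (⟨m, gen, val, G, d, hd⟩ : Decorated g N i) :=
  (DirectSum.component k (Decorated g N i) V.decTensor ⟨m, gen, val, G, d, hd⟩).comp
    ((V.relabelMap g N i s).comp ((V.inclusion _).comp (V.transportMap ⟨m, gen, val, G, d, hd⟩ τ π)))

theorem isoEnd_tprod {m : ℕ} {gen val : Fin m → ℕ} (G : StableGraph g N gen val) {d : Fin m → ℤ}
    (hd : ∑ v, d v = i) (s : Equiv.Perm (Fin N)) (τ : Equiv.Perm (Fin m))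
    (π : ∀ v, Equiv.Perm (Fin (val (τ v)))) (x : ∀ v, V.obj (gen v) (val v) (d v)) :
    V.isoEnd G hd s τ π (PiTensorProduct.tprod k x) = ((koszulSign τ d : ℤ) : k) •
      DirectSum.component k (Decorated g N i) V.decTensor ⟨m, gen, val, G, d, hd⟩
        (V.pureTensor ((G.transport τ π).relabel s) ((Equiv.sum_comp τ d).trans hd)
          fun v => V.rep _ _ _ (π v) (x (τ v))) := by
  rw [Int.cast_smul_eq_zsmul]
  let L := (DirectSum.component k (Decorated g N i) V.decTensor ⟨m, gen, val, G, d, hd⟩).comp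
    ((V.relabelMap g N i s).comp
      (V.inclusion (Decorated.transport (⟨m, gen, val, G, d, hd⟩ : Decorated g N i) τ π)))
  refine (congrArg L (V.transportMap_tprod ⟨m, gen, val, G, d, hd⟩ τ π x)).trans
    ((map_zsmul L _ _).trans (congrArg _ ?_))
  exact congrArg (DirectSum.component k (Decorated g N i) V.decTensor ⟨m, gen, val, G, d, hd⟩)
    (V.relabelMap_inclusion s _ _)

/-- The diagonal block of a renumbering vanishes unless the renumbering, followed by `s` on the
legs, maps the decorated graph to itself, that is, unless it is an automorphism preserving degrees.
In that case `trace_tensor` applies. -/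
theorem trace_isoEnd [∀ g n i, Module.Finite k (V.obj g n i)] {m : ℕ} {gen val : Fin m → ℕ}
    (G : StableGraph g N gen val) {d : Fin m → ℤ} (hd : ∑ v, d v = i) (s : Equiv.Perm (Fin N))
    (τ : Equiv.Perm (Fin m)) (hv : ∀ v, val (τ v) = val v)
    (π : ∀ v, Equiv.Perm (Fin (val (τ v)))) :
    LinearMap.trace k _ (V.isoEnd G hd s τ π) = V.autTrace G d s τ (flagPerm hv π) := by
  have hinv : (∀ a, castFlag hv (((G.transport τ π).relabel s).inv a) = G.inv (castFlag hv a)) ↔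
      ∀ a, flagPerm hv π (G.inv a) = G.inv (flagPerm hv π a) := by
    refine (StableGraph.flagEquiv val τ π).surjective.forall.trans (forall_congr' fun a => ?_)
    rw [show ((G.transport τ π).relabel s).inv (StableGraph.flagEquiv val τ π a) =
      StableGraph.flagEquiv val τ π (G.inv a) from StableGraph.transport_inv_apply G τ π a]
    rfl
  have hleg : (∀ j, castFlag hv (((G.transport τ π).relabel s).leg j) = G.leg j) ↔
      ∀ j, flagPerm hv π (G.leg j) = G.leg (s j) := by
    refine s.surjective.forall.trans (forall_congr' fun j => ?_)
    rw [show ((G.transport τ π).relabel s).leg (s j) =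
      StableGraph.flagEquiv val τ π (G.leg j) from congrArg
        (fun j => StableGraph.flagEquiv val τ π (G.leg j)) (s.symm_apply_apply j)]
    rfl
  by_cases h : G.IsAut s τ (flagPerm hv π) ∧ ∀ v, d (τ v) = d v
  · rw [autTrace, if_pos h]
    refine (trace_tensor τ (fun v => V.act (h.1.gen v) (h.2 v) ((π v).trans (finCongr (hv v)))) _ _
      fun x => ?_).trans (congrArg _ (orbProd_congr τ fun v => ?_))
    · rw [isoEnd_tprod]
      refine congrArg _ ((V.component_pureTensor_of_eq G _ hd _ _ h.1.gen hv h.2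
        (hinv.2 h.1.inv) (hleg.2 h.1.leg)).trans (congrArg _ (funext fun v => ?_)))
      exact V.act_act rfl _ rfl _ _ _ _
    · exact V.trace_projEnd_mul τ _ (flagPerm hv π) (flagPerm_mk hv π) h.1.gen h.2 v
  · rw [autTrace, if_neg h]
    have h0 : V.isoEnd G hd s τ π = 0 := by
      refine PiTensorProduct.ext (MultilinearMap.ext fun x => ?_)
      refine (V.isoEnd_tprod G hd s τ π x).trans ?_
      rw [V.component_pureTensor_of_ne G _ hd]
      · exact smul_zero _
      · rintro ⟨hg, _, hdd, h1, h2⟩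
        exact h ⟨⟨fst_flagPerm hv π, hg, hinv.1 h1, hleg.1 h2⟩, hdd⟩
    rw [h0, map_zero]

theorem isoEnd_eq_zero {m : ℕ} {gen val : Fin m → ℕ}
    (G : StableGraph g N gen val) {d : Fin m → ℤ} (hd : ∑ v, d v = i) (s : Equiv.Perm (Fin N))
    (τ : Equiv.Perm (Fin m)) (hv : ¬ ∀ v, val (τ v) = val v)
    (π : ∀ v, Equiv.Perm (Fin (val (τ v)))) : V.isoEnd G hd s τ π = 0 := by
  refine PiTensorProduct.ext (MultilinearMap.ext fun x => ?_)
  refine (V.isoEnd_tprod G hd s τ π x).trans ?_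
  rw [V.component_pureTensor_of_ne G _ hd]
  · exact smul_zero _
  · rintro ⟨-, hv', -⟩
    exact hv hv'

/-- Passing from families `π`, whose type depends on `τ`, to permutations `φ` of the set of flags
makes the sum uniform in `τ`. Every automorphism arises from a family, and a `τ` that changes
valences contributes zero on both sides. -/
theorem sum_trace_isoEnd [∀ g n i, Module.Finite k (V.obj g n i)] {m : ℕ} {gen val : Fin m → ℕ}
    (G : StableGraph g N gen val) {d : Fin m → ℤ} (hd : ∑ v, d v = i) (s : Equiv.Perm (Fin N))
    (τ : Equiv.Perm (Fin m)) :
    ∑ π : ∀ v, Equiv.Perm (Fin (val (τ v))), LinearMap.trace k _ (V.isoEnd G hd s τ π) =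
      ∑ φ, V.autTrace G d s τ φ := by
  by_cases hv : ∀ v, val (τ v) = val v
  · refine Finset.sum_of_injOn (flagPerm hv) (flagPerm_injective hv).injOn
      (fun _ _ => Finset.mem_coe.2 (Finset.mem_univ _)) ?_ fun π _ => V.trace_isoEnd G hd s τ hv π
    intro φ _ hφ
    refine if_neg fun h => hφ ?_
    obtain ⟨hv', π, hπ⟩ := exists_flagPerm φ h.1.fst
    exact ⟨π, Finset.mem_coe.2 (Finset.mem_univ _), hπ⟩
  · rw [Finset.sum_eq_zero fun π _ => by rw [V.isoEnd_eq_zero G hd s τ hv π, map_zero],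
      Finset.sum_eq_zero]
    intro φ _
    refine if_neg fun h => hv ?_
    exact (exists_flagPerm φ h.1.fst).choose

theorem trace_component [∀ g n i, Module.Finite k (V.obj g n i)] {m : ℕ} {gen val : Fin m → ℕ}
    (G : StableGraph g N gen val) {d : Fin m → ℤ} (hd : ∑ v, d v = i) (s : Equiv.Perm (Fin N)) :
    LinearMap.trace k _
      ((DirectSum.component k (Decorated g N i) V.decTensor ⟨m, gen, val, G, d, hd⟩).comp
        (((V.relabelMap g N i s).comp (V.isoAverage g N i)).comp
          (DirectSum.lof k (Decorated g N i) V.decTensor ⟨m, gen, val, G, d, hd⟩))) =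
      isoWeight k val * ∑ τ, ∑ φ, V.autTrace G d s τ φ := by
  have h : (DirectSum.component k (Decorated g N i) V.decTensor ⟨m, gen, val, G, d, hd⟩).comp
        (((V.relabelMap g N i s).comp (V.isoAverage g N i)).comp
          (DirectSum.lof k (Decorated g N i) V.decTensor ⟨m, gen, val, G, d, hd⟩)) =
      isoWeight k val • ∑ τ : Equiv.Perm (Fin m), ∑ π : ∀ v, Equiv.Perm (Fin (val (τ v))),
        V.isoEnd G hd s τ π := by
    refine LinearMap.ext fun x => ?_
    have h1 := V.isoAverage_inclusion ⟨m, gen, val, G, d, hd⟩ x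
    refine (congrArg (fun y => DirectSum.component k (Decorated g N i) V.decTensor
      ⟨m, gen, val, G, d, hd⟩ (V.relabelMap g N i s y)) h1).trans ?_
    simp only [map_smul, map_sum, LinearMap.smul_apply, LinearMap.sum_apply]
    rfl
  rw [h, map_smul, smul_eq_mul, map_sum]
  refine congrArg _ (Finset.sum_congr rfl fun τ _ => ?_)
  rw [map_sum, sum_trace_isoEnd]

/-! ### Finiteness of the free modular operad -/

/-- A bound for the numbers of vertices, the genera and the valences in stable graphs. -/
theorem _root_.ModularOperad.StableGraph.bounds {m : ℕ} {gen val : Fin m → ℕ}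
    (G : StableGraph g N gen val) :
    m < 6 * g + 3 * N ∧ (∀ v, gen v < 6 * g + 3 * N) ∧ ∀ v, val v < 6 * g + 3 * N := by
  classical
  have h1 : Fintype.card (Σ v, Fin (val v)) = ∑ v, val v := by simp
  have h2 : 2 ∣ G.inv.support.card :=
    Equiv.Perm.two_dvd_card_support (by ext1 a; simp [sq, G.inv_inv])
  have h3 : (Finset.univ.image G.leg).card = N := by
    rw [Finset.card_image_of_injective _ G.leg_injective]; simp
  have h4 : G.inv.supportᶜ = Finset.univ.image G.leg := by
    ext a
    have := Set.ext_iff.1 G.range_leg a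
    simp only [Set.mem_range, Set.mem_ofPred_eq] at this
    simp [this]
  have h5 := Finset.card_add_card_compl G.inv.support
  rw [h4, h3, h1] at h5
  have h6 : ∑ _v : Fin m, 3 ≤ ∑ v, (2 * gen v + val v) :=
    Finset.sum_le_sum fun v _ => G.stable v
  have h7 := G.genus_eq
  have h8 := G.nonempty
  have h9 : ∀ v, 2 * gen v + val v ≤ ∑ v, (2 * gen v + val v) := fun v =>
    Finset.single_le_sum (f := fun v => 2 * gen v + val v) (fun _ _ => Nat.zero_le _)
      (Finset.mem_univ v)
  rw [Finset.sum_add_distrib, ← Finset.mul_sum] at h6 h9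
  simp only [Finset.sum_const, Finset.card_univ, Fintype.card_fin, smul_eq_mul] at h6
  refine ⟨by omega, fun v => ?_, fun v => ?_⟩ <;> have := h9 v <;> omega

theorem subsingleton_decTensor (c : Decorated g N i) (v : Fin c.1)
    (hv : Subsingleton (V.obj (c.2.1 v) (c.2.2.1 v) (c.2.2.2.2.1 v))) :
    Subsingleton (V.decTensor c) := by
  have h : (LinearMap.id : V.decTensor c →ₗ[k] V.decTensor c) = 0 :=
    PiTensorProduct.ext (MultilinearMap.ext fun x =>
      MultilinearMap.map_coord_zero _ v (Subsingleton.elim _ _))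
  exact ⟨fun a b => (LinearMap.congr_fun h a).trans (LinearMap.congr_fun h b).symm⟩

/-- The decorated graphs with bounded invariants and with degrees in a given set. -/
def decorations (g N : ℕ) (i : ℤ) (B : ℕ) (D : Finset ℤ) : Finset (Decorated g N i) :=
  (Finset.range B).sigma fun m =>
    (Fintype.piFinset fun _ : Fin m => Finset.range B).sigma fun gen =>
      (Fintype.piFinset fun _ : Fin m => Finset.range B).sigma fun val =>
        (Set.finite_univ (α := StableGraph g N gen val)).toFinset ×ˢ
          Finset.subtype (fun d : Fin m → ℤ => ∑ v, d v = i) (Fintype.piFinset fun _ => D)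

theorem subsingleton_of_notMem {B : ℕ} (hB : 6 * g + 3 * N ≤ B) {D : Finset ℤ}
    (hD : ∀ g n i, g < B → n < B → Nontrivial (V.obj g n i) → i ∈ D) (c : Decorated g N i)
    (hc : c ∉ decorations g N i B D) : Subsingleton (V.decTensor c) := by
  obtain ⟨m, gen, val, G, d, hd⟩ := c
  obtain ⟨h1, h2, h3⟩ := G.bounds
  by_contra h
  refine hc ?_
  simp only [decorations, Finset.mem_sigma, Finset.mem_range, Fintype.mem_piFinset,
    Finset.mem_product, Set.Finite.mem_toFinset, Set.mem_univ, true_and, Finset.mem_subtype]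
  refine ⟨h1.trans_le hB, fun v => (h2 v).trans_le hB, fun v => (h3 v).trans_le hB, fun v => ?_⟩
  refine hD _ _ _ ((h2 v).trans_le hB) ((h3 v).trans_le hB) ?_
  rw [← not_subsingleton_iff_nontrivial]
  exact fun h' => h (V.subsingleton_decTensor ⟨m, gen, val, G, d, hd⟩ v h')

end StableSModule

end ModularOperad

end

/-! ### Finiteness and supertraces of the free modular operad -/

open scoped DirectSum TensorProduct

noncomputable section

namespace ModularOperad

universe w u

namespace StableSModule

variable {k : Type w} [Field k] (V : StableSModule.{w, u} k) {g N : ℕ} {i : ℤ}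

theorem exists_degrees (hV : V.FiniteDim) (B : ℕ) :
    ∃ D : Finset ℤ, ∀ g n i, g < B → n < B → Nontrivial (V.obj g n i) → i ∈ D := by
  classical
  refine ⟨(Finset.range B).biUnion fun g => (Finset.range B).biUnion fun n =>
    (hV g n).2.toFinset, fun g n i hg hn hi => ?_⟩
  simp only [Finset.mem_biUnion, Finset.mem_range, Set.Finite.mem_toFinset]
  exact ⟨g, hg, n, hn, hi⟩

theorem finite_decTensor [∀ g n i, Module.Finite k (V.obj g n i)] (c : Decorated g N i) :
    Module.Finite k (V.decTensor c) :=
  Module.Finite.of_basis (Basis.piTensorProduct fun v =>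
    Module.finBasis k (V.obj (c.2.1 v) (c.2.2.1 v) (c.2.2.2.2.1 v)))

theorem finite_graphSum (hV : V.FiniteDim) (g N : ℕ) (i : ℤ) :
    Module.Finite k (V.graphSum g N i) := by
  have : ∀ g n i, Module.Finite k (V.obj g n i) := fun g n i => (hV g n).1 i
  have : ∀ c : Decorated g N i, Module.Finite k (V.decTensor c) := V.finite_decTensor
  obtain ⟨D, hD⟩ := V.exists_degrees hV (6 * g + 3 * N)
  exact finite_directSum _ fun c hc => V.subsingleton_of_notMem le_rfl hD c hc

/-- The possible total degrees of decorations. -/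
def totalDegrees (B : ℕ) (D : Finset ℤ) : Finset ℤ :=
  (Finset.range B).biUnion fun m => (Fintype.piFinset fun _ : Fin m => D).image fun d => ∑ v, d v

theorem decorations_eq_empty {B : ℕ} {D : Finset ℤ} (hi : i ∉ totalDegrees B D) :
    decorations g N i B D = ∅ := by
  refine Finset.eq_empty_of_forall_notMem fun c hc => hi ?_
  obtain ⟨m, gen, val, G, d, hd⟩ := c
  simp only [decorations, Finset.mem_sigma, Finset.mem_product, Finset.mem_subtype] at hc
  exact Finset.mem_biUnion.2 ⟨m, hc.1, Finset.mem_image.2 ⟨d, hc.2.2.2.2, hd⟩⟩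

/-- Stable graphs of given genus and number of legs have boundedly many vertices, of bounded genera
and valences. Only finitely many decorated graphs then carry a nonzero tensor product, and only
finitely many total degrees occur. -/
theorem free_finiteDim (hV : V.FiniteDim) : V.free.FiniteDim := by
  intro g N
  refine ⟨fun i => ?_, ?_⟩
  · have := V.finite_graphSum hV g N i
    exact Module.Finite.quotient k (V.isoRelations g N i)
  · obtain ⟨D, hD⟩ := V.exists_degrees hV (6 * g + 3 * N)
    refine (totalDegrees (6 * g + 3 * N) D).finite_toSet.subset fun i hi => ?_
    by_contra h
    have he := decorations_eq_empty (g := g) (N := N) h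
    have h0 : ∀ c : Decorated g N i, Subsingleton (V.decTensor c) := fun c =>
      V.subsingleton_of_notMem le_rfl hD c (by rw [he]; exact Finset.notMem_empty c)
    have h1 : Subsingleton (V.graphSum g N i) :=
      ⟨fun a b => DFinsupp.ext fun c => (h0 c).elim _ _⟩
    have h2 : Subsingleton (V.graphSum g N i ⧸ V.isoRelations g N i) :=
      (Submodule.mkQ_surjective (V.isoRelations g N i)).subsingleton
    exact not_nontrivial_iff_subsingleton.2 h2 hi

/-- The trace of a renumbering of the legs on the free modular operad. -/
theorem trace_free [CharZero k] (hV : V.FiniteDim) {B : ℕ} (hB : 6 * g + 3 * N ≤ B)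
    {D : Finset ℤ} (hD : ∀ g n i, g < B → n < B → Nontrivial (V.obj g n i) → i ∈ D)
    (s : Equiv.Perm (Fin N)) :
    LinearMap.trace k (V.free.obj g N i) (V.free.rep g N i s) =
      ∑ c ∈ decorations g N i B D,
        isoWeight k c.2.2.1 * ∑ τ, ∑ φ, V.autTrace c.2.2.2.1 c.2.2.2.2.1 s τ φ := by
  have : ∀ g n i, Module.Finite k (V.obj g n i) := fun g n i => (hV g n).1 i
  have : ∀ c : Decorated g N i, Module.Finite k (V.decTensor c) := V.finite_decTensor
  have := V.finite_graphSum hV g N i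
  refine (trace_mapQ (V.isoRelations g N i) (V.isoAverage g N i) (V.isoRelations_le_ker g N i)
    (V.mkQ_isoAverage g N i) (V.relabelMap g N i s) (V.isoRelations_le g N i s)).trans ?_
  refine (trace_directSum _ (fun c hc => V.subsingleton_of_notMem hB hD c hc) _).trans ?_
  refine Finset.sum_congr rfl fun c _ => ?_
  obtain ⟨m, gen, val, G, d, hd⟩ := c
  exact V.trace_component G hd s

/-- The supertrace of a permutation of a given cycle type. -/
def chi (g : ℕ) (μ : Multiset ℕ) : k :=
  ∑ᶠ i : ℤ, ((i.negOnePow : ℤ) : k) * V.typeTrace g i μ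

theorem typeTrace_eq_zero {g : ℕ} {μ : Multiset ℕ} (h : ¬ Nontrivial (V.obj g μ.sum i)) :
    V.typeTrace g i μ = 0 := by
  have := not_nontrivial_iff_subsingleton.1 h
  rw [typeTrace]
  split_ifs
  · rw [Subsingleton.elim (V.rep g μ.sum i _) 0, map_zero]
  · rfl

theorem chi_eq_sum {g : ℕ} {μ : Multiset ℕ} {D : Finset ℤ}
    (hD : ∀ i, Nontrivial (V.obj g μ.sum i) → i ∈ D) :
    V.chi g μ = ∑ i ∈ D, ((i.negOnePow : ℤ) : k) * V.typeTrace g i μ := by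
  refine finsum_eq_sum_of_support_subset _ fun i hi => hD i ?_
  by_contra h
  exact hi (by dsimp only; rw [V.typeTrace_eq_zero h, mul_zero])

theorem fst_pow_iff {m : ℕ} {val : Fin m → ℕ} {τ : Equiv.Perm (Fin m)}
    {φ : Equiv.Perm (Σ v, Fin (val v))} (h : ∀ a, τ (φ a).1 = a.1) {n : ℕ} {v : Fin m}
    (hv : (τ ^ n) v = v) (a : Σ v, Fin (val v)) : ((φ ^ n) a).1 = v ↔ a.1 = v := by
  have h1 : ∀ a, (τ ^ n) ((φ ^ n) a).1 = a.1 := by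
    clear hv
    induction n with
    | zero => exact fun a => rfl
    | succ n ih =>
      intro a
      rw [pow_succ, pow_succ', Equiv.Perm.mul_apply, Equiv.Perm.mul_apply, h, ih]
  rw [← h1 a]
  conv_rhs => rw [← hv, (τ ^ n).injective.eq_iff]

theorem sum_orbType_pow {m : ℕ} {val : Fin m → ℕ} {τ : Equiv.Perm (Fin m)}
    {φ : Equiv.Perm (Σ v, Fin (val v))} (h : ∀ a, τ (φ a).1 = a.1) {n : ℕ} {v : Fin m}
    (hv : (τ ^ n) v = v) : (orbType (φ ^ n) fun a => a.1 = v).sum = val v := by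
  rw [sum_orbType _ (fst_pow_iff h hv),
    Nat.card_congr (Equiv.sigmaSubtype (β := fun v => Fin (val v)) v)]
  simp

/-- Only degrees invariant under `τ` contribute, and these are chosen orbit by orbit. Since sign and
traces are both products over orbits, summing over degrees turns each orbit's factor into a
supertrace of `𝒱`. -/
theorem sum_autTrace {m : ℕ} {gen val : Fin m → ℕ} (G : StableGraph g N gen val)
    (s : Equiv.Perm (Fin N)) (τ : Equiv.Perm (Fin m)) (φ : Equiv.Perm (Σ v, Fin (val v)))
    {D : Finset ℤ} (hD : ∀ v i, Nontrivial (V.obj (gen v) (val v) i) → i ∈ D) :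
    ∑ d ∈ Fintype.piFinset fun _ : Fin m => D,
      (((∑ v, d v).negOnePow : ℤ) : k) * V.autTrace G d s τ φ =
      open Classical in if G.IsAut s τ φ then
        orbProd τ fun v => V.chi (gen v) (orbType (φ ^ orbLen τ v) fun a => a.1 = v) else 0 := by
  classical
  split_ifs with h
  · have h1 : ∀ v, V.chi (gen v) (orbType (φ ^ orbLen τ v) fun a => a.1 = v) =
        ∑ i ∈ D, ((i.negOnePow : ℤ) : k) *
          V.typeTrace (gen v) i (orbType (φ ^ orbLen τ v) fun a => a.1 = v) := by
      intro v
      refine V.chi_eq_sum fun i hi => hD v i ?_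
      rwa [sum_orbType_pow h.fst (pow_orbLen τ v)] at hi
    rw [orbProd_congr τ h1, ← sum_invariant_prod, Finset.sum_filter]
    refine Finset.sum_congr rfl fun d _ => ?_
    split_ifs with hd
    · rw [autTrace, if_pos ⟨h, hd⟩, orbProd_mul, ← mul_assoc]
      refine congrArg (· * _) ?_
      have h2 := congrArg (fun u : ℤˣ => ((u : ℤ) : k)) (koszulSign_mul_negOnePow τ d hd)
      simp only [Units.val_mul, Int.cast_mul] at h2
      rw [mul_comm, h2]
      exact orbProd_map (((Int.castRingHom k).toMonoidHom).comp (Units.coeHom ℤ)) τ _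
    · rw [autTrace, if_neg fun h' => hd h'.2, mul_zero]
  · refine Finset.sum_eq_zero fun d _ => ?_
    rw [autTrace, if_neg fun h' => h h'.1, mul_zero]

/-- The alternating sum over total degrees is merged with the sum over degree decorations of each
graph, to which `sum_autTrace` applies. What is left is a sum over undecorated graphs and their
automorphisms. -/
theorem chi_free [CharZero k] (hV : V.FiniteDim) {B : ℕ} (hB : 6 * g + 3 * N ≤ B)
    (s : Equiv.Perm (Fin N)) :
    V.free.chi g (orbType s fun _ => True) =
      ∑ m ∈ Finset.range B, ∑ gen ∈ Fintype.piFinset fun _ : Fin m => Finset.range B,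
        ∑ val ∈ Fintype.piFinset fun _ : Fin m => Finset.range B,
          isoWeight k val *
            ∑ G ∈ (Set.finite_univ (α := StableGraph g N gen val)).toFinset, ∑ τ, ∑ φ,
              open Classical in if G.IsAut s τ φ then
                orbProd τ fun v => V.chi (gen v) (orbType (φ ^ orbLen τ v) fun a => a.1 = v)
                else 0 := by
  obtain ⟨D, hD⟩ := V.exists_degrees hV B
  have hs : (orbType s fun _ => True).sum = N := by
    rw [sum_orbType s fun _ => Iff.rfl]
    simp
  have h1 : V.free.chi g (orbType s fun _ => True) = ∑ i ∈ totalDegrees B D,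
      ((i.negOnePow : ℤ) : k) * ∑ c ∈ decorations g N i B D,
        isoWeight k c.2.2.1 * ∑ τ, ∑ φ, V.autTrace c.2.2.2.1 c.2.2.2.2.1 s τ φ := by
    rw [chi]
    simp only [typeTrace_orbType, V.trace_free hV hB hD]
    refine finsum_eq_sum_of_support_subset _ fun i hi => ?_
    by_contra h
    rw [Function.mem_support, decorations_eq_empty h] at hi
    simp at hi
  rw [h1]
  simp only [decorations, Finset.sum_sigma, Finset.sum_product, Finset.mul_sum]
  rw [Finset.sum_comm]
  refine Finset.sum_congr rfl fun m hm => ?_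
  rw [Finset.sum_comm]
  refine Finset.sum_congr rfl fun gen hgen => ?_
  rw [Finset.sum_comm]
  refine Finset.sum_congr rfl fun val hval => ?_
  rw [Finset.sum_comm]
  refine Finset.sum_congr rfl fun G _ => ?_
  have hD' : ∀ v i, Nontrivial (V.obj (gen v) (val v) i) → i ∈ D := fun v i => by
    simp only [Fintype.mem_piFinset, Finset.mem_range] at hgen hval
    exact hD _ _ _ (hgen v) (hval v)
  simp only [← V.sum_autTrace G s _ _ hD']
  have hm : ∀ d ∈ Fintype.piFinset fun _ : Fin m => D, ∑ v, d v ∈ totalDegrees B D := fun d hd =>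
    Finset.mem_biUnion.2 ⟨m, hm, Finset.mem_image.2 ⟨d, hd, rfl⟩⟩
  have h2 : ∀ i : ℤ, ∑ x ∈ Finset.subtype (fun d : Fin m → ℤ => ∑ v, d v = i)
      (Fintype.piFinset fun _ => D), ∑ τ, ∑ φ,
        ((i.negOnePow : ℤ) : k) * (isoWeight k val * V.autTrace G x.1 s τ φ) =
      ∑ d ∈ (Fintype.piFinset fun _ : Fin m => D).filter fun d => ∑ v, d v = i, ∑ τ, ∑ φ,
        isoWeight k val * ((((∑ v, d v).negOnePow : ℤ) : k) * V.autTrace G d s τ φ) := by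
    intro i
    rw [← Finset.sum_subtype_eq_sum_filter]
    refine Finset.sum_congr rfl fun d _ => Finset.sum_congr rfl fun τ _ =>
      Finset.sum_congr rfl fun φ _ => ?_
    rw [d.2, mul_left_comm]
  refine (Finset.sum_congr rfl fun i _ => h2 i).trans ?_
  rw [Finset.sum_fiberwise_of_maps_to hm, Finset.sum_comm]
  refine Finset.sum_congr rfl fun τ _ => ?_
  rw [Finset.sum_comm]
  exact Finset.sum_congr rfl fun φ _ => (Finset.mul_sum _ _ _).symm

end StableSModule

end ModularOperad

end

noncomputable section

namespace ModularOperad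

universe w

/-! ### Sums over functions and over the sizes of their fibres -/

section Functions

variable {M : Type*} [AddCommGroup M] [Module ℚ M]

/-- A form of the multinomial theorem: a linear functional on polynomials takes the monomial with
exponent `ν` to `S ν`. Applied to the `n`-th power of the sum of the variables, it gives the sum of
`F` by expanding in one way and the sum over fibre sizes by expanding in the other. -/
theorem sum_functions {K : Type} [Fintype K] [DecidableEq K] (n : ℕ) (F : (Fin n → K) → M)
    (S : (K → ℕ) → M)
    (hS : ∀ (ν : K → ℕ) (e : (Σ κ, Fin (ν κ)) ≃ Fin n), F (fun a => (e.symm a).1) = S ν) :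
    (n.factorial : ℚ)⁻¹ • ∑ h, F h =
      ∑ ν ∈ Finset.piAntidiag Finset.univ n, (∏ κ, ((ν κ).factorial : ℚ))⁻¹ • S ν := by
  let L : MvPolynomial K ℚ →ₗ[ℚ] M := (MvPolynomial.basisMonomials K ℚ).constr ℚ fun ν => S ν
  have hL : ∀ ν : K →₀ ℕ, L (MvPolynomial.monomial ν 1) = S ν := fun ν => by
    have := (MvPolynomial.basisMonomials K ℚ).constr_basis ℚ (fun ν => S ν) ν
    rwa [MvPolynomial.coe_basisMonomials] at this
  have h1 : ∀ h : Fin n → K, F h = L (∏ a, MvPolynomial.X (h a)) := by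
    intro h
    have : ∏ a, (MvPolynomial.X (h a) : MvPolynomial K ℚ) =
        MvPolynomial.monomial (∑ a, Finsupp.single (h a) 1) 1 := by
      rw [MvPolynomial.monomial_sum_one]
      rfl
    have hc : ∀ κ, (∑ a, Finsupp.single (h a) 1 : K →₀ ℕ) κ = Fintype.card {a // h a = κ} := by
      intro κ
      rw [Finsupp.finsetSum_apply, Fintype.card_subtype, Finset.card_filter]
      exact Finset.sum_congr rfl fun a _ => by rw [Finsupp.single_apply]
    rw [this, hL, ← hS _ ((Equiv.sigmaCongrRight fun κ => (finCongr (hc κ)).trans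
      (Fintype.equivFin {a // h a = κ}).symm).trans (Equiv.sigmaFiberEquiv h))]
    rfl
  simp only [h1, ← map_sum]
  rw [← Fintype.sum_pow, Finset.sum_pow_eq_sum_piAntidiag, map_sum, Finset.smul_sum]
  refine Finset.sum_congr rfl fun ν hν => ?_
  have h2 : (Nat.multinomial Finset.univ ν : MvPolynomial K ℚ) *
      ∏ κ, (MvPolynomial.X κ : MvPolynomial K ℚ) ^ ν κ =
      (Nat.multinomial Finset.univ ν : ℚ) •
        MvPolynomial.monomial (Finsupp.equivFunOnFinite.symm ν) 1 := by
    rw [MvPolynomial.monomial_eq, Finsupp.prod_fintype _ _ fun _ => pow_zero _]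
    simp [Algebra.smul_def]
  rw [h2, map_smul, hL, smul_smul]
  congr 1
  have h3 := Nat.multinomial_spec Finset.univ ν
  rw [(Finset.mem_piAntidiag.1 hν).1] at h3
  have h4 : (∏ κ, ((ν κ).factorial : ℚ)) * Nat.multinomial Finset.univ ν = n.factorial := by
    exact_mod_cast h3
  rw [← h4]
  have h5 : ∏ κ, ((ν κ).factorial : ℚ) ≠ 0 :=
    Finset.prod_ne_zero_iff.2 fun κ _ => Nat.cast_ne_zero.2 (Nat.factorial_ne_zero _)
  have h6 : (Nat.multinomial Finset.univ ν : ℚ) ≠ 0 := by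
    intro h
    rw [h, mul_zero] at h4
    exact Nat.cast_ne_zero.2 n.factorial_ne_zero h4.symm
  field_simp

theorem sum_piAntidiag_three (B l : ℕ) (hl : l < B) (G : ℕ → ℕ → ℕ → M) :
    ∑ ν ∈ Finset.piAntidiag (Finset.univ : Finset (Fin 3)) l, G (ν 0) (ν 1) (ν 2) =
      ∑ m ∈ Finset.range B, ∑ r ∈ Finset.range B, ∑ n ∈ Finset.range B,
        if m + r + n = l then G m r n else 0 := by
  rw [← Finset.sum_product', ← Finset.sum_product', ← Finset.sum_filter]
  refine Finset.sum_bij (fun ν _ => ((ν 0, ν 1), ν 2)) ?_ ?_ ?_ ?_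
  · intro ν hν
    have := (Finset.mem_piAntidiag.1 hν).1
    rw [Fin.sum_univ_three] at this
    simp only [Finset.mem_filter, Finset.mem_product, Finset.mem_range]
    omega
  · intro ν _ ν' _ h
    simp only [Prod.mk.injEq] at h
    funext i
    fin_cases i
    · exact h.1.1
    · exact h.1.2
    · exact h.2
  · rintro ⟨⟨m, r⟩, n⟩ h
    simp only [Finset.mem_filter, Finset.mem_product, Finset.mem_range] at h
    refine ⟨![m, r, n], Finset.mem_piAntidiag.2 ⟨?_, fun _ _ => Finset.mem_univ _⟩, rfl⟩
    rw [Fin.sum_univ_three]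
    exact h.2
  · exact fun _ _ => rfl

theorem sum_piAntidiag_eq {m : ℕ} (B r : ℕ) (hr : r < B) (G : (Fin m → ℕ) → M) :
    ∑ ν ∈ Finset.piAntidiag Finset.univ r, G ν =
      ∑ ν ∈ Fintype.piFinset fun _ : Fin m => Finset.range B,
        if ∑ v, ν v = r then G ν else 0 := by
  rw [← Finset.sum_filter]
  refine Finset.sum_congr (Finset.ext fun ν => ?_) fun _ _ => rfl
  rw [Finset.mem_piAntidiag, Finset.mem_filter, Fintype.mem_piFinset]
  constructor
  · rintro ⟨h, -⟩
    refine ⟨fun v => Finset.mem_range.2 (lt_of_le_of_lt ?_ hr), h⟩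
    rw [← h]
    exact Finset.single_le_sum (fun _ _ => Nat.zero_le _) (Finset.mem_univ v)
  · exact fun h => ⟨h.2, fun _ _ => Finset.mem_univ _⟩

end Functions

/-! ### Structures with given vertices, flags and legs -/

section Standard

variable {Y₀ Y₁ Y₂ Y₁' : Type}

/-- The labels of vertices, flags and legs. -/
def stdLab (Y₀ Y₁ Y₂ : Type) : Y₀ ⊕ (Y₁ ⊕ Y₂) → Fin 3 :=
  Sum.elim (fun _ => 0) (Sum.elim (fun _ => 1) fun _ => 2)

/-- The vertices of flags. -/
def stdAtt (Y₂ : Type) (h : Y₁ → Y₀) : Y₀ ⊕ (Y₁ ⊕ Y₂) → Y₀ ⊕ (Y₁ ⊕ Y₂) :=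
  Sum.elim Sum.inl (Sum.elim (fun a => Sum.inl (h a)) fun b => Sum.inr (Sum.inr b))

namespace WeightData

variable {R : Type*} [CommRing R] [Algebra ℚ R] (P : WeightData R)

open scoped Classical in
/-- The weight of a structure if it is connected. -/
def connWeight {Z : Type} [Finite Z] (x : Str Z) : R := if x.GConn then P.weight x else 0

theorem connWeight_map {Z Z' : Type} [Finite Z] [Finite Z'] (e : Z ≃ Z') (x : Str Z) :
    P.connWeight (x.map e) = P.connWeight x := by
  classical
  rw [connWeight, connWeight, weight_map]
  exact if_congr (Str.gConn_map e x) rfl rfl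

theorem valid_of_connWeight {Z : Type} [Finite Z] {x : Str Z} (h : P.connWeight x ≠ 0) :
    P.Valid x := by
  by_contra h'
  refine h ?_
  rw [connWeight, weight_of_not_valid h', ite_self]

theorem avgG_eq (l : ℕ) : P.avgG l = (l.factorial : ℚ)⁻¹ • ∑ x : Str (Fin l), P.connWeight x := by
  classical
  rw [avgG, totalG, Finset.sum_filter]
  rfl

open scoped Classical in
/-- The sum of the weights of the connected structures with given labels. -/
def labSum (Y₀ Y₁ Y₂ : Type) [Finite Y₀] [Finite Y₁] [Finite Y₂] : R :=
  ∑ x : Str (Y₀ ⊕ (Y₁ ⊕ Y₂)) with x.lab = stdLab Y₀ Y₁ Y₂, P.connWeight x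

open scoped Classical in
/-- The sum of the weights of the connected structures with given labels and vertices. -/
def attSum (Y₂ : Type) [Finite Y₀] [Finite Y₁] [Finite Y₂] (h : Y₁ → Y₀) : R :=
  ∑ x : Str (Y₀ ⊕ (Y₁ ⊕ Y₂)) with x.lab = stdLab Y₀ Y₁ Y₂ ∧ x.att = stdAtt Y₂ h, P.connWeight x

theorem avgG_eq_sum_labSum (l : ℕ) : P.avgG l =
    ∑ ν ∈ Finset.piAntidiag (Finset.univ : Finset (Fin 3)) l,
      (∏ κ, ((ν κ).factorial : ℚ))⁻¹ • P.labSum (Fin (ν 0)) (Fin (ν 1)) (Fin (ν 2)) := by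
  classical
  rw [avgG_eq, ← Finset.sum_fiberwise (g := fun x : Str (Fin l) => x.lab)]
  refine sum_functions l _ _ fun ν e => ?_
  let e₀ : Fin (ν 0) ⊕ (Fin (ν 1) ⊕ Fin (ν 2)) ≃ Σ κ, Fin (ν κ) :=
    { toFun := Sum.elim (fun i => ⟨0, i⟩) (Sum.elim (fun i => ⟨1, i⟩) fun i => ⟨2, i⟩)
      invFun := fun p => match p with
        | ⟨0, i⟩ => Sum.inl i
        | ⟨1, i⟩ => Sum.inr (Sum.inl i)
        | ⟨2, i⟩ => Sum.inr (Sum.inr i)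
      left_inv := by rintro (i | i | i) <;> rfl
      right_inv := by
        rintro ⟨κ, i⟩
        fin_cases κ <;> rfl }
  have he₀ : ∀ y, (e₀ y).1 = stdLab (Fin (ν 0)) (Fin (ν 1)) (Fin (ν 2)) y := by
    rintro (i | i | i) <;> rfl
  rw [labSum]
  symm
  refine Finset.sum_equiv (Str.mapEquiv (e₀.trans e)) (fun x => ?_)
    fun x _ => (P.connWeight_map _ x).symm
  simp only [Finset.mem_filter, Finset.mem_univ, true_and]
  constructor
  · intro h
    funext a
    refine (congrFun h _).trans ((he₀ _).symm.trans ?_)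
    simp
  · intro h
    funext y
    have := congrFun h (e (e₀ y))
    rw [Equiv.symm_apply_apply, he₀] at this
    rw [← this]
    simp [Str.mapEquiv, Str.map]

/-- In a valid structure flags are attached to vertices and all other elements to themselves, so the
attachment is exactly a map from flags to vertices. -/
theorem labSum_eq_sum_attSum [Finite Y₀] [Finite Y₂] (r : ℕ) [Fintype Y₀] [DecidableEq Y₀] :
    P.labSum Y₀ (Fin r) Y₂ = ∑ h : Fin r → Y₀, P.attSum Y₂ h := by
  classical
  simp only [labSum, attSum, Finset.sum_filter]
  rw [Finset.sum_comm]
  refine Finset.sum_congr rfl fun x _ => ?_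
  by_cases hx : x.lab = stdLab Y₀ (Fin r) Y₂
  · simp only [hx, true_and, if_true]
    by_cases hw : P.connWeight x = 0
    · simp [hw]
    have hv := P.valid_of_connWeight hw
    have h1 : ∀ a, ∃ y, x.att (Sum.inr (Sum.inl a)) = Sum.inl y := by
      intro a
      have h2 := (hv (Sum.inr (Sum.inl a))).lab_att (by rw [hx]; rfl)
      rw [hx] at h2
      generalize x.att (Sum.inr (Sum.inl a)) = b at h2
      obtain y | b | b := b
      · exact ⟨y, rfl⟩
      · exact absurd h2 (by simp [stdLab])
      · exact absurd h2 (by simp [stdLab])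
    choose h hh using h1
    have h3 : x.att = stdAtt Y₂ h := by
      funext z
      obtain y | a | b := z
      · exact (hv _).att_eq (by rw [hx]; simp [stdLab])
      · exact hh a
      · exact (hv _).att_eq (by rw [hx]; simp [stdLab])
    rw [Finset.sum_eq_single_of_mem h (Finset.mem_univ _), if_pos h3]
    intro h' _ hne
    refine if_neg fun h4 => hne (funext fun a => ?_)
    have := congrFun (h3.symm.trans h4) (Sum.inr (Sum.inl a))
    exact (Sum.inl_injective this).symm
  · simp [hx]

theorem attSum_congr [Finite Y₀] [Finite Y₁] [Finite Y₁'] [Finite Y₂] (e : Y₁ ≃ Y₁') (h : Y₁ → Y₀)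
    (h' : Y₁' → Y₀) (he : ∀ a, h' (e a) = h a) : P.attSum Y₂ h = P.attSum Y₂ h' := by
  classical
  rw [attSum, attSum]
  let e' := Equiv.sumCongr (Equiv.refl Y₀) (Equiv.sumCongr e (Equiv.refl Y₂))
  refine Finset.sum_equiv (Str.mapEquiv e') (fun x => ?_) fun x _ => (P.connWeight_map _ x).symm
  simp only [Finset.mem_filter, Finset.mem_univ, true_and]
  have h1 : ∀ z, stdLab Y₀ Y₁' Y₂ (e' z) = stdLab _ _ _ z := by
    rintro (z | z | z) <;> rfl
  have h2 : ∀ z, stdAtt Y₂ h' (e' z) = e' (stdAtt Y₂ h z) := by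
    rintro (z | z | z)
    · rfl
    · simp [e', stdAtt, he]
    · rfl
  refine and_congr ⟨fun h => funext fun z => ?_, fun h => funext fun z => ?_⟩
    ⟨fun h => funext fun z => ?_, fun h => funext fun z => ?_⟩
  · obtain ⟨z, rfl⟩ := e'.surjective z
    rw [h1, ← h]
    simp [Str.mapEquiv, Str.map]
  · have := congrFun h (e' z)
    rw [h1] at this
    rw [← this]
    simp [Str.mapEquiv, Str.map]
  · obtain ⟨z, rfl⟩ := e'.surjective z
    rw [h2, ← h]
    simp [Str.mapEquiv, Str.map]
  · have := congrFun h (e' z)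
    rw [h2] at this
    rw [← e'.injective.eq_iff, ← this]
    simp [Str.mapEquiv, Str.map]

theorem smul_labSum (m r N : ℕ) : (r.factorial : ℚ)⁻¹ • P.labSum (Fin m) (Fin r) (Fin N) =
    ∑ val ∈ Finset.piAntidiag (Finset.univ : Finset (Fin m)) r,
      (∏ v, ((val v).factorial : ℚ))⁻¹ •
        P.attSum (Fin N) (Sigma.fst : (Σ v, Fin (val v)) → Fin m) := by
  rw [labSum_eq_sum_attSum]
  exact sum_functions r _ _ fun ν e => (P.attSum_congr e _ _ fun a => by simp).symm

/-- Sorting by labels turns `1 / l!` into `1 / (m! r! N!)`, and sorting the attachments by valence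
turns `1 / r!` into `∏ 1 / (val v)!`. Apart from `1 / N!`, this is `isoWeight`, the normalization of
the average over isomorphisms. -/
theorem avgG_eq_sum_attSum (B l : ℕ) (hl : l < B) : P.avgG l =
    ∑ m ∈ Finset.range B, ∑ N ∈ Finset.range B,
      ∑ val ∈ Fintype.piFinset fun _ : Fin m => Finset.range B,
        if m + ∑ v, val v + N = l then
          ((m.factorial : ℚ)⁻¹ * (N.factorial : ℚ)⁻¹ * (∏ v, ((val v).factorial : ℚ))⁻¹) •
            P.attSum (Fin N) (Sigma.fst : (Σ v, Fin (val v)) → Fin m) else 0 := by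
  rw [avgG_eq_sum_labSum]
  have h := sum_piAntidiag_three B l hl fun m r N =>
    ((m.factorial : ℚ)⁻¹ * (N.factorial : ℚ)⁻¹) •
      ((r.factorial : ℚ)⁻¹ • P.labSum (Fin m) (Fin r) (Fin N))
  refine Eq.trans (Finset.sum_congr rfl fun ν _ => ?_) (h.trans ?_)
  · rw [smul_smul, Fin.prod_univ_three]
    congr 1
    rw [mul_inv, mul_inv]
    ring
  · refine Finset.sum_congr rfl fun m _ => ?_
    rw [Finset.sum_comm]
    refine Finset.sum_congr rfl fun N _ => ?_
    have h1 : ∀ r ∈ Finset.range B, (if m + r + N = l then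
        ((m.factorial : ℚ)⁻¹ * (N.factorial : ℚ)⁻¹) •
          ((r.factorial : ℚ)⁻¹ • P.labSum (Fin m) (Fin r) (Fin N)) else 0) =
        ∑ val ∈ Fintype.piFinset fun _ : Fin m => Finset.range B,
          if ∑ v, val v = r then (if m + ∑ v, val v + N = l then
            ((m.factorial : ℚ)⁻¹ * (N.factorial : ℚ)⁻¹ * (∏ v, ((val v).factorial : ℚ))⁻¹) •
              P.attSum (Fin N) (Sigma.fst : (Σ v, Fin (val v)) → Fin m) else 0) else 0 := by
      intro r hr
      rw [smul_labSum, sum_piAntidiag_eq B r (Finset.mem_range.1 hr)]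
      by_cases hrl : m + r + N = l
      · rw [if_pos hrl, Finset.smul_sum]
        refine Finset.sum_congr rfl fun val _ => ?_
        split_ifs with h2 h3
        · rw [smul_smul]
        · exact absurd hrl (by rwa [← h2])
        · rw [smul_zero]
      · rw [if_neg hrl, Finset.sum_eq_zero]
        intro val _
        split_ifs with h2 h3
        · exact absurd h3 (by rwa [h2])
        · rfl
        · rfl
    rw [Finset.sum_congr rfl h1, Finset.sum_comm]
    refine Finset.sum_congr rfl fun val _ => ?_
    rw [Finset.sum_ite_eq]
    refine ite_eq_left_iff.2 fun h2 => (if_neg fun h3 => h2 ?_).symm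
    rw [Finset.mem_range]
    omega

variable {k : Type w} [Field k] [CharZero k] {σ : Type} [PowerSumVars σ] [GradedVars σ]
  {Q : WeightData (GradedSeries σ k)}

theorem IsGraded.coeff_attSum (hQ : Q.IsGraded) {Y₀ Y₁ Y₂ : Type} [Finite Y₀] [Finite Y₁]
    [Finite Y₂] (h : Y₁ → Y₀) (d : ℕ) (hd : 4 * d < Nat.card (Y₀ ⊕ (Y₁ ⊕ Y₂))) :
    PowerSeries.coeff d (Q.attSum Y₂ h) = 0 := by
  classical
  rw [attSum, map_sum]
  refine Finset.sum_eq_zero fun x _ => ?_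
  rw [connWeight]
  split_ifs
  · exact hQ.coeff_weight x d hd
  · rfl

theorem IsGraded.coeff_connSum (hQ : Q.IsGraded) (d B : ℕ) (hB : 4 * d < B) :
    PowerSeries.coeff d Q.connSum = ∑ m ∈ Finset.range B, ∑ N ∈ Finset.range B,
      ∑ val ∈ Fintype.piFinset fun _ : Fin m => Finset.range B,
        ((m.factorial : ℚ)⁻¹ * (N.factorial : ℚ)⁻¹ * (∏ v, ((val v).factorial : ℚ))⁻¹) •
          PowerSeries.coeff d (Q.attSum (Fin N) (Sigma.fst : (Σ v, Fin (val v)) → Fin m)) := by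
  rw [connSum, coeff_specialize]
  have h1 : ∀ l ∈ Finset.range (4 * d + 1), PowerSeries.coeff d
      (PowerSeries.coeff l (PowerSeries.mk Q.avgG)) = _ := fun l hl => by
    rw [PowerSeries.coeff_mk, Q.avgG_eq_sum_attSum B l (by have := Finset.mem_range.1 hl; omega)]
  rw [Finset.sum_congr rfl h1]
  simp only [map_sum]
  rw [Finset.sum_comm]
  refine Finset.sum_congr rfl fun m _ => ?_
  rw [Finset.sum_comm]
  refine Finset.sum_congr rfl fun N _ => ?_
  rw [Finset.sum_comm]
  refine Finset.sum_congr rfl fun val _ => ?_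
  simp only [apply_ite (PowerSeries.coeff d), map_zero]
  rw [Finset.sum_ite_eq, coeff_rat_smul]
  refine ite_eq_left_iff.2 fun h2 => ?_
  rw [hQ.coeff_attSum, smul_zero]
  rw [Finset.mem_range] at h2
  simp
  omega

end WeightData

end Standard

end ModularOperad

end

noncomputable section

namespace ModularOperad

universe w

/-! ### Standard structures -/

section Standard

variable {Y₀ Y₁ Y₂ : Type}

/-- The structure with given gluing and with a permutation preserving the labels. -/
def stdStr (h : Y₁ → Y₀) (inv : Y₀ ⊕ (Y₁ ⊕ Y₂) → Y₀ ⊕ (Y₁ ⊕ Y₂)) (ρ : Equiv.Perm Y₀)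
    (φ : Equiv.Perm Y₁) (s : Equiv.Perm Y₂) : Str (Y₀ ⊕ (Y₁ ⊕ Y₂)) where
  lab := stdLab Y₀ Y₁ Y₂
  att := stdAtt Y₂ h
  inv := inv
  aut := Equiv.sumCongr ρ (Equiv.sumCongr φ s)

theorem sumCongr_injective {α β : Type} {ρ ρ' : Equiv.Perm α} {φ φ' : Equiv.Perm β}
    (h : (Equiv.sumCongr ρ φ : α ⊕ β ≃ α ⊕ β) = Equiv.sumCongr ρ' φ') : ρ = ρ' ∧ φ = φ' := by
  constructor
  · ext1 a
    exact Sum.inl_injective (congrFun (congrArg DFunLike.coe h) (Sum.inl a))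
  · ext1 a
    exact Sum.inr_injective (congrFun (congrArg DFunLike.coe h) (Sum.inr a))

theorem exists_sumCongr [Finite Y₀] [Finite Y₁] [Finite Y₂]
    (a : Equiv.Perm (Y₀ ⊕ (Y₁ ⊕ Y₂)))
    (ha : ∀ z, stdLab Y₀ Y₁ Y₂ (a z) = stdLab Y₀ Y₁ Y₂ z) :
    ∃ ρ φ s, a = Equiv.sumCongr ρ (Equiv.sumCongr φ s) := by
  have h1 : a ∈ (Equiv.Perm.sumCongrHom Y₀ (Y₁ ⊕ Y₂)).range := by
    refine Equiv.Perm.mem_sumCongrHom_range_of_perm_mapsTo_inl ?_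
    rintro _ ⟨y, rfl⟩
    have := ha (Sum.inl y)
    generalize a (Sum.inl y) = b at this
    obtain b | b | b := b
    · exact ⟨b, rfl⟩
    · exact absurd this (by simp [stdLab])
    · exact absurd this (by simp [stdLab])
  obtain ⟨⟨ρ, a'⟩, rfl⟩ := h1
  have h2 : a' ∈ (Equiv.Perm.sumCongrHom Y₁ Y₂).range := by
    refine Equiv.Perm.mem_sumCongrHom_range_of_perm_mapsTo_inl ?_
    rintro _ ⟨y, rfl⟩
    have : stdLab Y₀ Y₁ Y₂ (Sum.inr (a' (Sum.inl y))) = 1 := ha (Sum.inr (Sum.inl y))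
    generalize a' (Sum.inl y) = b at this
    obtain b | b := b
    · exact ⟨b, rfl⟩
    · exact absurd this (by simp [stdLab])
  obtain ⟨⟨φ, s⟩, rfl⟩ := h2
  exact ⟨ρ, φ, s, rfl⟩

namespace WeightData

variable {R : Type*} [CommRing R] [Algebra ℚ R] (P : WeightData R) [Fintype Y₀] [Fintype Y₁]
  [Fintype Y₂] [DecidableEq Y₀] [DecidableEq Y₁] [DecidableEq Y₂]

/-- Validity makes the automorphism preserve labels, so it is a triple of permutations of vertices,
flags and legs; only the gluing remains arbitrary. -/
theorem attSum_eq_sum_stdStr (h : Y₁ → Y₀) : P.attSum Y₂ h =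
    ∑ inv : Y₀ ⊕ (Y₁ ⊕ Y₂) → Y₀ ⊕ (Y₁ ⊕ Y₂), ∑ ρ, ∑ φ, ∑ s,
      P.connWeight (stdStr h inv ρ φ s) := by
  rw [attSum, ← Fintype.sum_prod_type', ← Fintype.sum_prod_type', ← Fintype.sum_prod_type']
  symm
  refine Finset.sum_of_injOn (fun p => stdStr h p.1.1.1 p.1.1.2 p.1.2 p.2) ?_ ?_ ?_ ?_
  · rintro ⟨⟨⟨i, ρ⟩, φ⟩, s⟩ _ ⟨⟨⟨i', ρ'⟩, φ'⟩, s'⟩ _ h'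
    have h1 : i = i' := congrArg Str.inv h'
    obtain ⟨h2, h3⟩ := sumCongr_injective (congrArg Str.aut h')
    obtain ⟨h4, h5⟩ := sumCongr_injective h3
    dsimp only at h2 h4 h5
    rw [h1, h2, h4, h5]
  · intro p _
    simp [stdStr]
  · intro x hx hx'
    by_contra hw
    have hv := P.valid_of_connWeight hw
    obtain ⟨h1, h2⟩ : x.lab = stdLab Y₀ Y₁ Y₂ ∧ x.att = stdAtt Y₂ h := by simpa using hx
    obtain ⟨ρ, φ, s, h3⟩ := exists_sumCongr x.aut fun z => by
      rw [← h1]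
      exact (hv z).lab_aut
    exact hx' ⟨(((x.inv, ρ), φ), s), Finset.mem_coe.2 (Finset.mem_univ _),
      Str.ext h1.symm h2.symm rfl h3.symm⟩
  · exact fun _ _ => rfl

variable {P}

theorem Valid.stdStr_att {h : Y₁ → Y₀} {inv : Y₀ ⊕ (Y₁ ⊕ Y₂) → Y₀ ⊕ (Y₁ ⊕ Y₂)}
    {ρ : Equiv.Perm Y₀} {φ : Equiv.Perm Y₁} {s : Equiv.Perm Y₂}
    (hv : P.Valid (stdStr h inv ρ φ s)) (a : Y₁) : h (φ a) = ρ (h a) :=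
  Sum.inl_injective (hv (Sum.inr (Sum.inl a))).att_aut

theorem Valid.weight_stdStr {h : Y₁ → Y₀} {inv : Y₀ ⊕ (Y₁ ⊕ Y₂) → Y₀ ⊕ (Y₁ ⊕ Y₂)}
    {ρ : Equiv.Perm Y₀} {φ : Equiv.Perm Y₁} {s : Equiv.Perm Y₂}
    (hv : P.Valid (stdStr h inv ρ φ s)) : P.weight (stdStr h inv ρ φ s) =
      orbProd ρ (fun v => P.psi (orbLen ρ v)
        (P.vert (orbType (φ ^ orbLen ρ v) fun a => h a = v))) *
      (orbProd φ (fun a => P.psi (orbLen φ a) P.flag) *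
        orbProd s fun b => P.psi (orbLen s b) P.leg) := by
  set x := stdStr h inv ρ φ s with hx
  have h0 : ∀ v, orbLen x.aut (Sum.inl v) = orbLen ρ v :=
    orbLen_eq_of_semiconj Sum.inl_injective fun _ => rfl
  have h1 : ∀ a, orbLen x.aut (Sum.inr (Sum.inl a)) = orbLen φ a :=
    orbLen_eq_of_semiconj (F := fun a => Sum.inr (Sum.inl a))
      (Sum.inr_injective.comp Sum.inl_injective) fun _ => rfl
  have h2 : ∀ a, orbLen x.aut (Sum.inr (Sum.inr a)) = orbLen s a :=
    orbLen_eq_of_semiconj (F := fun a => Sum.inr (Sum.inr a))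
      (Sum.inr_injective.comp Sum.inr_injective) fun _ => rfl
  have hinv : ∀ z, P.localWeight x (x.aut z) = P.localWeight x z := hv.localWeight_aut
  rw [weight_of_valid hv]
  refine (orbProd_sum hinv).trans (congrArg₂ _ (orbProd_congr ρ fun v => ?_)
    ((orbProd_sum fun z => hinv (Sum.inr z)).trans (congrArg₂ _ (orbProd_congr φ fun a => ?_)
      (orbProd_congr s fun b => ?_))))
  · rw [localWeight, h0, if_pos (by rfl)]
    congr 2
    symm
    refine orbType_transfer (fun a => Sum.inr (Sum.inl a))
      (Sum.inr_injective.comp Sum.inl_injective)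
      (pow_semiconj (F := fun a => Sum.inr (Sum.inl a)) (φ' := x.aut) (fun _ => rfl) _) ?_ ?_ ?_
    · intro a
      exact ⟨fun h => Sum.inl_injective h.2, fun h => ⟨rfl, congrArg Sum.inl h⟩⟩
    · refine hv.flagsAt_pow _ ?_
      rw [← h0, pow_orbLen]
    · rintro (y | a | b) ⟨hl, -⟩
      · exact absurd hl (by simp [hx, stdStr, stdLab])
      · exact ⟨a, rfl⟩
      · exact absurd hl (by simp [hx, stdStr, stdLab])
  · rw [localWeight, h1, if_neg (by simp [hx, stdStr, stdLab]), if_pos (by rfl)]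
  · rw [localWeight, h2, if_neg (by simp [hx, stdStr, stdLab]),
      if_neg (by simp [hx, stdStr, stdLab])]

end WeightData

end Standard

/-! ### Structures without gluing -/

section NoGluing

variable {k : Type w} [Field k] [CharZero k] {σ : Type} (chi : ℕ → Multiset ℕ → k)

theorem orbProd_orbLen {M : Type*} [CommMonoid M] {Z : Type} [Fintype Z] [DecidableEq Z]
    (φ : Equiv.Perm Z) (f : ℕ → M) :
    (orbProd φ fun z => f (orbLen φ z)) = (φ.partition.parts.map f).prod := by
  rw [← orbType_eq_parts, orbType_eq_map, Multiset.map_map]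
  rfl

theorem orbProd_perm_one {M : Type*} [CommMonoid M] {Z : Type} [Fintype Z] [DecidableEq Z] (w : Z → M) :
    orbProd (1 : Equiv.Perm Z) w = ∏ z, w z := by
  rw [prod_eq_orbProd 1 w fun _ => rfl]
  refine orbProd_congr 1 fun z => ?_
  rw [(orbLen_eq_one_iff 1 z).2 rfl, pow_one]

theorem adams_X [PowerSumVars σ] [GradedVars σ] (n : ℕ+) :
    adams n (PowerSeries.X : GradedSeries σ k) = PowerSeries.X ^ (n : ℕ) := by
  ext1 d
  rw [coeff_adams, PowerSeries.coeff_X_pow]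
  by_cases h : (n : ℕ) ∣ d
  · obtain ⟨e, rfl⟩ := h
    rw [if_pos (dvd_mul_right _ _), Nat.mul_div_cancel_left _ n.pos, PowerSeries.coeff_X]
    by_cases he : e = 1
    · simp [he]
    · rw [if_neg he, map_zero, if_neg]
      intro h
      exact he (Nat.eq_of_mul_eq_mul_left n.pos (h.trans (mul_one _).symm))
  · rw [if_neg h, if_neg]
    rintro rfl
    exact h dvd_rfl

theorem psi_flag_dataP (n : ℕ) : (dataP chi).psi n (dataP chi).flag =
    PowerSeries.C (MvPolynomial.X (Sum.inl n.toPNat')) := by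
  refine (adams_C _ _).trans ?_
  rw [MvPolynomial.rename_X]
  exact congrArg (fun m : ℕ+ => PowerSeries.C (MvPolynomial.X (Sum.inl m))) (mul_one _)

theorem orbProd_psi_flag_dataP {n : ℕ} (φ : Equiv.Perm (Fin n)) :
    orbProd φ (fun a => (dataP chi).psi (orbLen φ a) (dataP chi).flag) =
      PowerSeries.C (MvPolynomial.rename Sum.inl (cycleIndex k φ)) := by
  rw [orbProd_orbLen φ fun n => (dataP chi).psi n (dataP chi).flag, cycleIndex, map_multiset_prod,
    map_multiset_prod, Multiset.map_map, Multiset.map_map]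
  refine congrArg Multiset.prod (Multiset.map_congr rfl fun n _ => ?_)
  rw [psi_flag_dataP]
  simp [powerSum]

variable {Y₀ Y₁ Y₂ : Type} [Fintype Y₀] [Fintype Y₁] [Fintype Y₂]

/-- Without gluing a flag is tied only to its vertex, so every component contains exactly one vertex
or one leg. -/
theorem gConn_stdStr_id (h : Y₁ → Y₀) (ρ : Equiv.Perm Y₀) (φ : Equiv.Perm Y₁)
    (s : Equiv.Perm Y₂) :
    (stdStr h id ρ φ s).GConn ↔ Nonempty (Y₀ ⊕ Y₂) ∧ Subsingleton (Y₀ ⊕ Y₂) := by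
  let f : Y₀ ⊕ (Y₁ ⊕ Y₂) → Y₀ ⊕ Y₂ :=
    Sum.elim Sum.inl (Sum.elim (fun a => Sum.inl (h a)) Sum.inr)
  let g : Y₀ ⊕ Y₂ → Y₀ ⊕ (Y₁ ⊕ Y₂) := Sum.elim Sum.inl fun b => Sum.inr (Sum.inr b)
  have hfg : ∀ y, f (g y) = y := by rintro (y | y) <;> rfl
  have hatt : ∀ z, (stdStr h id ρ φ s).att z = g (f z) := by rintro (z | z | z) <;> rfl
  constructor
  · rintro ⟨⟨z⟩, hc⟩
    refine ⟨⟨f z⟩, ⟨fun a b => ?_⟩⟩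
    rw [← hfg a, ← hfg b]
    refine ((eqvGen_invariant (p := fun z => f z = f (g a)) ?_ (hc (g a) (g b))).1 rfl).symm
    rintro z z' (h1 | h1)
    · rw [← h1, hatt, hfg, hfg]
    · rw [← h1]
      rfl
  · rintro ⟨⟨y⟩, hs⟩
    have h1 : ∀ z, (stdStr h id ρ φ s).GRel z (g y) := fun z =>
      .rel _ _ (Or.inl ((hatt z).trans (congrArg g (Subsingleton.elim _ _))))
    exact ⟨⟨g y⟩, fun a b => (h1 a).trans _ _ _ ((h1 b).symm _ _)⟩

variable [DecidableEq Y₀] [DecidableEq Y₁] [DecidableEq Y₂]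

theorem valid_dataP_iff (h : Y₁ → Y₀) (inv : Y₀ ⊕ (Y₁ ⊕ Y₂) → Y₀ ⊕ (Y₁ ⊕ Y₂))
    (ρ : Equiv.Perm Y₀) (φ : Equiv.Perm Y₁) (s : Equiv.Perm Y₂) :
    (dataP chi).Valid (stdStr h inv ρ φ s) ↔ inv = id ∧ ∀ a, h (φ a) = ρ (h a) := by
  constructor
  · exact fun hv => ⟨funext fun z => (hv z).inv_eq_iff.2 (Set.mem_univ _), hv.stdStr_att⟩
  · rintro ⟨rfl, h1⟩ z
    refine ⟨?_, ?_, rfl, ?_, ?_, rfl, iff_of_true rfl (Set.mem_univ _)⟩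
    · obtain z | z | z := z <;> rfl
    · obtain z | z | z := z
      · rfl
      · exact congrArg Sum.inl (h1 z)
      · rfl
    · obtain z | z | z := z <;> simp [stdStr, stdLab, stdAtt]
    · obtain z | z | z := z <;> simp [stdStr, stdLab, stdAtt]

theorem attSum_dataP (h : Y₁ → Y₀) : (dataP chi).attSum Y₂ h =
    ∑ ρ, ∑ φ, ∑ s, (dataP chi).connWeight (stdStr (Y₂ := Y₂) h id ρ φ s) := by
  rw [WeightData.attSum_eq_sum_stdStr]
  refine Finset.sum_eq_single_of_mem _ (Finset.mem_univ _) fun inv _ hne => ?_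
  refine Finset.sum_eq_zero fun ρ _ => Finset.sum_eq_zero fun φ _ => Finset.sum_eq_zero fun s _ => ?_
  by_contra hw
  exact hne ((valid_dataP_iff chi _ _ _ _ _).1 ((dataP chi).valid_of_connWeight hw)).1

theorem attSum_dataP_eq_zero (h : Y₁ → Y₀) (hc : Fintype.card Y₀ + Fintype.card Y₂ ≠ 1) :
    (dataP chi).attSum Y₂ h = 0 := by
  rw [attSum_dataP]
  refine Finset.sum_eq_zero fun ρ _ => Finset.sum_eq_zero fun φ _ => Finset.sum_eq_zero fun s _ => ?_
  refine if_neg fun h' => hc ?_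
  rw [gConn_stdStr_id] at h'
  obtain ⟨⟨y⟩, hs⟩ := h'
  rw [← Fintype.card_sum]
  exact Fintype.card_eq_one_iff.2 ⟨y, fun _ => Subsingleton.elim _ _⟩

theorem attSum_dataP_vertex [Unique Y₀] [IsEmpty Y₂] {n : ℕ} (h : Fin n → Y₀) :
    (dataP chi).attSum Y₂ h = ∑ φ : Equiv.Perm (Fin n),
      vertSeries _ chi (orbType φ fun _ => True) *
        PowerSeries.C (MvPolynomial.rename Sum.inl (cycleIndex k φ)) := by
  rw [attSum_dataP, Fintype.sum_subsingleton _ 1]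
  refine Finset.sum_congr rfl fun φ _ => ?_
  rw [Fintype.sum_subsingleton _ 1, WeightData.connWeight, if_pos, WeightData.Valid.weight_stdStr,
    orbProd_perm_one, orbProd_perm_one, orbProd_psi_flag_dataP, Fintype.prod_unique,
    Fintype.prod_empty, mul_one]
  · congr 1
    rw [(orbLen_eq_one_iff 1 (default : Y₀)).2 rfl, pow_one]
    refine (adams_one _).trans ?_
    have : (fun a => h a = default) = fun _ => True := funext fun a =>
      propext (iff_of_true (Subsingleton.elim _ _) trivial)
    rw [this]
    rfl
  · exact (valid_dataP_iff chi _ _ _ _ _).2 ⟨rfl, fun a => Subsingleton.elim _ _⟩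
  · rw [gConn_stdStr_id]
    exact ⟨⟨Sum.inl default⟩, ⟨by
      rintro (a | a) (b | b)
      · rw [Subsingleton.elim a b]
      · exact isEmptyElim b
      · exact isEmptyElim a
      · exact isEmptyElim a⟩⟩

theorem attSum_dataP_leg [IsEmpty Y₀] [Unique Y₂] (h : Y₁ → Y₀) :
    (dataP chi).attSum Y₂ h =
      PowerSeries.X * PowerSeries.C (MvPolynomial.X (Sum.inl 1) * MvPolynomial.X (Sum.inr 1)) := by
  have : IsEmpty Y₁ := ⟨fun a => isEmptyElim (h a)⟩
  rw [attSum_dataP, Fintype.sum_subsingleton _ 1, Fintype.sum_subsingleton _ 1,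
    Fintype.sum_subsingleton _ 1, WeightData.connWeight, if_pos, WeightData.Valid.weight_stdStr,
    orbProd_perm_one, orbProd_perm_one, orbProd_perm_one, Fintype.prod_empty, Fintype.prod_empty,
    Fintype.prod_unique, one_mul, one_mul, (orbLen_eq_one_iff 1 (default : Y₂)).2 rfl]
  · exact adams_one _
  · exact (valid_dataP_iff chi _ _ _ _ _).2 ⟨rfl, fun a => isEmptyElim a⟩
  · rw [gConn_stdStr_id]
    exact ⟨⟨Sum.inr default⟩, ⟨by
      rintro (a | a) (b | b)
      · exact isEmptyElim a
      · exact isEmptyElim a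
      · exact isEmptyElim b
      · rw [Subsingleton.elim a b]⟩⟩

/-- The connected structures are a single leg, of weight `t p_1 q_1`, and single vertices with `n`
flags, which sum to the characteristic of `𝒱` expressed through `chi` and cycle indices. -/
theorem coeff_connSum_dataP (d B : ℕ) (hB : 4 * d + 1 < B) :
    PowerSeries.coeff d (dataP chi).connSum =
      (if d = 1 then MvPolynomial.X (Sum.inl 1) * MvPolynomial.X (Sum.inr 1) else 0) +
      ∑ n ∈ Finset.range B, (n.factorial : ℚ)⁻¹ • ∑ φ : Equiv.Perm (Fin n),
        PowerSeries.coeff d (vertSeries (ℕ+ ⊕ ℕ+) chi (orbType φ fun _ => True)) *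
          MvPolynomial.rename Sum.inl (cycleIndex k φ) := by
  rw [(isGraded_dataP chi).coeff_connSum d B (by omega)]
  have h0 : ∀ m N (val : Fin m → ℕ), m + N ≠ 1 →
      ((m.factorial : ℚ)⁻¹ * (N.factorial : ℚ)⁻¹ * (∏ v, ((val v).factorial : ℚ))⁻¹) •
          PowerSeries.coeff d ((dataP chi).attSum (Fin N)
            (Sigma.fst : (Σ v, Fin (val v)) → Fin m)) = 0 := by
    intro m N val hmN
    rw [attSum_dataP_eq_zero chi _ (by simpa using hmN), map_zero, smul_zero]
  rw [← Finset.sum_subset (s₁ := Finset.range 2) (by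
      intro x
      simp only [Finset.mem_range]
      omega)]
  · rw [Finset.sum_range_succ, Finset.sum_range_one]
    congr 1
    · rw [Finset.sum_eq_single_of_mem 1 (Finset.mem_range.2 (by omega))]
      · rw [Finset.sum_eq_single_of_mem (default : Fin 0 → ℕ)
          (Fintype.mem_piFinset.2 fun v => v.elim0) fun val _ h => absurd (Subsingleton.elim _ _) h,
          attSum_dataP_leg, PowerSeries.coeff_mul_C, PowerSeries.coeff_X]
        simp
      · exact fun N _ hN => Finset.sum_eq_zero fun val _ => h0 0 N val (by omega)
    · rw [Finset.sum_eq_single_of_mem 0 (Finset.mem_range.2 (by omega))]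
      · refine Finset.sum_bij' (fun val _ => val 0) (fun n _ _ => n) ?_ ?_ ?_ ?_ ?_
        · exact fun val hval => Fintype.mem_piFinset.1 hval 0
        · exact fun n hn => Fintype.mem_piFinset.2 fun _ => hn
        · exact fun val _ => funext fun v => by rw [Subsingleton.elim v 0]
        · exact fun n _ => rfl
        · intro val _
          rw [(dataP chi).attSum_congr (Equiv.uniqueSigma fun v : Fin 1 => Fin (val v)) Sigma.fst
            (fun _ => default) fun a => Subsingleton.elim _ _, attSum_dataP_vertex, map_sum]
          simp only [PowerSeries.coeff_mul_C]
          simp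
      · exact fun N _ hN => Finset.sum_eq_zero fun val _ => h0 1 N val (by omega)
  · intro m _ hm
    rw [Finset.mem_range] at hm
    exact Finset.sum_eq_zero fun N _ => Finset.sum_eq_zero fun val _ => h0 m N val (by omega)

end NoGluing

end ModularOperad

end

noncomputable section

namespace ModularOperad

universe w

/-! ### Gluing flags and legs -/

section Gluing

variable {Y₀ Y₁ Y₂ : Type}

/-- An involution of the flags and a numbering of its fixed points which define a connected
graph. -/
structure IsFlagGraph (h : Y₁ → Y₀) (inv : Equiv.Perm Y₁) (leg : Y₂ → Y₁) : Prop where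
  inv_inv : ∀ a, inv (inv a) = a
  injective : Function.Injective leg
  fixed : ∀ a, inv a = a ↔ ∃ b, leg b = a
  connected : ∀ v w, Relation.EqvGen (fun v w => ∃ a, h a = v ∧ h (inv a) = w) v w

/-- An automorphism of a graph. -/
structure IsFlagAut (h : Y₁ → Y₀) (inv : Equiv.Perm Y₁) (leg : Y₂ → Y₁) (ρ : Equiv.Perm Y₀)
    (φ : Equiv.Perm Y₁) (s : Equiv.Perm Y₂) : Prop where
  att : ∀ a, h (φ a) = ρ (h a)
  inv : ∀ a, φ (inv a) = inv (φ a)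
  leg : ∀ b, φ (leg b) = leg (s b)

open scoped Classical in
/-- The gluing of flags and legs defined by a graph. -/
def glue (Y₀ : Type) (inv : Equiv.Perm Y₁) (leg : Y₂ → Y₁) :
    Y₀ ⊕ (Y₁ ⊕ Y₂) → Y₀ ⊕ (Y₁ ⊕ Y₂) :=
  Sum.elim Sum.inl (Sum.elim
    (fun a => if hb : ∃ b, leg b = a then Sum.inr (Sum.inr hb.choose)
      else Sum.inr (Sum.inl (inv a)))
    fun b => Sum.inr (Sum.inl (leg b)))

variable {h : Y₁ → Y₀} {inv : Equiv.Perm Y₁} {leg : Y₂ → Y₁} {ρ : Equiv.Perm Y₀}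
  {φ : Equiv.Perm Y₁} {s : Equiv.Perm Y₂}

theorem glue_leg (b : Y₂) : glue Y₀ inv leg (Sum.inr (Sum.inr b)) = Sum.inr (Sum.inl (leg b)) := rfl

theorem IsFlagGraph.glue_apply_leg (hG : IsFlagGraph h inv leg) (b : Y₂) :
    glue Y₀ inv leg (Sum.inr (Sum.inl (leg b))) = Sum.inr (Sum.inr b) := by
  have hb : ∃ b', leg b' = leg b := ⟨b, rfl⟩
  refine (dif_pos hb).trans ?_
  rw [hG.injective hb.choose_spec]

theorem IsFlagGraph.glue_of_ne (hG : IsFlagGraph h inv leg) {a : Y₁} (ha : inv a ≠ a) :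
    glue Y₀ inv leg (Sum.inr (Sum.inl a)) = Sum.inr (Sum.inl (inv a)) :=
  dif_neg fun hb => ha ((hG.fixed a).2 hb)

theorem IsFlagGraph.glue_glue (hG : IsFlagGraph h inv leg) (z : Y₀ ⊕ (Y₁ ⊕ Y₂)) :
    glue Y₀ inv leg (glue Y₀ inv leg z) = z := by
  obtain v | a | b := z
  · rfl
  · by_cases ha : inv a = a
    · obtain ⟨b, rfl⟩ := (hG.fixed a).1 ha
      rw [hG.glue_apply_leg, glue_leg]
    · rw [hG.glue_of_ne ha, hG.glue_of_ne, hG.inv_inv]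
      rw [hG.inv_inv]
      exact Ne.symm ha
  · rw [glue_leg, hG.glue_apply_leg]

theorem IsFlagGraph.glue_injOn {inv' : Equiv.Perm Y₁} {leg' : Y₂ → Y₁}
    (hG : IsFlagGraph h inv leg) (hG' : IsFlagGraph h inv' leg')
    (hi : glue Y₀ inv leg = glue Y₀ inv' leg') : inv = inv' ∧ leg = leg' := by
  have h1 : leg = leg' := funext fun b =>
    Sum.inl_injective (Sum.inr_injective (congrFun hi (Sum.inr (Sum.inr b))))
  subst h1
  refine ⟨Equiv.ext fun a => ?_, rfl⟩
  by_cases ha : inv a = a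
  · rw [ha, (hG'.fixed a).2 ((hG.fixed a).1 ha)]
  · have ha' : inv' a ≠ a := fun h' => ha ((hG.fixed a).2 ((hG'.fixed a).1 h'))
    have := congrFun hi (Sum.inr (Sum.inl a))
    rw [hG.glue_of_ne ha, hG'.glue_of_ne ha'] at this
    exact Sum.inl_injective (Sum.inr_injective this)

variable {k : Type w} [Field k] [CharZero k] (chi : ℕ → Multiset ℕ → k)

/-- Compatibility with the glued involution splits into compatibility with the edges and, for flags
glued to legs, with the numbering of the legs; the other validity conditions hold for any graph. -/
theorem IsFlagGraph.valid_iff [Fintype Y₀] [Fintype Y₁] [Fintype Y₂] [DecidableEq Y₀]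
    [DecidableEq Y₁] [DecidableEq Y₂] (hG : IsFlagGraph h inv leg) :
    (dataQ chi).Valid (stdStr h (glue Y₀ inv leg) ρ φ s) ↔ IsFlagAut h inv leg ρ φ s := by
  constructor
  · intro hv
    have hleg : ∀ b, φ (leg b) = leg (s b) := fun b =>
      (Sum.inl_injective (Sum.inr_injective (hv (Sum.inr (Sum.inr b))).inv_aut)).symm
    refine ⟨hv.stdStr_att, fun a => ?_, hleg⟩
    by_cases ha : inv a = a
    · obtain ⟨b, rfl⟩ := (hG.fixed a).1 ha
      rw [ha, hleg, (hG.fixed _).2 ⟨_, rfl⟩]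
    · have h1 : glue Y₀ inv leg (Sum.inr (Sum.inl (φ a))) =
          Equiv.sumCongr ρ (Equiv.sumCongr φ s) (glue Y₀ inv leg (Sum.inr (Sum.inl a))) :=
        (hv (Sum.inr (Sum.inl a))).inv_aut
      rw [hG.glue_of_ne ha] at h1
      by_cases ha' : inv (φ a) = φ a
      · obtain ⟨b, hb⟩ := (hG.fixed _).1 ha'
        rw [← hb, hG.glue_apply_leg] at h1
        simp at h1
      · rw [hG.glue_of_ne ha'] at h1
        exact (Sum.inl_injective (Sum.inr_injective h1)).symm
  · intro hA z
    refine ⟨?_, ?_, ?_, ?_, ?_, hG.glue_glue z, ?_⟩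
    · obtain z | z | z := z <;> rfl
    · obtain z | z | z := z
      · rfl
      · exact congrArg Sum.inl (hA.att z)
      · rfl
    · obtain z | a | b := z
      · rfl
      · change glue Y₀ inv leg (Sum.inr (Sum.inl (φ a))) =
          Equiv.sumCongr ρ (Equiv.sumCongr φ s) (glue Y₀ inv leg (Sum.inr (Sum.inl a)))
        by_cases ha : inv a = a
        · obtain ⟨b, rfl⟩ := (hG.fixed a).1 ha
          rw [hG.glue_apply_leg, hA.leg, hG.glue_apply_leg]
          rfl
        · rw [hG.glue_of_ne ha, hG.glue_of_ne, ← hA.inv]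
          · rfl
          · rw [← hA.inv]
            exact fun h' => ha (φ.injective h')
      · exact congrArg (fun a => Sum.inr (Sum.inl a)) (hA.leg b).symm
    · obtain z | z | z := z <;> simp [stdStr, stdLab, stdAtt]
    · obtain z | z | z := z <;> simp [stdStr, stdLab, stdAtt]
    · obtain z | a | b := z
      · exact iff_of_true rfl rfl
      · refine iff_of_false ?_ (by simp [stdStr, stdLab, dataQ])
        change ¬ glue Y₀ inv leg (Sum.inr (Sum.inl a)) = _
        by_cases ha : inv a = a
        · obtain ⟨b, rfl⟩ := (hG.fixed a).1 ha
          rw [hG.glue_apply_leg]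
          simp
        · rw [hG.glue_of_ne ha]
          simpa using ha
      · exact iff_of_false (by simp [stdStr, glue]) (by simp [stdStr, stdLab, dataQ])

theorem IsFlagGraph.gConn [Nonempty Y₀] (hG : IsFlagGraph h inv leg) :
    (stdStr h (glue Y₀ inv leg) ρ φ s).GConn := by
  have hatt : ∀ a, (stdStr h (glue Y₀ inv leg) ρ φ s).GRel (Sum.inr (Sum.inl a))
    (Sum.inl (h a)) := fun a => .rel _ _ (Or.inl rfl)
  have h1 : ∀ v w, (stdStr h (glue Y₀ inv leg) ρ φ s).GRel (Sum.inl v) (Sum.inl w) := by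
    intro v w
    refine eqvGen_transfer Sum.inl ?_ (hG.connected v w)
    rintro _ _ ⟨a, rfl, rfl⟩
    by_cases ha : inv a = a
    · rw [ha]
      exact .refl _
    · exact ((hatt a).symm _ _).trans _ _ _
        (.trans _ _ _ (.rel _ _ (Or.inr (hG.glue_of_ne ha))) (hatt _))
  have h2 : ∀ z, ∃ v, (stdStr h (glue Y₀ inv leg) ρ φ s).GRel z (Sum.inl v) := by
    rintro (v | a | b)
    · exact ⟨v, .refl _⟩
    · exact ⟨_, hatt a⟩
    · exact ⟨_, .trans _ _ _ (.rel _ _ (Or.inr rfl)) (hatt _)⟩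
  refine ⟨⟨Sum.inl (Classical.arbitrary Y₀)⟩, fun a b => ?_⟩
  obtain ⟨v, hv⟩ := h2 a
  obtain ⟨w, hw⟩ := h2 b
  exact (hv.trans _ _ _ (h1 v w)).trans _ _ _ (hw.symm _ _)

/-- Two legs glued together would form a component of their own, which is impossible once a vertex
exists. Hence every leg is glued to a flag, and that flag becomes a fixed point of the involution of
the graph; all other flags are glued in pairs. -/
theorem exists_isFlagGraph [Nonempty Y₀] [Finite Y₀] [Finite Y₁] [Finite Y₂]
    {i : Y₀ ⊕ (Y₁ ⊕ Y₂) → Y₀ ⊕ (Y₁ ⊕ Y₂)}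
    (hv : (dataQ chi).Valid (stdStr h i ρ φ s)) (hc : (stdStr h i ρ φ s).GConn) :
    ∃ inv leg, IsFlagGraph h inv leg ∧ glue Y₀ inv leg = i := by
  have hii : ∀ z, i (i z) = z := fun z => (hv z).inv_inv
  have hfix : ∀ z, i z = z ↔ stdLab Y₀ Y₁ Y₂ z = 0 := fun z => (hv z).inv_eq_iff
  have hvert : ∀ v, i (Sum.inl v) = Sum.inl v := fun v => (hfix _).2 rfl
  have hne : ∀ z v, i (Sum.inr z) ≠ Sum.inl v := by
    intro z v hz
    have := hii (Sum.inr z)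
    rw [hz, hvert] at this
    exact absurd this (by simp)
  have hleg : ∀ b, ∃ a, i (Sum.inr (Sum.inr b)) = Sum.inr (Sum.inl a) := by
    intro b
    generalize hz : i (Sum.inr (Sum.inr b)) = z
    obtain v | a | b' := z
    · exact absurd hz (hne _ _)
    · exact ⟨a, rfl⟩
    -- The pair of legs `b`, `b'` is closed under attaching and gluing and contains no vertex,
    -- contrary to connectedness.
    · exfalso
      have hz' := hii (Sum.inr (Sum.inr b))
      rw [hz] at hz'
      have hp := (eqvGen_invariant (p := fun z : Y₀ ⊕ (Y₁ ⊕ Y₂) =>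
        z = Sum.inr (Sum.inr b) ∨ z = Sum.inr (Sum.inr b')) ?_
        (hc.2 (Sum.inr (Sum.inr b)) (Sum.inl (Classical.arbitrary Y₀)))).1 (Or.inl rfl)
      · simp at hp
      · rintro x y (hxy | hxy)
        · obtain v | a | c := x
          · rw [← hxy]; simp [stdStr, stdAtt]
          · rw [← hxy]; simp [stdStr, stdAtt]
          · rw [← hxy]; simp [stdStr, stdAtt]
        · have h1 : i x = y := hxy
          have h2 : x = i y := by rw [← h1, hii]
          constructor
          · rintro (rfl | rfl)
            · exact Or.inr (by rw [← h1, hz])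
            · exact Or.inl (by rw [← h1, hz'])
          · rintro (rfl | rfl)
            · exact Or.inr (by rw [h2, hz])
            · exact Or.inl (by rw [h2, hz'])
  choose leg hleg using hleg
  have hflag : ∀ a, ∃ a', (i (Sum.inr (Sum.inl a)) = Sum.inr (Sum.inl a') ∧ a' ≠ a) ∨
      (a' = a ∧ ∃ b, i (Sum.inr (Sum.inl a)) = Sum.inr (Sum.inr b)) := by
    intro a
    generalize hz : i (Sum.inr (Sum.inl a)) = z
    obtain v | a' | b := z
    · exact absurd hz (hne _ _)
    · refine ⟨a', Or.inl ⟨rfl, ?_⟩⟩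
      rintro rfl
      exact absurd ((hfix _).1 hz) (by simp [stdLab])
    · exact ⟨a, Or.inr ⟨rfl, b, rfl⟩⟩
  choose inv hinv using hflag
  have hinvol : Function.Involutive inv := by
    intro a
    rcases hinv a with ⟨h1, h2⟩ | ⟨h1, -⟩
    · have h3 := hii (Sum.inr (Sum.inl a))
      rw [h1] at h3
      rcases hinv (inv a) with ⟨h4, -⟩ | ⟨-, b, h4⟩
      · rw [h3] at h4
        exact (Sum.inl_injective (Sum.inr_injective h4)).symm
      · rw [h3] at h4
        simp at h4
    · rw [h1, h1]
  have hfixed : ∀ a, inv a = a ↔ ∃ b, leg b = a := by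
    intro a
    constructor
    · intro ha
      rcases hinv a with ⟨-, h2⟩ | ⟨-, b, h2⟩
      · exact absurd ha h2
      · refine ⟨b, ?_⟩
        have h3 := hii (Sum.inr (Sum.inl a))
        rw [h2, hleg] at h3
        exact Sum.inl_injective (Sum.inr_injective h3)
    · rintro ⟨b, rfl⟩
      have h3 := hii (Sum.inr (Sum.inr b))
      rw [hleg] at h3
      rcases hinv (leg b) with ⟨h2, -⟩ | ⟨h2, -⟩
      · rw [h3] at h2
        simp at h2
      · exact h2
  have hG : IsFlagGraph h hinvol.toPerm leg := by
    refine ⟨hinvol, fun b b' hb => ?_, hfixed, fun v w => ?_⟩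
    · have h1 := hii (Sum.inr (Sum.inr b))
      rw [hleg, hb, ← hleg, hii] at h1
      exact (Sum.inr_injective (Sum.inr_injective h1)).symm
    -- Contract every flag to its vertex and every leg to the vertex of its flag: gluings become
    -- edges or trivial steps.
    · refine eqvGen_transfer (Sum.elim id (Sum.elim h fun b => h (leg b))) ?_
        (hc.2 (Sum.inl v) (Sum.inl w))
      rintro z _ (rfl | rfl)
      · obtain v | a | b := z <;> exact .refl _
      · obtain v | a | b := z
        · have h1 : (stdStr h i ρ φ s).inv (Sum.inl v) = Sum.inl v := hvert v
          rw [h1]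
          exact .refl _
        · rcases hinv a with ⟨h1, -⟩ | ⟨h1, b, h2⟩
          · have h3 : (stdStr h i ρ φ s).inv (Sum.inr (Sum.inl a)) = _ := h1
            rw [h3]
            exact .rel _ _ ⟨a, rfl, rfl⟩
          · have h3 : (stdStr h i ρ φ s).inv (Sum.inr (Sum.inl a)) = _ := h2
            have h4 := hii (Sum.inr (Sum.inl a))
            rw [h2, hleg] at h4
            have h5 : leg b = a := Sum.inl_injective (Sum.inr_injective h4)
            rw [h3, ← h5]
            exact .refl _
        · have h3 : (stdStr h i ρ φ s).inv (Sum.inr (Sum.inr b)) = _ := hleg b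
          rw [h3]
          exact .refl _
  refine ⟨hinvol.toPerm, leg, hG, funext fun z => ?_⟩
  obtain v | a | b := z
  · exact (hvert v).symm
  · rcases hinv a with ⟨h1, h2⟩ | ⟨h1, b, h2⟩
    · rw [h1]
      exact hG.glue_of_ne h2
    · obtain ⟨b, rfl⟩ := (hfixed a).1 h1
      refine (hG.glue_apply_leg b).trans ?_
      rw [← hleg, hii]
  · exact (hleg b).symm

end Gluing

end ModularOperad

end

noncomputable section

namespace ModularOperad

universe w

/-! ### The contribution of the vertices -/

section Inverse

variable {Z : Type} [Finite Z] (τ : Equiv.Perm Z)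

theorem orbLen_inv (z : Z) : orbLen τ⁻¹ z = orbLen τ z := by
  have h : ∀ n : ℕ, (τ⁻¹ ^ n) z = z ↔ (τ ^ n) z = z := fun n => by
    rw [inv_pow, Equiv.Perm.inv_eq_iff_eq, eq_comm]
  refine Nat.dvd_antisymm ?_ ?_ <;> rw [← pow_eq_self_iff]
  · rw [h, pow_orbLen]
  · rw [← h, pow_orbLen]

theorem orbProd_inv {M : Type*} [CommMonoid M] (w : Z → M) (hw : ∀ z, w (τ z) = w z) :
    orbProd τ⁻¹ w = orbProd τ w :=
  orbProd_transfer id (fun _ _ => Equiv.Perm.sameCycle_inv) (fun _ => rfl)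
    (fun _ _ => eq_of_sameCycle hw) fun z _ => ⟨z, .refl _ _⟩

end Inverse

section Vertices

variable {k : Type w} [Field k] [CharZero k] {σ : Type} {Z : Type} [Fintype Z] [DecidableEq Z]

theorem coeff_eq_of_dvd_sub {R : Type*} [CommRing R] {f f' : PowerSeries R} {e : ℕ}
    (h : PowerSeries.X ^ (e + 1) ∣ f - f') : PowerSeries.coeff e f = PowerSeries.coeff e f' := by
  have := PowerSeries.X_pow_dvd_iff.1 h e (Nat.lt_succ_self e)
  rwa [map_sub, sub_eq_zero] at this

/-- The coefficient of `t ^ e` only depends on residues modulo `t ^ (e + 1)`, and reduction to the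
quotient ring commutes with products over orbits. -/
theorem coeff_orbProd_congr {R : Type*} [CommRing R] (τ : Equiv.Perm Z) (e : ℕ)
    {w w' : Z → PowerSeries R}
    (h : ∀ v, ∀ j ≤ e, PowerSeries.coeff j (w v) = PowerSeries.coeff j (w' v)) :
    PowerSeries.coeff e (orbProd τ w) = PowerSeries.coeff e (orbProd τ w') := by
  refine coeff_eq_of_dvd_sub ?_
  rw [← Ideal.mem_span_singleton, ← Ideal.Quotient.mk_eq_mk_iff_sub_mem]
  set I : Ideal (PowerSeries R) := Ideal.span {PowerSeries.X ^ (e + 1)}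
  refine (orbProd_map (Ideal.Quotient.mk I).toMonoidHom τ w).trans
    (Eq.trans (orbProd_congr τ fun v => ?_)
      (orbProd_map (Ideal.Quotient.mk I).toMonoidHom τ w').symm)
  refine Ideal.Quotient.mk_eq_mk_iff_sub_mem _ _ |>.2 ?_
  rw [Ideal.mem_span_singleton, PowerSeries.X_pow_dvd_iff]
  intro j hj
  rw [map_sub, h v j (by omega), sub_self]

variable (chi : ℕ → Multiset ℕ → k)

/-- The power of the grading variable contributed by a vertex of a given genus and valence. -/
def vertPow (σ : Type) (k : Type w) [Field k] (i n : ℕ) : GradedSeries σ k :=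
  if 2 < 2 * i + n then PowerSeries.X ^ (2 * i + n - 2) else 0

theorem coeff_vertSeries (ν : Multiset ℕ) (j B : ℕ) (hB : j + 2 < B) :
    PowerSeries.coeff j (vertSeries σ chi ν) = PowerSeries.coeff j
      (∑ i ∈ Finset.range B, vertPow σ k i ν.sum *
        PowerSeries.C (MvPolynomial.C (chi i ν))) := by
  rw [vertSeries, PowerSeries.coeff_mk, map_sum]
  have h1 : ∀ i, PowerSeries.coeff j (vertPow σ k i ν.sum *
      PowerSeries.C (MvPolynomial.C (chi i ν))) =
      MvPolynomial.C (if 0 < j then if 2 * i + ν.sum = j + 2 then chi i ν else 0 else 0) := by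
    intro i
    rw [PowerSeries.coeff_mul_C, vertPow]
    by_cases h : 2 < 2 * i + ν.sum
    · rw [if_pos h, PowerSeries.coeff_X_pow]
      by_cases h' : j = 2 * i + ν.sum - 2
      · rw [if_pos h', if_pos (by omega), if_pos (by omega), one_mul]
      · rw [if_neg h', zero_mul, if_neg (show ¬ 2 * i + ν.sum = j + 2 by omega), ite_self, map_zero]
    · rw [if_neg h, map_zero, zero_mul]
      split_ifs
      · omega
      · rw [map_zero]
      · rw [map_zero]
  rw [Finset.sum_congr rfl fun i _ => h1 i, ← map_sum]
  congr 1
  split_ifs with h0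
  · refine Finset.sum_subset ?_ fun i _ hi => if_neg ?_
    · intro i
      simp only [Finset.mem_range]
      omega
    · rw [Finset.mem_range] at hi
      omega
  · rw [Finset.sum_const_zero]

theorem adams_vertPow [PowerSumVars σ] [GradedVars σ] (n : ℕ+) (i j : ℕ) :
    adams n (vertPow σ k i j) = vertPow σ k i j ^ (n : ℕ) := by
  rw [vertPow]
  split_ifs
  · rw [map_pow, adams_X, ← pow_mul, ← pow_mul, mul_comm]
  · rw [map_zero, zero_pow n.ne_zero]

-- Modulo high powers of `t`, each vertex series is a finite sum over genera, so the product over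
-- orbits becomes a sum over genus functions constant on orbits. The Adams operation raises the
-- power of `t` of a vertex to the orbit length, which supplies one factor for every vertex of the
-- orbit.
open scoped Classical in
theorem coeff_orbProd_vertSeries [PowerSumVars σ] [GradedVars σ] (τ : Equiv.Perm Z)
    (ν : Z → Multiset ℕ) (hν : ∀ v, (ν (τ v)).sum = (ν v).sum) (e B : ℕ) (hB : e + 2 < B) :
    PowerSeries.coeff e (orbProd τ fun v =>
      adams (orbLen τ v).toPNat' (vertSeries σ chi (ν v))) =
    MvPolynomial.C (∑ gen ∈ Fintype.piFinset fun _ : Z => Finset.range B,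
      if (∀ v, gen (τ v) = gen v) ∧ (∀ v, 2 < 2 * gen v + (ν v).sum) ∧
        ∑ v, (2 * gen v + (ν v).sum - 2) = e
      then orbProd τ fun v => chi (gen v) (ν v) else 0) := by
  have hL : ∀ v, ((orbLen τ v).toPNat' : ℕ) = orbLen τ v := fun v =>
    PNat.toPNat'_coe (orbLen_pos τ v)
  let C' : k →+* GradedSeries σ k := (PowerSeries.C).comp MvPolynomial.C
  have h1 : ∀ v, ∀ j ≤ e, PowerSeries.coeff j
      (adams (orbLen τ v).toPNat' (vertSeries σ chi (ν v))) = PowerSeries.coeff j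
      (∑ i ∈ Finset.range B, vertPow σ k i (ν v).sum ^ orbLen τ v * C' (chi i (ν v))) := by
    intro v j hj
    have h2 : (∑ i ∈ Finset.range B, vertPow σ k i (ν v).sum ^ orbLen τ v * C' (chi i (ν v))) =
        adams (orbLen τ v).toPNat' (∑ i ∈ Finset.range B, vertPow σ k i (ν v).sum *
          PowerSeries.C (MvPolynomial.C (chi i (ν v)))) := by
      rw [map_sum]
      refine Finset.sum_congr rfl fun i _ => ?_
      rw [map_mul, adams_vertPow, adams_C, MvPolynomial.rename_C, hL]
      rfl
    rw [h2, coeff_adams, coeff_adams]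
    split_ifs
    · rw [coeff_vertSeries chi _ _ B]
      exact lt_of_le_of_lt (Nat.add_le_add_right ((Nat.div_le_self _ _).trans hj) 2) hB
    · rfl
  rw [coeff_orbProd_congr τ e h1, ← sum_invariant_prod, map_sum, Finset.sum_filter, map_sum]
  refine Finset.sum_congr rfl fun gen _ => ?_
  rw [ite_and]
  by_cases hgen : ∀ v, gen (τ v) = gen v
  · rw [if_pos hgen, if_pos hgen, orbProd_mul,
      ← prod_eq_orbProd τ (fun v => vertPow σ k (gen v) (ν v).sum) fun v => by rw [hgen, hν]]
    have h3 : orbProd τ (fun v => C' (chi (gen v) (ν v))) =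
        C' (orbProd τ fun v => chi (gen v) (ν v)) := (orbProd_map C'.toMonoidHom τ _).symm
    rw [h3]
    refine (PowerSeries.coeff_mul_C _ _ _).trans ?_
    by_cases hst : ∀ v, 2 < 2 * gen v + (ν v).sum
    · have h4 : ∏ v, vertPow σ k (gen v) (ν v).sum =
          PowerSeries.X ^ ∑ v, (2 * gen v + (ν v).sum - 2) := by
        rw [← Finset.prod_pow_eq_pow_sum]
        exact Finset.prod_congr rfl fun v _ => if_pos (hst v)
      rw [h4, PowerSeries.coeff_X_pow]
      by_cases he : ∑ v, (2 * gen v + (ν v).sum - 2) = e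
      · rw [if_pos he.symm, if_pos ⟨hst, he⟩, one_mul]
      · rw [if_neg (Ne.symm he), if_neg fun h => he h.2, zero_mul, map_zero]
    · rw [if_neg fun h => hst h.1, map_zero]
      push Not at hst
      obtain ⟨v, hv⟩ := hst
      rw [Finset.prod_eq_zero (Finset.mem_univ v) (if_neg hv.not_gt), map_zero, zero_mul]
  · rw [if_neg hgen, if_neg hgen, map_zero]

end Vertices

end ModularOperad

end

noncomputable section

namespace ModularOperad

universe w

/-! ### Sums over stable graphs -/

section FlagGraphs

variable {Y₀ Y₁ Y₂ : Type} [Fintype Y₀] [Fintype Y₁] [Fintype Y₂] [DecidableEq Y₀]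
  [DecidableEq Y₁] [DecidableEq Y₂] {h : Y₁ → Y₀} {inv : Equiv.Perm Y₁} {leg : Y₂ → Y₁}

theorem IsFlagGraph.card_support (hG : IsFlagGraph h inv leg) :
    inv.support.card + Fintype.card Y₂ = Fintype.card Y₁ := by
  have h1 : inv.supportᶜ = Finset.univ.image leg := by
    ext a
    have := hG.fixed a
    simpa using this
  rw [← Finset.card_add_card_compl inv.support, h1,
    Finset.card_image_of_injective _ hG.injective, Finset.card_univ]

theorem IsFlagGraph.two_dvd (hG : IsFlagGraph h inv leg) : 2 ∣ inv.support.card :=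
  Equiv.Perm.two_dvd_card_support (by ext1 a; simp [sq, hG.inv_inv])

/-- A connected graph with `m` vertices has at least `m - 1` edges. -/
theorem IsFlagGraph.card_le [Nonempty Y₀] (hG : IsFlagGraph h inv leg) :
    2 * Fintype.card Y₀ ≤ inv.support.card + 2 := by
  classical
  -- The underlying simple graph forgets loops and multiple edges, which only decreases the number
  -- of edges, and it is still connected.
  let S : SimpleGraph Y₀ := SimpleGraph.fromRel fun v w => ∃ a, h a = v ∧ h (inv a) = w
  have hS : S.Connected := by
    refine ⟨fun v w => ?_⟩
    induction hG.connected v w with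
    | rel v w hvw =>
      by_cases hne : v = w
      · rw [hne]
      · exact SimpleGraph.Adj.reachable ((SimpleGraph.fromRel_adj _ _ _).2 ⟨hne, Or.inl hvw⟩)
    | refl => exact .refl _
    | symm _ _ _ ih => exact ih.symm
    | trans _ _ _ _ _ ih ih' => exact ih.trans ih'
  have h1 := hS.card_vert_le_card_edgeSet_add_one
  rw [Nat.card_eq_fintype_card, Nat.card_eq_fintype_card, ← SimpleGraph.edgeFinset_card] at h1
  have h2 : S.edgeFinset ⊆ inv.support.image fun a => s(h a, h (inv a)) := by
    intro e
    induction e with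
    | _ v w =>
      rw [SimpleGraph.mem_edgeFinset, SimpleGraph.mem_edgeSet, SimpleGraph.fromRel_adj]
      rintro ⟨hne, ⟨a, rfl, rfl⟩ | ⟨a, rfl, rfl⟩⟩
      · refine Finset.mem_image.2 ⟨a, Equiv.Perm.mem_support.2 fun h' => hne ?_, rfl⟩
        rw [h']
      · refine Finset.mem_image.2 ⟨a, Equiv.Perm.mem_support.2 fun h' => hne ?_, Sym2.eq_swap⟩
        rw [h']
  -- Each edge in the image comes from at least two flags, namely `a` and `inv a`.
  have h3 := Finset.mul_card_image_le_card (f := fun a => s(h a, h (inv a))) inv.support 2 (by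
    intro e he
    obtain ⟨a, ha, rfl⟩ := Finset.mem_image.1 he
    have hne := Equiv.Perm.mem_support.1 ha
    rw [← Finset.card_pair hne]
    refine Finset.card_le_card fun b hb => ?_
    rw [Finset.mem_insert, Finset.mem_singleton] at hb
    rw [Finset.mem_filter]
    rcases hb with rfl | rfl
    · refine ⟨Equiv.Perm.apply_mem_support.2 ha, ?_⟩
      rw [hG.inv_inv]
      exact Sym2.eq_swap
    · exact ⟨ha, rfl⟩)
  have h4 := Finset.card_le_card h2
  omega

variable {k : Type w} [Field k] [CharZero k] (chi : ℕ → Multiset ℕ → k)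

-- With at least one vertex, valid connected gluings are the same as connected graphs with numbered
-- legs, and the valid triples of permutations are their automorphisms. Flags have weight `1`, so
-- only vertices and legs are left in the weight.
open scoped Classical in
theorem attSum_dataQ [Nonempty Y₀] (h : Y₁ → Y₀) : (dataQ chi).attSum Y₂ h =
    ∑ inv : Equiv.Perm Y₁, ∑ leg : Y₂ → Y₁, ∑ ρ, ∑ φ, ∑ s,
      if IsFlagGraph h inv leg ∧ IsFlagAut h inv leg ρ φ s then
        orbProd ρ (fun v => adams (orbLen ρ v).toPNat'
          (vertSeries ℕ+ chi (orbType (φ ^ orbLen ρ v) fun a => h a = v))) *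
        orbProd s (fun b => (dataQ chi).psi (orbLen s b) (dataQ chi).leg)
      else 0 := by
  rw [WeightData.attSum_eq_sum_stdStr]
  refine Eq.trans ?_ (Fintype.sum_prod_type' _)
  have h0 : ∀ (p : Equiv.Perm Y₁ × (Y₂ → Y₁)), ¬ IsFlagGraph h p.1 p.2 →
      ∑ ρ, ∑ φ, ∑ s, (if IsFlagGraph h p.1 p.2 ∧ IsFlagAut h p.1 p.2 ρ φ s then
        orbProd ρ (fun v => adams (orbLen ρ v).toPNat'
          (vertSeries ℕ+ chi (orbType (φ ^ orbLen ρ v) fun a => h a = v))) *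
        orbProd s (fun b => (dataQ chi).psi (orbLen s b) (dataQ chi).leg)
      else 0) = 0 := fun p hp => Finset.sum_eq_zero fun ρ _ => Finset.sum_eq_zero fun φ _ =>
    Finset.sum_eq_zero fun s _ => if_neg fun h' => hp h'.1
  refine Eq.trans ?_ (Finset.sum_filter_of_ne fun p _ hp => not_not.1 fun hp' => hp (h0 p hp'))
  symm
  refine Finset.sum_of_injOn (fun p => glue Y₀ p.1 p.2) ?_ (fun _ _ => by simp) ?_ ?_
  · intro p hp p' hp' hpp
    have h1 : IsFlagGraph h p.1 p.2 := by simpa using hp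
    have h2 : IsFlagGraph h p'.1 p'.2 := by simpa using hp'
    exact Prod.ext (h1.glue_injOn h2 hpp).1 (h1.glue_injOn h2 hpp).2
  · intro i _ hi
    refine Finset.sum_eq_zero fun ρ _ => Finset.sum_eq_zero fun φ _ =>
      Finset.sum_eq_zero fun s _ => ?_
    by_contra hw
    have hc : (stdStr h i ρ φ s).GConn := by
      by_contra hc
      exact hw (if_neg hc)
    obtain ⟨inv, leg, hG, rfl⟩ :=
      exists_isFlagGraph chi ((dataQ chi).valid_of_connWeight hw) hc
    exact hi ⟨(inv, leg), by simpa using hG, rfl⟩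
  · intro p hp
    have hG : IsFlagGraph h p.1 p.2 := by simpa using hp
    refine Finset.sum_congr rfl fun ρ _ => Finset.sum_congr rfl fun φ _ =>
      Finset.sum_congr rfl fun s _ => ?_
    rw [WeightData.connWeight, if_pos hG.gConn]
    by_cases hA : IsFlagAut h p.1 p.2 ρ φ s
    · have hv := (hG.valid_iff chi).2 hA
      rw [if_pos ⟨hG, hA⟩, hv.weight_stdStr]
      have h1 : orbProd φ (fun a => (dataQ chi).psi (orbLen φ a) (dataQ chi).flag) = 1 :=
        (orbProd_congr φ fun a => map_one _).trans (orbProd_one φ)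
      rw [h1, one_mul]
      rfl
    · rw [if_neg fun h' => hA h'.2, WeightData.weight_of_not_valid fun h' =>
        hA ((hG.valid_iff chi).1 h')]

theorem orbProd_psi_leg_dataQ {N : ℕ} (s : Equiv.Perm (Fin N)) :
    orbProd s (fun b => (dataQ chi).psi (orbLen s b) (dataQ chi).leg) =
      PowerSeries.C (cycleIndex k s) * PowerSeries.X ^ N := by
  have h1 : ∀ n : ℕ, 0 < n → (dataQ chi).psi n (dataQ chi).leg =
      PowerSeries.X ^ n * PowerSeries.C (powerSum k n) := by
    intro n hn
    refine (map_mul (adams n.toPNat') _ _).trans ?_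
    rw [adams_X, adams_C, MvPolynomial.rename_X, PNat.toPNat'_coe hn]
    congr 2
    exact congrArg MvPolynomial.X (mul_one _)
  rw [orbProd_congr s fun b => h1 _ (orbLen_pos s b), orbProd_mul, mul_comm]
  congr 1
  · rw [orbProd_orbLen s fun n => PowerSeries.C (powerSum k n), cycleIndex, map_multiset_prod,
      Multiset.map_map]
    rfl
  · rw [← prod_eq_orbProd s (fun _ => (PowerSeries.X : GradedSeries ℕ+ k)) fun _ => rfl]
    simp

end FlagGraphs

section StableGraphs

variable {M : Type*} [AddCommMonoid M] {m N : ℕ} {gen val : Fin m → ℕ}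

theorem StableGraph.isFlagGraph {g : ℕ} (G : StableGraph g N gen val) :
    IsFlagGraph Sigma.fst G.inv G.leg :=
  ⟨G.inv_inv, G.leg_injective, fun a => (Set.ext_iff.1 G.range_leg a).symm, G.connected⟩

theorem sum_vertexDegrees (hst : ∀ v, 2 < 2 * gen v + val v) :
    ∑ v, (2 * gen v + val v - 2) + 2 * m = 2 * ∑ v, gen v + ∑ v, val v := by
  have h1 : ∑ v : Fin m, 2 = 2 * m := by simp [mul_comm]
  rw [← h1, ← Finset.sum_add_distrib, Finset.mul_sum, ← Finset.sum_add_distrib]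
  exact Finset.sum_congr rfl fun v _ => by have := hst v; omega

-- The degree in `t`, with one extra unit for each leg, equals `2 * (g - 1) + 2 * N` by the genus
-- formula. Thus `d` and `N` determine the genus, and the flag graphs of degree `d` are the stable
-- graphs of that genus.
open scoped Classical in
theorem sum_isFlagGraph (hm : 0 < m) (d B : ℕ) (hB : d + 2 < B)
    (F : Equiv.Perm (Σ v, Fin (val v)) → (Fin N → Σ v, Fin (val v)) → M) :
    ∑ inv, ∑ leg, (if IsFlagGraph Sigma.fst inv leg ∧ (∀ v, 2 < 2 * gen v + val v) ∧
        ∑ v, (2 * gen v + val v - 2) + N = d then F inv leg else 0) =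
      ∑ g ∈ Finset.range B, if d + 2 = 2 * g + 2 * N then
        ∑ G ∈ (Set.finite_univ (α := StableGraph g N gen val)).toFinset, F G.inv G.leg
        else 0 := by
  have : Nonempty (Fin m) := ⟨⟨0, hm⟩⟩
  have key : ∀ inv (leg : Fin N → Σ v, Fin (val v)), IsFlagGraph Sigma.fst inv leg →
      (∀ v, 2 < 2 * gen v + val v) → ∑ v, (2 * gen v + val v - 2) + N = d →
      ∃ g, d + 2 = 2 * g + 2 * N ∧ ∑ v, gen v + inv.support.card / 2 + 1 = g + m := by
    intro inv leg hG hst hd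
    have h1 := hG.card_support
    have h2 := hG.two_dvd
    have h3 := hG.card_le
    have h4 := sum_vertexDegrees hst
    simp only [Fintype.card_sigma, Fintype.card_fin] at h1 h3
    -- The subtraction does not truncate: by `IsFlagGraph.card_le` a connected graph has at least `m
    -- - 1` edges, so the genus is a natural number.
    refine ⟨∑ v, gen v + inv.support.card / 2 + 1 - m, ?_, ?_⟩ <;> omega
  by_cases hg : ∃ g, d + 2 = 2 * g + 2 * N
  · obtain ⟨g, hg⟩ := hg
    rw [Finset.sum_eq_single_of_mem g (Finset.mem_range.2 (by omega)) fun g' _ hne =>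
      if_neg (by omega), if_pos hg, ← Fintype.sum_prod_type']
    symm
    refine Finset.sum_of_injOn (fun G => (G.inv, G.leg)) ?_ (fun _ _ => by simp) ?_ ?_
    · intro G _ G' _ h
      exact StableGraph.ext' (Prod.mk.inj h).1 (Prod.mk.inj h).2
    · rintro ⟨inv, leg⟩ _ h
      refine if_neg fun h' => h ?_
      obtain ⟨hG, hst, hd⟩ := h'
      obtain ⟨g', hg', hgen⟩ := key inv leg hG hst hd
      obtain rfl : g' = g := by omega
      refine ⟨⟨inv, hG.inv_inv, leg, hG.injective, Set.ext fun a => (hG.fixed a).symm, hst, hm,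
        hG.connected, hgen⟩, by simp, rfl⟩
    · intro G _
      refine (if_pos ⟨G.isFlagGraph, G.stable, ?_⟩).symm
      have h1 := G.isFlagGraph.card_support
      have h2 := G.isFlagGraph.two_dvd
      have h4 := sum_vertexDegrees G.stable
      have h5 := G.genus_eq
      simp only [Fintype.card_sigma, Fintype.card_fin] at h1
      omega
  · rw [Finset.sum_eq_zero, Finset.sum_eq_zero]
    · exact fun g _ => if_neg fun h => hg ⟨g, h⟩
    · refine fun inv _ => Finset.sum_eq_zero fun leg _ => if_neg ?_
      rintro ⟨hG, hst, hd⟩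
      obtain ⟨g, h, -⟩ := key inv leg hG hst hd
      exact hg ⟨g, h⟩

end StableGraphs

end ModularOperad

end

noncomputable section

namespace ModularOperad

universe w

/-! ### Gluings as sums over stable graphs -/

theorem sum_rotate {A M : Type*} [AddCommMonoid M] {a b c d : Type*} (s : Finset A)
    (sa : Finset a) (sb : Finset b) (sc : Finset c) (sd : Finset d) (f : a → b → c → d → A → M) :
    ∑ x ∈ sa, ∑ y ∈ sb, ∑ z ∈ sc, ∑ w ∈ sd, ∑ e ∈ s, f x y z w e =
      ∑ e ∈ s, ∑ x ∈ sa, ∑ y ∈ sb, ∑ z ∈ sc, ∑ w ∈ sd, f x y z w e := by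
  symm
  refine Finset.sum_comm.trans (Finset.sum_congr rfl fun _ _ => ?_)
  refine Finset.sum_comm.trans (Finset.sum_congr rfl fun _ _ => ?_)
  refine Finset.sum_comm.trans (Finset.sum_congr rfl fun _ _ => ?_)
  exact Finset.sum_comm

section

variable {k : Type w} [Field k] [CharZero k] (chi : ℕ → Multiset ℕ → k) {m N : ℕ}
  {val : Fin m → ℕ}

/-- The contribution of an automorphism of a graph with given genera of the vertices. -/
def autWeight (gen : Fin m → ℕ) (τ : Equiv.Perm (Fin m)) (φ : Equiv.Perm (Σ v, Fin (val v))) : k :=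
  orbProd τ fun v => chi (gen v) (orbType (φ ^ orbLen τ v) fun a => a.1 = v)

-- The inverse appears because `StableGraph.IsAut` describes vertices by the inverse of their actual
-- permutation; orbits and orbit lengths are the same for both. The legs contribute the cycle index
-- of `s` and a further `t ^ N`.
open scoped Classical in
theorem coeff_gluing_term {inv : Equiv.Perm (Σ v, Fin (val v))} {leg : Fin N → Σ v, Fin (val v)}
    {τ : Equiv.Perm (Fin m)} {φ : Equiv.Perm (Σ v, Fin (val v))} {s : Equiv.Perm (Fin N)}
    (hA : IsFlagAut Sigma.fst inv leg τ⁻¹ φ s) (d B : ℕ) (hB : d + 2 < B) :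
    PowerSeries.coeff d (orbProd τ⁻¹ (fun v => adams (orbLen τ⁻¹ v).toPNat'
          (vertSeries ℕ+ chi (orbType (φ ^ orbLen τ⁻¹ v) fun a => a.1 = v))) *
        orbProd s (fun b => (dataQ chi).psi (orbLen s b) (dataQ chi).leg)) =
      MvPolynomial.C (∑ gen ∈ Fintype.piFinset fun _ : Fin m => Finset.range B,
        if (∀ v, gen (τ v) = gen v) ∧ (∀ v, 2 < 2 * gen v + val v) ∧
          ∑ v, (2 * gen v + val v - 2) + N = d then autWeight chi gen τ φ else 0) *
        cycleIndex k s := by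
  have hfst : ∀ a, τ (φ a).1 = a.1 := fun a => by
    rw [hA.att]
    exact τ.apply_symm_apply _
  have hsum : ∀ v, (orbType (φ ^ orbLen τ v) fun a => a.1 = v).sum = val v := fun v =>
    StableSModule.sum_orbType_pow hfst (pow_orbLen τ v)
  have htype : ∀ v, orbType (φ ^ orbLen τ (τ v)) (fun a => a.1 = τ v) =
      orbType (φ ^ orbLen τ v) fun a => a.1 = v := by
    intro v
    rw [orbLen_apply]
    refine orbType_transfer φ φ.injective (fun a => ?_) (fun a => ?_)
      (fun a => StableSModule.fst_pow_iff hfst (pow_orbLen τ v) a) fun a _ => φ.surjective a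
    · rw [← Equiv.Perm.mul_apply, ← Equiv.Perm.mul_apply, ← pow_succ, ← pow_succ']
    · rw [← hfst a, τ.injective.eq_iff]
  rw [orbProd_psi_leg_dataQ, ← mul_assoc, PowerSeries.coeff_mul_X_pow', PowerSeries.coeff_mul_C]
  simp only [orbLen_inv]
  rw [orbProd_inv τ _ fun v => by rw [htype, orbLen_apply]]
  split_ifs with hN
  · rw [coeff_orbProd_vertSeries chi τ _ (fun v => by rw [htype]) (d - N) B (by omega)]
    congr 2
    refine Finset.sum_congr rfl fun gen _ => ?_
    have hiff : ((∀ v, gen (τ v) = gen v) ∧ (∀ v, 2 < 2 * gen v +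
        (orbType (φ ^ orbLen τ v) fun a => a.1 = v).sum) ∧
        ∑ v, (2 * gen v + (orbType (φ ^ orbLen τ v) fun a => a.1 = v).sum - 2) = d - N) ↔
        ((∀ v, gen (τ v) = gen v) ∧ (∀ v, 2 < 2 * gen v + val v) ∧
          ∑ v, (2 * gen v + val v - 2) + N = d) := by
      refine and_congr_right fun _ => and_congr (forall_congr' fun v => by rw [hsum]) ?_
      rw [Finset.sum_congr rfl fun v _ => by rw [hsum]]
      omega
    by_cases h : (∀ v, gen (τ v) = gen v) ∧ (∀ v, 2 < 2 * gen v + val v) ∧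
        ∑ v, (2 * gen v + val v - 2) + N = d
    · exact (if_pos (hiff.2 h)).trans (if_pos h).symm
    · exact (if_neg fun h' => h (hiff.1 h')).trans (if_neg h).symm
  · rw [Finset.sum_eq_zero, map_zero, zero_mul]
    intro gen _
    refine if_neg fun h => hN ?_
    have := h.2.2
    omega

open scoped Classical in
theorem coeff_attSum_dataQ (hm : 0 < m) (d B : ℕ) (hB : d + 2 < B) :
    PowerSeries.coeff d
      ((dataQ chi).attSum (Fin N) (Sigma.fst : (Σ v, Fin (val v)) → Fin m)) =
      ∑ s : Equiv.Perm (Fin N), MvPolynomial.C (∑ g ∈ Finset.range B,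
        if d + 2 = 2 * g + 2 * N then ∑ gen ∈ Fintype.piFinset fun _ : Fin m => Finset.range B,
          ∑ G ∈ (Set.finite_univ (α := StableGraph g N gen val)).toFinset, ∑ τ, ∑ φ,
            if G.IsAut s τ φ then autWeight chi gen τ φ else 0
        else 0) * cycleIndex k s := by
  have : Nonempty (Fin m) := ⟨⟨0, hm⟩⟩
  rw [attSum_dataQ, sum_rotate, map_sum]
  refine Finset.sum_congr rfl fun s _ => ?_
  have h1 : ∀ (inv : Equiv.Perm (Σ v, Fin (val v))) (leg : Fin N → Σ v, Fin (val v)),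
      PowerSeries.coeff d (∑ ρ : Equiv.Perm (Fin m), ∑ φ : Equiv.Perm (Σ v, Fin (val v)),
        if IsFlagGraph Sigma.fst inv leg ∧ IsFlagAut Sigma.fst inv leg ρ φ s then
        orbProd ρ (fun v => adams (orbLen ρ v).toPNat'
          (vertSeries ℕ+ chi (orbType (φ ^ orbLen ρ v) fun a => a.1 = v))) *
        orbProd s (fun b => (dataQ chi).psi (orbLen s b) (dataQ chi).leg)
        else 0) =
      MvPolynomial.C (∑ τ : Equiv.Perm (Fin m), ∑ φ : Equiv.Perm (Σ v, Fin (val v)),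
        ∑ gen ∈ Fintype.piFinset fun _ : Fin m => Finset.range B,
        if (IsFlagGraph Sigma.fst inv leg ∧ IsFlagAut Sigma.fst inv leg τ⁻¹ φ s) ∧
          (∀ v, gen (τ v) = gen v) ∧ (∀ v, 2 < 2 * gen v + val v) ∧
          ∑ v, (2 * gen v + val v - 2) + N = d then autWeight chi gen τ φ else 0) *
        cycleIndex k s := by
    intro inv leg
    rw [← Equiv.sum_comp (Equiv.inv (Equiv.Perm (Fin m))), map_sum, map_sum, Finset.sum_mul]
    refine Finset.sum_congr rfl fun τ _ => ?_
    rw [map_sum, map_sum, Finset.sum_mul]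
    refine Finset.sum_congr rfl fun φ _ => ?_
    rw [Equiv.inv_apply]
    by_cases h : IsFlagGraph Sigma.fst inv leg ∧ IsFlagAut Sigma.fst inv leg τ⁻¹ φ s
    · rw [if_pos h, coeff_gluing_term chi h.2 d B hB]
      simp only [h, true_and]
    · rw [if_neg h]
      simp only [h, false_and, if_false, Finset.sum_const_zero, map_zero, zero_mul]
  simp only [map_sum (PowerSeries.coeff d) _ (Finset.univ : Finset (Equiv.Perm (Σ v, Fin (val v)))),
    map_sum (PowerSeries.coeff d) _ (Finset.univ : Finset (Fin N → Σ v, Fin (val v)))]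
  simp only [h1, ← Finset.sum_mul, ← map_sum]
  congr 2
  rw [sum_rotate]
  have h2 : ∀ g ∈ Finset.range B, (if d + 2 = 2 * g + 2 * N then
        ∑ gen ∈ Fintype.piFinset fun _ : Fin m => Finset.range B,
          ∑ G ∈ (Set.finite_univ (α := StableGraph g N gen val)).toFinset, ∑ τ, ∑ φ,
            if G.IsAut s τ φ then autWeight chi gen τ φ else 0
        else 0) = ∑ gen ∈ Fintype.piFinset fun _ : Fin m => Finset.range B,
        if d + 2 = 2 * g + 2 * N then
          ∑ G ∈ (Set.finite_univ (α := StableGraph g N gen val)).toFinset, ∑ τ, ∑ φ,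
            if IsFlagAut Sigma.fst G.inv G.leg τ⁻¹ φ s ∧ ∀ v, gen (τ v) = gen v
            then autWeight chi gen τ φ else 0
        else 0 := by
    intro g _
    split_ifs
    · refine Finset.sum_congr rfl fun gen _ => Finset.sum_congr rfl fun G _ =>
        Finset.sum_congr rfl fun τ _ => Finset.sum_congr rfl fun φ _ => if_congr ?_ rfl rfl
      constructor
      · exact fun h => ⟨⟨fun a => Equiv.Perm.eq_inv_iff_eq.2 (h.fst a), h.inv, h.leg⟩, h.gen⟩
      · exact fun h => ⟨fun a => Equiv.Perm.eq_inv_iff_eq.1 (h.1.att a), h.2, h.1.inv, h.1.leg⟩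
    · exact Finset.sum_const_zero.symm
  rw [Finset.sum_congr rfl h2, Finset.sum_comm (s := Finset.range B)]
  refine Finset.sum_congr rfl fun gen _ => ?_
  rw [← sum_isFlagGraph hm d B hB fun inv leg => ∑ τ, ∑ φ,
    if IsFlagAut Sigma.fst inv leg τ⁻¹ φ s ∧ ∀ v, gen (τ v) = gen v
      then autWeight chi gen τ φ else 0]
  refine Finset.sum_congr rfl fun inv _ => Finset.sum_congr rfl fun leg _ => ?_
  split_ifs with h
  · refine Finset.sum_congr rfl fun τ _ => Finset.sum_congr rfl fun φ _ => if_congr ?_ rfl rfl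
    tauto
  · refine Finset.sum_eq_zero fun τ _ => Finset.sum_eq_zero fun φ _ => if_neg ?_
    tauto

end

end ModularOperad

end

noncomputable section

namespace ModularOperad

universe w u

/-! ### Gluings without vertices -/

section Empty

variable {k : Type w} [Field k] [CharZero k] (chi : ℕ → Multiset ℕ → k) {Y₀ Y₁ Y₂ : Type}
  [IsEmpty Y₀] [IsEmpty Y₁] [Fintype Y₀] [Fintype Y₁] [DecidableEq Y₀] [DecidableEq Y₁]
  (h : Y₁ → Y₀)

/-- Without vertices nothing is fixed by the gluing and attaching moves nothing, so a component
consists of one element and its partner. -/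
theorem card_eq_two_of_gConn [Fintype Y₂] [DecidableEq Y₂]
    {i : Y₀ ⊕ (Y₁ ⊕ Y₂) → Y₀ ⊕ (Y₁ ⊕ Y₂)} {ρ : Equiv.Perm Y₀}
    {φ : Equiv.Perm Y₁} {s : Equiv.Perm Y₂} (hv : (dataQ chi).Valid (stdStr h i ρ φ s))
    (hc : (stdStr h i ρ φ s).GConn) : Fintype.card Y₂ = 2 := by
  have hii : ∀ z, i (i z) = z := fun z => (hv z).inv_inv
  have hne : ∀ z, i z ≠ z := by
    intro z hz
    have : stdLab Y₀ Y₁ Y₂ z = 0 := (hv z).inv_eq_iff.1 hz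
    obtain v | a | b := z
    · exact isEmptyElim v
    · exact isEmptyElim a
    · exact absurd this (by simp [stdLab])
  have hatt : ∀ z, (stdStr h i ρ φ s).att z = z := by
    rintro (v | a | b)
    · exact isEmptyElim v
    · exact isEmptyElim a
    · rfl
  obtain ⟨⟨z⟩, hc⟩ := hc
  have hp : ∀ z', z' = z ∨ z' = i z := fun z' =>
    (eqvGen_invariant (p := fun z' => z' = z ∨ z' = i z) (by
      rintro x y (hxy | hxy)
      · rw [hatt] at hxy
        rw [hxy]
      · have h1 : i x = y := hxy
        rw [← h1]
        constructor
        · rintro (rfl | rfl)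
          · exact Or.inr rfl
          · exact Or.inl (hii _)
        · rintro (h2 | h2)
          · exact Or.inr (by rw [← h2, hii])
          · exact Or.inl (by rw [← hii x, h2, hii])) (hc z z')).1 (Or.inl rfl)
  have h1 : Fintype.card (Y₀ ⊕ (Y₁ ⊕ Y₂)) = 2 := by
    rw [← Finset.card_univ, Finset.card_eq_two]
    refine ⟨z, i z, (hne z).symm, ?_⟩
    ext z'
    simpa using hp z'
  simpa using h1

/-- The gluing of two legs. -/
def glueTwo (Y₀ Y₁ : Type) : Y₀ ⊕ (Y₁ ⊕ Fin 2) → Y₀ ⊕ (Y₁ ⊕ Fin 2) :=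
  Sum.elim Sum.inl (Sum.elim (fun a => Sum.inr (Sum.inl a))
    fun b => Sum.inr (Sum.inr (Equiv.swap 0 1 b)))

theorem valid_iff_glueTwo {i : Y₀ ⊕ (Y₁ ⊕ Fin 2) → Y₀ ⊕ (Y₁ ⊕ Fin 2)} {ρ : Equiv.Perm Y₀}
    {φ : Equiv.Perm Y₁} {s : Equiv.Perm (Fin 2)} :
    (dataQ chi).Valid (stdStr h i ρ φ s) ↔ i = glueTwo Y₀ Y₁ := by
  constructor
  · intro hv
    funext z
    obtain v | a | b := z
    · exact isEmptyElim v
    · exact isEmptyElim a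
    · have hne : i (Sum.inr (Sum.inr b)) ≠ Sum.inr (Sum.inr b) := fun hz =>
        absurd ((hv (Sum.inr (Sum.inr b))).inv_eq_iff.1 hz) (by simp [stdStr, stdLab, dataQ])
      change _ = Sum.inr (Sum.inr (Equiv.swap 0 1 b))
      generalize i (Sum.inr (Sum.inr b)) = z at hne ⊢
      obtain v | a | b' := z
      · exact isEmptyElim v
      · exact isEmptyElim a
      · have h1 : b' ≠ b := fun h' => hne (by rw [h'])
        have h2 : ∀ b b' : Fin 2, b' ≠ b → b' = Equiv.swap 0 1 b := by decide
        rw [h2 b b' h1]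
  · rintro rfl z
    obtain v | a | b := z
    · exact isEmptyElim v
    · exact isEmptyElim a
    · have h1 : ∀ (s : Equiv.Perm (Fin 2)) b, Equiv.swap 0 1 (s b) = s (Equiv.swap 0 1 b) := by
        decide
      have h3 : ∀ b : Fin 2, Equiv.swap 0 1 (Equiv.swap 0 1 b) = b := by decide
      refine ⟨rfl, rfl, congrArg (fun b => Sum.inr (Sum.inr b)) (h1 s b), ?_, ?_,
        congrArg (fun b => Sum.inr (Sum.inr b)) (h3 b), ?_⟩
      · simp [stdStr, stdLab]
      · exact fun _ => rfl
      · refine iff_of_false ?_ (by simp [stdStr, stdLab, dataQ])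
        change ¬ Sum.inr (Sum.inr (Equiv.swap 0 1 b)) = Sum.inr (Sum.inr b)
        have h2 : ∀ b : Fin 2, Equiv.swap 0 1 b ≠ b := by decide
        simpa using h2 b

theorem gConn_glueTwo (ρ : Equiv.Perm Y₀) (φ : Equiv.Perm Y₁) (s : Equiv.Perm (Fin 2)) :
    (stdStr h (glueTwo Y₀ Y₁) ρ φ s).GConn := by
  refine ⟨⟨Sum.inr (Sum.inr 0)⟩, ?_⟩
  rintro (v | a | b) (v' | a' | b')
  any_goals exact isEmptyElim v
  any_goals exact isEmptyElim a
  any_goals exact isEmptyElim v'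
  any_goals exact isEmptyElim a'
  by_cases hb : b' = b
  · rw [hb]
    exact .refl _
  · have h2 : ∀ b b' : Fin 2, b' ≠ b → b' = Equiv.swap 0 1 b := by decide
    rw [h2 b b' hb]
    exact .rel _ _ (Or.inr rfl)

/-- The only vertexless connected gluing is the edge joining two legs. Both permutations of the legs
are automorphisms, so it contributes `t ^ 2` times `q_1 ^ 2 + q_2`. -/
theorem attSum_dataQ_empty (N : ℕ) : (dataQ chi).attSum (Fin N) h =
    if N = 2 then ∑ s : Equiv.Perm (Fin N), PowerSeries.C (cycleIndex k s) * PowerSeries.X ^ N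
    else 0 := by
  rw [WeightData.attSum_eq_sum_stdStr]
  split_ifs with hN
  · subst hN
    rw [Finset.sum_eq_single_of_mem (glueTwo Y₀ Y₁) (Finset.mem_univ _)]
    · rw [Fintype.sum_subsingleton _ 1, Fintype.sum_subsingleton _ 1]
      refine Finset.sum_congr rfl fun s _ => ?_
      rw [WeightData.connWeight, if_pos (gConn_glueTwo h _ _ _),
        ((valid_iff_glueTwo chi h).2 rfl).weight_stdStr, orbProd_perm_one, orbProd_perm_one,
        Fintype.prod_empty, Fintype.prod_empty, one_mul, one_mul, orbProd_psi_leg_dataQ]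
    · intro i _ hi
      refine Finset.sum_eq_zero fun ρ _ => Finset.sum_eq_zero fun φ _ =>
        Finset.sum_eq_zero fun s _ => ?_
      by_contra hw
      exact hi ((valid_iff_glueTwo chi h).1 ((dataQ chi).valid_of_connWeight hw))
  · refine Finset.sum_eq_zero fun i _ => Finset.sum_eq_zero fun ρ _ =>
      Finset.sum_eq_zero fun φ _ => Finset.sum_eq_zero fun s _ => ?_
    by_contra hw
    have hc : (stdStr h i ρ φ s).GConn := by
      by_contra hc
      exact hw (if_neg hc)
    have := card_eq_two_of_gConn chi h ((dataQ chi).valid_of_connWeight hw) hc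
    simp at this
    exact hN this

theorem sum_cycleIndex_two : ∑ s : Equiv.Perm (Fin 2), cycleIndex k s =
    MvPolynomial.X 1 ^ 2 + MvPolynomial.X 2 := by
  have h1 : (Finset.univ : Finset (Equiv.Perm (Fin 2))) = {1, Equiv.swap 0 1} := by decide
  rw [h1, Finset.sum_pair (by decide)]
  congr 1
  · rw [cycleIndex, Equiv.Perm.parts_partition]
    simp [powerSum, sq]
    rfl
  · rw [cycleIndex, Equiv.Perm.parts_partition]
    have h2 : (Equiv.swap (0 : Fin 2) 1).cycleType = {2} :=
      ((Equiv.Perm.swap_isSwap_iff.2 (by decide)).isCycle.cycleType).trans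
        (congrArg _ (Equiv.Perm.card_support_swap (by decide)))
    have h3 : (Equiv.swap (0 : Fin 2) 1).support.card = 2 :=
      Equiv.Perm.card_support_swap (by decide)
    rw [h2, h3]
    simp [powerSum]
    rfl

end Empty

-- A stable graph has a vertex, so for `m = 0` the sum over graphs vanishes and only the exceptional
-- edge between two legs remains.
open scoped Classical in
theorem coeff_attSum_dataQ_add {k : Type w} [Field k] [CharZero k] (chi : ℕ → Multiset ℕ → k)
    {m N : ℕ} {val : Fin m → ℕ} (d B : ℕ) (hB : d + 2 < B) :
    PowerSeries.coeff d
      ((dataQ chi).attSum (Fin N) (Sigma.fst : (Σ v, Fin (val v)) → Fin m)) =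
      (∑ s : Equiv.Perm (Fin N), MvPolynomial.C (∑ g ∈ Finset.range B,
        if d + 2 = 2 * g + 2 * N then ∑ gen ∈ Fintype.piFinset fun _ : Fin m => Finset.range B,
          ∑ G ∈ (Set.finite_univ (α := StableGraph g N gen val)).toFinset, ∑ τ, ∑ φ,
            if G.IsAut s τ φ then autWeight chi gen τ φ else 0
        else 0) * cycleIndex k s) +
      if m = 0 ∧ N = 2 ∧ d = 2 then MvPolynomial.X 1 ^ 2 + MvPolynomial.X 2 else 0 := by
  rcases Nat.eq_zero_or_pos m with rfl | hm
  · have h0 : ∀ g (gen : Fin 0 → ℕ), IsEmpty (StableGraph g N gen val) := fun g gen =>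
      ⟨fun G => G.nonempty.false⟩
    have h1 : ∀ (s : Equiv.Perm (Fin N)), (∑ g ∈ Finset.range B,
        if d + 2 = 2 * g + 2 * N then ∑ gen ∈ Fintype.piFinset fun _ : Fin 0 => Finset.range B,
          ∑ G ∈ (Set.finite_univ (α := StableGraph g N gen val)).toFinset, ∑ τ, ∑ φ,
            if G.IsAut s τ φ then autWeight chi gen τ φ else 0
        else 0) = 0 := by
      intro s
      refine Finset.sum_eq_zero fun g _ => ?_
      split_ifs
      · refine Finset.sum_eq_zero fun gen _ => Finset.sum_eq_zero fun G _ => ?_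
        exact ((h0 g gen).false G).elim
      · rfl
    simp only [h1, map_zero, zero_mul, Finset.sum_const_zero, zero_add, true_and]
    rw [attSum_dataQ_empty]
    by_cases hN : N = 2
    · subst hN
      rw [if_pos rfl, ← Finset.sum_mul, PowerSeries.coeff_mul_X_pow', ← map_sum,
        PowerSeries.coeff_C, sum_cycleIndex_two]
      by_cases hd : d = 2
      · simp [hd]
      · have h2 : ¬ (2 = 2 ∧ d = 2) := fun h => hd h.2
        rw [if_neg h2]
        by_cases h3 : 2 ≤ d
        · rw [if_pos h3, if_neg (by omega)]
        · rw [if_neg h3]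
    · rw [if_neg hN, if_neg fun h => hN h.1, map_zero]
  · rw [coeff_attSum_dataQ chi hm d B hB, if_neg fun h => hm.ne' h.1, add_zero]

end ModularOperad

end

noncomputable section

namespace ModularOperad

universe w u

/-! ### The connected gluings and the characteristic of the free modular operad -/

section

variable {k : Type w} [Field k] [CharZero k] (V : StableSModule.{w, u} k)

-- Interchanging the summations collects, for the genus determined by `d` and `N`, the terms of
-- `chi_free`. The hypothesis on `B` suffices because `6 * g + 3 * N ≤ 3 * (2 * g + 2 * N) = 3 * (d
-- + 2)`.
open scoped Classical in
theorem StableSModule.sum_isoWeight (hV : V.FiniteDim) {N d B : ℕ} (hB : 3 * (d + 2) ≤ B)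
    (s : Equiv.Perm (Fin N)) :
    ∑ m ∈ Finset.range B, ∑ val ∈ Fintype.piFinset fun _ : Fin m => Finset.range B,
      isoWeight k val * ∑ g ∈ Finset.range B,
        (if d + 2 = 2 * g + 2 * N then ∑ gen ∈ Fintype.piFinset fun _ : Fin m => Finset.range B,
          ∑ G ∈ (Set.finite_univ (α := StableGraph g N gen val)).toFinset, ∑ τ, ∑ φ,
            if G.IsAut s τ φ then autWeight V.chi gen τ φ else 0
        else 0) =
    ∑ g ∈ Finset.range B, if d + 2 = 2 * g + 2 * N then
      V.free.chi g (orbType s fun _ => True) else 0 := by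
  simp only [Finset.mul_sum (Finset.range B), mul_ite, mul_zero]
  rw [Finset.sum_congr rfl fun m _ => Finset.sum_comm, Finset.sum_comm]
  refine Finset.sum_congr rfl fun g _ => ?_
  split_ifs with hg
  · rw [V.chi_free hV (by omega : 6 * g + 3 * N ≤ B)]
    refine Finset.sum_congr rfl fun m _ => ?_
    rw [Finset.sum_comm]
    refine Finset.sum_congr rfl fun val _ => ?_
    rw [Finset.mul_sum]
    rfl
  · simp

/-- The factor `1 / (m! ∏ (val v)!)` of the exponential generating function is absorbed by the
average defining the supertrace on the free operad, and `1 / N!` is left for the characteristic. For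
the exceptional edge, `1 / 2!` yields `h_2`. -/
theorem StableSModule.coeff_connSum_dataQ (hV : V.FiniteDim) (d B : ℕ) (hB : 4 * d + 6 < B) :
    PowerSeries.coeff d (dataQ V.chi).connSum =
      (if d = 2 then (2⁻¹ : ℚ) • (MvPolynomial.X 1 ^ 2 + MvPolynomial.X 2) else 0) +
      ∑ N ∈ Finset.range B, (N.factorial : ℚ)⁻¹ • ∑ s : Equiv.Perm (Fin N),
        MvPolynomial.C (∑ g ∈ Finset.range B, if d + 2 = 2 * g + 2 * N then
          V.free.chi g (orbType s fun _ => True) else 0) * cycleIndex k s := by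
  classical
  rw [(isGraded_dataQ V.chi).coeff_connSum d B (by omega)]
  simp only [coeff_attSum_dataQ_add V.chi d B (by omega), smul_add, Finset.sum_add_distrib]
  rw [add_comm]
  congr 1
  · rw [Finset.sum_eq_single_of_mem 0 (Finset.mem_range.2 (by omega)) fun m _ hm =>
      Finset.sum_eq_zero fun N _ => Finset.sum_eq_zero fun val _ => by
        rw [if_neg fun h => hm h.1, smul_zero],
      Finset.sum_eq_single_of_mem 2 (Finset.mem_range.2 (by omega)) fun N _ hN =>
        Finset.sum_eq_zero fun val _ => by rw [if_neg fun h => hN h.2.1, smul_zero],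
      Finset.sum_eq_single_of_mem (default : Fin 0 → ℕ)
          (Fintype.mem_piFinset.2 fun v => v.elim0) fun val _ h => absurd (Subsingleton.elim _ _) h]
    split_ifs with h1 h2
    · simp
    · exact absurd h1.2.2 h2
    · exact absurd ⟨rfl, rfl, ‹_›⟩ h1
    · rw [smul_zero]
  · rw [Finset.sum_comm]
    refine Finset.sum_congr rfl fun N _ => ?_
    have h1 : ∀ s : Equiv.Perm (Fin N), (∑ g ∈ Finset.range B, if d + 2 = 2 * g + 2 * N then
        V.free.chi g (orbType s fun _ => True) else 0) = _ := fun s =>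
      (V.sum_isoWeight hV (by omega : 3 * (d + 2) ≤ B) s).symm
    simp only [h1, map_sum MvPolynomial.C _ (Finset.range B), Finset.sum_mul (Finset.range B)]
    rw [Finset.sum_comm, Finset.smul_sum]
    refine Finset.sum_congr rfl fun m _ => ?_
    simp only [map_sum MvPolynomial.C _ (Fintype.piFinset fun _ : Fin m => Finset.range B),
      Finset.sum_mul (Fintype.piFinset fun _ : Fin m => Finset.range B)]
    rw [Finset.sum_comm, Finset.smul_sum]
    refine Finset.sum_congr rfl fun val _ => ?_
    rw [Finset.smul_sum, Finset.smul_sum]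
    refine Finset.sum_congr rfl fun s _ => ?_
    rw [← Finset.sum_mul, ← map_sum]
    simp only [← Rat.cast_smul_eq_qsmul k, ← MvPolynomial.smul_eq_C_mul, smul_smul]
    congr 1
    rw [isoWeight, Finset.prod_inv_distrib]
    push_cast
    ring

end

end ModularOperad

end

noncomputable section

namespace ModularOperad

universe w u

/-! ### Characteristics -/

theorem isWeightedHomogeneous_cycleIndex (k : Type w) [Field k] {n : ℕ} (s : Equiv.Perm (Fin n)) :
    MvPolynomial.IsWeightedHomogeneous (fun i : ℕ+ => (i : ℕ)) (cycleIndex k s) n := by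
  have h : ∀ m : Multiset ℕ, (∀ a ∈ m, 0 < a) → MvPolynomial.IsWeightedHomogeneous
      (fun i : ℕ+ => (i : ℕ)) (m.map (powerSum k)).prod m.sum := by
    intro m
    induction m using Multiset.induction with
    | empty => exact fun _ => MvPolynomial.isWeightedHomogeneous_one k _
    | cons a m ih =>
      intro hm
      rw [Multiset.map_cons, Multiset.prod_cons, Multiset.sum_cons]
      refine MvPolynomial.IsWeightedHomogeneous.mul ?_
        (ih fun b hb => hm b (Multiset.mem_cons_of_mem hb))
      have h1 := MvPolynomial.isWeightedHomogeneous_X k (fun i : ℕ+ => (i : ℕ)) a.toPNat'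
      rwa [PNat.toPNat'_coe (hm a (Multiset.mem_cons_self a m))] at h1
  have h2 := h s.partition.parts fun a ha => s.partition.parts_pos ha
  have h3 : s.partition.parts.sum = n := s.partition.parts_sum.trans (Fintype.card_fin n)
  rw [h3] at h2
  exact h2

namespace StableSModule

variable {k : Type w} [Field k] (V : StableSModule.{w, u} k)

theorem ch_eq (hV : V.FiniteDim) (g n : ℕ) : V.ch g n = (n.factorial : k)⁻¹ •
    ∑ s : Equiv.Perm (Fin n), V.chi g (orbType s fun _ => True) • cycleIndex k s := by
  have hD : ∀ i, Nontrivial (V.obj g n i) → i ∈ (hV g n).2.toFinset := fun i hi => by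
    simpa using hi
  have h1 : ∀ s : Equiv.Perm (Fin n), V.chi g (orbType s fun _ => True) =
      ∑ i ∈ (hV g n).2.toFinset, ((i.negOnePow : ℤ) : k) *
        LinearMap.trace k (V.obj g n i) (V.rep g n i s) := by
    intro s
    have hs : (orbType s fun _ => True).sum = n := by
      rw [sum_orbType s fun _ => Iff.rfl]
      simp
    rw [V.chi_eq_sum (D := (hV g n).2.toFinset) (by rwa [hs])]
    exact Finset.sum_congr rfl fun i _ => by rw [typeTrace_orbType]
  rw [ch, finsum_eq_sum_of_support_subset (s := (hV g n).2.toFinset)]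
  · simp only [h1, Finset.sum_smul]
    rw [Finset.sum_comm, Finset.smul_sum]
    refine Finset.sum_congr rfl fun i _ => ?_
    rw [smul_comm]
    congr 1
    rw [Finset.smul_sum]
    refine Finset.sum_congr rfl fun s _ => ?_
    rw [mul_smul, Int.cast_smul_eq_zsmul]
  · intro i hi
    refine hD i ?_
    by_contra h
    have := not_nontrivial_iff_subsingleton.1 h
    refine hi ?_
    dsimp only
    rw [Finset.sum_eq_zero, smul_zero, smul_zero]
    intro s _
    rw [Subsingleton.elim (V.rep g n i s) 0, map_zero, zero_smul]

theorem ch_eq_zero {g n : ℕ} (h : 2 * g + n ≤ 2) : V.ch g n = 0 := by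
  rw [ch, ← finsum_zero (α := ℤ)]
  refine finsum_congr fun i => ?_
  have := V.stable g n i h
  rw [Finset.sum_eq_zero, smul_zero, smul_zero]
  intro s _
  rw [Subsingleton.elim (V.rep g n i s) 0, map_zero, zero_smul]

theorem isWeightedHomogeneous_ch (hV : V.FiniteDim) (g n : ℕ) :
    MvPolynomial.IsWeightedHomogeneous (fun i : ℕ+ => (i : ℕ)) (V.ch g n) n := by
  rw [V.ch_eq hV]
  refine Submodule.smul_mem (MvPolynomial.weightedHomogeneousSubmodule k _ n) _
    (Submodule.sum_mem _ fun s _ => Submodule.smul_mem _ _ ?_)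
  exact isWeightedHomogeneous_cycleIndex k s

theorem coeff_Ch (α : ℕ+ →₀ ℕ) (e : ℤ) : (MvPowerSeries.coeff α V.Ch).coeff e =
    if 0 ≤ e + 1 then
      MvPolynomial.coeff α (V.ch (e + 1).toNat (α.sum fun i a => (i : ℕ) * a)) else 0 := by
  have h1 : MvPowerSeries.coeff α V.Ch = hbar k (-1) * HahnSeries.ofPowerSeries ℤ k
    (PowerSeries.mk fun g => if 2 < 2 * g + α.sum (fun i a => (i : ℕ) * a) then
      MvPolynomial.coeff α (V.ch g (α.sum fun i a => (i : ℕ) * a)) else 0) := rfl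
  rw [h1, hbar, HahnSeries.coeff_single_mul, one_mul, sub_neg_eq_add, PowerSeries.coeff_coe]
  by_cases he : 0 ≤ e + 1
  · rw [if_neg (not_lt.2 he), if_pos he, PowerSeries.coeff_mk]
    have h2 : (e + 1).natAbs = (e + 1).toNat := by omega
    rw [h2]
    split_ifs with h3
    · rfl
    · rw [V.ch_eq_zero (not_lt.1 h3), MvPolynomial.coeff_zero]
  · rw [if_pos (not_le.1 he), if_neg he]

end StableSModule

section Genus

variable {k : Type w} [Field k] {σ : Type} {wt : σ → ℕ} {f : GradedSeries σ k}
  {a : ℕ → ℕ → MvPolynomial σ k} {w : ℕ → ℕ}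

/-- From `d + 2 = 2 * g + w n`, the sum of the degree `d` and the weight `w n` is `2 * (g + w n -
1)`. -/
theorem mem_evenSeries_of_coeff_eq_sum
    (ha : ∀ g n, MvPolynomial.IsWeightedHomogeneous wt (a g n) (w n))
    (hf : ∀ d, ∃ B, PowerSeries.coeff d f = ∑ n ∈ Finset.range B, ∑ g ∈ Finset.range B,
      if d + 2 = 2 * g + w n then a g n else 0) : f ∈ evenSeries k wt := by
  intro d α h
  obtain ⟨B, hB⟩ := hf d
  rw [hB, MvPolynomial.coeff_sum] at h
  obtain ⟨n, -, h⟩ := Finset.exists_ne_zero_of_sum_ne_zero h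
  rw [MvPolynomial.coeff_sum] at h
  obtain ⟨g, -, h⟩ := Finset.exists_ne_zero_of_sum_ne_zero h
  split_ifs at h with hd
  · rw [ha g n h]
    exact ⟨g + w n - 1, by omega⟩
  · simp at h

/-- The weight of `α` determines `n` by injectivity of `w`, and the relation `2 * e + w n + 2 = 2 *
g + w n` then gives `g = e + 1`. So a coefficient of the Laurent series picks out one term of the
double sum. -/
theorem coeff_toSeries_of_coeff_eq_sum (hw : Function.Injective w) (hle : ∀ n, n ≤ w n)
    (ha : ∀ g n, MvPolynomial.IsWeightedHomogeneous wt (a g n) (w n))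
    (hf : ∀ d B, 4 * d + 6 < B → PowerSeries.coeff d f = ∑ n ∈ Finset.range B,
      ∑ g ∈ Finset.range B, if d + 2 = 2 * g + w n then a g n else 0)
    {α : σ →₀ ℕ} {n : ℕ} (hn : Finsupp.weight wt α = w n) (e : ℤ) :
    (MvPowerSeries.coeff α (toSeries wt f)).coeff e = if 0 ≤ e + 1 ∧ 0 ≤ 2 * e + w n then
      MvPolynomial.coeff α (a (e + 1).toNat n) else 0 := by
  rw [coeff_toSeries, hn]
  by_cases hd : 0 ≤ 2 * e + (w n : ℤ)
  · rw [if_pos hd, hf _ (4 * (2 * e + (w n : ℤ)).toNat + 7 + w n) (by omega), MvPolynomial.coeff_sum,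
      Finset.sum_eq_single_of_mem n (Finset.mem_range.2 (by have := hle n; omega))]
    · by_cases he : 0 ≤ e + 1
      · rw [if_pos ⟨he, hd⟩, Finset.sum_eq_single_of_mem (e + 1).toNat
          (Finset.mem_range.2 (by omega)) fun g _ hg => if_neg (by omega), if_pos (by omega)]
      · rw [if_neg fun h => he h.1, Finset.sum_eq_zero, MvPolynomial.coeff_zero]
        exact fun g _ => if_neg (by omega)
    · intro n' _ hne
      rw [MvPolynomial.coeff_sum]
      refine Finset.sum_eq_zero fun g _ => ?_
      split_ifs
      · exact (ha g n').coeff_eq_zero α (by rw [hn]; exact fun h => hne (hw h).symm)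
      · rfl
  · rw [if_neg hd, if_neg fun h => hd h.2]

end Genus

end ModularOperad

end

noncomputable section

namespace ModularOperad

universe w u

/-! ### The connected sums as characteristics -/

/-- The exponent of `ħ` is `(d - w) / 2 = -1`. Both exceptional terms, `t p_1 q_1` of weight three
and `t ^ 2` times a polynomial of weight four, have this form. -/
theorem toSeries_X_pow_mul_C {k : Type w} [Field k] {σ : Type} {wt : σ → ℕ}
    {P : MvPolynomial σ k} {w d : ℕ} (hP : MvPolynomial.IsWeightedHomogeneous wt P w)
    (hd : d + 2 = w) : toSeries wt (PowerSeries.X ^ d * PowerSeries.C P) =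
      hbar k (-1) • ((P.map (HahnSeries.C : k →+* LaurentSeries k) :
        MvPolynomial σ (LaurentSeries k)) : PowerSumSeries σ k) := by
  refine PowerSumSeries.ext' fun α e => ?_
  rw [MvPowerSeries.coeff_smul, MvPolynomial.coeff_coe, MvPolynomial.coeff_map, coeff_toSeries,
    PowerSeries.coeff_mul_C, PowerSeries.coeff_X_pow, hbar]
  refine Eq.trans ?_ HahnSeries.coeff_single_mul.symm
  rw [HahnSeries.C_apply, HahnSeries.coeff_single]
  by_cases hα : Finsupp.weight wt α = w
  · rw [hα]
    by_cases he : e = -1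
    · rw [if_pos (by omega), if_pos (by omega), if_pos (by omega), one_mul, one_mul]
    · rw [if_neg (show ¬ e - -1 = 0 by omega), mul_zero]
      split_ifs
      · omega
      · rw [zero_mul, MvPolynomial.coeff_zero]
      · rfl
  · have h0 := hP.coeff_eq_zero α hα
    simp only [h0, ite_self, mul_zero]
    split_ifs <;> simp [h0]

theorem X_pow_mul_C_mem_evenSeries {k : Type w} [Field k] {σ : Type} {wt : σ → ℕ}
    {P : MvPolynomial σ k} {w d : ℕ} (hP : MvPolynomial.IsWeightedHomogeneous wt P w)
    (hd : d + 2 = w) : PowerSeries.X ^ d * PowerSeries.C P ∈ evenSeries k wt := by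
  intro d' α h
  rw [PowerSeries.coeff_mul_C, PowerSeries.coeff_X_pow] at h
  split_ifs at h with h1
  · rw [one_mul] at h
    rw [hP h]
    exact ⟨d + 1, by omega⟩
  · simp at h

namespace StableSModule

variable {k : Type w} [Field k] [CharZero k] (V : StableSModule.{w, u} k)

theorem sum_chi_mul (hV : V.FiniteDim) {σ : Type} (F : MvPolynomial ℕ+ k →ₐ[k] MvPolynomial σ k)
    (n : ℕ) (S : Finset ℕ) (p : ℕ → Prop) [DecidablePred p] :
    (n.factorial : ℚ)⁻¹ • ∑ s : Equiv.Perm (Fin n), MvPolynomial.C (∑ g ∈ S,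
        if p g then V.chi g (orbType s fun _ => True) else 0) * F (cycleIndex k s) =
      ∑ g ∈ S, if p g then F (V.ch g n) else 0 := by
  simp only [map_sum MvPolynomial.C, Finset.sum_mul]
  rw [Finset.sum_comm, Finset.smul_sum]
  refine Finset.sum_congr rfl fun g _ => ?_
  split_ifs
  · rw [V.ch_eq hV, map_smul, map_sum, ← Rat.cast_smul_eq_qsmul k]
    push_cast
    congr 1
    refine Finset.sum_congr rfl fun s _ => ?_
    rw [map_smul, MvPolynomial.smul_eq_C_mul]
  · simp

/-- The part of the connected sum without gluings that comes from vertices. -/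
def vertexPart : GradedSeries (ℕ+ ⊕ ℕ+) k := (dataP V.chi).connSum -
  PowerSeries.X ^ 1 * PowerSeries.C (MvPolynomial.X (Sum.inl 1) * MvPolynomial.X (Sum.inr 1))

theorem coeff_vertexPart (hV : V.FiniteDim) (d B : ℕ) (hB : 4 * d + 6 < B) :
    PowerSeries.coeff d V.vertexPart = ∑ n ∈ Finset.range B, ∑ g ∈ Finset.range B,
      if d + 2 = 2 * g + n then MvPolynomial.rename Sum.inl (V.ch g n) else 0 := by
  rw [vertexPart, map_sub, coeff_connSum_dataP V.chi d B (by omega), PowerSeries.coeff_mul_C,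
    PowerSeries.coeff_X_pow, ite_mul, one_mul, zero_mul, add_sub_cancel_left]
  refine Finset.sum_congr rfl fun n _ => ?_
  have h1 : ∀ φ : Equiv.Perm (Fin n), PowerSeries.coeff d
      (vertSeries (ℕ+ ⊕ ℕ+) V.chi (orbType φ fun _ => True)) =
      MvPolynomial.C (∑ g ∈ Finset.range B, if 0 < d ∧ d + 2 = 2 * g + n then
        V.chi g (orbType φ fun _ => True) else 0) := by
    intro φ
    have hs : (orbType φ fun _ => True).sum = n := by
      rw [sum_orbType φ fun _ => Iff.rfl]
      simp
    rw [vertSeries, PowerSeries.coeff_mk, hs]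
    congr 1
    by_cases hd : 0 < d
    · rw [if_pos hd]
      refine (Finset.sum_congr rfl fun g _ => if_congr ?_ rfl rfl).trans
        (Finset.sum_subset ?_ fun g _ hg => if_neg ?_)
      · constructor
        · exact fun h => ⟨hd, h.symm⟩
        · exact fun h => h.2.symm
      · intro g
        simp only [Finset.mem_range]
        omega
      · rw [Finset.mem_range] at hg
        omega
    · rw [if_neg hd, Finset.sum_eq_zero]
      exact fun g _ => if_neg fun h => hd h.1
  simp only [h1]
  refine (V.sum_chi_mul hV (MvPolynomial.rename Sum.inl) n _ _).trans
    (Finset.sum_congr rfl fun g _ => ?_)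
  by_cases h2 : d + 2 = 2 * g + n
  · by_cases hd : 0 < d
    · rw [if_pos ⟨hd, h2⟩, if_pos h2]
    -- The condition `0 < d` in the vertex series is stability, as `d = 2 * (g - 1) + n`; dropping
    -- it adds only unstable terms, for which the characteristic vanishes.
    · rw [if_neg fun h => hd h.1, if_pos h2, V.ch_eq_zero (by omega), map_zero]
  · rw [if_neg fun h => h2 h.2, if_neg h2]

/-- The part of the connected sum with gluings that comes from graphs with vertices. -/
def graphPart : GradedSeries ℕ+ k := (dataQ V.chi).connSum -
  (2⁻¹ : k) • (PowerSeries.X ^ 2 * PowerSeries.C (MvPolynomial.X 1 ^ 2 + MvPolynomial.X 2))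

theorem coeff_graphPart (hV : V.FiniteDim) (d B : ℕ) (hB : 4 * d + 6 < B) :
    PowerSeries.coeff d V.graphPart = ∑ n ∈ Finset.range B, ∑ g ∈ Finset.range B,
      if d + 2 = 2 * g + 2 * n then V.free.ch g n else 0 := by
  have h0 : (2⁻¹ : k) • (MvPolynomial.X 1 ^ 2 + MvPolynomial.X 2 : MvPolynomial ℕ+ k) =
      (2⁻¹ : ℚ) • (MvPolynomial.X 1 ^ 2 + MvPolynomial.X 2) := by
    rw [← Rat.cast_smul_eq_qsmul k]
    push_cast
    rfl
  rw [graphPart, map_sub, V.coeff_connSum_dataQ hV d B hB, PowerSeries.coeff_smul,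
    PowerSeries.coeff_mul_C, PowerSeries.coeff_X_pow, ite_mul, one_mul, zero_mul, smul_ite,
    smul_zero, h0, add_sub_cancel_left]
  refine Finset.sum_congr rfl fun n _ => ?_
  exact V.free.sum_chi_mul (free_finiteDim V hV) (AlgHom.id k _) n _ _

theorem isWeightedHomogeneous_rename_ch (hV : V.FiniteDim) (g n : ℕ) :
    MvPolynomial.IsWeightedHomogeneous (GradedVars.wt (σ := ℕ+ ⊕ ℕ+))
      (MvPolynomial.rename Sum.inl (V.ch g n)) n := by
  intro α hα
  obtain ⟨β, rfl, hβ⟩ := MvPolynomial.coeff_rename_ne_zero _ _ _ hα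
  rw [← V.isWeightedHomogeneous_ch hV g n hβ]
  rw [Finsupp.weight_apply, Finsupp.weight_apply, Finsupp.sum_mapDomain_index_inj Sum.inl_injective]
  rfl

theorem weight_eq (α : ℕ+ →₀ ℕ) : Finsupp.weight (GradedVars.wt (σ := ℕ+)) α =
    2 * α.sum fun i a => (i : ℕ) * a := by
  rw [Finsupp.weight_apply, Finsupp.sum, Finsupp.sum, Finset.mul_sum]
  refine Finset.sum_congr rfl fun i _ => ?_
  change α i * (2 * (i : ℕ)) = _
  ring

theorem weight_val_eq (α : ℕ+ →₀ ℕ) : Finsupp.weight (fun i : ℕ+ => (i : ℕ)) α =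
    α.sum fun i a => (i : ℕ) * a := by
  rw [Finsupp.weight_apply]
  exact Finset.sum_congr rfl fun i _ => mul_comm _ _

theorem isWeightedHomogeneous_two_ch (hV : V.FiniteDim) (g n : ℕ) :
    MvPolynomial.IsWeightedHomogeneous (GradedVars.wt (σ := ℕ+)) (V.ch g n) (2 * n) := by
  intro α hα
  rw [weight_eq, ← weight_val_eq, V.isWeightedHomogeneous_ch hV g n hα]

theorem toSeries_graphPart (hV : V.FiniteDim) :
    toSeries GradedVars.wt V.graphPart = V.free.Ch := by
  refine PowerSumSeries.ext' fun α e => ?_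
  rw [coeff_toSeries_of_coeff_eq_sum (w := fun n => 2 * n) (fun n n' h => by simpa using h)
    (fun n => by omega) (V.free.isWeightedHomogeneous_two_ch (free_finiteDim V hV))
    (V.coeff_graphPart hV) (weight_eq α), coeff_Ch]
  by_cases he : 0 ≤ e + 1
  · rw [if_pos he]
    split_ifs with h
    · rfl
    -- A negative degree in `t` means that `2 * (g - 1) + 2 * n < 0`, so the type is unstable and
    -- the expected coefficient is zero as well.
    · rw [V.free.ch_eq_zero, MvPolynomial.coeff_zero]
      omega
  · rw [if_neg he, if_neg fun h => he h.1]

theorem toSeries_vertexPart (hV : V.FiniteDim) :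
    toSeries GradedVars.wt V.vertexPart = functionOfP V.Ch := by
  refine PowerSumSeries.ext' fun α e => ?_
  by_cases hα : α ∈ Set.range (Finsupp.embDomain (M := ℕ) (Function.Embedding.inl : ℕ+ ↪ ℕ+ ⊕ ℕ+))
  · obtain ⟨β, rfl⟩ := hα
    have hw : Finsupp.weight (GradedVars.wt (σ := ℕ+ ⊕ ℕ+))
        (β.embDomain (Function.Embedding.inl : ℕ+ ↪ ℕ+ ⊕ ℕ+)) =
        β.sum fun i a => (i : ℕ) * a := by
      rw [← weight_val_eq, Finsupp.weight_apply, Finsupp.weight_apply, Finsupp.sum_embDomain]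
      rfl
    rw [functionOfP, MvPowerSeries.coeff_embDomain_rename,
      coeff_toSeries_of_coeff_eq_sum (w := fun n => n) (fun n n' h => h)
      (fun n => le_rfl) (V.isWeightedHomogeneous_rename_ch hV)
      (V.coeff_vertexPart hV) hw, coeff_Ch, Finsupp.embDomain_eq_mapDomain]
    have hc : ∀ p : MvPolynomial ℕ+ k, MvPolynomial.coeff
        (β.mapDomain (Function.Embedding.inl : ℕ+ ↪ ℕ+ ⊕ ℕ+)) (MvPolynomial.rename Sum.inl p) =
        MvPolynomial.coeff β p := fun p =>
      MvPolynomial.coeff_rename_mapDomain _ Sum.inl_injective _ _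
    by_cases he : 0 ≤ e + 1
    · rw [if_pos he]
      split_ifs with h
      · exact hc _
      · rw [V.ch_eq_zero, MvPolynomial.coeff_zero]
        omega
    · rw [if_neg he, if_neg fun h => he h.1]
  · rw [functionOfP, MvPowerSeries.coeff_rename_eq_zero, coeff_toSeries]
    · have h1 : ∀ p : MvPolynomial ℕ+ k,
          MvPolynomial.coeff α (MvPolynomial.rename Sum.inl p) = 0 := by
        intro p
        refine MvPolynomial.coeff_rename_eq_zero _ _ _ fun u hu => ?_
        exact absurd ⟨u, by rw [Finsupp.embDomain_eq_mapDomain]; exact hu⟩ hα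
      split_ifs
      · rw [V.coeff_vertexPart hV _ _ (Nat.lt_succ_self _), MvPolynomial.coeff_sum]
        refine Finset.sum_eq_zero fun n _ => ?_
        rw [MvPolynomial.coeff_sum]
        refine Finset.sum_eq_zero fun g _ => ?_
        split_ifs
        · exact h1 _
        · rfl
      · rfl
    · rintro ⟨β, hβ⟩
      exact hα ⟨β, by rw [Finsupp.embDomain_eq_mapDomain]; exact hβ⟩

theorem isWeightedHomogeneous_legTerm : MvPolynomial.IsWeightedHomogeneous
    (GradedVars.wt (σ := ℕ+ ⊕ ℕ+))
    (MvPolynomial.X (Sum.inl 1) * MvPolynomial.X (Sum.inr 1) : MvPolynomial (ℕ+ ⊕ ℕ+) k) 3 :=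
  (MvPolynomial.isWeightedHomogeneous_X k _ (Sum.inl 1)).mul
    (MvPolynomial.isWeightedHomogeneous_X k _ (Sum.inr 1))

theorem isWeightedHomogeneous_edgeTerm : MvPolynomial.IsWeightedHomogeneous
    (GradedVars.wt (σ := ℕ+))
    (MvPolynomial.X 1 ^ 2 + MvPolynomial.X 2 : MvPolynomial ℕ+ k) 4 :=
  Submodule.add_mem (MvPolynomial.weightedHomogeneousSubmodule k _ 4)
    ((MvPolynomial.isWeightedHomogeneous_X k _ 1).pow 2)
    (MvPolynomial.isWeightedHomogeneous_X k _ 2)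

theorem toSeries_connSum_dataP (hV : V.FiniteDim) :
    toSeries GradedVars.wt (dataP V.chi).connSum = hbar k (-1) •
      (MvPowerSeries.X (Sum.inl 1) * MvPowerSeries.X (Sum.inr 1)) + functionOfP V.Ch := by
  rw [← V.toSeries_vertexPart hV, ← sub_eq_iff_eq_add, ← toSeries_sub, vertexPart, sub_sub_cancel,
    toSeries_X_pow_mul_C isWeightedHomogeneous_legTerm rfl]
  simp

theorem toSeries_connSum_dataQ (hV : V.FiniteDim) :
    toSeries GradedVars.wt (dataQ V.chi).connSum = hbar k (-1) • h₂ k + V.free.Ch := by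
  rw [← V.toSeries_graphPart hV, ← sub_eq_iff_eq_add, ← toSeries_sub, graphPart, sub_sub_cancel,
    toSeries_smul, toSeries_X_pow_mul_C isWeightedHomogeneous_edgeTerm rfl, h₂, smul_comm]
  simp

theorem connSum_dataP_mem_evenSeries (hV : V.FiniteDim) :
    (dataP V.chi).connSum ∈ evenSeries k GradedVars.wt := by
  rw [← sub_add_cancel (dataP V.chi).connSum (PowerSeries.X ^ 1 * PowerSeries.C
    (MvPolynomial.X (Sum.inl 1) * MvPolynomial.X (Sum.inr 1)))]
  exact add_mem (mem_evenSeries_of_coeff_eq_sum (V.isWeightedHomogeneous_rename_ch hV) fun d =>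
    ⟨_, V.coeff_vertexPart hV d _ (Nat.lt_succ_self _)⟩)
    (X_pow_mul_C_mem_evenSeries isWeightedHomogeneous_legTerm rfl)

theorem connSum_dataQ_mem_evenSeries (hV : V.FiniteDim) :
    (dataQ V.chi).connSum ∈ evenSeries k GradedVars.wt := by
  rw [← sub_add_cancel (dataQ V.chi).connSum ((2⁻¹ : k) • (PowerSeries.X ^ 2 * PowerSeries.C
    (MvPolynomial.X 1 ^ 2 + MvPolynomial.X 2)))]
  exact add_mem (mem_evenSeries_of_coeff_eq_sum
    (V.free.isWeightedHomogeneous_two_ch (free_finiteDim V hV)) fun d =>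
    ⟨_, V.coeff_graphPart hV d _ (Nat.lt_succ_self _)⟩) (Subalgebra.smul_mem _
    (X_pow_mul_C_mem_evenSeries isWeightedHomogeneous_edgeTerm rfl) _)

end StableSModule

end ModularOperad

end
theorem mainTheorem11 {k : Type*} [Field k] [CharZero k] (V : ModularOperad.StableSModule k)
    (hV : V.FiniteDim) :
    V.free.FiniteDim ∧
    ∃ (E : ModularOperad.PowerSumSeries (ℕ+ ⊕ ℕ+) k) (I : ModularOperad.PowerSumSeries ℕ+ k),
      ModularOperad.HasExp
        (ModularOperad.hbar k (-1) •
            (MvPowerSeries.X (Sum.inl 1) * MvPowerSeries.X (Sum.inr 1)) +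
          ModularOperad.functionOfP V.Ch) E ∧
      ModularOperad.HasGaussIntegral E I ∧
      ModularOperad.HasLog I (ModularOperad.hbar k (-1) • ModularOperad.h₂ k + V.free.Ch) := by
  -- The witnesses are the images under `toSeries` of the plethystic exponential for `dataP` and of
  -- its Gaussian integral. The latter is the plethystic exponential for `dataQ`, whose logarithm is
  -- the connected sum, already identified with `ħ⁻¹ h_2 + 𝐂𝐡(𝕄𝒱)`.
  refine ⟨V.free_finiteDim hV, _, _, ?_, ModularOperad.hasGaussIntegral_toSeries
    (ModularOperad.plethExp (ModularOperad.dataP V.chi).connSum), ?_⟩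
  · rw [← V.toSeries_connSum_dataP hV]
    exact ModularOperad.hasExp_toSeries (V.connSum_dataP_mem_evenSeries hV)
      (ModularOperad.WeightData.constantCoeff_connSum _)
  · rw [ModularOperad.gaussSeries_plethExp, ← V.toSeries_connSum_dataQ hV]
    exact ModularOperad.hasLog_toSeries (V.connSum_dataQ_mem_evenSeries hV)
      (ModularOperad.WeightData.constantCoeff_connSum _)
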